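/- **Setting.** An acyclic $s$–$t$ network has $n$ vertices, $m$ directed edges (parallel edges allowed), $s\ne t$, no directed cycle, every vertex reachable from $s$, a capacity $c_e>0$ on every edge $e$, and on every edge a concave differentiable function $f_e:[0,c_e]\to\mathbb R$ with $f_e(0)\ge 0$ and $0<w_{\min}\le f_e'\le w_{\max}$ on $[0,c_e]$. The level $l_u$ is the length of a longest path from $s$ to $u$, and the depth is $D=l_t$. A flow is a vector $x$ with $0\le x_e\le c_e$ that is conserved at every vertex other than $s,t$; its weight is $\sum_e f_e(x_e)$. A flow is an $a$-approximation if its weight is at least $a$ times the weight of every flow. **ConcaveFlow** with parameters $w_{\min}$, $w_{\max}=2^Tw_{\min}$ ($T\in\mathbb N$) and $\epsilon=2^{-k}$ ($k\ge1$) starts with $x=0$ and potentials $p_u=w_{\max}l_u$. For $i=0,1,\dots,T$, with $\delta_i=\epsilon w_{\max}/2^i$, it repeats the following round until $p_t=Dw_{\max}/2^{i+1}$ (if $i<T$), respectively until $p_t=0$ (if $i=T$): 1. form the eligible graph, in which an edge $e=uv$ gives a forward arc $u\to v$ whose capacity is the largest $\Delta\ge0$ with $x_e+\Delta\le c_e$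 and $p_u-p_v+f_e'(x_e+\Delta)\ge\delta_i$, and a backward arc $v\to u$ whose capacity is the largest $\Delta\ge0$ with $\Delta\le x_e$ and $p_u-p_v+f_e'(x_e-\Delta)\le0$ (only arcs of positive capacity are present); 2. send an arbitrary blocking flow from $s$ to $t$ in this graph, i.e. a flow of nonnegative value such that every $s$–$t$ path contains a saturated arc; 3. recompute the eligible graph and lower $p_u$ by $\delta_i$ for all $u$ not reachable from $s$ in it. After each scale $i<T$ it adds $\delta_i l_u$ to every $p_u$. At the end it returns $x$. **Theorem.** (a) For every acyclic $s$–$t$ network as above with $w_{\max}=2^Tw_{\min}$ and every $\epsilon=2^{-k}$, $k\ge1$, every flow that ConcaveFlow can return is a feasible $(1-9\epsilon)$-approximation to the maximum weight flow. (b) There are a constant $C$ and a fixed real-RAM program with the following property. (The program uses integer registers and arrays with addition, subtraction and comparison; real registers and arrays with $+,-,\times,\div$ and comparison; and $O(1)$-time queries to the derivatives. A query returns either the value $f_e'(y)$, or the largest amount by which a flow $y$ on $e$ can be increased, respectively decreased, within $[0,c_e]$ while the derivative stays $\ge\theta$, respectively $\le\theta$.) For every acyclic $s$–$t$ network as above,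 with arbitrary bounds $w_{\min},w_{\max}$, and every $0<\epsilon<1$, the program halts within $$C\cdot D\,m\,\epsilon^{-1}\Bigl(1+\log\frac{w_{\max}}{w_{\min}}\Bigr)\log n$$ steps and returns a $(1-\epsilon)$-approximation to the maximum weight flow. Its output is a flow that ConcaveFlow can return with the parameters $w_{\min}$, $2^Tw_{\min}$ and $2^{-k}$, for some $T,k\in\mathbb N$ with $w_{\max}\le 2^Tw_{\min}\le2w_{\max}$ and $9\cdot2^{-k}\le\epsilon\le18\cdot2^{-k}$. -/

import Mathlib

open scoped BigOperators

noncomputable section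

namespace ConcaveFlow

/-! ### Networks, flows and weights -/

/-- A directed (multi)graph with `n` vertices and `m` edges, a source `s`, a sink `t`, and on every
edge a capacity and a weight function. -/
structure Network (n m : ℕ) where
  src : Fin m → Fin n
  dst : Fin m → Fin n
  s : Fin n
  t : Fin n
  cap : Fin m → ℝ
  f : Fin m → ℝ → ℝ

variable {n m : ℕ}

/-- `N.Walk u v k`: there is a directed walk with exactly `k` edges from `u` to `v`. -/
inductive Network.Walk (N : Network n m) (u : Fin n) : Fin n → ℕ → Prop
  | nil : Network.Walk N u u 0
  | snoc (e : Fin m) (k : ℕ) (h : Network.Walk N u (N.src e) k) :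
      Network.Walk N u (N.dst e) (k + 1)

/-- The level of `u`: the length of a longest walk from `s` to `u` (in an acyclic graph walks are
paths, and their lengths are bounded). -/
def Network.level (N : Network n m) (u : Fin n) : ℕ := sSup {k | N.Walk N.s u k}

/-- The depth: the length of a longest path from `s` to `t`. -/
def Network.depth (N : Network n m) : ℕ := N.level N.t

/-- The derivative of the weight function of `e` on `[0, cap e]` (one-sided at the ends). -/
def Network.w (N : Network n m) (e : Fin m) (y : ℝ) : ℝ :=
  derivWithin (N.f e) (Set.Icc 0 (N.cap e)) y

/-- Acyclic `s`-`t` networks with positive capacities and concave differentiable weight functions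
whose derivatives lie between `wmin > 0` and `wmax`. -/
structure Network.IsConcave (N : Network n m) (wmin wmax : ℝ) : Prop where
  s_ne_t : N.s ≠ N.t
  acyclic : ∀ u k, N.Walk u u k → k = 0
  reachable : ∀ u, ∃ k, N.Walk N.s u k
  cap_pos : ∀ e, 0 < N.cap e
  concave : ∀ e, ConcaveOn ℝ (Set.Icc 0 (N.cap e)) (N.f e)
  differentiable : ∀ e, DifferentiableOn ℝ (N.f e) (Set.Icc 0 (N.cap e))
  zero_nonneg : ∀ e, 0 ≤ N.f e 0
  wmin_pos : 0 < wmin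
  le_deriv : ∀ e, ∀ y ∈ Set.Icc 0 (N.cap e), wmin ≤ N.w e y
  deriv_le : ∀ e, ∀ y ∈ Set.Icc 0 (N.cap e), N.w e y ≤ wmax

/-- Feasible flows: capacities are obeyed, and flow is conserved away from `s` and `t`. -/
structure Network.IsFlow (N : Network n m) (x : Fin m → ℝ) : Prop where
  nonneg : ∀ e, 0 ≤ x e
  le_cap : ∀ e, x e ≤ N.cap e
  conserve : ∀ v, v ≠ N.s → v ≠ N.t →
    ∑ e with N.dst e = v, x e = ∑ e with N.src e = v, x e

/-- The weight of a flow. -/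
def Network.weight (N : Network n m) (x : Fin m → ℝ) : ℝ := ∑ e, N.f e (x e)

/-- `x` is a feasible flow of weight at least `a` times the weight of every feasible flow. -/
def Network.IsApprox (N : Network n m) (a : ℝ) (x : Fin m → ℝ) : Prop :=
  N.IsFlow x ∧ ∀ y, N.IsFlow y → a * N.weight y ≤ N.weight x

/-! ### The algorithm ConcaveFlow -/

/-- The largest amount by which a flow of `y` on `e` can be increased while the derivative stays at
least `θ` (`0` if there is no such amount). -/
def Network.up (N : Network n m) (e : Fin m) (y θ : ℝ) : ℝ :=
  sSup {Δ | 0 ≤ Δ ∧ y + Δ ≤ N.cap e ∧ θ ≤ N.w e (y + Δ)}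

/-- The largest amount by which a flow of `y` on `e` can be decreased while the derivative stays at
most `θ` (`0` if there is no such amount). -/
def Network.down (N : Network n m) (e : Fin m) (y θ : ℝ) : ℝ :=
  sSup {Δ | 0 ≤ Δ ∧ Δ ≤ y ∧ N.w e (y - Δ) ≤ θ}

/-- Arcs of the residual graph: `(e, true)` is the edge `e` traversed forward, `(e, false)` is `e`
traversed backward. -/
abbrev Arc (m : ℕ) := Fin m × Bool

def Network.tail (N : Network n m) (a : Arc m) : Fin n := if a.2 then N.src a.1 else N.dst a.1

def Network.head (N : Network n m) (a : Arc m) : Fin n := if a.2 then N.dst a.1 else N.src a.1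

/-- The current flow and the current vertex potentials. -/
structure FlowPot (n m : ℕ) where
  x : Fin m → ℝ
  p : Fin n → ℝ

/-- The eligible capacity of an arc for the step size `δ`: forward along `e = uv` it is the largest
`Δ` with `x e + Δ ≤ cap e` and `p u - p v + w e (x e + Δ) ≥ δ`; backward it is the largest `Δ ≤ x e`
with `p u - p v + w e (x e - Δ) ≤ 0`. An arc belongs to the eligible graph if this is positive. -/
def Network.eligCap (N : Network n m) (δ : ℝ) (S : FlowPot n m) (a : Arc m) : ℝ :=
  if a.2 then N.up a.1 (S.x a.1) (δ - (S.p (N.src a.1) - S.p (N.dst a.1)))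
  else N.down a.1 (S.x a.1) (-(S.p (N.src a.1) - S.p (N.dst a.1)))

/-- `z` is a blocking flow from `s` to `t` for the arc capacities `c`: a flow from `s` to `t` of
nonnegative value such that every path from `s` to `t` contains a saturated arc, i.e. `t` cannot be
reached from `s` along unsaturated arcs. -/
structure Network.IsBlocking (N : Network n m) (c z : Arc m → ℝ) : Prop where
  nonneg : ∀ a, 0 ≤ z a
  le_cap : ∀ a, z a ≤ c a
  conserve : ∀ v, v ≠ N.s → v ≠ N.t →
    ∑ a with N.head a = v, z a = ∑ a with N.tail a = v, z a
  value_nonneg : ∑ a with N.head a = N.s, z a ≤ ∑ a with N.tail a = N.s, z a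
  blocking : ¬ Relation.ReflTransGen (fun u v => ∃ a, N.tail a = u ∧ N.head a = v ∧ z a < c a)
    N.s N.t

/-- `v` is reachable from `s` in the eligible graph. -/
def Network.Eligible (N : Network n m) (δ : ℝ) (S : FlowPot n m) (v : Fin n) : Prop :=
  Relation.ReflTransGen
    (fun u v => ∃ a, N.tail a = u ∧ N.head a = v ∧ 0 < N.eligCap δ S a) N.s v

/-- Augmentation by the arc flow `z`. -/
def augment (S : FlowPot n m) (z : Arc m → ℝ) : FlowPot n m :=
  ⟨fun e => S.x e + z (e, true) - z (e, false), S.p⟩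

open Classical in
/-- Dual adjustment: lower by `δ` the potentials of the vertices that are not eligible. -/
def Network.dualAdjust (N : Network n m) (δ : ℝ) (S : FlowPot n m) : FlowPot n m :=
  ⟨S.x, fun u => if N.Eligible δ S u then S.p u else S.p u - δ⟩

/-- Dual rescaling between two scales. -/
def Network.dualRescale (N : Network n m) (δ : ℝ) (S : FlowPot n m) : FlowPot n m :=
  ⟨S.x, fun u => S.p u + δ * N.level u⟩

/-- One scale: repeat "send a blocking flow in the eligible graph, then adjust the potentials" until
the potential of `t` equals `θ`. Any blocking flow may be chosen. -/
inductive Network.InnerLoop (N : Network n m) (δ θ : ℝ) : FlowPot n m → FlowPot n m → Prop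
  | done (S : FlowPot n m) (h : S.p N.t = θ) : Network.InnerLoop N δ θ S S
  | step (S S' : FlowPot n m) (z : Arc m → ℝ) (h : S.p N.t ≠ θ)
      (hz : N.IsBlocking (N.eligCap δ S) z)
      (hrest : Network.InnerLoop N δ θ (N.dualAdjust δ (augment S z)) S') :
      Network.InnerLoop N δ θ S S'

/-- The step size `ε * wmax / 2 ^ i` of scale `i`. -/
def stepSize (wmax ε : ℝ) (i : ℕ) : ℝ := ε * wmax / 2 ^ i

/-- The scales `i, i + 1, …, T`: scale `i < T` ends when the potential of `t` is
`depth * wmax / 2 ^ (i + 1)` and is followed by a dual rescaling; scale `T` ends when it is `0`. -/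
inductive Network.OuterLoop (N : Network n m) (wmax ε : ℝ) (T : ℕ) :
    ℕ → FlowPot n m → FlowPot n m → Prop
  | last (S S' : FlowPot n m) (h : N.InnerLoop (stepSize wmax ε T) 0 S S') :
      Network.OuterLoop N wmax ε T T S S'
  | next (i : ℕ) (S S₁ S' : FlowPot n m) (hi : i < T)
      (h : N.InnerLoop (stepSize wmax ε i) (N.depth * wmax / 2 ^ (i + 1)) S S₁)
      (hrest : Network.OuterLoop N wmax ε T (i + 1) (N.dualRescale (stepSize wmax ε i) S₁) S') :
      Network.OuterLoop N wmax ε T i S S'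

/-- `x` is an output of ConcaveFlow on `N` with the parameters `wmin`, `wmax = 2 ^ T * wmin` and
`ε`: start with the zero flow and the potentials `wmax * level u`, run the scales `0, …, T` with
`T = log₂ (wmax / wmin)`, and return the flow. -/
def Network.Returns (N : Network n m) (wmin wmax ε : ℝ) (x : Fin m → ℝ) : Prop :=
  ∃ (T : ℕ) (p : Fin n → ℝ), wmax = 2 ^ T * wmin ∧
    N.OuterLoop wmax ε T 0 ⟨fun _ => 0, fun u => wmax * N.level u⟩ ⟨x, p⟩

/-! ### A real RAM with derivative queries

Programs are finite texts in a small imperative language over integer and real registers and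
arrays. Integers are used for indexing and are only added, subtracted and compared; reals are added,
subtracted, multiplied, divided and compared (there is no rounding). -/

/-- Integer expressions: literals, registers, array entries, addition, truncated subtraction. -/
inductive NExp where
  | lit (k : ℕ)
  | var (i : ℕ)
  | arr (a : ℕ) (i : NExp)
  | add (e₁ e₂ : NExp)
  | sub (e₁ e₂ : NExp)

/-- Real expressions: literals, registers, array entries, arithmetic, and the three queries to the
derivative of the weight function of an edge. -/
inductive RExp where
  | lit (k : ℕ)
  | var (i : ℕ)
  | arr (a : ℕ) (i : NExp)
  | add (e₁ e₂ : RExp)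
  | sub (e₁ e₂ : RExp)
  | mul (e₁ e₂ : RExp)
  | div (e₁ e₂ : RExp)
  | deriv (e : NExp) (y : RExp)
  | up (e : NExp) (y θ : RExp)
  | down (e : NExp) (y θ : RExp)

/-- Tests. -/
inductive BExp where
  | nlt (e₁ e₂ : NExp)
  | neq (e₁ e₂ : NExp)
  | rlt (e₁ e₂ : RExp)
  | req (e₁ e₂ : RExp)
  | not (b : BExp)
  | and (b₁ b₂ : BExp)

/-- Programs. -/
inductive Prog where
  | skip
  | nset (i : ℕ) (e : NExp)
  | rset (i : ℕ) (e : RExp)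
  | nstore (a : ℕ) (i e : NExp)
  | rstore (a : ℕ) (i : NExp) (e : RExp)
  | seq (P Q : Prog)
  | cond (b : BExp) (P Q : Prog)
  | loop (b : BExp) (P : Prog)

/-- Memory: integer registers, real registers, integer arrays, real arrays. -/
structure Mem where
  nv : ℕ → ℕ
  rv : ℕ → ℝ
  na : ℕ → ℕ → ℕ
  ra : ℕ → ℕ → ℝ

/-- The number of operations in an expression. -/
def NExp.size : NExp → ℕ
  | lit _ => 1
  | var _ => 1
  | arr _ i => i.size + 1
  | add e₁ e₂ => e₁.size + e₂.size + 1
  | sub e₁ e₂ => e₁.size + e₂.size + 1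

def RExp.size : RExp → ℕ
  | lit _ => 1
  | var _ => 1
  | arr _ i => i.size + 1
  | add e₁ e₂ => e₁.size + e₂.size + 1
  | sub e₁ e₂ => e₁.size + e₂.size + 1
  | mul e₁ e₂ => e₁.size + e₂.size + 1
  | div e₁ e₂ => e₁.size + e₂.size + 1
  | deriv e y => e.size + y.size + 1
  | up e y θ => e.size + y.size + θ.size + 1
  | down e y θ => e.size + y.size + θ.size + 1

def BExp.size : BExp → ℕ
  | nlt e₁ e₂ => e₁.size + e₂.size + 1
  | neq e₁ e₂ => e₁.size + e₂.size + 1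
  | rlt e₁ e₂ => e₁.size + e₂.size + 1
  | req e₁ e₂ => e₁.size + e₂.size + 1
  | not b => b.size + 1
  | and b₁ b₂ => b₁.size + b₂.size + 1

def NExp.eval (M : Mem) : NExp → ℕ
  | lit k => k
  | var i => M.nv i
  | arr a i => M.na a (i.eval M)
  | add e₁ e₂ => e₁.eval M + e₂.eval M
  | sub e₁ e₂ => e₁.eval M - e₂.eval M

/-- The value of a real expression; queries to edges that do not exist are answered by `0`. -/
def RExp.eval (N : Network n m) (M : Mem) : RExp → ℝ
  | lit k => k
  | var i => M.rv i
  | arr a i => M.ra a (i.eval M)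
  | add e₁ e₂ => e₁.eval N M + e₂.eval N M
  | sub e₁ e₂ => e₁.eval N M - e₂.eval N M
  | mul e₁ e₂ => e₁.eval N M * e₂.eval N M
  | div e₁ e₂ => e₁.eval N M / e₂.eval N M
  | deriv e y => if h : e.eval M < m then N.w ⟨e.eval M, h⟩ (y.eval N M) else 0
  | up e y θ => if h : e.eval M < m then N.up ⟨e.eval M, h⟩ (y.eval N M) (θ.eval N M) else 0
  | down e y θ => if h : e.eval M < m then N.down ⟨e.eval M, h⟩ (y.eval N M) (θ.eval N M) else 0

def BExp.Holds (N : Network n m) (M : Mem) : BExp → Prop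
  | nlt e₁ e₂ => e₁.eval M < e₂.eval M
  | neq e₁ e₂ => e₁.eval M = e₂.eval M
  | rlt e₁ e₂ => e₁.eval N M < e₂.eval N M
  | req e₁ e₂ => e₁.eval N M = e₂.eval N M
  | not b => ¬ b.Holds N M
  | and b₁ b₂ => b₁.Holds N M ∧ b₂.Holds N M

/-- `Exec N P M M' k`: run on the memory `M`, with queries answered by `N`, the program `P` halts
with the memory `M'` after `k` time units; every operation and every query takes one time unit. -/
inductive Exec (N : Network n m) : Prog → Mem → Mem → ℕ → Prop
  | skip (M : Mem) : Exec N .skip M M 1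
  | nset (M : Mem) (i : ℕ) (e : NExp) :
      Exec N (.nset i e) M { M with nv := Function.update M.nv i (e.eval M) } (e.size + 1)
  | rset (M : Mem) (i : ℕ) (e : RExp) :
      Exec N (.rset i e) M { M with rv := Function.update M.rv i (e.eval N M) } (e.size + 1)
  | nstore (M : Mem) (a : ℕ) (i e : NExp) :
      Exec N (.nstore a i e) M
        { M with na := Function.update M.na a (Function.update (M.na a) (i.eval M) (e.eval M)) }
        (i.size + e.size + 1)
  | rstore (M : Mem) (a : ℕ) (i : NExp) (e : RExp) :
      Exec N (.rstore a i e) M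
        { M with ra := Function.update M.ra a (Function.update (M.ra a) (i.eval M) (e.eval N M)) }
        (i.size + e.size + 1)
  | seq (P Q : Prog) (M M₁ M' : Mem) (k l : ℕ) (hP : Exec N P M M₁ k) (hQ : Exec N Q M₁ M' l) :
      Exec N (.seq P Q) M M' (k + l)
  | cond_true (b : BExp) (P Q : Prog) (M M' : Mem) (k : ℕ) (hb : b.Holds N M)
      (hP : Exec N P M M' k) : Exec N (.cond b P Q) M M' (b.size + k + 1)
  | cond_false (b : BExp) (P Q : Prog) (M M' : Mem) (k : ℕ) (hb : ¬ b.Holds N M)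
      (hQ : Exec N Q M M' k) : Exec N (.cond b P Q) M M' (b.size + k + 1)
  | loop_true (b : BExp) (P : Prog) (M M₁ M' : Mem) (k l : ℕ) (hb : b.Holds N M)
      (hP : Exec N P M M₁ k) (hrest : Exec N (.loop b P) M₁ M' l) :
      Exec N (.loop b P) M M' (b.size + k + l + 1)
  | loop_false (b : BExp) (P : Prog) (M : Mem) (hb : ¬ b.Holds N M) :
      Exec N (.loop b P) M M (b.size + 1)

/-- The input: `n, m, s, t` in the integer registers `0, 1, 2, 3`; `wmin, wmax, ε` in the real
registers `0, 1, 2`; the sources and the targets of the edges in the integer arrays `0` and `1`; the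
capacities in the real array `0`; everything else is `0`. The weight functions are accessible only
through queries. -/
def inputMem (N : Network n m) (wmin wmax ε : ℝ) : Mem where
  nv i := if i = 0 then n else if i = 1 then m else if i = 2 then (N.s : ℕ)
    else if i = 3 then (N.t : ℕ) else 0
  rv i := if i = 0 then wmin else if i = 1 then wmax else if i = 2 then ε else 0
  na a i := if h : i < m then
      (if a = 0 then (N.src ⟨i, h⟩ : ℕ) else if a = 1 then (N.dst ⟨i, h⟩ : ℕ) else 0)
    else 0
  ra a i := if h : i < m then (if a = 0 then N.cap ⟨i, h⟩ else 0) else 0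

/-- The output: the first `m` entries of the real array `1`. -/
def output (m : ℕ) (M : Mem) (e : Fin m) : ℝ := M.ra 1 e

end ConcaveFlow

end

open scoped BigOperators

noncomputable section

namespace ConcaveFlow

variable {n m : ℕ}

/-! ### Program logic -/

/-! Part (a) is a primal-dual argument with scaling. For an edge e = uv the reduced derivative p_u -
p_v + f_e'(x_e) (`Network.red`) measures how far flow and potentials are from optimality. In the
scale with step δ it is at most 2δ on every edge that is not full (`Network.Inv`), and on every edge
that carries flow it is at least -δ, up to a slack σ_e. A blocking flow cuts the sink off from the
source in the eligible graph, so p_t drops by exactly δ per round. An arc missing from the eligible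
graph bounds the reduced derivative (`eligible_arc`), which is why lowering potentials by δ keeps
both bounds (`inv_dualAdjust`). Rescaling by δ l_u restores the upper bound for δ/2, but hurts the
lower bound of an edge in proportion to its level difference.

This loss is amortized. A unit of flow sent while p_t ≥ θ adds at least θ to the weight
(`weight_augment`) and exactly D to the sum of (l_v - l_u) x_e (`levelSum_augment`). With the
thresholds of the algorithm, the sum of σ_e x_e therefore never exceeds 6ε times the current weight
(`Network.Amortized`). At the end p_s = p_t = 0, so the potentials contribute nothing to any flow,
and δ = ε w_min. The tangent inequality then gives (1 - 2ε) f(y) ≤ (1 + 7ε) f(x) for every flow y,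
hence the factor 1 - 9ε (`approx_of_amortized`).

For part (b), p_t starts at D/ε steps above 0 and a rescaling adds only 2D of the new steps, so each
of the T + 1 scales takes O(D/ε) rounds and a round must run in time O(m log n). All of a round but
the blocking flow takes linear time. The blocking flow is found with link-cut trees. A return arc
from t to s, of capacity larger than all others together, turns augmenting paths into cycles; every
vertex scans its list of outgoing arcs once, and the current arcs of the non-roots form a forest.
The path from s to its root is extended by linking the root along its current arc; if this closes a
cycle, the cycle is saturated and cut, and a useless arc is skipped. No acyclicity of the eligible
graph is needed, since cycles that avoid the return arc are saturated just the same. An integer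
measure (`progress`) falls in every step and has range O(m + n).

A forest operation costs O(log n) amortized. Splaying obeys the access lemma (`splay_spec`). A
vertex is weighted by the part of the forest that hangs from it outside its own path, so exchanging
the preferred child leaves the potential unchanged (`Forest.swapStep_spec`), and the number of such
exchanges is paid for by the last splay of an access (`Forest.access_spec`). The programs are
verified with a loop rule that spends a potential on ghost states (`exec_loop`), and `program_time`
collects the constants. -/

/-- Loop-free programs. -/
def Prog.straight : Prog → Bool
  | .seq P Q => P.straight && Q.straight
  | .cond _ P Q => P.straight && Q.straight
  | .loop _ _ => false
  | _ => true

/-- An upper bound for the running time of a loop-free program. -/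
def Prog.cost : Prog → ℕ
  | .skip => 1
  | .nset _ e => e.size + 1
  | .rset _ e => e.size + 1
  | .nstore _ i e => i.size + e.size + 1
  | .rstore _ i e => i.size + e.size + 1
  | .seq P Q => P.cost + Q.cost
  | .cond b P Q => b.size + (P.cost + Q.cost) + 1
  | .loop _ _ => 0

def Mem.setN (M : Mem) (i v : ℕ) : Mem := { M with nv := Function.update M.nv i v }
def Mem.setR (M : Mem) (i : ℕ) (v : ℝ) : Mem := { M with rv := Function.update M.rv i v }
def Mem.setNA (M : Mem) (a i v : ℕ) : Mem :=
  { M with na := Function.update M.na a (Function.update (M.na a) i v) }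
def Mem.setRA (M : Mem) (a i : ℕ) (v : ℝ) : Mem :=
  { M with ra := Function.update M.ra a (Function.update (M.ra a) i v) }

section
variable (M : Mem) (i v a : ℕ) (w : ℝ)
@[simp] theorem Mem.setN_nv (j : ℕ) : (M.setN i v).nv j = if j = i then v else M.nv j := by
  simp [Mem.setN, Function.update_apply]
@[simp] theorem Mem.setN_rv : (M.setN i v).rv = M.rv := rfl
@[simp] theorem Mem.setN_na : (M.setN i v).na = M.na := rfl
@[simp] theorem Mem.setN_ra : (M.setN i v).ra = M.ra := rfl
@[simp] theorem Mem.setR_nv : (M.setR i w).nv = M.nv := rfl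
@[simp] theorem Mem.setR_rv (j : ℕ) : (M.setR i w).rv j = if j = i then w else M.rv j := by
  simp [Mem.setR, Function.update_apply]
@[simp] theorem Mem.setR_na : (M.setR i w).na = M.na := rfl
@[simp] theorem Mem.setR_ra : (M.setR i w).ra = M.ra := rfl
@[simp] theorem Mem.setNA_nv : (M.setNA a i v).nv = M.nv := rfl
@[simp] theorem Mem.setNA_rv : (M.setNA a i v).rv = M.rv := rfl
@[simp] theorem Mem.setNA_na (b j : ℕ) :
    (M.setNA a i v).na b j = if b = a ∧ j = i then v else M.na b j := by
  by_cases h : b = a <;> by_cases h' : j = i <;> simp [Mem.setNA, h, h']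
@[simp] theorem Mem.setNA_ra : (M.setNA a i v).ra = M.ra := rfl
@[simp] theorem Mem.setRA_nv : (M.setRA a i w).nv = M.nv := rfl
@[simp] theorem Mem.setRA_rv : (M.setRA a i w).rv = M.rv := rfl
@[simp] theorem Mem.setRA_na : (M.setRA a i w).na = M.na := rfl
@[simp] theorem Mem.setRA_ra (b j : ℕ) :
    (M.setRA a i w).ra b j = if b = a ∧ j = i then w else M.ra b j := by
  by_cases h : b = a <;> by_cases h' : j = i <;> simp [Mem.setRA, h, h']
end

open Classical in
/-- The effect of a loop-free program. -/
def Prog.sem (N : Network n m) : Prog → Mem → Mem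
  | .skip, M => M
  | .nset i e, M => M.setN i (e.eval M)
  | .rset i e, M => M.setR i (e.eval N M)
  | .nstore a i e, M => M.setNA a (i.eval M) (e.eval M)
  | .rstore a i e, M => M.setRA a (i.eval M) (e.eval N M)
  | .seq P Q, M => Prog.sem N Q (Prog.sem N P M)
  | .cond b P Q, M => if b.Holds N M then Prog.sem N P M else Prog.sem N Q M
  | .loop _ _, M => M

/-- Loop-free code gets a total functional semantics, so its effect can be computed by `simp` on
`Prog.sem` and its time bounded by `decide` on `Prog.cost`. Only loops need derivations in `Exec`.
-/
theorem Prog.exec_straight (N : Network n m) : ∀ (P : Prog), P.straight = true → ∀ M : Mem,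
    ∃ k, Exec N P M (P.sem N M) k ∧ k ≤ P.cost
  | .skip, _, M => ⟨_, .skip M, le_rfl⟩
  | .nset i e, _, M => ⟨_, .nset M i e, le_rfl⟩
  | .rset i e, _, M => ⟨_, .rset M i e, le_rfl⟩
  | .nstore a i e, _, M => ⟨_, .nstore M a i e, le_rfl⟩
  | .rstore a i e, _, M => ⟨_, .rstore M a i e, le_rfl⟩
  | .seq P Q, h, M => by
      simp only [Prog.straight, Bool.and_eq_true] at h
      obtain ⟨k, hk, hk'⟩ := P.exec_straight N h.1 M
      obtain ⟨l, hl, hl'⟩ := Q.exec_straight N h.2 (P.sem N M)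
      exact ⟨k + l, .seq _ _ _ _ _ _ _ hk hl, Nat.add_le_add hk' hl'⟩
  | .cond b P Q, h, M => by
      simp only [Prog.straight, Bool.and_eq_true] at h
      by_cases hb : b.Holds N M
      · obtain ⟨k, hk, hk'⟩ := P.exec_straight N h.1 M
        refine ⟨b.size + k + 1, ?_, by simp only [Prog.cost]; omega⟩
        simpa only [Prog.sem, if_pos hb] using Exec.cond_true b P Q M _ k hb hk
      · obtain ⟨k, hk, hk'⟩ := Q.exec_straight N h.2 M
        refine ⟨b.size + k + 1, ?_, by simp only [Prog.cost]; omega⟩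
        simpa only [Prog.sem, if_neg hb] using Exec.cond_false b P Q M _ k hb hk

/-- The program writes the integer register `i`. -/
def Prog.writesN (i : ℕ) : Prog → Bool
  | .nset j _ => i == j
  | .seq P Q => P.writesN i || Q.writesN i
  | .cond _ P Q => P.writesN i || Q.writesN i
  | .loop _ P => P.writesN i
  | _ => false

/-- The program writes the real register `i`. -/
def Prog.writesR (i : ℕ) : Prog → Bool
  | .rset j _ => i == j
  | .seq P Q => P.writesR i || Q.writesR i
  | .cond _ P Q => P.writesR i || Q.writesR i
  | .loop _ P => P.writesR i
  | _ => false

/-- The program writes the integer array `i`. -/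
def Prog.writesNA (i : ℕ) : Prog → Bool
  | .nstore j _ _ => i == j
  | .seq P Q => P.writesNA i || Q.writesNA i
  | .cond _ P Q => P.writesNA i || Q.writesNA i
  | .loop _ P => P.writesNA i
  | _ => false

/-- The program writes the real array `i`. -/
def Prog.writesRA (i : ℕ) : Prog → Bool
  | .rstore j _ _ => i == j
  | .seq P Q => P.writesRA i || Q.writesRA i
  | .cond _ P Q => P.writesRA i || Q.writesRA i
  | .loop _ P => P.writesRA i
  | _ => false

section
variable {N : Network n m} {P : Prog} {M M' : Mem} {k : ℕ}

/-- Frame rules: a location that is no target in the text of a program keeps its content. The side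
conditions are Boolean computations, mostly discharged by `rfl`. -/
theorem Exec.nv (h : Exec N P M M' k) {i : ℕ} (hi : P.writesN i = false) : M'.nv i = M.nv i := by
  induction h <;> simp_all [Prog.writesN]

theorem Exec.rv (h : Exec N P M M' k) {i : ℕ} (hi : P.writesR i = false) : M'.rv i = M.rv i := by
  induction h <;> simp_all [Prog.writesR]

theorem Exec.na (h : Exec N P M M' k) {i : ℕ} (hi : P.writesNA i = false) : M'.na i = M.na i := by
  induction h <;> simp_all [Prog.writesNA]

theorem Exec.ra (h : Exec N P M M' k) {i : ℕ} (hi : P.writesRA i = false) : M'.ra i = M.ra i := by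
  induction h <;> simp_all [Prog.writesRA]

end

/-- A loop whose iterations are paid for by a potential that depends on a ghost state. -/
theorem exec_loop {N : Network n m} {γ : Type*} (b : BExp) (P : Prog) (I : γ → Mem → Prop)
    (pot : γ → ℝ) (hpot : ∀ g M, I g M → 0 ≤ pot g)
    (hstep : ∀ g M, I g M → b.Holds N M → ∃ g' M' k, Exec N P M M' k ∧ I g' M' ∧
      (k : ℝ) + b.size + 1 ≤ pot g - pot g') :
    ∀ g M, I g M → ∃ g' M' k, Exec N (.loop b P) M M' k ∧ I g' M' ∧ ¬ b.Holds N M' ∧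
      (k : ℝ) ≤ pot g - pot g' + b.size + 1 := by
  -- `F` bounds the number of iterations: by `hstep` each of them lowers the potential by at least
  -- 1, because the right side there absorbs at least one time unit.
  have key : ∀ (F : ℕ) g M, pot g ≤ F → I g M → ∃ g' M' k, Exec N (.loop b P) M M' k ∧ I g' M' ∧
      ¬ b.Holds N M' ∧ (k : ℝ) ≤ pot g - pot g' + b.size + 1 := by
    intro F
    induction F with
    | zero =>
      intro g M hF hI
      by_cases hb : b.Holds N M
      · obtain ⟨g', M', k, -, hI', hk⟩ := hstep g M hI hb
        have h1 := hpot g' M' hI'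
        have h2 : (0 : ℝ) ≤ k := Nat.cast_nonneg _
        have h3 : (0 : ℝ) ≤ b.size := Nat.cast_nonneg _
        norm_num at hF
        linarith
      · exact ⟨g, M, _, .loop_false b P M hb, hI, hb, by push_cast; linarith⟩
    | succ F ih =>
      intro g M hF hI
      by_cases hb : b.Holds N M
      · obtain ⟨g₁, M₁, k, hk, hI₁, hle⟩ := hstep g M hI hb
        have h2 : (0 : ℝ) ≤ k := Nat.cast_nonneg _
        have h3 : (0 : ℝ) ≤ b.size := Nat.cast_nonneg _
        push_cast at hF
        obtain ⟨g', M', l, hl, hI', hb', hle'⟩ := ih g₁ M₁ (by linarith) hI₁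
        exact ⟨g', M', _, .loop_true b P M M₁ M' k l hb hk hl, hI', hb', by push_cast; linarith⟩
      · exact ⟨g, M, _, .loop_false b P M hb, hI, hb, by push_cast; linarith⟩
  intro g M hI
  obtain ⟨F, hF⟩ := exists_nat_ge (pot g)
  exact key F g M hF hI

/-- `for i = 0, …, bd - 1 do P`. -/
def Prog.forLoop (i : ℕ) (bd : NExp) (P : Prog) : Prog :=
  .seq (.nset i (.lit 0)) (.loop (.nlt (.var i) bd) (.seq P (.nset i (.add (.var i) (.lit 1)))))

/-- An iteration costs `c` for the body, 4 for the increment and `bd.size + 3` for the test. The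
extra `+ 1` in the bound covers the initial assignment and the failing test. The invariant is
required after the increment of the counter. -/
theorem exec_forLoop {N : Network n m} (i : ℕ) (bd : NExp) (P : Prog) (I : ℕ → Mem → Prop)
    (b : ℕ) (c : ℝ) (hc : 0 ≤ c) (hi : P.writesN i = false)
    (hbd : ∀ j M, I j M → bd.eval M = b)
    (hstep : ∀ j M, j < b → I j M → M.nv i = j → ∃ M' k, Exec N P M M' k ∧ (k : ℝ) ≤ c ∧
      I (j + 1) (M'.setN i (j + 1))) (M : Mem) (h0 : I 0 (M.setN i 0)) :
    ∃ M' k, Exec N (.forLoop i bd P) M M' k ∧ I b M' ∧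
      (k : ℝ) ≤ (b + 1) * (c + bd.size + 7) := by
  have hs : (0 : ℝ) ≤ bd.size := Nat.cast_nonneg _
  obtain ⟨g', M', k, hk, ⟨hI, hj, hle⟩, hb', hle'⟩ := exec_loop (N := N) (.nlt (.var i) bd)
    (.seq P (.nset i (.add (.var i) (.lit 1)))) (fun j M => I j M ∧ M.nv i = j ∧ j ≤ b)
    (fun j => ((b : ℝ) - j) * (c + bd.size + 7))
    (by
      rintro j M ⟨-, -, h⟩
      have : (j : ℝ) ≤ b := by exact_mod_cast h
      exact mul_nonneg (by linarith) (by linarith))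
    (by
      rintro j M ⟨hI, hj, hjb⟩ hb
      simp only [BExp.Holds, NExp.eval, hj, hbd j M hI] at hb
      obtain ⟨M', k, hk, hkc, hI'⟩ := hstep j M hb hI hj
      have hj' : M'.nv i = j := by rw [hk.nv hi, hj]
      refine ⟨j + 1, M'.setN i (j + 1), _, .seq _ _ _ _ _ _ _ hk
        (by simpa [NExp.eval, hj', Mem.setN] using
          Exec.nset (N := N) M' i (.add (.var i) (.lit 1))), ⟨hI', by simp, hb⟩, ?_⟩
      simp only [NExp.size, BExp.size]
      push_cast
      linarith) 0 (M.setN i 0) ⟨h0, by simp, Nat.zero_le _⟩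
  have hgb : g' = b := by
    simp only [BExp.Holds, NExp.eval, hbd _ _ hI, hj] at hb'
    omega
  subst hgb
  refine ⟨M', _, .seq _ _ _ _ _ _ _ (.nset M i (.lit 0)) hk, hI, ?_⟩
  simp only [NExp.size, BExp.size] at hle' ⊢
  push_cast at hle' ⊢
  linarith


/-! ### Binary trees with weighted vertices, and the potential of splaying -/

/-- Binary trees whose nodes carry vertices. -/
inductive Tr where
  | nil
  | node (l : Tr) (x : ℕ) (r : Tr)

namespace Tr

/-- The vertices in symmetric order. -/
def inord : Tr → List ℕ
  | nil => []
  | node l x r => l.inord ++ x :: r.inord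

/-- The root, `0` for the empty tree. -/
def rt : Tr → ℕ
  | nil => 0
  | node _ x _ => x

/-- The node `x` with the subtree `a` on side `d` and `b` on the other side
(`false` is the left side). -/
def mk (d : Bool) (a : Tr) (x : ℕ) (b : Tr) : Tr := if d then node b x a else node a x b

/-- The total weight of the vertices. -/
def size (wt : ℕ → ℕ) (t : Tr) : ℕ := (t.inord.map wt).sum

/-- The sum of the binary logarithms of the sizes of all subtrees. -/
def pot (wt : ℕ → ℕ) : Tr → ℝ
  | nil => 0
  | node l x r => Real.logb 2 (size wt (node l x r)) + l.pot wt + r.pot wt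

/-- A step down in a tree: the side taken, the node left, and the other subtree. -/
abbrev Frame := Bool × ℕ × Tr

/-- The tree with the subtree `t` in the context `c` (innermost frame first). -/
def plug (t : Tr) : List Frame → Tr
  | [] => t
  | f :: c => plug (mk f.1 t f.2.1 f.2.2) c

@[simp] theorem inord_nil : nil.inord = [] := rfl
@[simp] theorem inord_node (l : Tr) (x : ℕ) (r : Tr) :
    (node l x r).inord = l.inord ++ x :: r.inord := rfl
@[simp] theorem rt_nil : nil.rt = 0 := rfl
@[simp] theorem rt_node (l : Tr) (x : ℕ) (r : Tr) : (node l x r).rt = x := rfl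
@[simp] theorem rt_mk (d : Bool) (a : Tr) (x : ℕ) (b : Tr) : (mk d a x b).rt = x := by
  cases d <;> rfl
@[simp] theorem plug_nil (t : Tr) : plug t [] = t := rfl
theorem plug_cons (t : Tr) (f : Frame) (c : List Frame) :
    plug t (f :: c) = plug (mk f.1 t f.2.1 f.2.2) c := rfl

theorem mk_false (a : Tr) (x : ℕ) (b : Tr) : mk false a x b = node a x b := rfl
theorem mk_true (a : Tr) (x : ℕ) (b : Tr) : mk true a x b = node b x a := rfl

theorem exists_eq_mk (d : Bool) (l : Tr) (x : ℕ) (r : Tr) : ∃ a b, node l x r = mk d a x b := by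
  cases d
  exacts [⟨l, r, rfl⟩, ⟨r, l, rfl⟩]

theorem exists_mk_eq (d : Bool) (a : Tr) (x : ℕ) (b : Tr) : ∃ l r, mk d a x b = node l x r := by
  cases d
  exacts [⟨a, b, rfl⟩, ⟨b, a, rfl⟩]

theorem inord_mk_perm (d : Bool) (a : Tr) (x : ℕ) (b : Tr) :
    (mk d a x b).inord.Perm (x :: (a.inord ++ b.inord)) := by
  cases d
  · exact List.perm_middle
  · exact List.perm_middle.trans (List.Perm.cons _ List.perm_append_comm)

theorem mem_inord_mk {d : Bool} {a : Tr} {x : ℕ} {b : Tr} {y : ℕ} :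
    y ∈ (mk d a x b).inord ↔ y = x ∨ y ∈ a.inord ∨ y ∈ b.inord := by
  simp [(inord_mk_perm d a x b).mem_iff]

theorem rt_mem {t : Tr} (h : t ≠ nil) : t.rt ∈ t.inord := by
  cases t
  · exact absurd rfl h
  · simp

theorem inord_ne_nil {t : Tr} (h : t ≠ nil) : t.inord ≠ [] := List.ne_nil_of_mem (rt_mem h)

theorem inord_eq_nil {t : Tr} : t.inord = [] ↔ t = nil := by
  cases t <;> simp

theorem inord_plug_congr {t t' : Tr} (h : t.inord = t'.inord) (c : List Frame) :
    (plug t c).inord = (plug t' c).inord := by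
  induction c generalizing t t' with
  | nil => exact h
  | cons f c ih =>
    rw [plug_cons, plug_cons]
    apply ih
    rcases f with ⟨d, p, s⟩
    cases d <;> simp [mk, h]

theorem mem_inord_plug {t : Tr} {c : List Frame} {y : ℕ} (h : y ∈ t.inord) :
    y ∈ (plug t c).inord := by
  induction c generalizing t with
  | nil => exact h
  | cons f c ih => exact ih (mem_inord_mk.2 (.inr (.inl h)))

theorem plug_ne_nil (l : Tr) (x : ℕ) (r : Tr) (c : List Frame) : plug (node l x r) c ≠ nil := by
  intro h
  have := mem_inord_plug (c := c) (show x ∈ (node l x r).inord by simp)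
  rw [h] at this
  simp at this

/-- Every vertex of a tree is the root of a subtree. -/
theorem exists_plug {t : Tr} {x : ℕ} (h : x ∈ t.inord) :
    ∃ l r c, t = plug (node l x r) c := by
  have key : ∀ (t : Tr) (c₀ : List Frame), x ∈ t.inord →
      ∃ l r c, plug t c₀ = plug (node l x r) c := by
    intro t
    induction t with
    | nil => simp
    | node l y r ihl ihr =>
      intro c₀ hx
      simp only [inord_node, List.mem_append, List.mem_cons] at hx
      rcases hx with hx | rfl | hx
      · exact ihl ((false, y, r) :: c₀) hx
      · exact ⟨l, r, c₀, rfl⟩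
      · exact ihr ((true, y, l) :: c₀) hx
  exact key t [] h

theorem mk_not (d : Bool) (a : Tr) (x : ℕ) (b : Tr) : mk (!d) b x a = mk d a x b := by
  cases d <;> rfl

variable {wt : ℕ → ℕ}

@[simp] theorem size_nil : nil.size wt = 0 := rfl

theorem size_mk (d : Bool) (a : Tr) (x : ℕ) (b : Tr) :
    (mk d a x b).size wt = wt x + a.size wt + b.size wt := by
  simp only [size, ((inord_mk_perm d a x b).map wt).sum_eq]
  simp [add_assoc]

theorem size_node (l : Tr) (x : ℕ) (r : Tr) :
    (node l x r).size wt = wt x + l.size wt + r.size wt := size_mk false l x r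

theorem pot_mk (d : Bool) (a : Tr) (x : ℕ) (b : Tr) :
    (mk d a x b).pot wt = Real.logb 2 ((mk d a x b).size wt) + a.pot wt + b.pot wt := by
  cases d
  · rfl
  · simp only [mk, pot, if_true]
    ring

theorem size_congr {wt' : ℕ → ℕ} {t : Tr} (h : ∀ x ∈ t.inord, wt x = wt' x) :
    t.size wt = t.size wt' := by
  unfold size
  congr 1
  exact List.map_congr_left h

theorem pot_congr {wt' : ℕ → ℕ} {t : Tr} (h : ∀ x ∈ t.inord, wt x = wt' x) :
    t.pot wt = t.pot wt' := by
  induction t with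
  | nil => rfl
  | node l x r ihl ihr =>
    simp only [pot]
    rw [size_congr h, ihl fun y hy => h y (by simp [hy]), ihr fun y hy => h y (by simp [hy])]

theorem le_size {t : Tr} {x : ℕ} (h : x ∈ t.inord) : wt x ≤ t.size wt :=
  List.le_sum_of_mem (List.mem_map_of_mem h)

theorem size_le_plug (t : Tr) (c : List Frame) : t.size wt ≤ (plug t c).size wt := by
  induction c generalizing t with
  | nil => exact le_rfl
  | cons f c ih =>
    refine le_trans ?_ (ih _)
    rw [size_mk]
    omega

theorem size_plug_congr {t t' : Tr} (h : t.inord = t'.inord) (c : List Frame) :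
    (plug t c).size wt = (plug t' c).size wt := by
  rw [size, inord_plug_congr h, size]

/-- Rearranging a subtree changes the potential only inside the subtree, because the sizes at its
ancestors depend on the set of vertices alone. So a local gain is a global one. -/
theorem pot_plug_congr {t t' : Tr} (h : t.inord = t'.inord) (c : List Frame) :
    (plug t' c).pot wt - t'.pot wt = (plug t c).pot wt - t.pot wt := by
  induction c generalizing t t' with
  | nil => simp
  | cons f c ih =>
    rcases f with ⟨d, p, s⟩
    have h' : (mk d t p s).inord = (mk d t' p s).inord := by cases d <;> simp [mk, h]
    have := ih h'
    simp only [plug_cons]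
    rw [pot_mk, pot_mk, show (mk d t p s).size wt = (mk d t' p s).size wt by rw [size, h', size]]
      at this
    linarith

/-- The inequality of the arithmetic and geometric means. The 2 gained here is what pays for a
double rotation. -/
theorem logb_add_logb_le {a b s : ℝ} (ha : 0 < a) (hb : 0 < b) (h : a + b ≤ s) :
    Real.logb 2 a + Real.logb 2 b ≤ 2 * Real.logb 2 s - 2 := by
  have hs : 0 < s := by linarith
  have h1 : a * b ≤ (s / 2) ^ 2 := by nlinarith [sq_nonneg (a - b)]
  have h2 := Real.logb_le_logb_of_le (b := 2) (by norm_num) (mul_pos ha hb) h1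
  rw [Real.logb_mul ha.ne' hb.ne', Real.logb_pow, Real.logb_div hs.ne' (by norm_num),
    Real.logb_self_eq_one (by norm_num)] at h2
  push_cast at h2
  linarith

theorem logb_mono {a b : ℕ} (ha : 1 ≤ a) (h : a ≤ b) : Real.logb 2 a ≤ Real.logb 2 b :=
  Real.logb_le_logb_of_le (by norm_num) (by exact_mod_cast ha) (by exact_mod_cast h)

/-- A single rotation yields no gain; it occurs at most once per splay, directly below the root. -/
theorem pot_zig (hwt : ∀ x, 1 ≤ wt x) (d : Bool) (a : Tr) (x : ℕ) (b : Tr) (p : ℕ) (s : Tr) :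
    (mk d a x (mk d b p s)).pot wt ≤ (mk d (mk d a x b) p s).pot wt +
      3 * (Real.logb 2 ((mk d (mk d a x b) p s).size wt) -
        Real.logb 2 ((mk d a x b).size wt)) := by
  have hx := hwt x
  have hp := hwt p
  simp only [pot_mk, size_mk]
  have h1 : Real.logb 2 ((wt x + a.size wt + (wt p + b.size wt + s.size wt) : ℕ) : ℝ) =
    Real.logb 2 ((wt p + (wt x + a.size wt + b.size wt) + s.size wt : ℕ) : ℝ) := by
    congr 2; omega
  have h2 : Real.logb 2 ((wt p + b.size wt + s.size wt : ℕ) : ℝ) ≤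
    Real.logb 2 ((wt p + (wt x + a.size wt + b.size wt) + s.size wt : ℕ) : ℝ) :=
    logb_mono (by omega) (by omega)
  have h3 : Real.logb 2 ((wt x + a.size wt + b.size wt : ℕ) : ℝ) ≤
    Real.logb 2 ((wt p + (wt x + a.size wt + b.size wt) + s.size wt : ℕ) : ℝ) :=
    logb_mono (by omega) (by omega)
  linarith

/-- The old subtree of `x` and the new subtree of `g` are disjoint and fit into the whole, so
`logb_add_logb_le` applies to their sizes. -/
theorem pot_zigzig (hwt : ∀ x, 1 ≤ wt x) (d : Bool) (a : Tr) (x : ℕ) (b : Tr) (p : ℕ) (s : Tr)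
    (g : ℕ) (u : Tr) :
    (mk d a x (mk d b p (mk d s g u))).pot wt + 2 ≤ (mk d (mk d (mk d a x b) p s) g u).pot wt +
      3 * (Real.logb 2 ((mk d (mk d (mk d a x b) p s) g u).size wt) -
        Real.logb 2 ((mk d a x b).size wt)) := by
  have hx := hwt x
  have hp := hwt p
  have hg := hwt g
  simp only [pot_mk, size_mk]
  set X := wt x + a.size wt + b.size wt with hX
  set S := wt g + (wt p + X + s.size wt) + u.size wt with hS
  have h1 : wt x + a.size wt + (wt p + b.size wt + (wt g + s.size wt + u.size wt)) = S := by omega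
  rw [h1]
  set P' := wt p + b.size wt + (wt g + s.size wt + u.size wt)
  have h2 : Real.logb 2 (P' : ℝ) ≤ Real.logb 2 (S : ℝ) := logb_mono (by omega) (by omega)
  have h3 : Real.logb 2 (X : ℝ) ≤ Real.logb 2 ((wt p + X + s.size wt : ℕ) : ℝ) :=
    logb_mono (by omega) (by omega)
  have h4 := logb_add_logb_le (a := (X : ℝ)) (b := ((wt g + s.size wt + u.size wt : ℕ) : ℝ))
    (s := S) (by exact_mod_cast (by omega)) (by exact_mod_cast (by omega))
    (by exact_mod_cast (by omega))
  linarith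

/-- Here the disjoint pair consists of the new subtrees of `g` and `p`, the two children of `x`
after the double rotation. -/
theorem pot_zigzag (hwt : ∀ x, 1 ≤ wt x) (d : Bool) (a : Tr) (x : ℕ) (b : Tr) (p : ℕ) (s : Tr)
    (g : ℕ) (u : Tr) :
    (mk d (mk (!d) a g u) x (mk d b p s)).pot wt + 2 ≤
      (mk (!d) (mk d (mk d a x b) p s) g u).pot wt +
      3 * (Real.logb 2 ((mk (!d) (mk d (mk d a x b) p s) g u).size wt) -
        Real.logb 2 ((mk d a x b).size wt)) := by
  have hx := hwt x
  have hp := hwt p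
  have hg := hwt g
  simp only [pot_mk, size_mk]
  set X := wt x + a.size wt + b.size wt with hX
  set S := wt g + (wt p + X + s.size wt) + u.size wt with hS
  have h1 : wt x + (wt g + a.size wt + u.size wt) + (wt p + b.size wt + s.size wt) = S := by omega
  rw [h1]
  have h2 : Real.logb 2 (X : ℝ) ≤ Real.logb 2 (S : ℝ) := logb_mono (by omega) (by omega)
  have h3 : Real.logb 2 (X : ℝ) ≤ Real.logb 2 ((wt p + X + s.size wt : ℕ) : ℝ) :=
    logb_mono (by omega) (by omega)
  have h4 := logb_add_logb_le (a := ((wt g + a.size wt + u.size wt : ℕ) : ℝ))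
    (b := ((wt p + b.size wt + s.size wt : ℕ) : ℝ))
    (s := S) (by exact_mod_cast (by omega)) (by exact_mod_cast (by omega))
    (by exact_mod_cast (by omega))
  linarith

end Tr


/-! ### Splay trees in memory

Integer arrays: `10`, `11` left and right child, `12` parent, `13` vertex of least value in the
subtree, `14` last vertex of the subtree. Real arrays: `4` base value, `5` offset of the subtree,
`6` least value in the subtree, without the offsets of its root and of the ancestors. The value of a
vertex is its base value plus the offsets of all its ancestors, itself included. -/

def block : List Prog → Prog
  | [] => .skip
  | [P] => P
  | P :: Q :: L => .seq P (block (Q :: L))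

/-- The array of the children on side `d`. -/
def chA (d : Bool) : ℕ := if d then 11 else 10

/-- Take the subtree on side `d` into account in the data of the vertex in register `14`. -/
def pullChild (d : Bool) : Prog :=
  .seq (.nset 15 (.arr (chA d) (.var 14)))
    (.cond (.neq (.var 15) (.lit 0)) .skip
      (.seq (if d then .nstore 14 (.var 14) (.arr 14 (.var 15)) else .skip)
        (.cond (.rlt (.add (.arr 5 (.var 15)) (.arr 6 (.var 15))) (.arr 6 (.var 14)))
        (.seq (.rstore 6 (.var 14) (.add (.arr 5 (.var 15)) (.arr 6 (.var 15))))
          (.nstore 13 (.var 14) (.arr 13 (.var 15)))) .skip)))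

/-- Recompute the data of the subtree of the vertex in register `14`. -/
def pull : Prog := block
  [.nstore 13 (.var 14) (.var 14), .nstore 14 (.var 14) (.var 14),
   .rstore 6 (.var 14) (.arr 4 (.var 14)), pullChild false, pullChild true]

/-- The local data of the root `x` of a subtree with the vertices `xs`, where the offsets of the
proper ancestors of `x` add up to `o` and the values are `v`. -/
structure Loc (M : Mem) (v : ℕ → ℝ) (o : ℝ) (xs : List ℕ) (x : ℕ) : Prop where
  val : v x = M.ra 4 x + M.ra 5 x + o
  mem : M.na 13 x ∈ xs
  min : ∀ y ∈ xs, v (M.na 13 x) ≤ v y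
  mn : M.ra 6 x + M.ra 5 x + o = v (M.na 13 x)
  last : xs.getLast? = some (M.na 14 x)

/-- The tree is stored in memory; `q` is the parent of its root, and the offsets of the proper
ancestors of the root add up to the given number. -/
def Rep (M : Mem) (v : ℕ → ℝ) : ℕ → ℝ → Tr → Prop
  | _, _, .nil => True
  | q, o, .node l x r => x ≠ 0 ∧ M.na 12 x = q ∧ M.na 10 x = l.rt ∧ M.na 11 x = r.rt ∧
      Loc M v o (Tr.node l x r).inord x ∧ Rep M v x (o + M.ra 5 x) l ∧ Rep M v x (o + M.ra 5 x) r

theorem rep_mk {M : Mem} {v : ℕ → ℝ} {q : ℕ} {o : ℝ} {d : Bool} {a : Tr} {x : ℕ} {b : Tr} :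
    Rep M v q o (.mk d a x b) ↔ x ≠ 0 ∧ M.na 12 x = q ∧ M.na (chA d) x = a.rt ∧
      M.na (chA !d) x = b.rt ∧ Loc M v o (Tr.mk d a x b).inord x ∧
      Rep M v x (o + M.ra 5 x) a ∧ Rep M v x (o + M.ra 5 x) b := by
  cases d
  · rfl
  · simp only [Tr.mk, Rep, chA, if_true, Bool.not_true]
    tauto

/-- The vertices of a context. -/
def ctxVerts : List Tr.Frame → List ℕ
  | [] => []
  | f :: c => f.2.1 :: (f.2.2.inord ++ ctxVerts c)

theorem inord_plug_perm (t : Tr) (c : List Tr.Frame) :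
    (t.plug c).inord.Perm (t.inord ++ ctxVerts c) := by
  induction c generalizing t with
  | nil => simp [ctxVerts]
  | cons f c ih =>
    refine (ih _).trans ?_
    refine ((Tr.inord_mk_perm _ _ _ _).append_right _).trans ?_
    simp only [ctxVerts]
    rw [List.cons_append, List.append_assoc]
    exact List.perm_middle.symm

/-- The context is stored in memory: its hole holds a subtree with root `h` and vertices `vs`, whose
parent is `q` and above which the offsets add up to `o`. -/
def RepC (M : Mem) (v : ℕ → ℝ) (q₀ : ℕ) (o₀ : ℝ) :
    List Tr.Frame → ℕ → List ℕ → ℕ → ℝ → Prop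
  | [], _, _, q, o => q = q₀ ∧ o = o₀
  | f :: c, h, vs, q, o => q = f.2.1 ∧ f.2.1 ≠ 0 ∧ M.na (chA f.1) f.2.1 = h ∧
      M.na (chA !f.1) f.2.1 = f.2.2.rt ∧
      ∃ o', o = o' + M.ra 5 f.2.1 ∧ Rep M v f.2.1 (o' + M.ra 5 f.2.1) f.2.2 ∧
        ∃ xs, (xs = if f.1 then f.2.2.inord ++ f.2.1 :: vs else vs ++ f.2.1 :: f.2.2.inord) ∧
        Loc M v o' xs f.2.1 ∧ RepC M v q₀ o₀ c f.2.1 xs (M.na 12 f.2.1) o'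

/-- Cuts a stored tree at a node, so that a rotation can be verified at the node while the context
is carried along. -/
theorem rep_plug {M : Mem} {v : ℕ → ℝ} {q₀ : ℕ} {o₀ : ℝ} {c : List Tr.Frame} {t : Tr} :
    Rep M v q₀ o₀ (t.plug c) ↔
      ∃ q o, RepC M v q₀ o₀ c t.rt t.inord q o ∧ Rep M v q o t := by
  induction c generalizing t with
  | nil => simp [RepC]
  | cons f c ih =>
    rw [Tr.plug_cons, ih]
    rcases f with ⟨d, p, s⟩
    simp only [RepC, rep_mk, Tr.rt_mk]
    have hxs : (Tr.mk d t p s).inord =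
      if d then s.inord ++ p :: t.inord else t.inord ++ p :: s.inord := by cases d <;> rfl
    constructor
    · rintro ⟨q, o, hC, h0, hq, hd, hd', hL, ht, hs⟩
      exact ⟨p, o + M.ra 5 p, ⟨rfl, h0, hd, hd', o, rfl, hs, _, hxs, hL, hq ▸ hC⟩, ht⟩
    · rintro ⟨q, o, ⟨rfl, h0, hd, hd', o', rfl, hs, xs, rfl, hL, hC⟩, ht⟩
      rw [← hxs] at hL hC
      exact ⟨_, o', hC, h0, rfl, hd, hd', hL, ht, hs⟩

/-- The two memories hold the same data for the vertex `y`. -/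
structure Agree (M M' : Mem) (y : ℕ) : Prop where
  ch : ∀ d, M'.na (chA d) y = M.na (chA d) y
  par : M'.na 12 y = M.na 12 y
  am : M'.na 13 y = M.na 13 y
  last : M'.na 14 y = M.na 14 y
  base : M'.ra 4 y = M.ra 4 y
  off : M'.ra 5 y = M.ra 5 y
  mn : M'.ra 6 y = M.ra 6 y

theorem Agree.refl (M : Mem) (y : ℕ) : Agree M M y :=
  ⟨fun _ => rfl, rfl, rfl, rfl, rfl, rfl, rfl⟩

theorem Agree.trans {M M' M'' : Mem} {y : ℕ} (h : Agree M M' y) (h' : Agree M' M'' y) :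
    Agree M M'' y :=
  ⟨fun d => (h'.ch d).trans (h.ch d), h'.par.trans h.par, h'.am.trans h.am, h'.last.trans h.last,
    h'.base.trans h.base, h'.off.trans h.off, h'.mn.trans h.mn⟩

theorem Loc.congr {M M' : Mem} {v : ℕ → ℝ} {o : ℝ} {xs : List ℕ} {x : ℕ} (h : Loc M v o xs x)
    (ha : Agree M M' x) : Loc M' v o xs x := by
  constructor
  · rw [ha.base, ha.off, h.val]
  · rw [ha.am]; exact h.mem
  · rw [ha.am]; exact h.min
  · rw [ha.mn, ha.off, ha.am, h.mn]
  · rw [ha.last, h.last]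

/-- Change of values. -/
theorem Rep.congr_val {M : Mem} {v v' : ℕ → ℝ} {q : ℕ} {o : ℝ} {t : Tr} (h : Rep M v q o t)
    (hv : ∀ y ∈ t.inord, v' y = v y) : Rep M v' q o t := by
  induction t generalizing q o with
  | nil => trivial
  | node l x r ihl ihr =>
    obtain ⟨h0, hq, hl, hr, hL, h1, h2⟩ := h
    refine ⟨h0, hq, hl, hr, ?_, ihl h1 fun y hy => hv y (by simp [hy]),
      ihr h2 fun y hy => hv y (by simp [hy])⟩
    have hm := hv _ hL.mem
    exact ⟨by rw [hv x (by simp), hL.val], hL.mem, fun y hy => by rw [hm, hv y hy]; exact hL.min y hy,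
      by rw [hL.mn, hm], hL.last⟩

/-- Change of memory; the parent of the root may change, and its offset, too, if the values remain
the same. -/
theorem Rep.reroot {M M' : Mem} {v : ℕ → ℝ} {q q' : ℕ} {o o' : ℝ} {t : Tr} (h : Rep M v q o t)
    (hnd : t.inord.Nodup) (ha : ∀ y ∈ t.inord, y ≠ t.rt → Agree M M' y)
    (hr : t ≠ .nil → (∀ d, M'.na (chA d) t.rt = M.na (chA d) t.rt) ∧ M'.na 12 t.rt = q' ∧
      M'.na 13 t.rt = M.na 13 t.rt ∧ M'.na 14 t.rt = M.na 14 t.rt ∧ M'.ra 4 t.rt = M.ra 4 t.rt ∧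
      M'.ra 5 t.rt + o' = M.ra 5 t.rt + o ∧ M'.ra 6 t.rt = M.ra 6 t.rt) : Rep M' v q' o' t := by
  induction t generalizing q o q' o' with
  | nil => trivial
  | node l x r ihl ihr =>
    obtain ⟨h0, hq, hl, hr', hL, h1, h2⟩ := h
    obtain ⟨hch, hq', ham, hla, hba, hof, hmn⟩ := hr (by simp)
    simp only [Tr.rt_node] at *
    simp only [Tr.inord_node] at hnd
    have hxl : x ∉ l.inord := fun hx => by
      have := (List.nodup_append.1 hnd).2.2 x hx x (by simp)
      exact this rfl
    have hxr : x ∉ r.inord := (List.nodup_cons.1 (List.nodup_append.1 hnd).2.1).1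
    have hA : ∀ y ∈ l.inord ++ r.inord, Agree M M' y := by
      intro y hy
      refine ha y ?_ ?_
      · simp only [List.mem_append, Tr.inord_node, List.mem_cons] at hy ⊢
        tauto
      · rintro rfl
        simp only [List.mem_append] at hy
        tauto
    refine ⟨h0, hq', by have := hch false; simp only [chA] at this; simpa using this.trans hl,
      by have := hch true; simp only [chA] at this; simpa using this.trans hr', ?_, ?_, ?_⟩
    · exact ⟨by rw [hL.val, hba]; linarith, by rw [ham]; exact hL.mem, by rw [ham]; exact hL.min,
        by rw [ham, ← hL.mn, hmn]; linarith, by rw [hla, hL.last]⟩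
    · refine ihl h1 (List.nodup_append.1 hnd).1 (fun y hy _ => hA y (by simp [hy])) fun hne => ?_
      have := hA l.rt (by simp [Tr.rt_mem hne])
      refine ⟨this.ch, ?_, this.am, this.last, this.base, by rw [this.off]; linarith, this.mn⟩
      rw [this.par]
      cases l
      · exact absurd rfl hne
      · exact h1.2.1
    · refine ihr h2 (List.nodup_cons.1 (List.nodup_append.1 hnd).2.1).2
        (fun y hy _ => hA y (by simp [hy])) fun hne => ?_
      have := hA r.rt (by simp [Tr.rt_mem hne])
      refine ⟨this.ch, ?_, this.am, this.last, this.base, by rw [this.off]; linarith, this.mn⟩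
      rw [this.par]
      cases r
      · exact absurd rfl hne
      · exact h2.2.1

theorem Rep.par_rt {M : Mem} {v : ℕ → ℝ} {q : ℕ} {o : ℝ} {t : Tr} (h : Rep M v q o t)
    (hne : t ≠ .nil) : M.na 12 t.rt = q := by
  cases t
  · exact absurd rfl hne
  · exact h.2.1

theorem Rep.congr {M M' : Mem} {v : ℕ → ℝ} {q : ℕ} {o : ℝ} {t : Tr} (h : Rep M v q o t)
    (hnd : t.inord.Nodup) (ha : ∀ y ∈ t.inord, Agree M M' y) : Rep M' v q o t :=
  h.reroot hnd (fun y hy _ => ha y hy) fun hne => by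
    have := ha _ (Tr.rt_mem hne)
    exact ⟨this.ch, this.par.trans (h.par_rt hne), this.am, this.last, this.base,
      by rw [this.off], this.mn⟩

theorem RepC.congr {M M' : Mem} {v : ℕ → ℝ} {q₀ : ℕ} {o₀ : ℝ} {c : List Tr.Frame} {h : ℕ}
    {vs : List ℕ} {q : ℕ} {o : ℝ} (hC : RepC M v q₀ o₀ c h vs q o) (hnd : (ctxVerts c).Nodup)
    (ha : ∀ y ∈ ctxVerts c, Agree M M' y) : RepC M' v q₀ o₀ c h vs q o := by
  induction c generalizing h vs q o with
  | nil => exact hC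
  | cons f c ih =>
    obtain ⟨hq, h0, hd, hd', o', ho, hs, xs, hxs, hL, hC⟩ := hC
    have hA := ha f.2.1 (by simp [ctxVerts])
    simp only [ctxVerts, List.nodup_cons, List.nodup_append] at hnd
    refine ⟨hq, h0, by rw [hA.ch, hd], by rw [hA.ch, hd'], o', by rw [hA.off, ho], ?_, xs, hxs,
      hL.congr hA, ?_⟩
    · rw [hA.off]
      exact hs.congr hnd.2.1 fun y hy => ha y (by simp [ctxVerts, hy])
    · rw [hA.par]
      exact ih hC hnd.2.2.1 fun y hy => ha y (by simp [ctxVerts, hy])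

/-- Change of the root in the hole. -/
theorem RepC.update {M M' : Mem} {v : ℕ → ℝ} {q₀ : ℕ} {o₀ : ℝ} {c : List Tr.Frame} {h h' : ℕ}
    {vs : List ℕ} {q : ℕ} {o : ℝ} (hC : RepC M v q₀ o₀ c h vs q o) (hnd : (ctxVerts c).Nodup)
    (ha : ∀ y ∈ ctxVerts c, (∀ d, M'.na (chA d) y =
      if (c.head?.map fun f => (f.1, f.2.1)) = some (d, y) then h' else M.na (chA d) y) ∧
      M'.na 12 y = M.na 12 y ∧ M'.na 13 y = M.na 13 y ∧ M'.na 14 y = M.na 14 y ∧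
      M'.ra 4 y = M.ra 4 y ∧ M'.ra 5 y = M.ra 5 y ∧ M'.ra 6 y = M.ra 6 y) :
    RepC M' v q₀ o₀ c h' vs q o := by
  cases c with
  | nil => exact hC
  | cons f c =>
    rcases f with ⟨d, p, s⟩
    obtain ⟨hq, h0, hd, hd', o', ho, hs, xs, hxs, hL, hC⟩ := hC
    simp only at *
    obtain ⟨h1, h2, h3, h4, h5, h6, h7⟩ := ha p (by simp [ctxVerts])
    have hnd' := hnd
    simp only [ctxVerts, List.nodup_cons, List.nodup_append, List.mem_append] at hnd
    have hA : ∀ y ∈ s.inord ++ ctxVerts c, Agree M M' y := by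
      intro y hy
      obtain ⟨h1, h2, h3, h4, h5, h6, h7⟩ := ha y (by simp only [ctxVerts]; exact .tail _ hy)
      refine ⟨fun e => ?_, h2, h3, h4, h5, h6, h7⟩
      rw [h1, if_neg]
      rintro h
      simp only [List.head?_cons, Option.map_some, Option.some.injEq, Prod.mk.injEq] at h
      rw [← h.2, List.mem_append] at hy
      exact hnd.1 hy
    refine ⟨hq, h0, by rw [h1]; simp, by rw [h1]; simp [hd'], o', by rw [h6, ho], ?_, xs, hxs, ?_, ?_⟩
    · rw [h6]
      exact hs.congr hnd.2.1 fun y hy => hA y (by simp [hy])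
    · exact ⟨by rw [h5, h6, hL.val], by rw [h3]; exact hL.mem, by rw [h3]; exact hL.min,
        by rw [h7, h6, h3, hL.mn], by rw [h4, hL.last]⟩
    · simp only
      rw [h2]
      exact hC.congr hnd.2.2.1 fun y hy => hA y (by simp [hy])

theorem Prog.sem_nv (N : Network n m) {P : Prog} (hP : P.straight = true) (M : Mem) {i : ℕ}
    (hi : P.writesN i = false) : (P.sem N M).nv i = M.nv i := by
  obtain ⟨k, hk, -⟩ := P.exec_straight N hP M
  exact hk.nv hi

theorem Prog.sem_na (N : Network n m) {P : Prog} (hP : P.straight = true) (M : Mem) {i : ℕ}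
    (hi : P.writesNA i = false) : (P.sem N M).na i = M.na i := by
  obtain ⟨k, hk, -⟩ := P.exec_straight N hP M
  exact hk.na hi

theorem Prog.sem_ra (N : Network n m) {P : Prog} (hP : P.straight = true) (M : Mem) {i : ℕ}
    (hi : P.writesRA i = false) : (P.sem N M).ra i = M.ra i := by
  obtain ⟨k, hk, -⟩ := P.exec_straight N hP M
  exact hk.ra hi

theorem Rep.loc {M : Mem} {v : ℕ → ℝ} {q : ℕ} {o : ℝ} {t : Tr} (h : Rep M v q o t)
    (hne : t ≠ .nil) : Loc M v o t.inord t.rt := by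
  cases t
  · exact absurd rfl hne
  · exact h.2.2.2.2.1

theorem Rep.ne_zero {M : Mem} {v : ℕ → ℝ} {q : ℕ} {o : ℝ} {t : Tr} (h : Rep M v q o t) :
    0 ∉ t.inord := by
  induction t generalizing q o with
  | nil => simp
  | node l x r ihl ihr =>
    obtain ⟨h0, -, -, -, -, h1, h2⟩ := h
    simp only [Tr.inord_node, List.mem_append, List.mem_cons, not_or]
    exact ⟨ihl h1, h0.symm, ihr h2⟩

theorem Rep.rt_eq_zero {M : Mem} {v : ℕ → ℝ} {q : ℕ} {o : ℝ} {t : Tr} (h : Rep M v q o t) :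
    t.rt = 0 ↔ t = .nil := by
  refine ⟨fun h' => ?_, fun h' => by rw [h']; rfl⟩
  by_contra hne
  exact h.ne_zero (h' ▸ Tr.rt_mem hne)

/-- The effect of a step of `pull` on the least value. -/
theorem pullChild_min (N : Network n m) (d : Bool)
    {M : Mem} {v : ℕ → ℝ} {o : ℝ} {p : ℕ} (hp : M.nv 14 = p) {t : Tr} {xs ys : List ℕ}
    (hch : M.na (chA d) p = t.rt) (ht : Rep M v p (o + M.ra 5 p) t) (hpt : p ∉ t.inord)
    (hys : ∀ y, y ∈ ys ↔ y ∈ xs ∨ y ∈ t.inord)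
    (h : M.na 13 p ∈ xs ∧ (∀ y ∈ xs, v (M.na 13 p) ≤ v y) ∧
      M.ra 6 p + M.ra 5 p + o = v (M.na 13 p)) :
    let M' := (pullChild d).sem N M
    M'.na 13 p ∈ ys ∧ (∀ y ∈ ys, v (M'.na 13 p) ≤ v y) ∧
      M'.ra 6 p + M.ra 5 p + o = v (M'.na 13 p) ∧
      (∀ y, y ≠ p → M'.na 13 y = M.na 13 y ∧ M'.na 14 y = M.na 14 y ∧ M'.ra 6 y = M.ra 6 y) ∧
      (d = false ∨ t = .nil → M'.na 14 p = M.na 14 p) ∧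
      (d = true → t ≠ .nil → M'.na 14 p = M.na 14 t.rt) := by
  obtain ⟨h1, h2, h3⟩ := h
  by_cases hne : t = .nil
  · subst hne
    simp only [Tr.rt_nil] at hch
    simp only [Tr.inord_nil, List.not_mem_nil, or_false] at hys
    have : (pullChild d).sem N M = M.setN 15 0 := by
      simp [pullChild, Prog.sem, NExp.eval, BExp.Holds, hp, hch]
    rw [this]
    exact ⟨by rwa [hys], fun y hy => h2 y ((hys y).1 hy), by simpa using h3, by simp, by simp,
      by simp⟩
  · have hL := ht.loc hne
    have hc0 : t.rt ≠ 0 := fun h => hne (ht.rt_eq_zero.1 h)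
    have hcp : t.rt ≠ p := fun h => hpt (h ▸ Tr.rt_mem hne)
    have hm := hL.mn
    generalize t.rt = c at hch hL hc0 hcp hm ⊢
    -- Only the right child can change the last vertex, so the two sides differ merely in whether
    -- `na 14 p` is overwritten before the minima are compared.
    have hM : ∃ M₀ : Mem, (∀ a, a ≠ 14 → M₀.na a = M.na a) ∧ M₀.ra = M.ra ∧
        (∀ y, y ≠ p → M₀.na 14 y = M.na 14 y) ∧
        (M₀.na 14 p = if d then M.na 14 c else M.na 14 p) ∧
        (pullChild d).sem N M = if M.ra 5 c + M.ra 6 c < M.ra 6 p then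
          (M₀.setRA 6 p (M.ra 5 c + M.ra 6 c)).setNA 13 p (M.na 13 c) else M₀ := by
      cases d
      · refine ⟨M.setN 15 c, by simp, by simp, by simp, by simp, ?_⟩
        simp [pullChild, Prog.sem, NExp.eval, RExp.eval, BExp.Holds, hp, hch, hc0]
      · refine ⟨(M.setN 15 c).setNA 14 p (M.na 14 c), fun a h => by ext; simp [h], by simp,
          fun y h => by simp [h], by simp, ?_⟩
        simp [pullChild, Prog.sem, NExp.eval, RExp.eval, BExp.Holds, hp, hch, hc0]
    obtain ⟨M₀, e1, e2, e3, e4, hM⟩ := hM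
    have hlt : M.ra 5 c + M.ra 6 c < M.ra 6 p ↔ v (M.na 13 c) < v (M.na 13 p) := by
      rw [← h3, ← hm]
      constructor <;> intro <;> linarith
    have e14 : d = true → M₀.na 14 p = M.na 14 c := fun h => by rw [e4, if_pos h]
    have e14' : d = false ∨ t = .nil → M₀.na 14 p = M.na 14 p := fun h => by
      rw [e4, if_neg (by simpa [hne] using h)]
    rw [hM]
    by_cases hlt' : M.ra 5 c + M.ra 6 c < M.ra 6 p
    · have hv := hlt.1 hlt'
      rw [if_pos hlt']
      refine ⟨?_, fun y hy => ?_, ?_, fun y hy => ?_, fun h => ?_, fun h _ => ?_⟩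
      · simpa using (hys _).2 (.inr hL.mem)
      · rcases (hys y).1 hy with hy | hy
        · simpa using hv.le.trans (h2 y hy)
        · simpa using hL.min y hy
      · simp only [Mem.setNA_ra, Mem.setRA_ra, Mem.setNA_na, and_self, if_true]
        linarith
      · simp [hy, e1, e2, e3]
      · simpa using e14' h
      · simpa using e14 h
    · have hv := not_lt.1 fun h => hlt' (hlt.2 h)
      rw [if_neg hlt']
      simp only [e1 13 (by simp), e2]
      refine ⟨(hys _).2 (.inl h1), fun y hy => ?_, h3, fun y hy => by simp [e3 y hy], e14',
        fun h _ => e14 h⟩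
      rcases (hys y).1 hy with hy | hy
      · exact h2 y hy
      · exact hv.trans (hL.min y hy)

/-- The minimum is taken over `[p]`, then over the left list with `p`, then over all vertices. The
last vertex is that of the right subtree, or `p` if the right subtree is empty. -/
theorem pull_spec (N : Network n m) {M : Mem} {v : ℕ → ℝ} {o : ℝ} {p : ℕ} (hp : M.nv 14 = p)
    {l r : Tr} (hl : M.na 10 p = l.rt) (hr : M.na 11 p = r.rt)
    (hlr : Rep M v p (o + M.ra 5 p) l) (hrr : Rep M v p (o + M.ra 5 p) r)
    (hnd : (Tr.node l p r).inord.Nodup) (hv : v p = M.ra 4 p + M.ra 5 p + o) :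
    Loc (pull.sem N M) v o (Tr.node l p r).inord p ∧
      (∀ y, y ≠ p → Agree M (pull.sem N M) y) ∧
      (∀ a, a ≠ 13 → a ≠ 14 → (pull.sem N M).na a = M.na a) ∧
      (∀ a, a ≠ 6 → (pull.sem N M).ra a = M.ra a) := by
  have hna : ∀ a, a ≠ 13 → a ≠ 14 → (pull.sem N M).na a = M.na a := fun a h h' =>
    Prog.sem_na N rfl M (by simp [pull, block, pullChild, Prog.writesNA, h, h'])
  have hra : ∀ a, a ≠ 6 → (pull.sem N M).ra a = M.ra a := fun a h =>
    Prog.sem_ra N rfl M (by simp [pull, block, pullChild, Prog.writesRA, h])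
  simp only [Tr.inord_node] at hnd
  have hpl : p ∉ l.inord := fun hx => (List.nodup_append.1 hnd).2.2 p hx p (by simp) rfl
  have hpr : p ∉ r.inord := (List.nodup_cons.1 (List.nodup_append.1 hnd).2.1).1
  set M₁ := ((M.setNA 13 p p).setNA 14 p p).setRA 6 p (M.ra 4 p) with hM₁
  have hA₁ : ∀ y, y ≠ p → Agree M M₁ y := fun y hy =>
    ⟨fun d => by cases d <;> simp [M₁, chA], by simp [M₁], by simp [M₁, hy], by simp [M₁, hy],
      by simp [M₁], by simp [M₁], by simp [M₁, hy]⟩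
  have hneq : ∀ {t : Tr}, p ∉ t.inord → ∀ y ∈ t.inord, y ≠ p := fun h y hy hyp => h (hyp ▸ hy)
  have h1 := pullChild_min N false (M := M₁) (v := v) (o := o) (p := p)
    (by simp [M₁, hp]) (t := l) (xs := [p]) (ys := l.inord ++ [p]) (by simp [M₁, chA, hl])
    (by simpa [M₁] using hlr.congr (List.nodup_append.1 hnd).1 fun y hy => hA₁ y (hneq hpl y hy))
    hpl (by simp [or_comm]) ⟨by simp [M₁], by simp [M₁], by simp [M₁, hv]⟩
  set M₂ := (pullChild false).sem N M₁ with hM₂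
  have hst : (pullChild false).straight = true := rfl
  have h2na : ∀ a, a ≠ 13 → M₂.na a = M₁.na a := fun a h =>
    Prog.sem_na N rfl M₁ (by simp [pullChild, Prog.writesNA, h])
  have h2ra : ∀ a, a ≠ 6 → M₂.ra a = M₁.ra a := fun a h =>
    Prog.sem_ra N rfl M₁ (by simp [pullChild, Prog.writesRA, h])
  have h2nv : M₂.nv 14 = p := by
    rw [hM₂, Prog.sem_nv N hst M₁ (by simp [pullChild, Prog.writesN])]
    simp [M₁, hp]
  obtain ⟨ha, hb, hc, hd, he, -⟩ := h1
  have hA₂ : ∀ y, y ≠ p → Agree M M₂ y := fun y hy =>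
    (hA₁ y hy).trans ⟨fun d => by rw [h2na _ (by cases d <;> simp [chA])], by rw [h2na _ (by simp)],
      (hd y hy).1, (hd y hy).2.1, by rw [h2ra _ (by simp)], by rw [h2ra _ (by simp)], (hd y hy).2.2⟩
  have h3 := pullChild_min N true (M := M₂)
    (v := v) (o := o) (p := p) h2nv (t := r) (xs := l.inord ++ [p])
    (ys := (Tr.node l p r).inord) (by rw [h2na _ (by simp [chA])]; simp [M₁, chA, hr])
    (by
      rw [h2ra _ (by simp)]
      simpa [M₁] using hrr.congr (List.nodup_cons.1 (List.nodup_append.1 hnd).2.1).2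
        fun y hy => hA₂ y (hneq hpr y hy))
    hpr (by simp [or_assoc]) ⟨ha, hb, by rw [h2ra 5 (by simp)]; simpa [M₁] using hc⟩
  have hM : pull.sem N M =
      (pullChild true).sem N M₂ := by
    simp [pull, block, Prog.sem, M₂, M₁, NExp.eval, RExp.eval, hp]
  rw [← hM] at h3
  obtain ⟨ha', hb', hc', hd', he', he''⟩ := h3
  refine ⟨⟨?_, ha', hb', ?_, ?_⟩, fun y hy => ?_, hna, hra⟩
  · rw [hra _ (by simp), hra _ (by simp), hv]
  · rw [hra 5 (by simp)]
    rw [h2ra 5 (by simp)] at hc'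
    simpa [M₁] using hc'
  · rw [Tr.inord_node, List.getLast?_append, List.getLast?_cons]
    by_cases hrn : r = .nil
    · rw [he' (.inr hrn), h2na 14 (by simp), hrn]
      simp [M₁]
    · have hrp : r.rt ≠ p := hneq hpr _ (Tr.rt_mem hrn)
      rw [he'' rfl hrn, h2na 14 (by simp), (hrr.loc hrn).last]
      simp [M₁, hrp]
  · exact (hA₂ y hy).trans ⟨fun d => by
        rw [hna _ (by cases d <;> simp [chA]) (by cases d <;> simp [chA])]
        rw [h2na _ (by cases d <;> simp [chA])]; cases d <;> simp [M₁, chA],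
      by rw [hna _ (by simp) (by simp), h2na _ (by simp)]; simp [M₁], (hd' y hy).1, (hd' y hy).2.1,
      by rw [hra _ (by simp), h2ra _ (by simp)]; simp [M₁],
      by rw [hra _ (by simp), h2ra _ (by simp)]; simp [M₁], (hd' y hy).2.2⟩

/-! ### Rotations and splaying in memory -/

/-- Let the vertex in register `10` replace the child in register `11` of the vertex in
register `12`. -/
def replaceChild : Prog :=
  .cond (.neq (.arr 10 (.var 12)) (.var 11)) (.nstore 10 (.var 12) (.var 10))
    (.cond (.neq (.arr 11 (.var 12)) (.var 11)) (.nstore 11 (.var 12) (.var 10)) .skip)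

/-- Rotate the vertex in register `10`, which is the child on side `d` of the vertex in
register `11`. -/
def rotateSide (d : Bool) : Prog := block
  [.nset 12 (.arr 12 (.var 11)), .nset 13 (.arr (chA !d) (.var 10)), .nset 14 (.var 11),
   .rset 10 (.arr 5 (.var 10)), replaceChild,
   .nstore (chA d) (.var 11) (.var 13), .nstore (chA !d) (.var 10) (.var 11),
   .nstore 12 (.var 13) (.var 11), .nstore 12 (.var 10) (.var 12), .nstore 12 (.var 11) (.var 10),
   .rstore 5 (.var 13) (.add (.arr 5 (.var 13)) (.var 10)),
   .rstore 5 (.var 10) (.add (.arr 5 (.var 11)) (.var 10)),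
   .rstore 5 (.var 11) (.sub (.lit 0) (.var 10)),
   .nstore 13 (.var 10) (.arr 13 (.var 11)), .nstore 14 (.var 10) (.arr 14 (.var 11)),
   .rstore 6 (.var 10) (.sub (.arr 6 (.var 11)) (.var 10)),
   pull]

theorem chA_ne {d : Bool} : chA d ≠ 12 ∧ chA d ≠ 13 ∧ chA d ≠ 14 ∧ chA d ≠ chA (!d) := by
  cases d <;> simp [chA]

theorem chA_inj {d e : Bool} : chA d = chA e ↔ d = e := by
  cases d <;> cases e <;> simp [chA]

/-- The memory in `rotateSide` before the data of the lower vertex are recomputed. -/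
theorem rotateSide_sem (N : Network n m) (d : Bool) {M : Mem} {x p q b : ℕ} (hx : M.nv 10 = x)
    (hp : M.nv 11 = p) (hq : M.na 12 p = q) (hb : M.na (chA !d) x = b) (hxp : x ≠ p) (hbx : b ≠ x)
    (hbp : b ≠ p) {R : ℕ → ℕ → ℕ}
    (hR : ∀ M' : Mem, M'.na = M.na → M'.nv 10 = x → M'.nv 11 = p → M'.nv 12 = q →
      replaceChild.sem N M' = { M' with na := R }) :
    ∃ M₁ : Mem, (rotateSide d).sem N M = pull.sem N M₁ ∧ M₁.nv 10 = x ∧ M₁.nv 14 = p ∧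
      (∀ a y, M₁.na a y =
        if a = 12 then (if y = p then x else if y = x then q else if y = b then p else R 12 y)
        else if a = chA d ∧ y = p then b else if a = chA !d ∧ y = x then p
        else if a = 13 ∧ y = x then R 13 p else if a = 14 ∧ y = x then R 14 p else R a y) ∧
      M₁.ra 4 = M.ra 4 ∧
      (∀ y, M₁.ra 5 y = if y = p then - M.ra 5 x else if y = x then M.ra 5 p + M.ra 5 x
        else if y = b then M.ra 5 b + M.ra 5 x else M.ra 5 y) ∧
      (∀ y, M₁.ra 6 y = if y = x then M.ra 6 p - M.ra 5 x else M.ra 6 y) := by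
  have hR' := hR ((((M.setN 12 q).setN 13 b).setN 14 p).setR 10 (M.ra 5 x)) (by simp) (by simp [hx])
    (by simp [hp]) (by simp)
  refine ⟨_, by simp only [rotateSide, block, Prog.sem]; rfl, ?_, ?_, ?_, ?_, ?_, ?_⟩ <;>
    simp only [NExp.eval, RExp.eval, hx, hp, hq, hb, Mem.setN_nv, Mem.setN_na, Mem.setN_ra,
      Nat.reduceEqDiff, if_false, if_true, hR', Mem.setR_nv, Mem.setNA_nv, Mem.setNA_na,
      Mem.setNA_ra, Mem.setRA_nv, Mem.setRA_na, Mem.setRA_ra, Mem.setR_ra, Mem.setR_rv, Mem.setRA_rv,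
      Mem.setNA_rv, Mem.setN_rv]
  · intro a y
    have := hbx.symm
    have := hbp.symm
    have h1 := chA_ne (d := d)
    have h2 := chA_ne (d := !d)
    simp only [hxp.symm, h1.2.1.symm, h1.2.2.1.symm, h2.2.1.symm, h2.2.2.1.symm, false_and, if_false,
      and_true, and_false]
    by_cases ha : a = 12
    · subst ha
      simp [h1.1.symm, h2.1.symm]
    · by_cases h3 : a = 14 <;> by_cases h4 : a = 13 <;> by_cases h5 : a = chA d <;>
        by_cases h6 : a = chA !d <;> simp_all
  · rfl
  · intro y
    have := hbx.symm
    have := hbp.symm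
    by_cases h1 : y = p <;> by_cases h2 : y = x <;> by_cases h3 : y = b <;> simp_all
  · intro y
    simp

/-- The case of the root of a splay tree: its parent pointer leads to another path (or to 0), where
it is not a child, so nothing is overwritten there. -/
theorem replaceChild_sem_nil (N : Network n m) {M : Mem} (h : ∀ d, M.na (chA d) (M.nv 12) ≠ M.nv 11) :
    replaceChild.sem N M = { M with na := M.na } := by
  have h1 := h false
  have h2 := h true
  simp only [chA, Bool.false_eq_true, if_false, if_true] at h1 h2
  simp [replaceChild, Prog.sem, BExp.Holds, NExp.eval, h1, h2]

theorem replaceChild_sem_cons (N : Network n m) {M : Mem} (d : Bool)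
    (h : M.na (chA d) (M.nv 12) = M.nv 11) (h' : M.na (chA !d) (M.nv 12) ≠ M.nv 11) :
    replaceChild.sem N M = { M with na := (M.setNA (chA d) (M.nv 12) (M.nv 10)).na } := by
  cases d <;> simp only [chA, Bool.false_eq_true, if_false, if_true, Bool.not_true,
    Bool.not_false] at h h'
  · simp [replaceChild, Prog.sem, BExp.Holds, NExp.eval, h, chA]
    rfl
  · simp [replaceChild, Prog.sem, BExp.Holds, NExp.eval, h, h', chA]
    rfl

theorem pull_spec_mk (N : Network n m) {M : Mem} {v : ℕ → ℝ} {o : ℝ} {p : ℕ} (hp : M.nv 14 = p)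
    {d : Bool} {a b : Tr} (ha : M.na (chA d) p = a.rt) (hb : M.na (chA !d) p = b.rt)
    (hra : Rep M v p (o + M.ra 5 p) a) (hrb : Rep M v p (o + M.ra 5 p) b)
    (hnd : (Tr.mk d a p b).inord.Nodup) (hv : v p = M.ra 4 p + M.ra 5 p + o) :
    Loc (pull.sem N M) v o (Tr.mk d a p b).inord p ∧
      (∀ y, y ≠ p → Agree M (pull.sem N M) y) ∧
      (∀ a, a ≠ 13 → a ≠ 14 → (pull.sem N M).na a = M.na a) ∧
      (∀ a, a ≠ 6 → (pull.sem N M).ra a = M.ra a) := by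
  cases d
  · exact pull_spec N hp ha hb hra hrb hnd hv
  · exact pull_spec N hp hb ha hrb hra hnd hv

theorem Tr.inord_rotate' (d : Bool) (a : Tr) (x : ℕ) (b : Tr) (p : ℕ) (s : Tr) :
    (mk d (mk d a x b) p s).inord = (mk d a x (mk d b p s)).inord := by
  cases d <;> simp [mk]

/-- With ξ the old offset of `x`, the new offsets are offset(p) + ξ at `x`, -ξ at `p`, and offset(b)
+ ξ at the middle subtree, which preserves all sums along ancestors. The set of vertices below `x`
is now that formerly below `p`, so `x` inherits the aggregates of `p` and only those of `p` are
recomputed. The hypothesis on `q₀` prevents a child pointer outside the tree from being redirected.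
-/
theorem rotateSide_spec (N : Network n m) (d : Bool) {M : Mem} {v : ℕ → ℝ} {q₀ : ℕ} {o₀ : ℝ}
    {x p : ℕ} {a b s : Tr} {c : List Tr.Frame} (hx : M.nv 10 = x) (hp : M.nv 11 = p)
    (hrep : Rep M v q₀ o₀ ((Tr.mk d (.mk d a x b) p s).plug c))
    (hnd : ((Tr.mk d (.mk d a x b) p s).plug c).inord.Nodup) (h0 : ∀ e, M.na (chA e) 0 = 0)
    (hq₀ : ∀ e, ∀ y ∈ ((Tr.mk d (.mk d a x b) p s).plug c).inord, M.na (chA e) q₀ ≠ y) :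
    Rep ((rotateSide d).sem N M) v q₀ o₀ ((Tr.mk d a x (.mk d b p s)).plug c) ∧
      (∀ y, y ∉ ((Tr.mk d (.mk d a x b) p s).plug c).inord → y ≠ 0 →
        Agree M ((rotateSide d).sem N M) y) ∧
      (∀ e, ((rotateSide d).sem N M).na (chA e) 0 = 0) ∧ ((rotateSide d).sem N M).nv 10 = x := by
  have hperm := inord_plug_perm (Tr.mk d (.mk d a x b) p s) c
  rw [hperm.nodup_iff] at hnd
  simp only [hperm.mem_iff, List.mem_append, Tr.mem_inord_mk] at hq₀ ⊢
  have hnd₂ : (p :: x :: (a.inord ++ b.inord ++ s.inord ++ ctxVerts c)).Nodup := by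
    refine (List.Perm.nodup_iff ?_).1 hnd
    refine ((Tr.inord_mk_perm _ _ _ _).append_right _).trans ?_
    rw [List.cons_append]
    refine List.Perm.cons _ ?_
    rw [← List.cons_append, ← List.cons_append]
    exact ((Tr.inord_mk_perm _ _ _ _).append_right _).append_right _
  have hndt : (Tr.mk d a x (.mk d b p s)).inord.Nodup := by
    rw [← Tr.inord_rotate']; exact (List.nodup_append.1 hnd).1
  have hndp : (Tr.mk d b p s).inord.Nodup := by
    have := (Tr.inord_mk_perm d a x (.mk d b p s)).nodup_iff.1 hndt
    exact (List.nodup_append.1 (List.nodup_cons.1 this).2).2.1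
  obtain ⟨q, o, hC, ht⟩ := rep_plug.1 hrep
  obtain ⟨hp0, hpq, hdp, hdp', hLp, hrx, hrs⟩ := rep_mk.1 ht
  obtain ⟨hx0, hxp', hdx, hdx', hLx, hra, hrb⟩ := rep_mk.1 hrx
  simp only [Tr.rt_mk] at hC hdp
  simp only [List.nodup_cons, List.nodup_append, List.mem_cons, List.mem_append, not_or] at hnd₂
  obtain ⟨⟨hpx, ⟨⟨hpa, hpb⟩, hps⟩, hpc⟩, ⟨⟨⟨hxa, hxb⟩, hxs⟩, hxc⟩,
    ⟨⟨hna, hnb, hab⟩, hns, habs⟩, hnc, habsc⟩ := hnd₂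
  have hbx : b.rt ≠ x := by
    rintro h
    by_cases hbn : b = .nil
    · exact hx0 (by rw [← h, hbn]; rfl)
    · exact hxb (h ▸ Tr.rt_mem hbn)
  have hbp : b.rt ≠ p := by
    rintro h
    by_cases hbn : b = .nil
    · exact hp0 (by rw [← h, hbn]; rfl)
    · exact hpb (h ▸ Tr.rt_mem hbn)
  -- `R` holds the integer arrays after the parent of `p` has been informed. It treats uniformly the
  -- case that `p` is the root and the case that `p` is a child of the innermost frame.
  obtain ⟨R, hR, hR1, hR2⟩ : ∃ R : ℕ → ℕ → ℕ,
      (∀ M' : Mem, M'.na = M.na → M'.nv 10 = x → M'.nv 11 = p → M'.nv 12 = q →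
        replaceChild.sem N M' = { M' with na := R }) ∧
      (∀ a y, a = 12 ∨ a = 13 ∨ a = 14 → R a y = M.na a y) ∧
      ∀ e y, R (chA e) y =
        if (c.head?.map fun f => (f.1, f.2.1)) = some (e, y) then x else M.na (chA e) y := by
    cases c with
    | nil =>
      refine ⟨M.na, fun M' h1 h2 h3 h4 => ?_, fun _ _ _ => rfl, fun e y => by simp⟩
      rw [replaceChild_sem_nil N, ← h1]
      intro e
      rw [h1, h3, h4, hC.1]
      exact hq₀ e p (.inl (.inl rfl))
    | cons f c =>
      rcases f with ⟨e, g, u⟩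
      obtain ⟨hq, hg0, hg1, hg2, -⟩ := hC
      simp only at hq hg0 hg1 hg2
      subst hq
      refine ⟨(M.setNA (chA e) q x).na, fun M' h1 h2 h3 h4 => ?_, fun a y ha => ?_, fun e' y => ?_⟩
      · rw [replaceChild_sem_cons N e]
        · simp only [Mem.setNA, h1, h2, h4]
        · rw [h1, h3, h4, hg1]
        · rw [h1, h3, h4, hg2]
          intro h
          by_cases hun : u = .nil
          · exact hp0 (by rw [← h, hun]; rfl)
          · exact hpc (by simp [ctxVerts, ← h, Tr.rt_mem hun])
      · have := chA_ne (d := e)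
        rw [Mem.setNA_na, if_neg]
        rintro ⟨rfl, -⟩
        tauto
      · simp only [Mem.setNA_na, chA_inj, List.head?_cons, Option.map_some, Option.some.injEq,
          Prod.mk.injEq]
        congr 1
        simp [eq_comm]
  obtain ⟨M₁, hM₁, h10, h14, hn, hr4, hr5, hr6⟩ :=
    rotateSide_sem N d hx hp hpq hdx' (Ne.symm hpx) hbx hbp hR
  have hch : ∀ e y, M₁.na (chA e) y = if e = d ∧ y = p then b.rt else if e = !d ∧ y = x then p
      else R (chA e) y := by
    intro e y
    have h := chA_ne (d := e)
    rw [hn]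
    simp only [h.1, h.2.1, h.2.2.1, chA_inj, if_false, false_and]
  have h12 : ∀ y, M₁.na 12 y = if y = p then x else if y = x then q else if y = b.rt then p
      else M.na 12 y := by
    intro y
    rw [hn, if_pos rfl, hR1 _ _ (.inl rfl)]
  have h13 : ∀ y, M₁.na 13 y = if y = x then M.na 13 p else M.na 13 y := by
    intro y
    have h := chA_ne (d := d)
    have h' := chA_ne (d := !d)
    rw [hn, hR1 13 p (by simp), hR1 14 p (by simp), hR1 13 y (by simp)]
    simp [h.2.1.symm, h'.2.1.symm]
  have h14' : ∀ y, M₁.na 14 y = if y = x then M.na 14 p else M.na 14 y := by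
    intro y
    have h := chA_ne (d := d)
    have h' := chA_ne (d := !d)
    rw [hn, hR1 13 p (by simp), hR1 14 p (by simp), hR1 14 y (by simp)]
    simp [h.2.2.1.symm, h'.2.2.1.symm]
  have hc_head : ∀ e y, y ∉ ctxVerts c → (c.head?.map fun f => (f.1, f.2.1)) ≠ some (e, y) := by
    intro e y hy h
    cases c with
    | nil => simp at h
    | cons f c =>
      simp only [List.head?_cons, Option.map_some, Option.some.injEq, Prod.mk.injEq] at h
      exact hy (by simp [ctxVerts, h.2])
  have hAg : ∀ y, y ≠ x → y ≠ p → y ≠ b.rt → y ∉ ctxVerts c → Agree M M₁ y := by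
    intro y h1 h2 h3 h4
    exact ⟨fun e => by simp [hch, h1, h2, hR2, hc_head e y h4], by simp [h12, h1, h2, h3],
      by simp [h13, h1], by simp [h14', h1], by rw [hr4], by simp [hr5, h1, h2, h3], by simp [hr6, h1]⟩
  -- If `b` is empty, its root number is 0 and the writes meant for the root of `b` go to cell 0.
  -- Hence agreement with the old memory is claimed only for nonzero cells.
  have hbne : ∀ y, y ≠ 0 → y ∉ b.inord → y ≠ b.rt := by
    rintro y hy0 hy rfl
    by_cases hbn : b = .nil
    · exact hy0 (by rw [hbn]; rfl)
    · exact hy (Tr.rt_mem hbn)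
  have h5x : M₁.ra 5 x = M.ra 5 p + M.ra 5 x := by simp [hr5, Ne.symm hpx]
  have h5p : M₁.ra 5 p = - M.ra 5 x := by simp [hr5]
  have hAa : ∀ y ∈ a.inord, Agree M M₁ y := fun y hy =>
    hAg y (fun h => hxa (h ▸ hy)) (fun h => hpa (h ▸ hy))
      (hbne y (fun h => hra.ne_zero (h ▸ hy)) fun h => hab y hy y h rfl)
      fun h => habsc y (.inl (.inl hy)) y h rfl
  have hAs : ∀ y ∈ s.inord, Agree M M₁ y := fun y hy =>
    hAg y (fun h => hxs (h ▸ hy)) (fun h => hps (h ▸ hy))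
      (hbne y (fun h => hrs.ne_zero (h ▸ hy)) fun h => habs y (.inr h) y hy rfl)
      fun h => habsc y (.inr hy) y h rfl
  have hra₁ : Rep M₁ v x (o + M₁.ra 5 x) a := by
    convert hra.congr hna hAa using 1
    rw [h5x]; ring
  have hrs₁ : Rep M₁ v p (o + M₁.ra 5 x + M₁.ra 5 p) s := by
    convert hrs.congr hns hAs using 1
    rw [h5x, h5p]; ring
  have hrb₁ : Rep M₁ v p (o + M₁.ra 5 x + M₁.ra 5 p) b := by
    have hb1 : ∀ y ∈ b.inord, y ≠ x := fun y hy h => hxb (h ▸ hy)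
    have hb2 : ∀ y ∈ b.inord, y ≠ p := fun y hy h => hpb (h ▸ hy)
    have hb3 : ∀ y ∈ b.inord, y ∉ ctxVerts c := fun y hy h => habsc y (.inl (.inr hy)) y h rfl
    refine hrb.reroot hnb (fun y hy hyr => hAg y (hb1 y hy) (hb2 y hy) hyr (hb3 y hy)) fun hbn => ?_
    have hm := Tr.rt_mem hbn
    refine ⟨fun e => ?_, ?_, ?_, ?_, by rw [hr4], ?_, ?_⟩
    · simp [hch, hbx, hbp, hR2, hc_head e _ (hb3 _ hm)]
    · simp [h12, hbx, hbp]
    · simp [h13, hbx]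
    · simp [h14', hbx]
    · rw [h5x, h5p]; simp [hr5, hbx, hbp]; ring
    · simp [hr6, hbx]
  have hps₁ := pull_spec_mk N h14 (v := v) (o := o + M₁.ra 5 x) (d := d) (a := b) (b := s)
    (by simp [hch]) (by simp [hch, hpx, hR2, hc_head (!d) p hpc, hdp']) hrb₁ hrs₁ hndp
    (by rw [hr4, h5x, h5p, hLp.val]; ring)
  rw [hM₁]
  obtain ⟨hLp', hAg', hna', hra'⟩ := hps₁
  set M' := pull.sem N M₁ with hM'
  have hxA := hAg' x (Ne.symm hpx)
  have hpA5 : M'.ra 5 p = M₁.ra 5 p := by rw [hra' _ (by simp)]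
  have hrep' : Rep M' v q o (.mk d a x (.mk d b p s)) := by
    rw [rep_mk]
    refine ⟨hx0, ?_, ?_, ?_, ?_, ?_, ?_⟩
    · rw [hxA.par]; simp [h12, Ne.symm hpx]
    · rw [hxA.ch, hch]; simp [Ne.symm hpx, hR2, hc_head d x hxc, hdx]
    · rw [hxA.ch, hch]; simp
    · rw [← Tr.inord_rotate']
      have e13 : M₁.na 13 x = M.na 13 p := by simp [h13]
      refine Loc.congr (M := M₁) ⟨?_, ?_, ?_, ?_, ?_⟩ hxA
      · rw [hr4, h5x, hLx.val]; ring
      · rw [e13]; exact hLp.mem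
      · rw [e13]; exact hLp.min
      · rw [e13, ← hLp.mn, h5x]; simp [hr6]
      · rw [hLp.last]; simp [h14']
    · rw [hxA.off]
      exact hra₁.congr hna fun y hy => hAg' y fun h => hpa (h ▸ hy)
    · rw [hxA.off, rep_mk]
      refine ⟨hp0, ?_, ?_, ?_, hLp', ?_, ?_⟩
      · rw [hna' _ (by simp) (by simp)]; simp [h12]
      · rw [hna' _ chA_ne.2.1 chA_ne.2.2.1, hch]; simp
      · rw [hna' _ chA_ne.2.1 chA_ne.2.2.1, hch]
        simp [hpx, hR2, hc_head (!d) p hpc, hdp']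
      · rw [hpA5]
        exact hrb₁.congr hnb fun y hy => hAg' y fun h => hpb (h ▸ hy)
      · rw [hpA5]
        exact hrs₁.congr hns fun y hy => hAg' y fun h => hps (h ▸ hy)
  refine ⟨rep_plug.2 ⟨q, o, ?_, hrep'⟩, ?_, ?_, ?_⟩
  · rw [← Tr.inord_rotate', Tr.rt_mk]
    refine hC.update hnc fun y hy => ?_
    have hyx : y ≠ x := fun h => hxc (h ▸ hy)
    have hyp : y ≠ p := fun h => hpc (h ▸ hy)
    have hy0 : y ≠ 0 := fun h => hrep.ne_zero (hperm.mem_iff.2 (by simp [← h, hy]))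
    have hyb : y ≠ b.rt := hbne y hy0 fun h => habsc y (.inl (.inr h)) y hy rfl
    have hA := hAg' y hyp
    refine ⟨fun e => ?_, ?_, ?_, ?_, ?_, ?_, ?_⟩
    · rw [hA.ch, hch]; simp [hyx, hyp, hR2]
    · rw [hA.par]; simp [h12, hyx, hyp, hyb]
    · rw [hA.am]; simp [h13, hyx]
    · rw [hA.last]; simp [h14', hyx]
    · rw [hA.base, hr4]
    · rw [hA.off]; simp [hr5, hyx, hyp, hyb]
    · rw [hA.mn]; simp [hr6, hyx]
  · intro y hy hy0
    simp only [not_or] at hy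
    obtain ⟨⟨h1, ⟨h2, h3, h4⟩, h5⟩, h6⟩ := hy
    exact (hAg y h2 h1 (hbne y hy0 h4) h6).trans (hAg' y h1)
  · intro e
    have hc0 : 0 ∉ ctxVerts c := fun h => hrep.ne_zero (hperm.mem_iff.2 (by simp [h]))
    rw [hna' _ chA_ne.2.1 chA_ne.2.2.1, hch]
    simp [Ne.symm hp0, Ne.symm hx0, hR2, hc_head e 0 hc0, h0]
  · rw [hM', Prog.sem_nv N rfl M₁ (by rfl), h10]

/-- Rotate the vertex in register `10`. -/
def rotate : Prog := .seq (.nset 11 (.arr 12 (.var 10)))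
  (.cond (.neq (.arr 10 (.var 11)) (.var 10)) (rotateSide false) (rotateSide true))

/-- The vertex `x` is a child of the vertex `p`. -/
def childTest (p x : NExp) : BExp :=
  .not (.and (.not (.neq (.arr 10 p) x)) (.not (.neq (.arr 11 p) x)))

/-- A step of splaying the vertex in register `10`. -/
def splayStep : Prog := block
  [.nset 20 (.var 10), .nset 18 (.arr 12 (.var 10)), .nset 19 (.arr 12 (.var 18)),
   .cond (childTest (.var 19) (.var 18))
    (.cond (.not (.and (.not (.and (.neq (.arr 10 (.var 19)) (.var 18))
        (.neq (.arr 10 (.var 18)) (.var 10)))) (.not (.and (.neq (.arr 11 (.var 19)) (.var 18))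
        (.neq (.arr 11 (.var 18)) (.var 10))))))
      (block [.nset 10 (.var 18), rotate, .nset 10 (.var 20), rotate])
      (.seq rotate rotate)) rotate]

/-- Splay the vertex in register `10`. -/
def splay : Prog := .loop (childTest (.arr 12 (.var 10)) (.var 10)) splayStep

theorem childTest_holds {N : Network n m} {M : Mem} {p x : NExp} :
    (childTest p x).Holds N M ↔ ∃ d, M.na (chA d) (p.eval M) = x.eval M := by
  simp only [childTest, BExp.Holds, NExp.eval, Bool.exists_bool, chA, if_true, if_false,
    Bool.false_eq_true]
  tauto

/-- A tree in memory, whose root has the parent `q` without being a child of it. -/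
structure SolidRep (M : Mem) (v : ℕ → ℝ) (q : ℕ) (o : ℝ) (t : Tr) : Prop where
  rep : Rep M v q o t
  nodup : t.inord.Nodup
  zero : ∀ e, M.na (chA e) 0 = 0
  not_mem : q ∉ t.inord
  ne : ∀ e, ∀ y ∈ t.inord, M.na (chA e) q ≠ y

theorem rotate_spec (N : Network n m) (d : Bool) {M : Mem} {v : ℕ → ℝ} {q₀ : ℕ} {o₀ : ℝ}
    {x p : ℕ} {a b s : Tr} {c : List Tr.Frame} (hx : M.nv 10 = x)
    (h : SolidRep M v q₀ o₀ ((Tr.mk d (.mk d a x b) p s).plug c)) :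
    SolidRep (rotate.sem N M) v q₀ o₀ ((Tr.mk d a x (.mk d b p s)).plug c) ∧
      (∀ y, y ∉ ((Tr.mk d (.mk d a x b) p s).plug c).inord → y ≠ 0 →
        Agree M (rotate.sem N M) y) ∧ (rotate.sem N M).nv 10 = x := by
  obtain ⟨hrep, hnd, h0, hq, hq₀⟩ := h
  obtain ⟨q, o, hC, ht⟩ := rep_plug.1 hrep
  obtain ⟨hp0, hpq, hdp, hdp', hLp, hrx, hrs⟩ := rep_mk.1 ht
  obtain ⟨hx0, hxp', -⟩ := rep_mk.1 hrx
  have hsx : s.rt ≠ x := by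
    intro h
    by_cases hs : s = .nil
    · exact hx0 (by rw [← h, hs]; rfl)
    · have h1 := (inord_plug_perm (Tr.mk d (.mk d a x b) p s) c).nodup_iff.1 hnd
      have h2 := (Tr.inord_mk_perm _ _ _ _).nodup_iff.1 (List.nodup_append.1 h1).1
      have h3 := (List.nodup_append.1 (List.nodup_cons.1 h2).2).2.2
      exact h3 x (Tr.mem_inord_mk.2 (.inl rfl)) s.rt (Tr.rt_mem hs) h.symm
  have hM : rotate.sem N M = (rotateSide d).sem N (M.setN 11 p) := by
    simp only [rotate, Prog.sem, BExp.Holds, NExp.eval, hx, hxp', Mem.setN_nv, Mem.setN_na, if_true,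
      Nat.reduceEqDiff, if_false]
    simp only [Tr.rt_mk] at hdp
    cases d
    · simp only [chA, Bool.false_eq_true, if_false] at hdp
      rw [if_pos hdp]
    · simp only [chA, Bool.not_true, Bool.false_eq_true, if_false] at hdp'
      rw [if_neg (by rw [hdp']; exact hsx)]
  have hA : ∀ y, Agree M (M.setN 11 p) y := fun y => ⟨fun _ => rfl, rfl, rfl, rfl, rfl, rfl, rfl⟩
  obtain ⟨h1, h2, h3, h4⟩ := rotateSide_spec N d (M := M.setN 11 p) (v := v) (q₀ := q₀) (o₀ := o₀)
    (x := x) (p := p) (a := a) (b := b) (s := s) (c := c) (by simp [hx]) (by simp)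
    (hrep.congr hnd fun y _ => hA y) hnd h0 hq₀
  rw [← hM] at h1 h2 h3 h4
  have hin := Tr.inord_plug_congr (Tr.inord_rotate' d a x b p s) c
  have h2' : ∀ y, y ∉ ((Tr.mk d (.mk d a x b) p s).plug c).inord → y ≠ 0 →
      Agree M (rotate.sem N M) y := fun y hy hy0 => (hA y).trans (h2 y hy hy0)
  refine ⟨⟨h1, hin ▸ hnd, h3, hin ▸ hq, fun e y hy => ?_⟩, h2', h4⟩
  by_cases hq0 : q₀ = 0
  · rw [hq0, h3]
    rintro rfl
    exact h1.ne_zero hy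
  · rw [(h2' q₀ hq hq0).ch]
    exact hq₀ e y (hin ▸ hy)

theorem splayStep_cost : splayStep.cost ≤ 5000 ∧ splayStep.straight = true := by decide

theorem SolidRep.setN {M : Mem} {v : ℕ → ℝ} {q : ℕ} {o : ℝ} {t : Tr} (h : SolidRep M v q o t)
    (i x : ℕ) : SolidRep (M.setN i x) v q o t :=
  ⟨h.rep.congr h.nodup fun _ _ => ⟨fun _ => rfl, rfl, rfl, rfl, rfl, rfl, rfl⟩, h.nodup, h.zero,
    h.not_mem, h.ne⟩

/-- The access lemma. The logarithms telescope over the steps, every double rotation releases 2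
units, and there are `c.length / 2` of them; this pays for the depth up to rounding. The induction
is on a bound for the depth because a double rotation removes two frames at once. -/
theorem splay_spec (N : Network n m) {v : ℕ → ℝ} {q₀ : ℕ} {o₀ : ℝ} {wt : ℕ → ℕ}
    (hwt : ∀ x, 1 ≤ wt x) (k : ℕ) : ∀ (c : List Tr.Frame) (l : Tr) (x : ℕ) (r : Tr) (M : Mem),
    c.length ≤ k → M.nv 10 = x → SolidRep M v q₀ o₀ ((Tr.node l x r).plug c) →
    ∃ M' τ l' r', Exec N splay M M' τ ∧ τ ≤ 5100 * (c.length + 1) ∧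
      SolidRep M' v q₀ o₀ (Tr.node l' x r') ∧
      (Tr.node l' x r').inord = ((Tr.node l x r).plug c).inord ∧
      (∀ y, y ∉ ((Tr.node l x r).plug c).inord → y ≠ 0 → Agree M M' y) ∧ M'.nv 10 = x ∧
      (Tr.node l' x r').pot wt + 2 * ((c.length / 2 : ℕ) : ℝ) ≤ ((Tr.node l x r).plug c).pot wt +
        3 * (Real.logb 2 (((Tr.node l x r).plug c).size wt) -
          Real.logb 2 ((Tr.node l x r).size wt)) := by
  have hcost := splayStep_cost
  induction k with
  | zero =>
    intro c l x r M hc hx h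
    obtain rfl := List.length_eq_zero_iff.1 (Nat.le_zero.1 hc)
    have hpar : M.na 12 x = q₀ := h.rep.2.1
    refine ⟨M, _, l, r, .loop_false _ _ M ?_, by simp [childTest, BExp.size, NExp.size], h, rfl,
      fun y _ _ => .refl M y, hx, by simp⟩
    rw [childTest_holds]
    rintro ⟨e, he⟩
    simp only [NExp.eval, hx, hpar] at he
    exact h.ne e x (by simp) he
  | succ k ih =>
    intro c l x r M hc hx h
    rcases c with _ | ⟨⟨d, p, s⟩, c⟩
    · exact ih [] l x r M (Nat.zero_le _) hx h
    obtain ⟨a, b, hab⟩ := Tr.exists_eq_mk d l x r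
    rw [hab] at h ⊢
    obtain ⟨q, o, hC, ht⟩ := rep_plug.1 h.rep
    obtain ⟨hqp, hp0, hdp, hdp', o', ho, hs, xs, hxs, hLp, hC'⟩ := hC
    simp only [Tr.rt_mk] at hqp hp0 hdp hdp' hC'
    obtain ⟨hx0, hxq, -⟩ := rep_mk.1 ht
    rw [hqp] at hxq
    have hloop : (childTest (.arr 12 (.var 10)) (.var 10)).Holds N M := by
      rw [childTest_holds]
      exact ⟨d, by simp [NExp.eval, hx, hxq, hdp]⟩
    obtain ⟨τ₁, hτ₁, hτ₁'⟩ := splayStep.exec_straight N hcost.2 M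
    set M₁ := (((M.setN 20 x).setN 18 p).setN 19 (M.na 12 p)) with hM₁
    have h₁ : SolidRep M₁ v q₀ o₀ (((Tr.mk d a x b).plug ((d, p, s) :: c))) :=
      ((h.setN _ _).setN _ _).setN _ _
    have hA₁ : ∀ y, Agree M M₁ y := fun y => ⟨fun _ => rfl, rfl, rfl, rfl, rfl, rfl, rfl⟩
    have hx₁ : M₁.nv 10 = x := by simp [M₁, hx]
    have hstep : splayStep.sem N M = Prog.sem N (.cond (childTest (.var 19) (.var 18))
      (.cond (.not (.and (.not (.and (.neq (.arr 10 (.var 19)) (.var 18))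
        (.neq (.arr 10 (.var 18)) (.var 10)))) (.not (.and (.neq (.arr 11 (.var 19)) (.var 18))
        (.neq (.arr 11 (.var 18)) (.var 10))))))
      (block [.nset 10 (.var 18), rotate, .nset 10 (.var 20), rotate])
      (.seq rotate rotate)) rotate) M₁ := by
      have : M₁ = (block [.nset 20 (.var 10), .nset 18 (.arr 12 (.var 10)),
          .nset 19 (.arr 12 (.var 18))]).sem N M := by
        simp [block, Prog.sem, NExp.eval, hx, hxq, M₁]
      rw [this]
      rfl
    have htest : (childTest (.var 19) (.var 18)).Holds N M₁ ↔ ∃ e, M.na (chA e) (M.na 12 p) = p := by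
      rw [childTest_holds]
      simp [NExp.eval, M₁]
    rcases c with _ | ⟨⟨e, g, u⟩, c⟩
    -- The vertex has a parent but no grandparent within the splay tree: the final single rotation.
    · have hpq : M.na 12 p = q₀ := hC'.1
      have hno : ¬ (childTest (.var 19) (.var 18)).Holds N M₁ := by
        rw [htest, hpq]
        rintro ⟨e, he⟩
        exact h.ne e p (Tr.mem_inord_mk.2 (.inl rfl)) he
      rw [Prog.sem, if_neg hno] at hstep
      obtain ⟨hr1, hr2, hr3⟩ := rotate_spec N d (c := []) hx₁ h₁
      rw [← hstep] at hr1 hr2 hr3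
      obtain ⟨l', r', hlr⟩ := Tr.exists_mk_eq d a x (.mk d b p s)
      rw [Tr.plug_nil, hlr] at hr1
      obtain ⟨M', τ₂, l'', r'', hx2, hτ₂, hs2, hin2, hA2, hx2', hpot2⟩ :=
        ih [] l' x r' _ (Nat.zero_le _) hr3 hr1
      have hin : (Tr.node l' x r').inord = ((Tr.mk d a x b).plug [(d, p, s)]).inord := by
        rw [← hlr]; exact (Tr.inord_rotate' d a x b p s).symm
      refine ⟨M', _, l'', r'', .loop_true _ _ _ _ _ _ _ hloop hτ₁ hx2, ?_, hs2, hin2.trans hin,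
        fun y hy hy0 => ((hA₁ y).trans (hr2 y hy hy0)).trans (hA2 y ?_ hy0), hx2', ?_⟩
      · simp only [List.length_nil, List.length_cons, childTest, BExp.size, NExp.size] at hτ₂ ⊢
        omega
      · rw [Tr.plug_nil, hin]; exact hy
      · have := Tr.pot_zig hwt d a x b p s
        rw [hlr] at this
        simp only [List.length_nil, Tr.plug_nil, sub_self, mul_zero, add_zero, Nat.zero_div,
          CharP.cast_eq_zero, List.length_cons, zero_add] at hpot2 ⊢
        rw [Tr.plug_cons, Tr.plug_nil]
        exact hpot2.trans this
    · obtain ⟨hpg, hg0, heg, heg', o'', ho', hu, xs', hxs', hLg, hC''⟩ := hC'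
      simp only at hpg hg0 heg heg' hC''
      have hyes : (childTest (.var 19) (.var 18)).Holds N M₁ := htest.2 ⟨e, by rw [hpg, heg]⟩
      rw [Prog.sem, if_pos hyes, Prog.sem] at hstep
      have hnd := (inord_plug_perm (Tr.mk d a x b) ((d, p, s) :: (e, g, u) :: c)).nodup_iff.1 h.nodup
      have hndc := (List.nodup_append.1 hnd).2.1
      have hxu : ∀ y, y = p → u.rt ≠ y := by
        rintro y rfl hy
        by_cases hun : u = .nil
        · exact hp0 (by rw [← hy, hun]; rfl)
        · exact (List.nodup_cons.1 hndc).1 (by simp [ctxVerts, ← hy, Tr.rt_mem hun])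
      have hsx : s.rt ≠ x := by
        intro hy
        by_cases hsn : s = .nil
        · exact hx0 (by rw [← hy, hsn]; rfl)
        · exact (List.nodup_append.1 hnd).2.2 x (Tr.mem_inord_mk.2 (.inl rfl)) s.rt
            (by simp [ctxVerts, Tr.rt_mem hsn]) hy.symm
      have hdir : (BExp.not (.and (.not (.and (.neq (.arr 10 (.var 19)) (.var 18))
        (.neq (.arr 10 (.var 18)) (.var 10)))) (.not (.and (.neq (.arr 11 (.var 19)) (.var 18))
        (.neq (.arr 11 (.var 18)) (.var 10)))))).Holds N M₁ ↔ d = e := by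
        have e10 : M₁.nv 10 = x := hx₁
        have e18 : M₁.nv 18 = p := by simp [M₁]
        have e19 : M₁.nv 19 = g := by simp [M₁, hpg]
        have ena : M₁.na = M.na := rfl
        have hxu' := hxu p rfl
        simp only [BExp.Holds, NExp.eval, e10, e18, e19, ena]
        cases d <;> cases e <;> simp only [chA, Bool.not_true, Bool.not_false, Bool.false_eq_true,
          if_true, if_false] at hdp hdp' heg heg' <;> simp [hdp, hdp', heg, heg', hxu', hsx]
      by_cases hde : d = e
      · subst hde
        rw [if_pos (hdir.2 rfl)] at hstep
        obtain ⟨hr1, hr2, hr3⟩ := rotate_spec N d (M := M₁.setN 10 p) (x := p) (p := g)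
          (a := .mk d a x b) (b := s) (s := u) (c := c) (by simp) (h₁.setN 10 p)
        set M₂ := rotate.sem N (M₁.setN 10 p) with hM₂
        have h20 : M₂.nv 20 = x := by
          rw [hM₂, Prog.sem_nv N (by rfl) _ (by rfl)]; simp [M₁]
        obtain ⟨hs1, hs2, hs3⟩ := rotate_spec N d (M := M₂.setN 10 x) (x := x) (p := p)
          (a := a) (b := b) (s := .mk d s g u) (c := c) (by simp) (hr1.setN 10 x)
        have hstep' : splayStep.sem N M = rotate.sem N (M₂.setN 10 x) := by
          rw [hstep]
          show rotate.sem N ((rotate.sem N (M₁.setN 10 (M₁.nv 18))).setN 10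
            ((rotate.sem N (M₁.setN 10 (M₁.nv 18))).nv 20)) = _
          rw [show M₁.nv 18 = p by simp [M₁], ← hM₂, h20]
        rw [← hstep'] at hs1 hs2 hs3
        obtain ⟨l', r', hlr⟩ := Tr.exists_mk_eq d a x (.mk d b p (.mk d s g u))
        rw [hlr] at hs1
        have hi1 := Tr.inord_plug_congr (Tr.inord_rotate' d (.mk d a x b) p s g u) c
        have hi0 := Tr.inord_rotate' d a x b p (.mk d s g u)
        rw [hlr] at hi0
        have hi2 := Tr.inord_plug_congr hi0 c
        obtain ⟨M', τ₂, l'', r'', hx2, hτ₂, hs2', hin2, hA2, hx2', hpot2⟩ :=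
          ih c l' x r' _ (by simp only [List.length_cons] at hc; omega) hs3 hs1
        refine ⟨M', _, l'', r'', .loop_true _ _ _ _ _ _ _ hloop hτ₁ hx2, ?_, hs2',
          hin2.trans (hi2.symm.trans hi1.symm),
          fun y hy hy0 => ?_, hx2', ?_⟩
        · simp only [List.length_cons, childTest, BExp.size, NExp.size] at hτ₂ ⊢
          omega
        · have hA₂ : Agree (M₁.setN 10 p) M₂ y := hr2 y hy hy0
          have hA₃ : Agree (M₂.setN 10 x) (splayStep.sem N M) y :=
            hs2 y (by rw [← hi1]; exact hy) hy0
          have hA₂' : Agree M M₂ y :=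
            (hA₁ y).trans ⟨hA₂.ch, hA₂.par, hA₂.am, hA₂.last, hA₂.base, hA₂.off, hA₂.mn⟩
          exact (hA₂'.trans ⟨hA₃.ch, hA₃.par, hA₃.am, hA₃.last, hA₃.base, hA₃.off, hA₃.mn⟩).trans
            (hA2 y (by rw [← hi2, ← hi1]; exact hy) hy0)
        · have hz := Tr.pot_zigzig hwt d a x b p s g u
          rw [hlr] at hz
          have hi3 := (Tr.inord_rotate' d (.mk d a x b) p s g u).trans hi0
          have hp1 := Tr.pot_plug_congr (wt := wt) hi3 c
          have hsz : ((Tr.node l' x r').plug c).size wt =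
            ((Tr.mk d (.mk d (.mk d a x b) p s) g u).plug c).size wt :=
            (Tr.size_plug_congr hi3 c).symm
          have hsz' : (Tr.node l' x r').size wt =
            (Tr.mk d (.mk d (.mk d a x b) p s) g u).size wt := by rw [Tr.size, ← hi3, Tr.size]
          rw [hsz, hsz'] at hpot2
          simp only [List.length_cons, Tr.plug_cons] at hpot2 ⊢
          have : (c.length + 1 + 1) / 2 = c.length / 2 + 1 := by omega
          rw [this]
          push_cast
          linarith
      · obtain rfl : e = !d := by cases d <;> cases e <;> simp_all
        rw [if_neg (by rw [hdir]; exact hde)] at hstep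
        obtain ⟨hr1, hr2, hr3⟩ := rotate_spec N d (M := M₁) (x := x) (p := p)
          (a := a) (b := b) (s := s) (c := (!d, g, u) :: c) hx₁ h₁
        set M₂ := rotate.sem N M₁ with hM₂
        rw [Tr.plug_cons, ← Tr.mk_not d a x (.mk d b p s)] at hr1
        obtain ⟨hs1, hs2, hs3⟩ := rotate_spec N (!d) (M := M₂) (x := x) (p := g)
          (a := .mk d b p s) (b := a) (s := u) (c := c) hr3 hr1
        have hstep' : splayStep.sem N M = rotate.sem N M₂ := hstep
        rw [← hstep', Tr.mk_not] at hs1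
        rw [← hstep'] at hs2 hs3
        obtain ⟨l', r', hlr⟩ := Tr.exists_mk_eq d (.mk (!d) a g u) x (.mk d b p s)
        rw [hlr] at hs1
        have hi1 := Tr.inord_plug_congr (Tr.inord_rotate' d a x b p s) ((!d, g, u) :: c)
        have hi0 : (Tr.mk (!d) (.mk d a x (.mk d b p s)) g u).inord = (Tr.node l' x r').inord := by
          rw [← hlr]
          cases d <;> simp [Tr.mk]
        have hi2 := Tr.inord_plug_congr hi0 c
        obtain ⟨M', τ₂, l'', r'', hx2, hτ₂, hs2', hin2, hA2, hx2', hpot2⟩ :=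
          ih c l' x r' _ (by simp only [List.length_cons] at hc; omega) hs3 hs1
        refine ⟨M', _, l'', r'', .loop_true _ _ _ _ _ _ _ hloop hτ₁ hx2, ?_, hs2',
          hin2.trans (hi2.symm.trans hi1.symm),
          fun y hy hy0 => ?_, hx2', ?_⟩
        · simp only [List.length_cons, childTest, BExp.size, NExp.size] at hτ₂ ⊢
          omega
        · have hA₂ : Agree M₁ M₂ y := hr2 y hy hy0
          have hA₃ : Agree M₂ (splayStep.sem N M) y :=
            hs2 y (by
              rw [Tr.mk_not d a x (.mk d b p s)]
              show y ∉ ((Tr.mk d a x (.mk d b p s)).plug ((!d, g, u) :: c)).inord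
              rw [← hi1]
              exact hy) hy0
          exact (((hA₁ y).trans hA₂).trans hA₃).trans
            (hA2 y (by
              rw [← hi2]
              show y ∉ ((Tr.mk d a x (.mk d b p s)).plug ((!d, g, u) :: c)).inord
              rw [← hi1]
              exact hy) hy0)
        · have hz := Tr.pot_zigzag hwt d a x b p s g u
          rw [hlr] at hz
          have hi3 : (Tr.mk (!d) (.mk d (.mk d a x b) p s) g u).inord = (Tr.node l' x r').inord :=
            (Tr.inord_plug_congr (Tr.inord_rotate' d a x b p s) [(!d, g, u)]).trans hi0
          have hp1 := Tr.pot_plug_congr (wt := wt) hi3 c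
          have hsz : ((Tr.node l' x r').plug c).size wt =
            ((Tr.mk (!d) (.mk d (.mk d a x b) p s) g u).plug c).size wt :=
            (Tr.size_plug_congr hi3 c).symm
          have hsz' : (Tr.node l' x r').size wt =
            (Tr.mk (!d) (.mk d (.mk d a x b) p s) g u).size wt := by rw [Tr.size, ← hi3, Tr.size]
          rw [hsz, hsz'] at hpot2
          simp only [List.length_cons, Tr.plug_cons] at hpot2 ⊢
          have : (c.length + 1 + 1) / 2 = c.length / 2 + 1 := by omega
          rw [this]
          push_cast
          linarith


/-! ### Forests of splay trees -/

/-- The vertices `1, …, n` are partitioned into splay trees, which represent the paths of a rooted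
forest, where `nx x` is the parent of `x` unless `x` is in the set `R` of roots. The parent of the
last vertex of a path is stored with the root of its splay tree. The weight of a vertex is the
number of its descendants, itself included, that are not descendants of its predecessor in its
path. -/
structure Forest (n : ℕ) (M : Mem) (F : Multiset Tr) (wt : ℕ → ℕ) (v : ℕ → ℝ) (nx : ℕ → ℕ)
    (R : Finset ℕ) : Prop where
  verts : F.bind (fun t => (t.inord : Multiset ℕ)) = (Finset.Icc 1 n).val
  rep : ∀ t ∈ F, Rep M v (M.na 12 t.rt) 0 t
  par : ∀ t ∈ F, t ≠ .nil → M.na 12 t.rt = 0 ∨ (M.na 12 t.rt ∈ Finset.Icc 1 n ∧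
    ∀ z, t.inord.getLast? = some z → nx z = M.na 12 t.rt)
  chain : ∀ t ∈ F, t.inord.IsChain (fun x y => nx x = y)
  wts : ∀ x, wt x = 1 + (F.map fun t => if M.na 12 t.rt = x then t.size wt else 0).sum
  roots : ∀ t ∈ F, ∀ x ∈ t.inord, x ∈ R ↔ t.inord.getLast? = some x ∧ M.na 12 t.rt = 0
  zero : ∀ e, M.na (chA e) 0 = 0

/-- The potential of a forest. -/
def potF (wt : ℕ → ℕ) (F : Multiset Tr) : ℝ := (F.map (Tr.pot wt)).sum

theorem potF_cons (wt : ℕ → ℕ) (t : Tr) (F : Multiset Tr) :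
    potF wt (t ::ₘ F) = t.pot wt + potF wt F := by simp [potF]

theorem Rep.child_mem {M : Mem} {v : ℕ → ℝ} {q : ℕ} {o : ℝ} {t : Tr} (h : Rep M v q o t) {y : ℕ}
    (hy : y ∈ t.inord) (e : Bool) : M.na (chA e) y = 0 ∨ M.na (chA e) y ∈ t.inord := by
  induction t generalizing q o with
  | nil => simp at hy
  | node l x r ihl ihr =>
    obtain ⟨h0, hq, hl, hr, hL, h1, h2⟩ := h
    simp only [Tr.inord_node, List.mem_append, List.mem_cons] at hy ⊢
    rcases hy with hy | rfl | hy
    · rcases ihl h1 hy with h | h <;> simp [h]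
    · cases e
      · by_cases hn : l = .nil
        · left; simp [chA, hl, hn]
        · right; left; simpa [chA, hl] using Tr.rt_mem hn
      · by_cases hn : r = .nil
        · left; simp [chA, hr, hn]
        · right; right; right; simpa [chA, hr] using Tr.rt_mem hn
    · rcases ihr h2 hy with h | h <;> simp [h]

namespace Forest

section
variable {M : Mem} {F : Multiset Tr} {wt : ℕ → ℕ} {v : ℕ → ℝ} {nx : ℕ → ℕ} {R : Finset ℕ}

theorem one_le (h : Forest n M F wt v nx R) (x : ℕ) : 1 ≤ wt x := by rw [h.wts]; omega

theorem nodup (h : Forest n M F wt v nx R) {t : Tr} (ht : t ∈ F) : t.inord.Nodup := by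
  obtain ⟨F, rfl⟩ := Multiset.exists_cons_of_mem ht
  have := (Finset.Icc 1 n).nodup
  rw [← h.verts, Multiset.cons_bind, Multiset.nodup_add] at this
  exact this.1

theorem disj {t : Tr} {F : Multiset Tr} (h : Forest n M (t ::ₘ F) wt v nx R) {t' : Tr}
    (ht' : t' ∈ F) {y : ℕ} (hy : y ∈ t.inord) : y ∉ t'.inord := by
  have := (Finset.Icc 1 n).nodup
  rw [← h.verts, Multiset.cons_bind, Multiset.nodup_add] at this
  intro hy'
  exact Multiset.disjoint_left.1 this.2.2 (Multiset.mem_coe.2 hy)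
    (Multiset.mem_bind.2 ⟨t', ht', Multiset.mem_coe.2 hy'⟩)

theorem mem_Icc (h : Forest n M F wt v nx R) {t : Tr} (ht : t ∈ F) {x : ℕ} (hx : x ∈ t.inord) :
    x ∈ Finset.Icc 1 n := by
  rw [← Finset.mem_val, ← h.verts]
  exact Multiset.mem_bind.2 ⟨t, ht, Multiset.mem_coe.2 hx⟩

theorem exists_mem (h : Forest n M F wt v nx R) {x : ℕ} (hx : x ∈ Finset.Icc 1 n) :
    ∃ t ∈ F, x ∈ t.inord := by
  rw [← Finset.mem_val, ← h.verts] at hx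
  simpa using Multiset.mem_bind.1 hx

/-- The tree is counted in the weight of the vertex that it hangs from. This strict increase along
parent links replaces any explicit statement that the forest is acyclic. -/
theorem size_lt (h : Forest n M F wt v nx R) {t : Tr} (ht : t ∈ F) :
    t.size wt < wt (M.na 12 t.rt) := by
  obtain ⟨F, rfl⟩ := Multiset.exists_cons_of_mem ht
  rw [h.wts (M.na 12 t.rt)]
  simp
  omega

/-- The parent of a path lies outside the path by `size_lt`, and the children of a vertex stay
inside the splay tree of that vertex by `Rep.child_mem`. So no child pointer of the parent leads
into this tree, and splaying stops at the right place. -/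
theorem solidRep (h : Forest n M F wt v nx R) {t : Tr} (ht : t ∈ F) (hne : t ≠ .nil) :
    SolidRep M v (M.na 12 t.rt) 0 t := by
  have hnm : M.na 12 t.rt ∉ t.inord := fun hm =>
    absurd (h.size_lt ht) (not_lt.2 (Tr.le_size hm))
  refine ⟨h.rep t ht, h.nodup ht, h.zero, hnm, fun e y hy => ?_⟩
  have hy0 : y ≠ 0 := fun h0 => (h.rep t ht).ne_zero (h0 ▸ hy)
  rcases h.par t ht hne with hp | ⟨hp, -⟩
  · rw [hp, h.zero]; exact hy0.symm
  · obtain ⟨t', ht', hq⟩ := h.exists_mem hp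
    obtain ⟨F, rfl⟩ := Multiset.exists_cons_of_mem ht
    rcases Multiset.mem_cons.1 ht' with rfl | ht'
    · exact absurd hq hnm
    · intro hc
      rcases (h.rep t' (by simp [ht'])).child_mem hq e with h1 | h1
      · exact hy0 (hc.symm.trans h1)
      · exact h.disj ht' hy (hc ▸ h1)

/-- Double counting: summing the weights over all vertices gives the sum of the sizes of all trees,
and by `wts` also n plus the sizes of those trees that hang from a vertex. Hence the trees that hang
from no vertex have total size at most n. -/
theorem size_le (h : Forest n M F wt v nx R) {t : Tr} (ht : t ∈ F) : t.size wt ≤ n := by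
  have key : ((F.map fun t => if M.na 12 t.rt ∈ Finset.Icc 1 n then 0 else t.size wt).sum) ≤ n := by
    have h1 : ∑ x ∈ Finset.Icc 1 n, wt x = (F.map fun t => t.size wt).sum := by
      rw [Finset.sum, ← h.verts, Multiset.map_bind, Multiset.sum_bind]
      congr 1
    have h2 : ∑ x ∈ Finset.Icc 1 n, wt x = n +
        (F.map fun t => if M.na 12 t.rt ∈ Finset.Icc 1 n then t.size wt else 0).sum := by
      rw [Finset.sum_congr rfl fun x _ => h.wts x, Finset.sum_add_distrib]
      congr 1
      · simp
      · show ((Finset.Icc 1 n).val.map fun x =>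
          (F.map fun t => if M.na 12 t.rt = x then t.size wt else 0).sum).sum = _
        rw [Multiset.sum_map_sum_map]
        congr 1
        refine Multiset.map_congr rfl fun t _ => ?_
        exact Finset.sum_ite_eq _ _ _
    have h3 : (F.map fun t => t.size wt).sum =
        (F.map fun t => if M.na 12 t.rt ∈ Finset.Icc 1 n then t.size wt else 0).sum +
        (F.map fun t => if M.na 12 t.rt ∈ Finset.Icc 1 n then 0 else t.size wt).sum := by
      rw [← Multiset.sum_map_add]
      congr 1
      refine Multiset.map_congr rfl fun t _ => ?_
      split_ifs <;> simp
    omega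
  -- A tree of largest size cannot hang from a vertex, as the tree of that vertex would be larger
  -- still; so its size is part of the sum in `key`.
  by_contra hlt
  obtain ⟨t₁, ht₁, hmax⟩ : ∃ s₁ ∈ (F.map (Tr.size wt)).toFinset,
      ∀ s ∈ (F.map (Tr.size wt)).toFinset, s ≤ s₁ := by
    have hne : (F.map (Tr.size wt)).toFinset.Nonempty := ⟨t.size wt, by
      simp only [Multiset.mem_toFinset]; exact Multiset.mem_map_of_mem _ ht⟩
    exact ⟨_, Finset.max'_mem _ hne, fun s hs => Finset.le_max' _ s hs⟩
  simp only [Multiset.mem_toFinset, Multiset.mem_map, forall_exists_index, and_imp,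
    forall_apply_eq_imp_iff₂] at ht₁ hmax
  obtain ⟨t₁, ht₁, rfl⟩ := ht₁
  by_cases hp : M.na 12 t₁.rt ∈ Finset.Icc 1 n
  · obtain ⟨t₂, ht₂, hm⟩ := h.exists_mem hp
    have := h.size_lt ht₁
    have := Tr.le_size (wt := wt) hm
    have := hmax t₂ ht₂
    omega
  · obtain ⟨F, rfl⟩ := Multiset.exists_cons_of_mem ht₁
    rw [Multiset.map_cons, Multiset.sum_cons, if_neg hp] at key
    have := hmax t ht
    omega

/-- Replacing a tree by another one for the same path. -/
theorem replace {M' : Mem} {t t' : Tr} {F : Multiset Tr} (h : Forest n M (t ::ₘ F) wt v nx R)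
    (hin : t'.inord = t.inord) (ht' : Rep M' v (M.na 12 t.rt) 0 t') (hne : t ≠ .nil)
    (h0 : ∀ e, M'.na (chA e) 0 = 0) (hA : ∀ y, y ∉ t.inord → y ≠ 0 → Agree M M' y) :
    Forest n M' (t' ::ₘ F) wt v nx R := by
  have hne' : t' ≠ .nil := fun h' => hne (Tr.inord_eq_nil.1 (by rw [← hin, h']; rfl))
  have hpar : M'.na 12 t'.rt = M.na 12 t.rt := ht'.par_rt hne'
  have hsz : t'.size wt = t.size wt := by rw [Tr.size, hin, Tr.size]
  have hAF : ∀ s ∈ F, ∀ y ∈ s.inord, Agree M M' y := fun s hs y hy => hA y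
    (fun hy' => h.disj hs hy' hy) fun h0 => (h.rep s (by simp [hs])).ne_zero (h0 ▸ hy)
  have hpF : ∀ s ∈ F, s ≠ .nil → M'.na 12 s.rt = M.na 12 s.rt := fun s hs hsn =>
    (hAF s hs _ (Tr.rt_mem hsn)).par
  constructor
  · rw [← h.verts, Multiset.cons_bind, Multiset.cons_bind, hin]
  · intro s hs
    rcases Multiset.mem_cons.1 hs with rfl | hs
    · rwa [hpar]
    · by_cases hsn : s = .nil
      · rw [hsn]; trivial
      · rw [hpF s hs hsn]
        exact (h.rep s (by simp [hs])).congr (h.nodup (by simp [hs])) (hAF s hs)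
  · intro s hs hsn
    rcases Multiset.mem_cons.1 hs with rfl | hs
    · rw [hpar, hin]
      exact h.par t (by simp) hne
    · rw [hpF s hs hsn]
      exact h.par s (by simp [hs]) hsn
  · intro s hs
    rcases Multiset.mem_cons.1 hs with rfl | hs
    · rw [hin]; exact h.chain t (by simp)
    · exact h.chain s (by simp [hs])
  · intro x
    rw [h.wts x, Multiset.map_cons, Multiset.map_cons, Multiset.sum_cons, Multiset.sum_cons, hpar, hsz]
    congr 3
    refine Multiset.map_congr rfl fun s hs => ?_
    by_cases hsn : s = .nil
    · simp [hsn]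
    · rw [hpF s hs hsn]
  · intro s hs x hx
    rcases Multiset.mem_cons.1 hs with rfl | hs
    · rw [hpar, hin]; exact h.roots t (by simp) x (hin ▸ hx)
    · rw [hpF s hs fun hsn => by simp [hsn] at hx]
      exact h.roots s (by simp [hs]) x hx
  · exact h0

theorem setN (h : Forest n M F wt v nx R) (i x : ℕ) : Forest n (M.setN i x) F wt v nx R :=
  ⟨h.verts, fun t ht => (h.rep t ht).congr (h.nodup ht)
    fun _ _ => ⟨fun _ => rfl, rfl, rfl, rfl, rfl, rfl, rfl⟩, h.par, h.chain, h.wts, h.roots, h.zero⟩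

theorem lg_nonneg (h : Forest n M F wt v nx R) {t : Tr} (ht : t ∈ F) (hne : t ≠ .nil) :
    0 ≤ Real.logb 2 (t.size wt) ∧ Real.logb 2 (t.size wt) ≤ Real.logb 2 n := by
  have h1 : 1 ≤ t.size wt := (h.one_le _).trans (Tr.le_size (Tr.rt_mem hne))
  refine ⟨Real.logb_nonneg (by norm_num) (by exact_mod_cast h1), Tr.logb_mono h1 (h.size_le ht)⟩

theorem splay_plug (N : Network n m) {l : Tr} {x : ℕ} {r : Tr} {c : List Tr.Frame}
    {F : Multiset Tr} (h : Forest n M ((Tr.node l x r).plug c ::ₘ F) wt v nx R)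
    (hx : M.nv 10 = x) :
    ∃ M' τ l' r', Exec N splay M M' τ ∧ τ ≤ 5100 * (c.length + 1) ∧
      Forest n M' (Tr.node l' x r' ::ₘ F) wt v nx R ∧
      (Tr.node l' x r').inord = ((Tr.node l x r).plug c).inord ∧
      M'.na 12 x = M.na 12 ((Tr.node l x r).plug c).rt ∧ M'.nv 10 = x ∧
      (∀ y, y ∉ ((Tr.node l x r).plug c).inord → y ≠ 0 → Agree M M' y) ∧
      (Tr.node l' x r').pot wt + 2 * ((c.length / 2 : ℕ) : ℝ) ≤ ((Tr.node l x r).plug c).pot wt +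
        3 * (Real.logb 2 (((Tr.node l x r).plug c).size wt) -
          Real.logb 2 ((Tr.node l x r).size wt)) := by
  have hne := Tr.plug_ne_nil l x r c
  obtain ⟨M', τ, l', r', hex, hτ, hs, hin, hA, h10, hpot⟩ := splay_spec N h.one_le c.length c l x r M
    le_rfl hx (h.solidRep (by simp) hne)
  exact ⟨M', τ, l', r', hex, hτ, h.replace hin hs.rep hne hs.zero hA, hin, hs.rep.2.1, h10, hA, hpot⟩

theorem splay (N : Network n m) (h : Forest n M F wt v nx R) {x : ℕ} (hx : M.nv 10 = x)
    (hxn : x ∈ Finset.Icc 1 n) :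
    ∃ t F₀ M' τ l' r', F = t ::ₘ F₀ ∧ x ∈ t.inord ∧ Exec N ConcaveFlow.splay M M' τ ∧
      Forest n M' (Tr.node l' x r' ::ₘ F₀) wt v nx R ∧ (Tr.node l' x r').inord = t.inord ∧
      M'.na 12 x = M.na 12 t.rt ∧ M'.nv 10 = x ∧ (∀ y, y ∉ t.inord → y ≠ 0 → Agree M M' y) ∧
      (τ : ℝ) ≤ 5100 * (potF wt F - potF wt (Tr.node l' x r' ::ₘ F₀) + 3 * Real.logb 2 n + 2) := by
  obtain ⟨t, ht, hxt⟩ := h.exists_mem hxn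
  obtain ⟨F₀, rfl⟩ := Multiset.exists_cons_of_mem ht
  obtain ⟨l, r, c, rfl⟩ := Tr.exists_plug hxt
  obtain ⟨M', τ, l', r', hex, hτ, hF, hin, hp, h10, hA, hpot⟩ := h.splay_plug N hx
  refine ⟨_, F₀, M', τ, l', r', rfl, hxt, hex, hF, hin, hp, h10, hA, ?_⟩
  rw [potF_cons, potF_cons]
  have h1 := (h.lg_nonneg ht (Tr.plug_ne_nil l x r c)).2
  have h2 : 0 ≤ Real.logb 2 ((Tr.node l x r).size wt) := by
    refine Real.logb_nonneg (by norm_num) ?_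
    exact_mod_cast (h.one_le x).trans (Tr.le_size (by simp))
  have h3 : (τ : ℝ) ≤ 5100 * (c.length + 1) := by exact_mod_cast hτ
  have h4 : (c.length : ℝ) ≤ 2 * ((c.length / 2 : ℕ) : ℝ) + 1 := by
    exact_mod_cast (by omega : c.length ≤ 2 * (c.length / 2) + 1)
  linarith

end

end Forest

/-! ### Access: making the path to the root a path of the partition -/

/-- The left subtree of the root in register `10` is replaced by the tree with the root in
register `16`; proceed to the parent. -/
def swapStep : Prog := block
  [.nset 15 (.arr 10 (.var 10)),
   .rstore 5 (.var 15) (.add (.arr 5 (.var 15)) (.arr 5 (.var 10))),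
   .rstore 5 (.var 16) (.sub (.arr 5 (.var 16)) (.arr 5 (.var 10))),
   .nstore 10 (.var 10) (.var 16), .nset 14 (.var 10), pull, .nset 16 (.var 10),
   .nset 10 (.arr 12 (.var 10))]

theorem swapStep_cost : swapStep.cost ≤ 300 ∧ swapStep.straight = true := by decide

/-- Make the path from the vertex in register `17` to its root a path of the partition. -/
def access : Prog := block
  [.nset 10 (.var 17), .nset 16 (.lit 0),
   .loop (.not (.neq (.var 10) (.lit 0))) (.seq splay swapStep), .nset 10 (.var 17), splay]

/-- The left subtree `l` becomes a path hanging from `x`, and `c`, which hung from `x`, becomes part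
of the path of `x`. The weight of `x` changes by the size of `l` minus that of `c`, so the size of
the tree at `x` and hence the whole potential stay the same: changing the preferred child is free.
-/
theorem Forest.swapStep_spec {M : Mem} {F : Multiset Tr} {wt : ℕ → ℕ} {v : ℕ → ℝ} {nx : ℕ → ℕ}
    {R : Finset ℕ} (N : Network n m) {l r c : Tr} {x : ℕ}
    (h : Forest n M (Tr.node l x r ::ₘ c ::ₘ F) wt v nx R)
    (hx : M.nv 10 = x) (h16 : M.nv 16 = c.rt) (hc : c ≠ .nil → M.na 12 c.rt = x) :
    ∃ M', swapStep.sem N M = M' ∧ M'.nv 16 = x ∧ M'.nv 10 = M.na 12 x ∧ M'.na 12 x = M.na 12 x ∧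
    ∃ wt', Forest n M' (Tr.node c x r ::ₘ l ::ₘ F) wt' v nx R ∧
      potF wt' (Tr.node c x r ::ₘ l ::ₘ F) = potF wt (Tr.node l x r ::ₘ c ::ₘ F) ∧
      (Tr.node c x r).size wt' = (Tr.node l x r).size wt := by
  have hrep := h.rep (Tr.node l x r) (by simp)
  obtain ⟨hx0, -, hl, hr, hL, hrl, hrr⟩ := hrep
  have hnd := h.nodup (t := Tr.node l x r) (by simp)
  have hndc := h.nodup (t := c) (by simp)
  have hxc : ∀ y, y ∈ (Tr.node l x r).inord → y ∉ c.inord := fun y hy => h.disj (by simp) hy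
  have hFl : ∀ s ∈ F, ∀ y ∈ s.inord, y ∉ (Tr.node l x r).inord := fun s hs y hy hy' =>
    h.disj (by simp [hs]) hy' hy
  have hFc : ∀ s ∈ F, ∀ y ∈ s.inord, y ∉ c.inord := by
    intro s hs y hy hy'
    rw [Multiset.cons_swap] at h
    exact h.disj (t' := s) (by simp [hs]) hy' hy
  have hnd' := hnd
  simp only [Tr.inord_node, List.nodup_append, List.nodup_cons, List.mem_cons] at hnd'
  obtain ⟨hndl, ⟨hxr, hndr⟩, hlxr⟩ := hnd'
  have hxl : x ∉ l.inord := fun hm => hlxr x hm x (.inl rfl) rfl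
  have hxc' : x ∉ c.inord := hxc x (by simp)
  have hlc : ∀ y ∈ l.inord, y ∉ c.inord := fun y hy => hxc y (by simp [hy])
  have hrc : ∀ y ∈ r.inord, y ∉ c.inord := fun y hy => hxc y (by simp [hy])
  have hrt : ∀ {t : Tr} {y : ℕ}, y ≠ 0 → y ∉ t.inord → y ≠ t.rt := by
    rintro t y hy0 hy rfl
    by_cases htn : t = .nil
    · exact hy0 (by rw [htn]; rfl)
    · exact hy (Tr.rt_mem htn)
  have hc0 := (h.rep c (by simp)).ne_zero
  -- The roots of `l` and `c` have the same number only if both trees are empty. Then both writes go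
  -- to the dummy cell 0, which the representation never reads.
  set M₁ := ((((((M.setN 15 l.rt).setRA 5 l.rt (M.ra 5 l.rt + M.ra 5 x)).setRA 5 c.rt
    ((if c.rt = l.rt then M.ra 5 l.rt + M.ra 5 x else M.ra 5 c.rt) - M.ra 5 x)).setNA 10 x c.rt)).setN
    14 x) with hM₁
  have hxl' : x ≠ l.rt := hrt hx0 hxl
  have hxc'' : x ≠ c.rt := hrt hx0 hxc'
  have hsem : (pull.sem N M₁) = Prog.sem N (block
      [.nset 15 (.arr 10 (.var 10)),
       .rstore 5 (.var 15) (.add (.arr 5 (.var 15)) (.arr 5 (.var 10))),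
       .rstore 5 (.var 16) (.sub (.arr 5 (.var 16)) (.arr 5 (.var 10))),
       .nstore 10 (.var 10) (.var 16), .nset 14 (.var 10), pull]) M := by
    simp only [block, Prog.sem]
    congr 1
    simp [NExp.eval, RExp.eval, hx, h16, hl, M₁, hxl']
  have hAg : ∀ y, y ≠ x → y ≠ l.rt → y ≠ c.rt → Agree M M₁ y := by
    intro y h1 h2 h3
    exact ⟨fun e => by cases e <;> simp [M₁, chA, h1], by simp [M₁], by simp [M₁], by simp [M₁],
      by simp [M₁], by simp [M₁, h2, h3], by simp [M₁]⟩
  have h5x : M₁.ra 5 x = M.ra 5 x := by simp [M₁, hxl', hxc'']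
  have hlcrt : l ≠ .nil → l.rt ≠ c.rt := fun hln =>
    hrt (fun h0 => hrl.ne_zero (h0 ▸ Tr.rt_mem hln)) (hlc _ (Tr.rt_mem hln))
  have hclrt : c ≠ .nil → c.rt ≠ l.rt := fun hcn =>
    hrt (fun h0 => hc0 (h0 ▸ Tr.rt_mem hcn)) fun hm => hlc _ hm (Tr.rt_mem hcn)
  have hrl₁ : Rep M₁ v x 0 l := by
    refine hrl.reroot hndl (fun y hy hyr => hAg y (fun h => hxl (h ▸ hy)) hyr
      (hrt (fun h0 => hrl.ne_zero (h0 ▸ hy)) (hlc y hy))) fun hln => ?_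
    have h1 := hlcrt hln
    have h2 : l.rt ≠ x := hxl'.symm
    refine ⟨fun e => by cases e <;> simp [M₁, chA, h2], ?_, by simp [M₁], by simp [M₁], by simp [M₁],
      by simp [M₁, h1], by simp [M₁]⟩
    rw [← hrl.par_rt hln]
    simp [M₁]
  have hrc₁ : Rep M₁ v x (0 + M₁.ra 5 x) c := by
    refine (h.rep c (by simp)).reroot hndc (fun y hy hyr => hAg y (fun h => hxc' (h ▸ hy))
      (hrt (fun h0 => hc0 (h0 ▸ hy)) fun hm => hlc y hm hy) hyr) fun hcn => ?_
    have h1 := hclrt hcn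
    have h2 : c.rt ≠ x := hxc''.symm
    refine ⟨fun e => by cases e <;> simp [M₁, chA, h2], ?_, by simp [M₁], by simp [M₁], by simp [M₁],
      ?_, by simp [M₁]⟩
    · rw [← hc hcn]; simp [M₁]
    · rw [h5x]; simp [M₁, h1]
  have hrr₁ : Rep M₁ v x (0 + M₁.ra 5 x) r := by
    rw [h5x]
    exact hrr.congr hndr fun y hy => hAg y (fun h => hxr (h ▸ hy))
      (hrt (fun h0 => hrr.ne_zero (h0 ▸ hy)) fun hm => hlxr y hm y (.inr hy) rfl)
      (hrt (fun h0 => hrr.ne_zero (h0 ▸ hy)) (hrc y hy))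
  have hndn : (Tr.node c x r).inord.Nodup := by
    simp only [Tr.inord_node, List.nodup_append, List.nodup_cons, List.mem_cons]
    refine ⟨hndc, ⟨hxr, hndr⟩, ?_⟩
    rintro a ha b (rfl | hb) rfl
    · exact hxc' ha
    · exact hrc _ hb ha
  obtain ⟨hLx, hAg', hna', hra'⟩ := pull_spec N (M := M₁) (v := v) (o := 0) (p := x) (l := c)
    (r := r) (by simp [M₁]) (by simp [M₁]) (by simp [M₁, hr]) hrc₁ hrr₁ hndn
    (by rw [hL.val, h5x]; simp [M₁])
  set M₂ := pull.sem N M₁ with hM₂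
  have hAg₂ : ∀ y, y ≠ x → y ≠ l.rt → y ≠ c.rt → Agree M M₂ y := fun y h1 h2 h3 =>
    (hAg y h1 h2 h3).trans (hAg' y h1)
  have h12 : ∀ y, M₂.na 12 y = M.na 12 y := fun y => by
    rw [hna' _ (by simp) (by simp)]; simp [M₁]
  have h5x' : M₂.ra 5 x = M₁.ra 5 x := by rw [hra' _ (by simp)]
  have hparl : l ≠ .nil → M₂.na 12 l.rt = x := fun hln => by rw [h12, hrl.par_rt hln]
  have hm : swapStep.sem N M = (M₂.setN 16 x).setN 10 (M.na 12 x) := by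
    have : swapStep.sem N M = Prog.sem N (block [.nset 16 (.var 10), .nset 10 (.arr 12 (.var 10))]) M₂ := by
      rw [hsem]; rfl
    rw [this]
    have h10 : M₂.nv 10 = x := by
      rw [hM₂, Prog.sem_nv N rfl _ rfl]; simp [M₁, hx]
    simp [block, Prog.sem, NExp.eval, h10, h12]
  refine ⟨_, hm, by simp, by simp, by simp [h12], ?_⟩
  obtain ⟨wt', hwt'⟩ : ∃ wt', wt' = Function.update wt x (wt x - c.size wt + l.size wt) := ⟨_, rfl⟩
  have hwne : ∀ y, y ≠ x → wt y = wt' y := fun y hy => by rw [hwt', Function.update_of_ne hy]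
  have hsl : l.size wt' = l.size wt := (Tr.size_congr fun y hy => hwne y fun h => hxl (h ▸ hy)).symm
  have hsc : c.size wt' = c.size wt := (Tr.size_congr fun y hy => hwne y fun h => hxc' (h ▸ hy)).symm
  have hsr : r.size wt' = r.size wt := (Tr.size_congr fun y hy => hwne y fun h => hxr (h ▸ hy)).symm
  have hxF : ∀ s ∈ F, x ∉ s.inord := fun s hs hm => hFl s hs x hm (by simp)
  have hsF : ∀ s ∈ F, s.size wt' = s.size wt := fun s hs =>
    (Tr.size_congr fun y hy => hwne y fun h => hxF s hs (h ▸ hy)).symm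
  have hwx : wt x = 1 + (c.size wt + (F.map fun t => if M.na 12 t.rt = x then t.size wt else 0).sum) := by
    have hpx : M.na 12 x ≠ x := fun hp => by
      have := h.size_lt (t := Tr.node l x r) (by simp)
      rw [Tr.rt_node, hp] at this
      exact absurd this (not_lt.2 (Tr.le_size (by simp)))
    rw [h.wts x]
    simp only [Multiset.map_cons, Multiset.sum_cons, Tr.rt_node, hpx, if_false, zero_add]
    by_cases hcn : c = .nil
    · simp [hcn]
    · rw [if_pos (hc hcn)]
  have hsz : (Tr.node c x r).size wt' = (Tr.node l x r).size wt := by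
    rw [Tr.size_node, Tr.size_node, hsc, hsr, hwt', Function.update_self]
    omega
  refine ⟨wt', (Forest.setN (Forest.setN (M := M₂) ?_ _ _) _ _), ?_, hsz⟩
  · have hAF : ∀ s ∈ F, ∀ y ∈ s.inord, Agree M M₂ y := fun s hs y hy => by
      have hy0 : y ≠ 0 := fun h0 => (h.rep s (by simp [hs])).ne_zero (h0 ▸ hy)
      have := hFl s hs y hy
      simp only [Tr.inord_node, List.mem_append, List.mem_cons, not_or] at this
      exact hAg₂ y this.2.1 (hrt hy0 this.1) (hrt hy0 (hFc s hs y hy))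
    constructor
    · rw [← h.verts]
      simp only [Multiset.cons_bind, Tr.inord_node, ← Multiset.coe_add, ← Multiset.cons_coe]
      rw [← add_assoc, ← add_assoc]
      congr 1
      simp only [Multiset.add_cons, Multiset.cons_add]
      congr 1
      rw [add_comm, ← add_assoc, add_right_comm]
    · intro s hs
      rcases Multiset.mem_cons.1 hs with rfl | hs
      · rw [Tr.rt_node]
        refine ⟨hx0, rfl, ?_, ?_, hLx, ?_, ?_⟩
        · rw [hna' _ (by simp) (by simp)]; simp [M₁]
        · rw [hna' _ (by simp) (by simp)]; simp [M₁, hr]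
        · rw [h5x']; exact hrc₁.congr hndc fun y hy => hAg' y fun h => hxc' (h ▸ hy)
        · rw [h5x']; exact hrr₁.congr hndr fun y hy => hAg' y fun h => hxr (h ▸ hy)
      · rcases Multiset.mem_cons.1 hs with rfl | hs
        · by_cases hln : s = .nil
          · rw [hln]; trivial
          · rw [hparl hln]
            exact hrl₁.congr hndl fun y hy => hAg' y fun h => hxl (h ▸ hy)
        · rw [h12]
          exact (h.rep s (by simp [hs])).congr (h.nodup (by simp [hs])) (hAF s hs)
    · intro s hs hsn
      rcases Multiset.mem_cons.1 hs with rfl | hs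
      · have := h.par (Tr.node l x r) (by simp) (by simp)
        rw [h12]
        simpa [List.getLast?_append, List.getLast?_cons] using this
      · rcases Multiset.mem_cons.1 hs with rfl | hs
        · rw [hparl hsn]
          refine .inr ⟨h.mem_Icc (t := Tr.node s x r) (by simp) (by simp), fun z hz => ?_⟩
          have := h.chain (Tr.node s x r) (by simp)
          rw [Tr.inord_node, List.isChain_append] at this
          exact this.2.2 z hz x (by simp)
        · rw [h12]; exact h.par s (by simp [hs]) hsn
    · intro s hs
      have h1 := h.chain (Tr.node l x r) (by simp)
      rw [Tr.inord_node, List.isChain_append] at h1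
      rcases Multiset.mem_cons.1 hs with rfl | hs
      · rw [Tr.inord_node, List.isChain_append]
        refine ⟨h.chain c (by simp), h1.2.1, fun z hz y hy => ?_⟩
        simp only [List.head?_cons, Option.mem_def, Option.some.injEq] at hy
        subst hy
        have hcn : c ≠ .nil := by rintro rfl; simp at hz
        have := h.par c (by simp) hcn
        rw [hc hcn] at this
        exact (this.resolve_left hx0).2 z hz
      · rcases Multiset.mem_cons.1 hs with rfl | hs
        · exact h1.1
        · exact h.chain s (by simp [hs])
    · intro y
      simp only [Multiset.map_cons, Multiset.sum_cons, h12, Tr.rt_node, hsz, hsl]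
      have hFs : (F.map fun t => if M.na 12 t.rt = y then t.size wt' else 0) =
          F.map fun t => if M.na 12 t.rt = y then t.size wt else 0 :=
        Multiset.map_congr rfl fun s hs => by rw [hsF s hs]
      rw [hFs]
      by_cases hyx : y = x
      · subst hyx
        have hpx : M.na 12 y ≠ y := fun hp => by
          have := h.size_lt (t := Tr.node l y r) (by simp)
          rw [Tr.rt_node, hp] at this
          exact absurd this (not_lt.2 (Tr.le_size (by simp)))
        have hl' : (if M.na 12 l.rt = y then l.size wt else 0) = l.size wt := by
          by_cases hln : l = .nil
          · simp [hln]
          · rw [if_pos (hrl.par_rt hln)]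
        rw [if_neg hpx, hl', hwt', Function.update_self]
        omega
      · rw [← hwne y hyx, h.wts y]
        simp only [Multiset.map_cons, Multiset.sum_cons, Tr.rt_node]
        have hc' : (if M.na 12 c.rt = y then c.size wt else 0) = 0 := by
          by_cases hcn : c = .nil
          · simp [hcn]
          · rw [if_neg (by rw [hc hcn]; exact Ne.symm hyx)]
        have hl' : (if M.na 12 l.rt = y then l.size wt else 0) = 0 := by
          by_cases hln : l = .nil
          · simp [hln]
          · rw [if_neg (by rw [hrl.par_rt hln]; exact Ne.symm hyx)]
        rw [hc', hl']
        rfl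
    · intro s hs y hy
      rcases Multiset.mem_cons.1 hs with rfl | hs
      · rw [Tr.rt_node, h12]
        simp only [Tr.inord_node, List.mem_append] at hy
        rcases hy with hy | hy
        · have hcn : c ≠ .nil := by rintro rfl; simp at hy
          have h1 := h.roots c (by simp) y hy
          rw [hc hcn] at h1
          have h2 : (Tr.node c x r).inord.getLast? ≠ some y := by
            simp only [Tr.inord_node, List.getLast?_append, List.getLast?_cons]
            intro h'
            have hmem : y ∈ x :: r.inord := by
              apply List.mem_of_getLast?
              simpa [List.getLast?_cons] using h'
            rcases List.mem_cons.1 hmem with rfl | hmem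
            · exact hxc' hy
            · exact hrc y hmem hy
          rw [h1]
          exact ⟨fun h' => absurd h'.2 hx0, fun h' => absurd h'.1 h2⟩
        · have := h.roots (Tr.node l x r) (by simp) y (by simp at hy ⊢; tauto)
          rw [this]
          simp [List.getLast?_append, List.getLast?_cons]
      · rcases Multiset.mem_cons.1 hs with rfl | hs
        · have hln : s ≠ .nil := by rintro rfl; simp at hy
          have h1 := h.roots (Tr.node s x r) (by simp) y (by simp [hy])
          rw [hparl hln, h1]
          have h2 : (Tr.node s x r).inord.getLast? ≠ some y := by
            simp only [Tr.inord_node, List.getLast?_append, List.getLast?_cons]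
            intro h'
            have hmem : y ∈ x :: r.inord := by
              apply List.mem_of_getLast?
              simpa [List.getLast?_cons] using h'
            exact hlxr y hy y (by simpa using hmem) rfl
          exact ⟨fun h' => absurd h'.1 h2, fun h' => absurd h'.2 hx0⟩
        · rw [h12]; exact h.roots s (by simp [hs]) y hy
    · intro e
      rw [hna' _ chA_ne.2.1 chA_ne.2.2.1]
      have := h.zero e
      cases e <;> simp [M₁, chA, Ne.symm hx0] at this ⊢ <;> exact this
  · rw [potF_cons, potF_cons, potF_cons, potF_cons]
    simp only [Tr.pot]
    rw [hsz]
    have e1 : c.pot wt' = c.pot wt := (Tr.pot_congr fun y hy => hwne y fun h => hxc' (h ▸ hy)).symm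
    have e2 : l.pot wt' = l.pot wt := (Tr.pot_congr fun y hy => hwne y fun h => hxl (h ▸ hy)).symm
    have e3 : r.pot wt' = r.pot wt := (Tr.pot_congr fun y hy => hwne y fun h => hxr (h ▸ hy)).symm
    have e4 : potF wt' F = potF wt F := by
      unfold potF
      congr 1
      exact Multiset.map_congr rfl fun s hs =>
        (Tr.pot_congr fun y hy => hwne y fun h => hxF s hs (h ▸ hy)).symm
    rw [e1, e2, e3, e4]
    ring


/-- The left spine of the tree has `j` nodes, the lowest of which is `v`. -/
def Tr.Spine (v : ℕ) : ℕ → Tr → Prop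
  | 0, t => t = .nil
  | _ + 1, .nil => False
  | j + 1, .node l x _ => Tr.Spine v j l ∧ (j = 0 → x = v)

theorem Tr.Spine.exists_plug {v j : ℕ} {t : Tr} (h : Tr.Spine v (j + 1) t) :
    (∃ r c, t = (Tr.node .nil v r).plug c ∧ c.length = j) ∧ t.inord.head? = some v := by
  have key : ∀ (j : ℕ) (t : Tr) (c₀ : List Tr.Frame), Tr.Spine v (j + 1) t →
      (∃ r c, t.plug c₀ = (Tr.node .nil v r).plug c ∧ c.length = j + c₀.length) ∧
        t.inord.head? = some v := by
    intro j
    induction j with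
    | zero =>
      rintro (_ | ⟨l, x, r⟩) c₀ h
      · exact h.elim
      · obtain ⟨h1, h2⟩ := h
        obtain rfl : l = .nil := h1
        obtain rfl := h2 rfl
        exact ⟨⟨r, c₀, rfl, by simp⟩, rfl⟩
    | succ j ih =>
      rintro (_ | ⟨l, x, r⟩) c₀ h
      · exact h.elim
      · obtain ⟨⟨r', c, h1, h2⟩, h3⟩ := ih l ((false, x, r) :: c₀) h.1
        refine ⟨⟨r', c, h1, by rw [h2]; simp; omega⟩, ?_⟩
        simp [List.head?_append, h3]
  simpa using key j t [] h

/-- An empty tree may be added at will; it is the initial value of the path accumulated during an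
access. -/
theorem Forest.cons_nil {M : Mem} {F : Multiset Tr} {wt : ℕ → ℕ} {v : ℕ → ℝ} {nx : ℕ → ℕ}
    {R : Finset ℕ} (h : Forest n M F wt v nx R) : Forest n M (.nil ::ₘ F) wt v nx R := by
  refine ⟨by simpa using h.verts, ?_, ?_, ?_, ?_, ?_, h.zero⟩
  · intro t ht
    rcases Multiset.mem_cons.1 ht with rfl | ht
    exacts [trivial, h.rep t ht]
  · intro t ht hn
    rcases Multiset.mem_cons.1 ht with rfl | ht
    exacts [absurd rfl hn, h.par t ht hn]
  · intro t ht
    rcases Multiset.mem_cons.1 ht with rfl | ht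
    exacts [.nil, h.chain t ht]
  · intro x
    rw [h.wts x]
    simp [Tr.size]
  · intro t ht x hx
    rcases Multiset.mem_cons.1 ht with rfl | ht
    exacts [by simp at hx, h.roots t ht x hx]

theorem Forest.size_pos {M : Mem} {F : Multiset Tr} {wt : ℕ → ℕ} {v : ℕ → ℝ} {nx : ℕ → ℕ}
    {R : Finset ℕ} (h : Forest n M F wt v nx R) {t : Tr} (hne : t ≠ .nil) : 1 ≤ t.size wt :=
  (h.one_le _).trans (Tr.le_size (Tr.rt_mem hne))

/-- The tree `c` is the part of the path gathered so far and hangs from the next vertex, so the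
logarithms of the sizes telescope over all the splays and leave a single 3 log n. The rotations are
paid for through `D`. The constant overhead of an iteration is not: it is recorded in `j`, because
every iteration puts one more node on the left spine above `v₀`. `fuel` works since `c` grows
strictly. -/
theorem Forest.access_loop (N : Network n m) {v : ℕ → ℝ} {nx : ℕ → ℕ} {R : Finset ℕ} {v₀ : ℕ}
    (hv : v₀ ∈ Finset.Icc 1 n) : ∀ (fuel : ℕ) (M : Mem) (F : Multiset Tr) (wt : ℕ → ℕ) (c : Tr)
    (j : ℕ), Forest n M (c ::ₘ F) wt v nx R → M.nv 16 = c.rt → Tr.Spine v₀ j c →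
    (c = .nil → M.nv 10 = v₀) → (c ≠ .nil → M.na 12 c.rt = M.nv 10) →
    n < fuel + c.size wt → ∃ M' τ F' wt' c' j' D,
      Exec N (.loop (.not (.neq (.var 10) (.lit 0))) (.seq ConcaveFlow.splay ConcaveFlow.swapStep)) M M' τ ∧
      Forest n M' (c' ::ₘ F') wt' v nx R ∧ Tr.Spine v₀ j' c' ∧ 1 ≤ j' ∧
      M'.na 12 c'.rt = 0 ∧ j ≤ j' ∧ τ + 11000 * j ≤ 5100 * D + 11000 * j' + 10 ∧
      potF wt' (c' ::ₘ F') + (D : ℕ) ≤ potF wt (c ::ₘ F) +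
        3 * (Real.logb 2 n - Real.logb 2 (max 1 (c.size wt) : ℕ)) := by
  intro fuel
  induction fuel with
  | zero =>
    intro M F wt c j h _ _ _ _ hf
    exact absurd (h.size_le (t := c) (by simp)) (by omega)
  | succ fuel ih =>
    intro M F wt c j h h16 hsp hc0 hc1 hf
    have hv1 := Finset.mem_Icc.1 hv
    by_cases hX : M.nv 10 = 0
    · have hcn : c ≠ .nil := fun hn => by rw [hc0 hn] at hX; omega
      have hj : 1 ≤ j := by
        rcases j with _ | j
        · exact absurd hsp hcn
        · omega
      refine ⟨M, _, F, wt, c, j, 0, .loop_false _ _ _ (by simp [BExp.Holds, NExp.eval, hX]), h, hsp,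
        hj, by rw [hc1 hcn, hX], le_rfl, by simp [BExp.size, NExp.size]; omega, ?_⟩
      have h1 := h.size_pos hcn
      rw [max_eq_right h1]
      have := (h.lg_nonneg (t := c) (by simp) hcn).2
      push_cast
      linarith
    · obtain ⟨X, hXe⟩ : ∃ X, M.nv 10 = X := ⟨_, rfl⟩
      rw [hXe] at hX hc1 hc0
      have hXn : X ∈ Finset.Icc 1 n := by
        by_cases hcn : c = .nil
        · rw [hc0 hcn]; exact hv
        · have := h.par c (by simp) hcn
          rw [hc1 hcn] at this
          exact (this.resolve_left hX).1
      have hXc : X ∉ c.inord := by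
        intro hm
        have hcn : c ≠ .nil := by rintro rfl; simp at hm
        have := h.size_lt (t := c) (by simp)
        rw [hc1 hcn] at this
        exact absurd this (not_lt.2 (Tr.le_size hm))
      obtain ⟨t, ht, hXt⟩ := h.exists_mem hXn
      rcases Multiset.mem_cons.1 ht with rfl | ht
      · exact absurd hXt hXc
      obtain ⟨F, rfl⟩ := Multiset.exists_cons_of_mem ht
      obtain ⟨l, r, fs, rfl⟩ := Tr.exists_plug hXt
      have h' := h
      rw [Multiset.cons_swap] at h'
      obtain ⟨M₁, τ₁, l', r', hex, hτ, hF, hin, hp, h10, hA, hpot⟩ := h'.splay_plug N hXe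
      have hcA : c ≠ .nil → M₁.na 12 c.rt = M.na 12 c.rt := fun hcn =>
        (hA _ (fun hm => h'.disj (t' := c) (by simp) hm (Tr.rt_mem hcn))
          fun h0 => (h.rep c (by simp)).ne_zero (h0 ▸ Tr.rt_mem hcn)).par
      obtain ⟨M₂, hM₂, e16, e10, e12, wt₂, hF₂, hp₂, hs₂⟩ := hF.swapStep_spec N h10
        (by rw [hex.nv rfl, h16]) (fun hcn => by rw [hcA hcn, hc1 hcn])
      obtain ⟨τ₂, hex₂, hτ₂⟩ := Prog.exec_straight N swapStep swapStep_cost.2 M₁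
      have hτ₂' : τ₂ ≤ 300 := hτ₂.trans swapStep_cost.1
      rw [hM₂] at hex₂
      have hsl : ((Tr.node l X r).plug fs).size wt = (Tr.node l' X r').size wt := by
        rw [Tr.size, ← hin, Tr.size]
      have hcs : c.size wt < (Tr.node l X r).size wt := by
        by_cases hcn : c = .nil
        · rw [hcn]
          have := h.size_pos (t := Tr.node l X r) (by simp)
          simp [Tr.size] at this ⊢
          omega
        · have := h.size_lt (t := c) (by simp)
          rw [hc1 hcn] at this
          exact this.trans_le (Tr.le_size (by simp))
      have hle := Tr.size_le_plug (wt := wt) (Tr.node l X r) fs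
      obtain ⟨M', τ, F', wt', c', j', D, hl, hF', hsp', hj', hpar, hjj, hτ', hpot'⟩ :=
        ih M₂ (l' ::ₘ F) wt₂ (Tr.node c X r') (j + 1) hF₂ e16
        ⟨hsp, fun hj => hc0 (by subst hj; exact hsp)⟩ (by simp)
        (by intro _; rw [Tr.rt_node, e12, e10]) (by rw [hs₂, ← hsl]; omega)
      refine ⟨M', _, F', wt', c', j', D + 2 * (fs.length / 2),
        .loop_true _ _ _ M₂ _ _ _ (by simp [BExp.Holds, NExp.eval, hXe, hX])
        (.seq _ _ _ _ _ _ _ hex hex₂) hl, hF', hsp', hj', hpar, by omega,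
        by simp only [BExp.size, NExp.size]; omega, ?_⟩
      rw [hs₂, ← hsl, max_eq_right (by omega)] at hpot'
      simp only [potF_cons] at hp₂ hpot' ⊢
      have h1 : Real.logb 2 (max 1 (c.size wt) : ℕ) ≤ Real.logb 2 ((Tr.node l X r).size wt) :=
        Tr.logb_mono (le_max_left _ _) (max_le (by omega) hcs.le)
      push_cast at hpot hpot' h1 ⊢
      linarith

/-- The final splay lifts `x` from the bottom of a left spine with one node per iteration of the
loop, so its rotations pay for these iterations. The loop and the final splay contribute 3 log n
each. -/
theorem Forest.access_spec (N : Network n m) {M : Mem} {F : Multiset Tr} {wt : ℕ → ℕ} {v : ℕ → ℝ}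
    {nx : ℕ → ℕ} {R : Finset ℕ} (h : Forest n M F wt v nx R) {x : ℕ} (hx : x ∈ Finset.Icc 1 n)
    (h17 : M.nv 17 = x) : ∃ M' τ r F' wt', Exec N access M M' τ ∧
      Forest n M' (.node .nil x r ::ₘ F') wt' v nx R ∧ M'.na 12 x = 0 ∧
      (τ : ℝ) ≤ 20000 * (potF wt F - potF wt' (.node .nil x r ::ₘ F') + 6 * Real.logb 2 n + 3) := by
  have hx1 := Finset.mem_Icc.1 hx
  obtain ⟨M₁, τ₁, F₁, wt₁, c, j, D, hl, hF₁, hsp, hj, hpar, -, hτ₁, hpot₁⟩ := Forest.access_loop N hx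
    (n + 1) ((M.setN 10 x).setN 16 0) F wt .nil 0
    ((h.cons_nil.setN _ _).setN _ _) (by simp) rfl (by simp) (by simp) (by omega)
  obtain ⟨j, rfl⟩ : ∃ i, j = i + 1 := ⟨j - 1, by omega⟩
  obtain ⟨⟨r, fs, rfl, hfs⟩, hhd⟩ := hsp.exists_plug
  obtain ⟨M', τ₂, l', r', hex, hτ₂, hF, hin, hp, -, -, hpot⟩ := (hF₁.setN 10 x).splay_plug N (by simp)
  -- `x` is the first vertex of its path, so nothing lies to the left of it.
  have hl' : l' = .nil := by
    have hnd := hF.nodup (t := Tr.node l' x r') (by simp)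
    rw [← hin, Tr.inord_node] at hhd
    rw [Tr.inord_node, List.nodup_append] at hnd
    by_contra hne
    obtain ⟨a, as, has⟩ := List.exists_cons_of_ne_nil (Tr.inord_ne_nil hne)
    rw [has] at hhd hnd
    simp only [List.cons_append, List.head?_cons, Option.some.injEq] at hhd
    exact hnd.2.2 a (by simp) x (by simp) hhd
  subst hl'
  have h17' : M₁.nv 17 = x := by rw [hl.nv rfl]; simp [h17]
  have e1 : Exec N (.nset 10 (.var 17)) M (M.setN 10 x) 2 := by
    simpa [Mem.setN, NExp.eval, NExp.size, h17] using Exec.nset (N := N) M 10 (.var 17)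
  have e2 : Exec N (.nset 16 (.lit 0)) (M.setN 10 x) ((M.setN 10 x).setN 16 0) 2 := by
    simpa [Mem.setN, NExp.eval, NExp.size] using Exec.nset (N := N) (M.setN 10 x) 16 (.lit 0)
  have e3 : Exec N (.nset 10 (.var 17)) M₁ (M₁.setN 10 x) 2 := by
    simpa [Mem.setN, NExp.eval, NExp.size, h17'] using Exec.nset (N := N) M₁ 10 (.var 17)
  refine ⟨M', _, r', F₁, wt₁, .seq _ _ _ _ _ _ _ e1 (.seq _ _ _ _ _ _ _ e2
    (.seq _ _ _ _ _ _ _ hl (.seq _ _ _ _ _ _ _ e3 hex))), hF, ?_, ?_⟩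
  · rw [hp]; simpa using hpar
  · simp only [potF_cons] at hpot₁ ⊢
    have h1 := (hF₁.lg_nonneg (by simp) (Tr.plug_ne_nil .nil x r fs)).2
    have h2 : 0 ≤ Real.logb 2 ((Tr.node .nil x r).size wt₁) :=
      Real.logb_nonneg (by norm_num) (by exact_mod_cast hF₁.size_pos (by simp))
    rw [hfs] at hpot hτ₂
    -- The overhead of 11000 per iteration and the 5100 per level of the final splay together stay
    -- below 20000 per spine node.
    have h3 : τ₁ + τ₂ + 10 ≤ 20000 * D + 20000 * (2 * (j / 2)) + 50000 := by omega
    have h4 : (τ₁ : ℝ) + τ₂ + 10 ≤ 20000 * D + 20000 * (2 * (j / 2 : ℕ)) + 50000 := by exact_mod_cast h3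
    simp [Tr.size, Tr.pot] at hpot₁
    push_cast
    linarith

/-! ### Changing values, splitting and linking paths -/

namespace Forest

section
variable {M M' : Mem} {F : Multiset Tr} {wt : ℕ → ℕ} {v v' : ℕ → ℝ} {nx nx' : ℕ → ℕ}
  {R R' : Finset ℕ}

/-- The successor function matters only off `R`, since a root is the last vertex of a path without a
parent. So the current arc of a root can be replaced without touching the trees. -/
theorem congr (h : Forest n M F wt v nx R) (hA : ∀ y ∈ Finset.Icc 1 n, Agree M M' y)
    (h0 : ∀ e, M'.na (chA e) 0 = 0) (hv : ∀ x ∈ Finset.Icc 1 n, v' x = v x)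
    (hnx : ∀ x ∈ Finset.Icc 1 n, x ∉ R → nx' x = nx x) : Forest n M' F wt v' nx' R := by
  have hp : ∀ t ∈ F, t ≠ .nil → M'.na 12 t.rt = M.na 12 t.rt := fun t ht hn =>
    (hA _ (h.mem_Icc ht (Tr.rt_mem hn))).par
  refine ⟨h.verts, ?_, ?_, ?_, ?_, ?_, h0⟩
  · intro t ht
    by_cases hn : t = .nil
    · rw [hn]; trivial
    · rw [hp t ht hn]
      exact ((h.rep t ht).congr (h.nodup ht) fun y hy => hA y (h.mem_Icc ht hy)).congr_val
        fun y hy => hv y (h.mem_Icc ht hy)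
  · intro t ht hn
    rw [hp t ht hn]
    rcases h.par t ht hn with h1 | h1
    · exact .inl h1
    · by_cases h2 : M.na 12 t.rt = 0
      · exact .inl h2
      · refine .inr ⟨h1.1, fun z hz => ?_⟩
        have hzt := List.mem_of_getLast? hz
        rw [hnx z (h.mem_Icc ht hzt) fun hR => h2 ((h.roots t ht z hzt).1 hR).2, h1.2 z hz]
  · intro t ht
    have h1 := h.chain t ht
    rw [List.isChain_iff_getElem] at h1 ⊢
    intro i hi
    have hm : t.inord[i] ∈ t.inord := List.getElem_mem _
    rw [hnx _ (h.mem_Icc ht hm), h1 i hi]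
    intro hR
    have h2 := ((h.roots t ht _ hm).1 hR).1
    rw [List.getLast?_eq_getElem?, List.getElem?_eq_some_iff] at h2
    obtain ⟨h3, h4⟩ := h2
    have := (h.nodup ht).getElem_inj_iff.1 h4
    omega
  · intro x
    rw [h.wts x]
    congr 2
    refine Multiset.map_congr rfl fun t ht => ?_
    by_cases hn : t = .nil
    · simp [hn, Tr.size]
    · rw [hp t ht hn]
  · intro t ht x hx
    have hn : t ≠ .nil := by rintro rfl; simp at hx
    rw [hp t ht hn]
    exact h.roots t ht x hx

/-- Change of the values in one tree. -/
theorem revalue {t : Tr} {F : Multiset Tr} (h : Forest n M (t ::ₘ F) wt v nx R)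
    (ht : Rep M' v' (M.na 12 t.rt) 0 t) (hne : t ≠ .nil) (h0 : ∀ e, M'.na (chA e) 0 = 0)
    (hA : ∀ y ∈ Finset.Icc 1 n, y ∉ t.inord → Agree M M' y)
    (hv : ∀ x ∈ Finset.Icc 1 n, x ∉ t.inord → v' x = v x) :
    Forest n M' (t ::ₘ F) wt v' nx R := by
  have hp : ∀ s ∈ t ::ₘ F, s ≠ .nil → M'.na 12 s.rt = M.na 12 s.rt := fun s hs hn => by
    rcases Multiset.mem_cons.1 hs with rfl | hs'
    · exact ht.par_rt hn
    · exact (hA _ (h.mem_Icc hs (Tr.rt_mem hn)) fun hm => h.disj hs' hm (Tr.rt_mem hn)).par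
  refine ⟨h.verts, ?_, ?_, h.chain, ?_, ?_, h0⟩
  · intro s hs
    by_cases hn : s = .nil
    · rw [hn]; trivial
    rw [hp s hs hn]
    rcases Multiset.mem_cons.1 hs with rfl | hs'
    · exact ht
    · exact ((h.rep s hs).congr (h.nodup hs) fun y hy => hA y (h.mem_Icc hs hy)
        fun hm => h.disj hs' hm hy).congr_val fun y hy => hv y (h.mem_Icc hs hy)
        fun hm => h.disj hs' hm hy
  · intro s hs hn
    rw [hp s hs hn]
    exact h.par s hs hn
  · intro x
    rw [h.wts x]
    congr 2
    refine Multiset.map_congr rfl fun t ht => ?_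
    by_cases hn : t = .nil
    · simp [hn, Tr.size]
    · rw [hp t ht hn]
  · intro s hs x hx
    have hn : s ≠ .nil := by rintro rfl; simp at hx
    rw [hp s hs hn]
    exact h.roots s hs x hx

/-- Separating a path in two. -/
theorem split {t a b : Tr} {F : Multiset Tr} (h : Forest n M (t ::ₘ F) wt v nx R)
    (h12 : M.na 12 t.rt = 0) (hin : t.inord = a.inord ++ b.inord)
    (ha : Rep M' v 0 0 a) (hb : Rep M' v 0 0 b)
    (h0 : ∀ e, M'.na (chA e) 0 = 0) (hA : ∀ y ∈ Finset.Icc 1 n, y ∉ t.inord → Agree M M' y)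
    (hR : ∀ y ∈ Finset.Icc 1 n, y ∈ R' ↔ y ∈ R ∨ a.inord.getLast? = some y) :
    Forest n M' (a ::ₘ b ::ₘ F) wt v nx R' := by
  have hpa : a ≠ .nil → M'.na 12 a.rt = 0 := ha.par_rt
  have hpb : b ≠ .nil → M'.na 12 b.rt = 0 := hb.par_rt
  have hAF : ∀ s ∈ F, ∀ y ∈ s.inord, Agree M M' y := fun s hs y hy =>
    hA y (h.mem_Icc (t := s) (by simp [hs]) hy) fun hy' => h.disj hs hy' hy
  have hpF : ∀ s ∈ F, s ≠ .nil → M'.na 12 s.rt = M.na 12 s.rt := fun s hs hsn =>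
    (hAF s hs _ (Tr.rt_mem hsn)).par
  have hnd := h.nodup (t := t) (by simp)
  rw [hin, List.nodup_append] at hnd
  have hch := h.chain t (by simp)
  rw [hin, List.isChain_append] at hch
  refine ⟨?_, ?_, ?_, ?_, ?_, ?_, h0⟩
  · rw [← h.verts]
    simp [hin, ← Multiset.coe_add, add_assoc]
  · intro s hs
    by_cases hn : s = .nil
    · rw [hn]; trivial
    rcases Multiset.mem_cons.1 hs with rfl | hs
    · rwa [hpa hn]
    rcases Multiset.mem_cons.1 hs with rfl | hs
    · rwa [hpb hn]
    · rw [hpF s hs hn]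
      exact (h.rep s (by simp [hs])).congr (h.nodup (by simp [hs])) (hAF s hs)
  · intro s hs hn
    rcases Multiset.mem_cons.1 hs with rfl | hs
    · exact .inl (hpa hn)
    rcases Multiset.mem_cons.1 hs with rfl | hs
    · exact .inl (hpb hn)
    · rw [hpF s hs hn]
      exact h.par s (by simp [hs]) hn
  · intro s hs
    rcases Multiset.mem_cons.1 hs with rfl | hs
    · exact hch.1
    rcases Multiset.mem_cons.1 hs with rfl | hs
    · exact hch.2.1
    · exact h.chain s (by simp [hs])
  · intro x
    rw [h.wts x]
    simp only [Multiset.map_cons, Multiset.sum_cons, h12]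
    rw [← add_assoc (ite _ _ _)]
    congr 2
    · have e1 : (if M'.na 12 a.rt = x then a.size wt else 0) = if 0 = x then a.size wt else 0 := by
        by_cases hn : a = .nil
        · simp [hn, Tr.size]
        · rw [hpa hn]
      have e2 : (if M'.na 12 b.rt = x then b.size wt else 0) = if 0 = x then b.size wt else 0 := by
        by_cases hn : b = .nil
        · simp [hn, Tr.size]
        · rw [hpb hn]
      rw [e1, e2]
      have : t.size wt = a.size wt + b.size wt := by simp [Tr.size, hin]
      split_ifs <;> omega
    · congr 1
      refine Multiset.map_congr rfl fun s hs => ?_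
      by_cases hn : s = .nil
      · simp [hn, Tr.size]
      · rw [hpF s hs hn]
  · intro s hs y hy
    have hn : s ≠ .nil := by rintro rfl; simp at hy
    have ht := h.roots t (by simp) y
    rcases Multiset.mem_cons.1 hs with rfl | hs
    · have hyt : y ∈ t.inord := by rw [hin]; simp [hy]
      rw [hR y (h.mem_Icc (by simp) hyt), ht hyt, hpa hn, h12, hin]
      simp only [and_true, List.getLast?_append]
      refine ⟨?_, .inr⟩
      rintro (h1 | h1)
      · by_cases hbn : b = .nil
        · simpa [hbn] using h1
        · obtain ⟨z, hz⟩ := List.getLast?_isSome.2 (Tr.inord_ne_nil hbn) |> Option.isSome_iff_exists.1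
          rw [hz] at h1
          simp only [Option.some_or, Option.some.injEq] at h1
          subst h1
          exact absurd rfl (hnd.2.2 z hy z (List.mem_of_getLast? hz))
      · exact h1
    rcases Multiset.mem_cons.1 hs with rfl | hs
    · have hyt : y ∈ t.inord := by rw [hin]; simp [hy]
      rw [hR y (h.mem_Icc (by simp) hyt), ht hyt, hpb hn, h12, hin]
      simp only [and_true, List.getLast?_append]
      obtain ⟨z, hz⟩ := List.getLast?_isSome.2 (Tr.inord_ne_nil hn) |> Option.isSome_iff_exists.1
      rw [hz]
      simp only [Option.some_or, or_iff_left_iff_imp]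
      intro h1
      exact absurd rfl (hnd.2.2 y (List.mem_of_getLast? h1) y hy)
    · rw [hR y (h.mem_Icc (t := s) (by simp [hs]) hy), hpF s hs hn, h.roots s (by simp [hs]) y hy]
      refine or_iff_left fun h1 => ?_
      exact absurd hy (h.disj hs (by rw [hin]; simp [List.mem_of_getLast? h1]))

/-- Linking a root to another tree. -/
theorem link {t a b : Tr} {w z : ℕ} {F : Multiset Tr}
    (h : Forest n M (t ::ₘ .node a w b ::ₘ F) wt v nx R) (hne : t ≠ .nil)
    (h12 : M.na 12 t.rt = 0) (hw : M.na 12 w = 0) (hz : t.inord.getLast? = some z) (hnx : nx z = w)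
    (hM : M' = M.setNA 12 t.rt w) (hR : ∀ y ∈ Finset.Icc 1 n, y ∈ R' ↔ y ∈ R ∧ y ≠ z) :
    ∃ wt', Forest n M' (t ::ₘ .node a w b ::ₘ F) wt' v nx R' ∧
      potF wt' (t ::ₘ .node a w b ::ₘ F) ≤ potF wt (t ::ₘ .node a w b ::ₘ F) + Real.logb 2 n := by
  have hwI : w ∈ Finset.Icc 1 n := h.mem_Icc (t := .node a w b) (by simp) (by simp)
  have hwt : w ∉ t.inord := fun hm => h.disj (t' := .node a w b) (by simp) hm (by simp)
  have hrt : ∀ s ∈ .node a w b ::ₘ F, s ≠ .nil → s.rt ≠ t.rt := fun s hs hn he =>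
    h.disj hs (Tr.rt_mem hne) (he ▸ Tr.rt_mem hn)
  have hp : ∀ s ∈ .node a w b ::ₘ F, s ≠ .nil → M'.na 12 s.rt = M.na 12 s.rt := fun s hs hn => by
    rw [hM]; simp [hrt s hs hn]
  have hpt : M'.na 12 t.rt = w := by rw [hM]; simp
  have hpw : M'.na 12 w = 0 := (hp (.node a w b) (by simp) (by simp)).trans hw
  -- Only the weight of `w` grows. As `w` is the root of its splay tree, and that tree hangs from
  -- nothing, only one logarithm in the potential changes, and by at most log n.
  obtain ⟨wt', hwt'⟩ : ∃ wt', wt' = Function.update wt w (wt w + t.size wt) := ⟨_, rfl⟩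
  have hw0 : w ≠ 0 := by rw [Finset.mem_Icc] at hwI; omega
  have hwne : ∀ y, y ≠ w → wt y = wt' y := fun y hy => by
    rw [hwt', Function.update_of_ne hy]
  have hnw : (Tr.node a w b).inord.Nodup := h.nodup (t := .node a w b) (by simp)
  have hdj : ∀ s ∈ F, w ∉ s.inord := fun s hs hm => by
    rw [Multiset.cons_swap] at h
    exact h.disj (t' := s) (by simp [hs]) (by simp) hm
  have hsz0 : ∀ s ∈ t ::ₘ .node a w b ::ₘ F, w ∉ s.inord → ∀ y ∈ s.inord, wt y = wt' y :=
    fun s hs hws y hy => hwne y fun hyw => hws (hyw ▸ hy)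
  have hst : t.size wt' = t.size wt := (Tr.size_congr (hsz0 t (by simp) hwt)).symm
  have hsF : ∀ s ∈ F, s.size wt' = s.size wt := fun s hs =>
    (Tr.size_congr (hsz0 s (by simp [hs]) (hdj s hs))).symm
  simp only [Tr.inord_node, List.nodup_append, List.nodup_cons] at hnw
  have hwa : w ∉ a.inord := fun hm => hnw.2.2 w hm w (by simp) rfl
  have hca : ∀ y ∈ a.inord, wt y = wt' y := fun y hy => hwne y fun hyw => hwa (hyw ▸ hy)
  have hcb : ∀ y ∈ b.inord, wt y = wt' y := fun y hy => hwne y fun hyw => hnw.2.1.1 (hyw ▸ hy)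
  have hsw : (Tr.node a w b).size wt' = (Tr.node a w b).size wt + t.size wt := by
    rw [Tr.size_node, Tr.size_node, ← Tr.size_congr hca, ← Tr.size_congr hcb, hwt',
      Function.update_self]
    omega
  have hF : Forest n M' (t ::ₘ .node a w b ::ₘ F) wt' v nx R' := by
    refine ⟨h.verts, ?_, ?_, h.chain, ?_, ?_, fun e => ?_⟩
    · intro s hs
      by_cases hn : s = .nil
      · rw [hn]; trivial
      rcases Multiset.mem_cons.1 hs with rfl | hs'
      · rw [hpt]
        refine (h.rep s hs).reroot (h.nodup hs) (fun y hy hys => ?_) fun _ => ?_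
        · rw [hM]
          exact ⟨fun e => by cases e <;> simp [chA], by simp [hys], by simp, by simp, rfl, rfl, rfl⟩
        · exact ⟨fun e => by rw [hM]; cases e <;> simp [chA], hpt, by simp [hM], by simp [hM],
            by simp [hM], by simp [hM], by simp [hM]⟩
      · rw [hp s hs' hn]
        refine (h.rep s hs).congr (h.nodup hs) fun y hy => ?_
        have hys : y ≠ t.rt := fun he => h.disj hs' (Tr.rt_mem hne) (he ▸ hy)
        rw [hM]
        exact ⟨fun e => by cases e <;> simp [chA], by simp [hys], by simp, by simp, rfl, rfl, rfl⟩
    · intro s hs hn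
      rcases Multiset.mem_cons.1 hs with rfl | hs'
      · rw [hpt]
        refine .inr ⟨hwI, fun y hy => ?_⟩
        rw [hz, Option.some.injEq] at hy
        rw [← hy, hnx]
      · rw [hp s hs' hn]
        exact h.par s hs hn
    · intro x
      have e1 : (F.map fun s => if M'.na 12 s.rt = x then s.size wt' else 0) =
          F.map fun s => if M.na 12 s.rt = x then s.size wt else 0 := by
        refine Multiset.map_congr rfl fun s hs => ?_
        rw [hsF s hs]
        by_cases hn : s = .nil
        · simp [hn, Tr.size]
        · rw [hp s (by simp [hs]) hn]
      have hx := h.wts x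
      simp only [Multiset.map_cons, Multiset.sum_cons, e1, hpt, hst, hsw,
        hpw, Tr.rt_node, hw, h12] at hx ⊢
      by_cases hx0 : x = 0
      · subst hx0
        rw [hwt', Function.update_of_ne (Ne.symm hw0)]
        simp only [if_true, hw0, if_false] at hx ⊢
        omega
      · simp only [Ne.symm hx0, if_false] at hx ⊢
        rw [hwt']
        by_cases hxw : x = w
        · subst hxw
          rw [Function.update_self]
          simp only [if_true]
          omega
        · rw [Function.update_of_ne hxw, if_neg (Ne.symm hxw)]
          exact hx
    · intro s hs y hy
      have hn : s ≠ .nil := by rintro rfl; simp at hy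
      rw [hR y (h.mem_Icc hs hy), h.roots s hs y hy]
      rcases Multiset.mem_cons.1 hs with rfl | hs'
      · rw [hpt, hz]
        simp only [Option.some.injEq, hw0, and_false, iff_false, not_and, not_not]
        exact fun h1 => h1.1.symm
      · rw [hp s hs' hn]
        refine and_iff_left fun h1 => ?_
        exact h.disj hs' (List.mem_of_getLast? hz) (h1 ▸ hy)
    · rw [hM]
      have := h.zero e
      cases e <;> simp [chA] at this ⊢ <;> exact this
  refine ⟨wt', hF, ?_⟩
  have h1 := (hF.lg_nonneg (t := .node a w b) (by simp) (by simp)).2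
  have h2 := (h.lg_nonneg (t := .node a w b) (by simp) (by simp)).1
  have e4 : potF wt' F = potF wt F := by
    unfold potF
    congr 1
    exact Multiset.map_congr rfl fun s hs => (Tr.pot_congr (hsz0 s (by simp [hs]) (hdj s hs))).symm
  simp only [potF_cons, Tr.pot, e4]
  rw [← Tr.pot_congr hca, ← Tr.pot_congr hcb, ← Tr.pot_congr (hsz0 t (by simp) hwt)]
  linarith

end

end Forest

/-! ### Operations on forests in memory -/

/-- Remove the subtree on side `d` of the root in register `10`. -/
def cutSide (d : Bool) : Prog := block
  [.nset 15 (.arr (chA d) (.var 10)), .nstore (chA d) (.var 10) (.lit 0),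
   .nstore 12 (.var 15) (.lit 0), .rstore 5 (.var 15) (.add (.arr 5 (.var 15)) (.arr 5 (.var 10))),
   .nset 14 (.var 10), pull]

theorem Tr.mk_inord_split (d : Bool) (a : Tr) (x : ℕ) (b : Tr) : (Tr.mk d a x b).inord =
    (if d then Tr.mk d .nil x b else a).inord ++ (if d then a else Tr.mk d .nil x b).inord := by
  cases d <;> simp [Tr.mk]

/-- Side `true` cuts the vertices after `x` off, so that `x` ends its path; side `false` cuts the
vertices before `x` off. In either case the new root is the last vertex of the front part, and the
potential does not rise because only the size at `x` changes, downwards. -/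
theorem Forest.cutSide {M : Mem} {F : Multiset Tr} {wt : ℕ → ℕ} {v : ℕ → ℝ} {nx : ℕ → ℕ}
    {R R' : Finset ℕ} (N : Network n m) (d : Bool) {a b : Tr} {x : ℕ}
    (h : Forest n M (Tr.mk d a x b ::ₘ F) wt v nx R) (hx : M.nv 10 = x) (hp : M.na 12 x = 0)
    (hR : ∀ y ∈ Finset.Icc 1 n, y ∈ R' ↔
      y ∈ R ∨ (if d then Tr.mk d .nil x b else a).inord.getLast? = some y) :
    Forest n ((cutSide d).sem N M) (Tr.mk d .nil x b ::ₘ a ::ₘ F) wt v nx R' ∧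
      potF wt (Tr.mk d .nil x b ::ₘ a ::ₘ F) ≤ potF wt (Tr.mk d a x b ::ₘ F) := by
  have hne : Tr.mk d a x b ≠ .nil := by cases d <;> simp [Tr.mk]
  have hrep := h.rep (Tr.mk d a x b) (by simp)
  rw [rep_mk] at hrep
  obtain ⟨hx0, -, hl, hr, hL, hrl, hrr⟩ := hrep
  have hnd := h.nodup (t := Tr.mk d a x b) (by simp)
  have hnd' := hnd
  rw [(Tr.inord_mk_perm d a x b).nodup_iff] at hnd'
  simp only [List.nodup_cons, List.nodup_append, List.mem_append, not_or] at hnd'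
  obtain ⟨⟨hxa, hxb⟩, hna, hnb, hab⟩ := hnd'
  have hxa' : x ≠ a.rt := by
    rintro rfl
    by_cases hn : a = .nil
    · exact hx0 (by rw [hn]; rfl)
    · exact hxa (Tr.rt_mem hn)
  have hrt : ∀ {y}, y ≠ 0 → y ∉ a.inord → y ≠ a.rt := by
    rintro y hy0 hy rfl
    by_cases hn : a = .nil
    · exact hy0 (by rw [hn]; rfl)
    · exact hy (Tr.rt_mem hn)
  set M₁ := ((((M.setN 15 a.rt).setNA (chA d) x 0).setNA 12 a.rt 0).setRA 5 a.rt
    (M.ra 5 a.rt + M.ra 5 x)).setN 14 x with hM₁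
  have hsem : (ConcaveFlow.cutSide d).sem N M = pull.sem N M₁ := by
    simp only [ConcaveFlow.cutSide, block, Prog.sem]
    congr 1
    simp [NExp.eval, RExp.eval, hx, hl, M₁]
  have hd12 : chA d ≠ 12 ∧ chA d ≠ 13 ∧ chA d ≠ 14 ∧ chA d ≠ chA (!d) := chA_ne
  have hAg : ∀ y, y ≠ x → y ≠ a.rt → Agree M M₁ y := by
    intro y h1 h2
    exact ⟨fun e => by cases e <;> simp [M₁, chA, h1], by simp [M₁, hd12.1.symm, h2],
      by simp [M₁, hd12.2.1.symm], by simp [M₁, hd12.2.2.1.symm],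
      by simp [M₁], by simp [M₁, h2], by simp [M₁]⟩
  have h5x : M₁.ra 5 x = M.ra 5 x := by simp [M₁, hxa']
  have hra₁ : Rep M₁ v 0 0 a := by
    refine hrl.reroot hna (fun y hy hyr => hAg y (fun h => hxa (h ▸ hy)) hyr) fun hn => ?_
    have h2 : a.rt ≠ x := hxa'.symm
    refine ⟨fun e => by cases e <;> simp [M₁, chA, h2], by simp [M₁], by simp [M₁, hd12.2.1.symm],
      by simp [M₁, hd12.2.2.1.symm], by simp [M₁], by simp [M₁], by simp [M₁]⟩
  have hrb₁ : Rep M₁ v x (0 + M₁.ra 5 x) b := by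
    rw [h5x]
    exact hrr.congr hnb fun y hy => hAg y (fun h => hxb (h ▸ hy))
      (hrt (fun h0 => hrr.ne_zero (h0 ▸ hy)) fun hm => hab y hm y hy rfl)
  have hnd₁ : (Tr.mk d .nil x b).inord.Nodup := by
    rw [(Tr.inord_mk_perm d .nil x b).nodup_iff]
    simp [hxb, hnb]
  obtain ⟨hLx, hAg', hna', hra'⟩ := pull_spec_mk N (M := M₁) (v := v) (o := 0) (p := x) (d := d)
    (a := .nil) (b := b) (by simp [M₁]) (by simp [M₁, hd12.1])
    (by rw [← hr]; cases d <;> simp [M₁, chA]) trivial hrb₁ hnd₁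
    (by rw [hL.val, h5x]; simp [M₁])
  rw [← hsem] at hLx hAg' hna' hra'
  set M₂ := (ConcaveFlow.cutSide d).sem N M with hM₂
  have hra₂ : Rep M₂ v 0 0 a := hra₁.congr hna fun y hy => hAg' y fun h => hxa (h ▸ hy)
  have hrx₂ : Rep M₂ v 0 0 (Tr.mk d .nil x b) := by
    rw [rep_mk]
    refine ⟨hx0, ?_, ?_, ?_, hLx, trivial, ?_⟩
    · rw [hna' _ (by simp) (by simp)]; simp [M₁, hxa', hd12.1.symm, hp]
    · rw [hna' _ hd12.2.1 hd12.2.2.1]; simp [M₁, hd12.1]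
    · rw [hna' _ chA_ne.2.1 chA_ne.2.2.1, ← hr]; cases d <;> simp [M₁, chA]
    · rw [hra' _ (by simp)]
      exact hrb₁.congr hnb fun y hy => hAg' y fun h => hxb (h ▸ hy)
  have h0 : ∀ e, M₂.na (chA e) 0 = 0 := fun e => by
    rw [hna' _ chA_ne.2.1 chA_ne.2.2.1]
    have := h.zero e
    cases e <;> cases d <;> simp [M₁, chA, Ne.symm hx0] at this ⊢ <;> exact this
  have hA₂ : ∀ y ∈ Finset.Icc 1 n, y ∉ (Tr.mk d a x b).inord → Agree M M₂ y := by
    intro y hy hyt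
    rw [Tr.mem_inord_mk] at hyt
    simp only [not_or] at hyt
    have hy1 := Finset.mem_Icc.1 hy
    exact (hAg y (by tauto) (hrt (by omega) (by tauto))).trans (hAg' y (by tauto))
  refine ⟨?_, ?_⟩
  · cases d
    · have := h.split (M' := M₂) (R' := R') (a := a) (b := Tr.mk false .nil x b)
        (by simpa [Tr.mk] using hp) (Tr.mk_inord_split false a x b) hra₂ hrx₂ h0 hA₂
        (by simpa using hR)
      rwa [Multiset.cons_swap] at this
    · exact h.split (M' := M₂) (R' := R') (a := Tr.mk true .nil x b) (b := a)
        (by simpa [Tr.mk] using hp) (Tr.mk_inord_split true a x b) hrx₂ hra₂ h0 hA₂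
        (by simpa using hR)
  · rw [potF_cons, potF_cons, potF_cons, Tr.pot_mk, Tr.pot_mk]
    have h1 : Real.logb 2 ((Tr.mk d .nil x b).size wt) ≤ Real.logb 2 ((Tr.mk d a x b).size wt) := by
      refine Tr.logb_mono ((h.one_le x).trans (Tr.le_size (Tr.mem_inord_mk.2 ?_))) ?_
      · tauto
      · rw [Tr.size_mk, Tr.size_mk]
        simp [Tr.size]
    have h2 : Tr.pot wt .nil = 0 := rfl
    linarith

/-- Set the base value of the root in register `10`. -/
def setBase (e : RExp) : Prog := block [.rstore 4 (.var 10) e, .nset 14 (.var 10), pull]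

/-- No other vertex inherits from a base value, and at the root of a splay tree no ancestor
aggregates it. So one `pull` suffices. -/
theorem Forest.setBase {M : Mem} {F : Multiset Tr} {wt : ℕ → ℕ} {v v' : ℕ → ℝ} {nx : ℕ → ℕ}
    {R : Finset ℕ} (N : Network n m) (e : RExp) {l r : Tr} {x : ℕ}
    (h : Forest n M (.node l x r ::ₘ F) wt v nx R) (hx : M.nv 10 = x)
    (hvx : v' x = e.eval N M + M.ra 5 x) (hv : ∀ y ∈ Finset.Icc 1 n, y ≠ x → v' y = v y) :
    Forest n ((ConcaveFlow.setBase e).sem N M) (.node l x r ::ₘ F) wt v' nx R := by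
  have hrep := h.rep (.node l x r) (by simp)
  obtain ⟨hx0, -, hl, hr, hL, hrl, hrr⟩ := hrep
  have hnd := h.nodup (t := .node l x r) (by simp)
  have hnd' := hnd
  simp only [Tr.inord_node, List.nodup_append, List.nodup_cons, List.mem_cons] at hnd'
  obtain ⟨hndl, ⟨hxr, hndr⟩, hlxr⟩ := hnd'
  have hxl : x ∉ l.inord := fun hm => hlxr x hm x (.inl rfl) rfl
  set M₁ := (M.setRA 4 x (e.eval N M)).setN 14 x with hM₁
  have hsem : (ConcaveFlow.setBase e).sem N M = pull.sem N M₁ := by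
    simp only [ConcaveFlow.setBase, block, Prog.sem]
    congr 1
    simp [NExp.eval, hx, M₁]
  have hAg : ∀ y, y ≠ x → Agree M M₁ y := fun y hy =>
    ⟨fun e => by simp [M₁], by simp [M₁], by simp [M₁], by simp [M₁], by simp [M₁, hy],
      by simp [M₁], by simp [M₁]⟩
  have hm : ∀ y ∈ (Tr.node l x r).inord, y ∈ Finset.Icc 1 n := fun y hy => h.mem_Icc (by simp) hy
  have hrl₁ : Rep M₁ v' x (0 + M₁.ra 5 x) l := by
    refine Rep.congr_val (v := v) ?_ fun y hy => hv y (hm y (by simp [hy])) fun h => hxl (h ▸ hy)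
    refine Rep.congr (M := M) ?_ hndl fun y hy => hAg y fun h => hxl (h ▸ hy)
    simpa [M₁] using hrl
  have hrr₁ : Rep M₁ v' x (0 + M₁.ra 5 x) r := by
    refine Rep.congr_val (v := v) ?_ fun y hy => hv y (hm y (by simp [hy])) fun h => hxr (h ▸ hy)
    refine Rep.congr (M := M) ?_ hndr fun y hy => hAg y fun h => hxr (h ▸ hy)
    simpa [M₁] using hrr
  obtain ⟨hLx, hAg', hna', hra'⟩ := pull_spec N (M := M₁) (v := v') (o := 0) (p := x)
    (l := l) (r := r) (by simp [M₁]) (by simp [M₁, hl]) (by simp [M₁, hr]) hrl₁ hrr₁ hnd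
    (by rw [hvx]; simp [M₁])
  rw [← hsem] at hLx hAg' hna' hra'
  refine h.revalue ?_ (by simp) (fun e => ?_) (fun y hy hyt => ?_) fun y hy hyt => hv y hy ?_
  · refine ⟨hx0, ?_, ?_, ?_, hLx, ?_, ?_⟩
    · rw [hna' _ (by simp) (by simp)]; simp [M₁]
    · rw [hna' _ (by simp) (by simp)]; simp [M₁, hl]
    · rw [hna' _ (by simp) (by simp)]; simp [M₁, hr]
    · rw [hra' _ (by simp)]
      exact hrl₁.congr hndl fun y hy => hAg' y fun h => hxl (h ▸ hy)
    · rw [hra' _ (by simp)]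
      exact hrr₁.congr hndr fun y hy => hAg' y fun h => hxr (h ▸ hy)
  · rw [hna' _ chA_ne.2.1 chA_ne.2.2.1]
    simpa [M₁] using h.zero e
  · have : y ≠ x := fun h => hyt (by simp [h])
    exact (hAg y this).trans (hAg' y this)
  · rintro rfl
    simp at hyt

theorem Rep.shift {M : Mem} {v v' : ℕ → ℝ} {q : ℕ} {o μ : ℝ} {t : Tr} (h : Rep M v q o t)
    (hv : ∀ y ∈ t.inord, v' y = v y - μ) : Rep M v' q (o - μ) t := by
  induction t generalizing q o with
  | nil => trivial
  | node l x r ihl ihr =>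
    obtain ⟨h0, hq, hl, hr, hL, h1, h2⟩ := h
    have e : o - μ + M.ra 5 x = o + M.ra 5 x - μ := by ring
    refine ⟨h0, hq, hl, hr, ?_, e ▸ ihl h1 fun y hy => hv y (by simp [hy]),
      e ▸ ihr h2 fun y hy => hv y (by simp [hy])⟩
    have hm := hv _ hL.mem
    exact ⟨by rw [hv x (by simp), hL.val]; ring, hL.mem,
      fun y hy => by rw [hm, hv y hy]; linarith [hL.min y hy],
      by rw [hm, ← hL.mn]; ring, hL.last⟩

/-- Lazy update: a single write to the offset of the root of the splay tree lowers the values along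
the whole path. -/
theorem Forest.shift {M : Mem} {F : Multiset Tr} {wt : ℕ → ℕ} {v v' : ℕ → ℝ} {nx : ℕ → ℕ}
    {R : Finset ℕ} {l r : Tr} {x : ℕ} {μ : ℝ} (h : Forest n M (.node l x r ::ₘ F) wt v nx R)
    (hv : ∀ y ∈ (Tr.node l x r).inord, v' y = v y - μ)
    (hv' : ∀ y ∈ Finset.Icc 1 n, y ∉ (Tr.node l x r).inord → v' y = v y) :
    Forest n (M.setRA 5 x (M.ra 5 x - μ)) (.node l x r ::ₘ F) wt v' nx R := by
  have hrep := h.rep (.node l x r) (by simp)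
  have hA : ∀ y, y ≠ x → Agree M (M.setRA 5 x (M.ra 5 x - μ)) y := fun y hy =>
    ⟨fun e => by simp, by simp, by simp, by simp, by simp, by simp [hy], by simp⟩
  refine h.revalue ?_ (by simp) (fun e => by simpa using h.zero e)
    (fun y hy hyt => hA y fun h => hyt (by simp [h])) hv'
  refine (hrep.shift hv).reroot (h.nodup (by simp)) (fun y hy hyr => hA y hyr) fun _ => ?_
  refine ⟨fun d => rfl, rfl, rfl, rfl, by simp, ?_, by simp⟩
  simp
  ring
/-! ### Blocking flows -/

/-- The arcs `1, …, A` on the vertices `1, …, n`, given by tails and heads, and for every vertex the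
list of the arcs leaving it, in decreasing order. The arc `A` leads from `t` to `s`. -/
structure Arcs (n : ℕ) where
  A : ℕ
  tl : ℕ → ℕ
  hd : ℕ → ℕ
  fi : ℕ → ℕ
  nx : ℕ → ℕ
  s : ℕ
  t : ℕ
  s_mem : s ∈ Finset.Icc 1 n
  t_mem : t ∈ Finset.Icc 1 n
  s_ne : s ≠ t
  A_pos : 1 ≤ A
  tl_A : tl A = t
  hd_A : hd A = s
  tl_mem : ∀ a ∈ Finset.Icc 1 A, tl a ∈ Finset.Icc 1 n
  hd_mem : ∀ a ∈ Finset.Icc 1 A, hd a ∈ Finset.Icc 1 n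
  fi_mem : ∀ x ∈ Finset.Icc 1 n, fi x = 0 ∨ (fi x ∈ Finset.Icc 1 A ∧ tl (fi x) = x)
  le_fi : ∀ a ∈ Finset.Icc 1 A, a ≤ fi (tl a)
  nx_mem : ∀ a ∈ Finset.Icc 1 A, nx a = 0 ∨ (nx a ∈ Finset.Icc 1 A ∧ tl (nx a) = tl a)
  nx_lt : ∀ a ∈ Finset.Icc 1 A, nx a < a
  le_nx : ∀ a ∈ Finset.Icc 1 A, ∀ b ∈ Finset.Icc 1 A, tl b = tl a → b < a → b ≤ nx a

/-- The state of the blocking flow algorithm: `r` are the residual capacities of the arcs; those of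
the current arcs are the values of the forest. -/
structure BF (G : Arcs n) (c : ℕ → ℝ) (M : Mem) (r : ℕ → ℝ) (F : Multiset Tr) (wt : ℕ → ℕ)
    (R : Finset ℕ) : Prop where
  hd : M.na 3 = G.hd
  nx : M.na 4 = G.nx
  s : M.nv 4 = G.s
  forest : Forest n M F wt (fun x => r (M.na 6 x)) (fun x => G.hd (M.na 6 x)) R
  cur : ∀ x ∈ Finset.Icc 1 n, M.na 6 x = 0 ∨
    (M.na 6 x ∈ Finset.Icc 1 G.A ∧ G.tl (M.na 6 x) = x)
  res : ∀ a, (a ∈ Finset.Icc 1 G.A → a ≠ M.na 6 (G.tl a)) → M.ra 3 a = r a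
  passed : ∀ a ∈ Finset.Icc 1 G.A, M.na 6 (G.tl a) < a → r a = 0 ∨ M.na 6 (G.hd a) = 0
  nonneg : ∀ a ∈ Finset.Icc 1 G.A, 0 ≤ r a
  le_cap : ∀ a ∈ Finset.Icc 1 G.A, r a ≤ c a
  conserve : ∀ x ∈ Finset.Icc 1 n, ∑ a ∈ Finset.Icc 1 G.A with G.tl a = x, (c a - r a) =
    ∑ a ∈ Finset.Icc 1 G.A with G.hd a = x, (c a - r a)
  linked : ∀ x ∈ Finset.Icc 1 n, x ∉ R → M.na 6 x ≠ 0
  top : M.na 6 G.t = G.A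
  roots : R ⊆ Finset.Icc 1 n

open Classical in
/-- The contribution of a root to the progress measure: `-1` if its current arc is useless. -/
def rootVal (G : Arcs n) (cur : ℕ → ℕ) (r : ℕ → ℝ) (x : ℕ) : ℤ :=
  if cur x ≠ 0 ∧ (r (cur x) = 0 ∨ cur (G.hd (cur x)) = 0) then -1 else 1

/-- The progress measure. -/
def progress (G : Arcs n) (cur : ℕ → ℕ) (r : ℕ → ℝ) (R : Finset ℕ) : ℤ :=
  4 * ((Finset.Icc 1 G.A).filter fun a => a ≤ cur (G.tl a)).card + ∑ x ∈ R, rootVal G cur r x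

theorem rootVal_abs (G : Arcs n) (cur : ℕ → ℕ) (r : ℕ → ℝ) (x : ℕ) :
    -1 ≤ rootVal G cur r x ∧ rootVal G cur r x ≤ 1 := by
  unfold rootVal
  split_ifs <;> norm_num

theorem progress_bounds (G : Arcs n) (cur : ℕ → ℕ) (r : ℕ → ℝ) {R : Finset ℕ}
    (hR : R ⊆ Finset.Icc 1 n) :
    -(n : ℤ) ≤ progress G cur r R ∧ progress G cur r R ≤ 4 * G.A + n := by
  have h1 : R.card ≤ n := by simpa using Finset.card_le_card hR
  have h2 : ((Finset.Icc 1 G.A).filter fun a => a ≤ cur (G.tl a)).card ≤ G.A := by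
    simpa using Finset.card_filter_le (Finset.Icc 1 G.A) fun a => a ≤ cur (G.tl a)
  have h3 : ∑ x ∈ R, rootVal G cur r x ≤ R.card := by
    simpa using Finset.sum_le_card_nsmul R _ 1 fun x _ => (rootVal_abs G cur r x).2
  have h4 : -(R.card : ℤ) ≤ ∑ x ∈ R, rootVal G cur r x := by
    simpa using Finset.card_nsmul_le_sum R _ (-1) fun x _ => (rootVal_abs G cur r x).1
  unfold progress
  constructor <;> omega

theorem BF.update {G : Arcs n} {c : ℕ → ℝ} {M M' : Mem} {r : ℕ → ℝ} {F F' : Multiset Tr}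
    {wt wt' : ℕ → ℕ} {R : Finset ℕ} (h : BF G c M r F wt R) (h3 : M'.na 3 = M.na 3)
    (h4 : M'.na 4 = M.na 4) (h6 : M'.na 6 = M.na 6) (hr : M'.ra 3 = M.ra 3) (hs : M'.nv 4 = M.nv 4)
    (hF : Forest n M' F' wt' (fun x => r (M.na 6 x)) (fun x => G.hd (M.na 6 x)) R) :
    BF G c M' r F' wt' R := by
  refine ⟨h3.trans h.hd, h4.trans h.nx, hs.trans h.s, ?_, ?_, ?_, ?_, h.nonneg, h.le_cap,
    h.conserve, ?_, ?_, h.roots⟩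
  · rw [h6]; exact hF
  · rw [h6]; exact h.cur
  · rw [h6, hr]; exact h.res
  · rw [h6]; exact h.passed
  · rw [h6]; exact h.linked
  · rw [h6]; exact h.top

/-- On a chain that closes up, `f` acts as a cyclic shift. This yields conservation of flow when a
cycle is saturated. -/
theorem map_eq_of_isChain {α : Type*} {f : α → α} {x : α} {xs : List α}
    (h : (x :: xs).IsChain (fun a b => f a = b)) {z : α} (hz : (x :: xs).getLast? = some z)
    (hf : f z = x) : (x :: xs).map f = xs ++ [x] := by
  have key : ∀ (xs : List α) (y : α), (y :: xs).IsChain (fun a b => f a = b) →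
      (y :: xs).getLast? = some z → (y :: xs).map f = xs ++ [x] := by
    intro xs
    induction xs with
    | nil =>
      intro y _ hy
      simp only [List.getLast?_singleton, Option.some.injEq] at hy
      simp [hy, hf]
    | cons a xs ih =>
      intro y hy hl
      rw [List.isChain_cons_cons] at hy
      rw [List.getLast?_cons_cons] at hl
      rw [List.map_cons, ih a hy.2 hl, hy.1]
      simp
  exact key xs x h hz

/-- On a cycle of current arcs, every vertex has one arc leaving and one arc entering. -/
theorem sum_cycle (G : Arcs n) {cur : ℕ → ℕ} {xs : List ℕ} {z : ℕ} (hnd : xs.Nodup)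
    (hcur : ∀ x ∈ xs, cur x ∈ Finset.Icc 1 G.A ∧ G.tl (cur x) = x)
    (hch : xs.IsChain (fun x y => G.hd (cur x) = y)) (hz : xs.getLast? = some z)
    (hf : xs.head? = some (G.hd (cur z))) (μ : ℝ) (y : ℕ) :
    (∑ a ∈ Finset.Icc 1 G.A with G.tl a = y, if cur (G.tl a) = a ∧ G.tl a ∈ xs then μ else 0) =
    ∑ a ∈ Finset.Icc 1 G.A with G.hd a = y, if cur (G.tl a) = a ∧ G.tl a ∈ xs then μ else 0 := by
  -- Reindexing by tails: different vertices have different current arcs, because the tail of the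
  -- current arc of a vertex is the vertex.
  have key : ∀ P : ℕ → Prop, [DecidablePred P] → (∑ a ∈ Finset.Icc 1 G.A with P a,
      if cur (G.tl a) = a ∧ G.tl a ∈ xs then μ else 0) =
      ∑ x ∈ xs.toFinset, if P (cur x) then μ else 0 := by
    intro P _
    rw [Finset.sum_filter, Finset.sum_congr rfl (g := fun a =>
      if cur (G.tl a) = a ∧ G.tl a ∈ xs then (if P a then μ else 0) else 0)
      fun a _ => by split_ifs <;> rfl, ← Finset.sum_filter]
    have himg : ((Finset.Icc 1 G.A).filter fun a => cur (G.tl a) = a ∧ G.tl a ∈ xs) =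
        xs.toFinset.image cur := by
      ext a
      simp only [Finset.mem_filter, Finset.mem_image, List.mem_toFinset]
      constructor
      · rintro ⟨-, h1, h2⟩
        exact ⟨_, h2, h1⟩
      · rintro ⟨x, hx, rfl⟩
        have := hcur x hx
        rw [this.2]
        exact ⟨this.1, rfl, hx⟩
    rw [himg, Finset.sum_image]
    intro a ha b hb hab
    rw [← (hcur a (by simpa using ha)).2, hab, (hcur b (by simpa using hb)).2]
  rw [key, key]
  obtain ⟨x, xs, rfl⟩ : ∃ a as, xs = a :: as := by
    cases xs
    · simp at hz
    · exact ⟨_, _, rfl⟩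
  have hmap := map_eq_of_isChain hch hz (by simpa using hf.symm)
  have e1 : (∑ a ∈ (x :: xs).toFinset, if G.tl (cur a) = y then μ else 0) =
      (((x :: xs).map fun a => if a = y then μ else 0)).sum := by
    rw [List.sum_toFinset _ hnd]
    congr 1
    refine List.map_congr_left fun a ha => ?_
    rw [(hcur a ha).2]
  have e2 : (∑ a ∈ (x :: xs).toFinset, if G.hd (cur a) = y then μ else 0) =
      (((x :: xs).map fun a => G.hd (cur a)).map fun a => if a = y then μ else 0).sum := by
    rw [List.sum_toFinset _ hnd, List.map_map]
    rfl
  rw [e1, e2, hmap]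
  simp [add_comm]

/-- By conservation at the sink the flow on the return arc is at most the flow entering the sink,
hence at most the capacity of all other arcs. So the return arc is never saturated. -/
theorem BF.top_pos {G : Arcs n} {c : ℕ → ℝ} {M : Mem} {r : ℕ → ℝ} {F : Multiset Tr} {wt : ℕ → ℕ}
    {R : Finset ℕ} (h : BF G c M r F wt R) (hc : ∑ a ∈ Finset.Ico 1 G.A, c a < c G.A)
     : 0 < r G.A := by
  have h1 := h.conserve G.t G.t_mem
  have hA : G.A ∈ Finset.Icc 1 G.A := by have := G.A_pos; simp [this]
  have h2 : c G.A - r G.A ≤ ∑ a ∈ Finset.Icc 1 G.A with G.tl a = G.t, (c a - r a) := by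
    refine Finset.single_le_sum (f := fun a => c a - r a) (fun a ha => ?_) ?_
    · have := h.le_cap a (Finset.mem_filter.1 ha).1
      linarith
    · simp [hA, G.tl_A]
  have h3 : ∑ a ∈ Finset.Icc 1 G.A with G.hd a = G.t, (c a - r a) ≤ ∑ a ∈ Finset.Ico 1 G.A, c a := by
    calc _ ≤ ∑ a ∈ Finset.Icc 1 G.A with G.hd a = G.t, c a := Finset.sum_le_sum fun a ha => by
          have := h.nonneg a (Finset.mem_filter.1 ha).1
          linarith
      _ ≤ _ := by
          refine Finset.sum_le_sum_of_subset_of_nonneg (fun a ha => ?_) fun a ha _ => ?_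
          · obtain ⟨h4, h5⟩ := Finset.mem_filter.1 ha
            rw [Finset.mem_Icc] at h4
            rw [Finset.mem_Ico]
            refine ⟨h4.1, lt_of_le_of_ne h4.2 ?_⟩
            rintro rfl
            exact G.s_ne (G.hd_A.symm.trans h5)
          · rw [Finset.mem_Ico] at ha
            have ha' : a ∈ Finset.Icc 1 G.A := Finset.mem_Icc.2 ⟨ha.1, ha.2.le⟩
            exact (h.nonneg a ha').trans (h.le_cap a ha')
  linarith

theorem Forest.eq_of_mem {M : Mem} {F : Multiset Tr} {wt : ℕ → ℕ} {v : ℕ → ℝ} {nx : ℕ → ℕ}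
    {R : Finset ℕ} (h : Forest n M F wt v nx R) {t t' : Tr} (ht : t ∈ F) (ht' : t' ∈ F) {y : ℕ}
    (hy : y ∈ t.inord) (hy' : y ∈ t'.inord) : t = t' := by
  obtain ⟨F, rfl⟩ := Multiset.exists_cons_of_mem ht
  rcases Multiset.mem_cons.1 ht' with h1 | h1
  · exact h1.symm
  · exact absurd hy' (h.disj h1 hy)

section
variable {G : Arcs n} {c : ℕ → ℝ} {M : Mem} {r : ℕ → ℝ} {F : Multiset Tr} {wt : ℕ → ℕ}
  {R : Finset ℕ}

theorem BF.access (N : Network n m) (h : BF G c M r F wt R) {x : ℕ} (hx : x ∈ Finset.Icc 1 n)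
    (h17 : M.nv 17 = x) : ∃ M' τ rr F' wt', Exec N ConcaveFlow.access M M' τ ∧
      BF G c M' r (.node .nil x rr ::ₘ F') wt' R ∧ M'.na 12 x = 0 ∧
      (Tr.node .nil x rr).inord.getLast? = some (M'.na 14 x) ∧
      (τ : ℝ) ≤ 20000 * (potF wt F - potF wt' (.node .nil x rr ::ₘ F') + 6 * Real.logb 2 n + 3) := by
  obtain ⟨M', τ, rr, F', wt', hex, hF, h12, hτ⟩ := h.forest.access_spec N hx h17
  refine ⟨M', τ, rr, F', wt', hex, h.update (hex.na rfl) (hex.na rfl) (hex.na rfl) (hex.ra rfl)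
    (hex.nv rfl) hF, h12, ?_, hτ⟩
  exact ((hF.rep (.node .nil x rr) (by simp)).loc (by simp)).last

theorem BF.splay (N : Network n m) (h : BF G c M r F wt R) {x : ℕ} (hx : M.nv 10 = x)
    (hxn : x ∈ Finset.Icc 1 n) :
    ∃ t F₀ M' τ l' r', F = t ::ₘ F₀ ∧ x ∈ t.inord ∧ Exec N ConcaveFlow.splay M M' τ ∧
      BF G c M' r (Tr.node l' x r' ::ₘ F₀) wt R ∧ (Tr.node l' x r').inord = t.inord ∧
      M'.na 12 x = M.na 12 t.rt ∧ M'.nv 10 = x ∧ (∀ y, y ∉ t.inord → y ≠ 0 → Agree M M' y) ∧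
      (τ : ℝ) ≤ 20000 * (potF wt F - potF wt (Tr.node l' x r' ::ₘ F₀) + 6 * Real.logb 2 n + 3) := by
  obtain ⟨t, F₀, M', τ, l', r', he, hxt, hex, hF, hin, h12, h10, hA, hτ⟩ := h.forest.splay N hx hxn
  refine ⟨t, F₀, M', τ, l', r', he, hxt, hex, h.update (hex.na rfl) (hex.na rfl) (hex.na rfl)
    (hex.ra rfl) (hex.nv rfl) hF, hin, h12, h10, hA, ?_⟩
  have h1 : (0 : ℝ) ≤ τ := Nat.cast_nonneg _
  have h2 : 0 ≤ Real.logb 2 n := by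
    refine Real.logb_nonneg (by norm_num) ?_
    have := Finset.mem_Icc.1 hxn
    exact_mod_cast this.1.trans this.2
  linarith

/-- The root `x` of the path is dead, i.e. its list of arcs is exhausted. Its predecessor on the
path becomes a root whose current arc has a dead head, which contributes -1 to the progress measure.
-/
theorem BF.cut_dead (N : Network n m) {l : Tr} {x : ℕ}
    (h : BF G c M r (.node l x .nil ::ₘ F) wt R) (hx : M.nv 10 = x) (hp : M.na 12 x = 0)
    (hd : M.na 6 x = 0) (hl : l ≠ .nil) : ∃ F' R', BF G c ((cutSide false).sem N M) r F' wt R' ∧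
      potF wt F' ≤ potF wt (.node l x .nil ::ₘ F) ∧
      progress G (((cutSide false).sem N M).na 6) r R' ≤ progress G (M.na 6) r R - 1 := by
  obtain ⟨u, hu⟩ := Option.isSome_iff_exists.1 (List.getLast?_isSome.2 (Tr.inord_ne_nil hl))
  have hul := List.mem_of_getLast? hu
  have hut : u ∈ (Tr.node l x .nil).inord := by simp [hul]
  have hnd := h.forest.nodup (t := .node l x .nil) (by simp)
  have hux : u ≠ x := by
    rw [Tr.inord_node, List.nodup_append] at hnd
    exact hnd.2.2 u hul x (by simp)
  have hun := h.forest.mem_Icc (t := .node l x .nil) (by simp) hut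
  have huR : u ∉ R := by
    rw [h.forest.roots (.node l x .nil) (by simp) u hut]
    simp [hux.symm]
  have hnx : G.hd (M.na 6 u) = x := by
    have := h.forest.chain (.node l x .nil) (by simp)
    rw [Tr.inord_node, List.isChain_append] at this
    exact this.2.2 u hu x (by simp)
  obtain ⟨hF, hpot⟩ := Forest.cutSide (R' := insert u R) N false (a := l) (x := x) (b := .nil) h.forest hx hp
    (by intro y _; simp [hu, or_comm, eq_comm])
  have h6 : ((cutSide false).sem N M).na 6 = M.na 6 := Prog.sem_na N rfl M rfl
  refine ⟨_, insert u R, ⟨?_, ?_, ?_, ?_, ?_, ?_, ?_, h.nonneg, h.le_cap, h.conserve, ?_, ?_, ?_⟩,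
    hpot, ?_⟩
  · exact (Prog.sem_na N rfl M rfl).trans h.hd
  · exact (Prog.sem_na N rfl M rfl).trans h.nx
  · exact (Prog.sem_nv N rfl M rfl).trans h.s
  · rw [h6]; exact hF
  · rw [h6]; exact h.cur
  · rw [h6, Prog.sem_ra N rfl M rfl]; exact h.res
  · rw [h6]; exact h.passed
  · rw [h6]
    intro y hy hyR
    exact h.linked y hy fun h' => hyR (by simp [h'])
  · rw [h6]; exact h.top
  · exact Finset.insert_subset hun h.roots
  · rw [h6, progress, Finset.sum_insert huR]
    have : rootVal G (M.na 6) r u = -1 := if_pos ⟨h.linked u hun huR, .inr (by rw [hnx, hd])⟩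
    rw [this, progress]
    linarith

/-- Replace the current arc of the root in register `10` by the next arc. -/
def advance : Prog := block
  [.rstore 3 (.arr 6 (.var 10)) (.add (.arr 4 (.var 10)) (.arr 5 (.var 10))),
   .nstore 6 (.var 10) (.arr 4 (.arr 6 (.var 10))),
   setBase (.sub (.arr 3 (.arr 6 (.var 10))) (.arr 5 (.var 10)))]

/-- The arc given up removes 4 from the measure, whereas the value of the root can rise by at most
2; this fixes the factor 4 in `progress`. Uselessness is permanent: residual capacities only fall
and dead vertices stay dead, so the arc need never be looked at again. -/
theorem BF.advance (N : Network n m) {l : Tr} {x : ℕ}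
    (h : BF G c M r (.node l x .nil ::ₘ F) wt R) (hx : M.nv 10 = x) (hp : M.na 12 x = 0)
    (hd : M.na 6 x ≠ 0) (hbad : r (M.na 6 x) = 0 ∨ M.na 6 (G.hd (M.na 6 x)) = 0)
    (hs : M.na 6 G.s ≠ 0) (hc : ∑ a ∈ Finset.Ico 1 G.A, c a < c G.A) :
    BF G c (ConcaveFlow.advance.sem N M) r (.node l x .nil ::ₘ F) wt R ∧
      progress G ((ConcaveFlow.advance.sem N M).na 6) r R ≤ progress G (M.na 6) r R - 1 := by
  have hxn := h.forest.mem_Icc (t := .node l x .nil) (x := x) (by simp) (by simp)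
  have hxR : x ∈ R := by
    rw [h.forest.roots (.node l x .nil) (by simp) x (by simp)]
    simp [hp]
  -- The current arc of the sink is the return arc, which is unsaturated and leads to the living
  -- vertex `G.s`. So the sink never advances.
  have hxt : x ≠ G.t := by
    rintro rfl
    rw [h.top] at hbad
    rcases hbad with h1 | h1
    · exact (h.top_pos hc).ne' h1
    · rw [G.hd_A] at h1; exact hs h1
  obtain ⟨a₀, ha₀⟩ : ∃ a₀, M.na 6 x = a₀ := ⟨_, rfl⟩
  have hcur := (h.cur x hxn).resolve_left hd
  rw [ha₀] at hcur hd hbad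
  obtain ⟨b₀, hb₀⟩ : ∃ b₀, G.nx a₀ = b₀ := ⟨_, rfl⟩
  have hba : b₀ < a₀ := hb₀ ▸ G.nx_lt a₀ hcur.1
  have hval : M.ra 4 x + M.ra 5 x = r a₀ := by
    have := ((h.forest.rep (.node l x .nil) (by simp)).loc (by simp)).val
    simp only [Tr.rt_node, ha₀] at this
    linarith
  -- The next arc is not current, so its residual capacity is still found in the array and not in
  -- the forest.
  have hresb : M.ra 3 b₀ = r b₀ := h.res b₀ fun hb => by
    have := G.nx_mem a₀ hcur.1
    rw [hb₀] at this
    rcases this with h1 | h1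
    · rw [h1] at hb; simp at hb
    · rw [h1.2, hcur.2, ha₀]; exact hba.ne
  set M₁ := (M.setRA 3 a₀ (r a₀)).setNA 6 x b₀ with hM₁
  set e : RExp := .sub (.arr 3 (.arr 6 (.var 10))) (.arr 5 (.var 10))
  have hsem : ConcaveFlow.advance.sem N M = (setBase e).sem N M₁ := by
    show (setBase e).sem N (Prog.sem N (.nstore 6 (.var 10) (.arr 4 (.arr 6 (.var 10))))
      (Prog.sem N (.rstore 3 (.arr 6 (.var 10)) (.add (.arr 4 (.var 10)) (.arr 5 (.var 10)))) M)) = _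
    congr 1
    simp [Prog.sem, NExp.eval, RExp.eval, hx, ha₀, hval, h.nx, hb₀, M₁]
  have hcur₁ : ∀ y, M₁.na 6 y = if y = x then b₀ else M.na 6 y := fun y => by simp [M₁]
  have hF₁ : Forest n M₁ (.node l x .nil ::ₘ F) wt (fun x => r (M.na 6 x))
      (fun x => G.hd (M₁.na 6 x)) R := by
    refine h.forest.congr (fun y hy => ?_) (fun e => ?_) (fun _ _ => rfl) fun y hy hyR => ?_
    · exact ⟨fun e => by cases e <;> simp [M₁, chA], by simp [M₁], by simp [M₁], by simp [M₁],
        by simp [M₁], by simp [M₁], by simp [M₁]⟩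
    · have := h.forest.zero e
      cases e <;> simp [M₁, chA] at this ⊢ <;> exact this
    · have : y ≠ x := fun h => hyR (h ▸ hxR)
      simp only [hcur₁, if_neg this]
  have hF₂ := hF₁.setBase N e (v' := fun x => r (M₁.na 6 x)) (by simp [M₁, hx])
    (by simp only [hcur₁, e, RExp.eval, NExp.eval]; simp [M₁, hx, hba.ne, hresb])
    fun y _ hyx => by simp only [hcur₁, if_neg hyx]
  rw [← hsem] at hF₂
  have h6 : (ConcaveFlow.advance.sem N M).na 6 = M₁.na 6 := by
    rw [hsem]; exact Prog.sem_na N rfl M₁ rfl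
  have h3 : (ConcaveFlow.advance.sem N M).ra 3 = M₁.ra 3 := by
    rw [hsem]; exact Prog.sem_ra N rfl M₁ rfl
  have hnb : ∀ a ∈ Finset.Icc 1 G.A, G.tl a = x → a < a₀ → a ≤ b₀ := fun a ha hax hlt => by
    rw [← hb₀]; exact G.le_nx a₀ hcur.1 a ha (by rw [hax, hcur.2]) hlt
  refine ⟨⟨?_, ?_, ?_, ?_, ?_, ?_, ?_, h.nonneg, h.le_cap, h.conserve, ?_, ?_, h.roots⟩, ?_⟩
  · exact (Prog.sem_na N rfl M rfl).trans h.hd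
  · exact (Prog.sem_na N rfl M rfl).trans h.nx
  · exact (Prog.sem_nv N rfl M rfl).trans h.s
  · rw [h6]; exact hF₂
  · rw [h6]
    intro y hy
    rw [hcur₁]
    by_cases hyx : y = x
    · rw [if_pos hyx, hyx]
      have := G.nx_mem a₀ hcur.1
      rwa [hb₀, hcur.2] at this
    · rw [if_neg hyx]
      exact h.cur y hy
  · rw [h6, h3]
    intro a ha
    rw [hcur₁] at ha
    simp only [M₁, Mem.setNA_ra, Mem.setRA_ra, true_and]
    by_cases haa : a = a₀
    · rw [if_pos haa, haa]
    · rw [if_neg haa]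
      refine h.res a fun hI => ?_
      have := ha hI
      split_ifs at this with hta
      · rw [hta, ha₀]; exact haa
      · exact this
  · rw [h6]
    intro a ha hlt
    rw [hcur₁] at hlt ⊢
    have hold : ∀ y, M.na 6 y = 0 → (if y = x then b₀ else M.na 6 y) = 0 := fun y hy => by
      rw [if_neg]
      · exact hy
      · rintro rfl
        exact hd (ha₀.symm.trans hy)
    split_ifs at hlt with hta
    · rcases lt_trichotomy a a₀ with h1 | rfl | h1
      · have := hnb a ha hta h1
        omega
      · exact hbad.imp_right (hold _)
      · exact (h.passed a ha (by rw [hta, ha₀]; exact h1)).imp_right (hold _)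
    · exact (h.passed a ha hlt).imp_right (hold _)
  · rw [h6]
    intro y hy hyR
    have : y ≠ x := fun h => hyR (h ▸ hxR)
    rw [hcur₁, if_neg this]
    exact h.linked y hy hyR
  · rw [h6, hcur₁, if_neg hxt.symm]
    exact h.top
  · rw [h6]
    have hcard : ((Finset.Icc 1 G.A).filter fun a => a ≤ M₁.na 6 (G.tl a)).card + 1 ≤
        ((Finset.Icc 1 G.A).filter fun a => a ≤ M.na 6 (G.tl a)).card := by
      rw [Nat.add_one_le_iff]
      refine Finset.card_lt_card ⟨fun a ha => ?_, fun hsub => ?_⟩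
      · rw [Finset.mem_filter, hcur₁] at ha
        rw [Finset.mem_filter]
        refine ⟨ha.1, ?_⟩
        have := ha.2
        split_ifs at this with hta
        · rw [hta, ha₀]; omega
        · exact this
      · have := hsub (Finset.mem_filter.2 ⟨hcur.1, by rw [hcur.2, ha₀]⟩)
        rw [Finset.mem_filter, hcur₁, if_pos hcur.2] at this
        omega
    -- Another root whose arc was useless keeps that arc useless, because `x` was alive before and
    -- no dead vertex revives. Only the term of `x` can go up.
    have hsum : ∑ y ∈ R, rootVal G (M₁.na 6) r y ≤ ∑ y ∈ R, rootVal G (M.na 6) r y + 2 := by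
      rw [← Finset.add_sum_erase R _ hxR, ← Finset.add_sum_erase R (rootVal G (M.na 6) r) hxR]
      have h1 := (rootVal_abs G (M₁.na 6) r x).2
      have h2 := (rootVal_abs G (M.na 6) r x).1
      have h3 : ∑ y ∈ R.erase x, rootVal G (M₁.na 6) r y ≤
          ∑ y ∈ R.erase x, rootVal G (M.na 6) r y := by
        refine Finset.sum_le_sum fun y hy => ?_
        have hyx := Finset.ne_of_mem_erase hy
        by_cases hb : M.na 6 y ≠ 0 ∧ (r (M.na 6 y) = 0 ∨ M.na 6 (G.hd (M.na 6 y)) = 0)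
        · have : rootVal G (M₁.na 6) r y = -1 := by
            refine if_pos ?_
            rw [hcur₁ y, if_neg hyx]
            refine ⟨hb.1, hb.2.imp_right fun h0 => ?_⟩
            rw [hcur₁, if_neg]
            · exact h0
            · intro h'
              rw [h', ha₀] at h0
              exact hd h0
          rw [this]
          exact (rootVal_abs G _ _ _).1
        · have : rootVal G (M.na 6) r y = 1 := if_neg hb
          rw [this]
          exact (rootVal_abs G _ _ _).2
      linarith
    unfold progress
    omega
end

theorem Prog.exec_le (N : Network n m) {P : Prog} {k : ℕ} (hP : P.straight = true ∧ P.cost ≤ k)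
    (M : Mem) : ∃ τ, Exec N P M (P.sem N M) τ ∧ (τ : ℝ) ≤ k := by
  obtain ⟨τ, h, hτ⟩ := Prog.exec_straight N P hP.1 M
  exact ⟨τ, h, by exact_mod_cast hτ.trans hP.2⟩

/-- Saturate the cycle that is formed by the path from the vertex in register `22`, which is the
root of its splay tree, and the current arc of the last vertex, and separate the path. -/
def saturate : Prog := block
  [.nset 10 (.arr 13 (.var 22)),
   .rstore 5 (.var 22) (.sub (.arr 5 (.var 22)) (.add (.arr 6 (.var 22)) (.arr 5 (.var 22)))),
   splay, cutSide true]

theorem cutSide_cost : (cutSide true).straight = true ∧ (cutSide true).cost ≤ 300 := by decide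
theorem cutSide_cost' : (cutSide false).straight = true ∧ (cutSide false).cost ≤ 300 := by decide

section
variable {G : Arcs n} {c : ℕ → ℝ} {M : Mem} {r : ℕ → ℝ} {F : Multiset Tr} {wt : ℕ → ℕ}
  {R : Finset ℕ}

/-- The path from `w` to its root `x` together with the current arc of `x` is a cycle. Lowering all
its residual capacities by their minimum `μ` preserves conservation and saturates the arc of `u`,
where the path is cut. If `u` is another vertex than `x`, a root of value -1 appears; if `u` is `x`,
the value of `x` falls from 1 to -1. -/
theorem BF.saturate (N : Network n m) {w x : ℕ} {rr : Tr}
    (h : BF G c M r (.node .nil w rr ::ₘ F) wt R) (hw : M.nv 22 = w) (hp : M.na 12 w = 0)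
    (hx : (Tr.node .nil w rr).inord.getLast? = some x) (hxw : G.hd (M.na 6 x) = w)
    (hgood : rootVal G (M.na 6) r x = 1) (hx0 : M.na 6 x ≠ 0) :
    ∃ M' τ r' F' R', Exec N ConcaveFlow.saturate M M' τ ∧ BF G c M' r' F' wt R' ∧
      (τ : ℝ) ≤ 20000 * (potF wt (.node .nil w rr ::ₘ F) - potF wt F' + 6 * Real.logb 2 n + 4) ∧
      M'.na 6 = M.na 6 ∧ progress G (M.na 6) r' R' ≤ progress G (M.na 6) r R - 1 := by
  set t := Tr.node .nil w rr with ht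
  have htF : t ∈ t ::ₘ F := by simp
  have hndt := h.forest.nodup htF
  have hrep := h.forest.rep t htF
  have hL := hrep.loc (by simp [ht])
  simp only [ht, Tr.rt_node] at hL
  rw [← ht] at hL
  obtain ⟨u, hu⟩ : ∃ u, M.na 13 w = u := ⟨_, rfl⟩
  obtain ⟨μ, hμ⟩ : ∃ μ, M.ra 6 w + M.ra 5 w = μ := ⟨_, rfl⟩
  have hut : u ∈ t.inord := hu ▸ hL.mem
  have hvu : r (M.na 6 u) = μ := by
    have := hL.mn
    rw [hu] at this
    linarith
  have hmin : ∀ y ∈ t.inord, μ ≤ r (M.na 6 y) := fun y hy => by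
    have := hL.min y hy
    rw [hu] at this
    rwa [← hvu]
  have hI : ∀ y ∈ t.inord, y ∈ Finset.Icc 1 n := fun y hy => h.forest.mem_Icc htF hy
  have hroot : ∀ y ∈ t.inord, y ∈ R ↔ y = x := fun y hy => by
    have hw' : t.rt = w := rfl
    rw [h.forest.roots t htF y hy, hx, hw', hp, Option.some.injEq, and_iff_left rfl, eq_comm]
  have hxt := List.mem_of_getLast? hx
  have hxR : x ∈ R := (hroot x hxt).2 rfl
  have halive : ∀ y ∈ t.inord, M.na 6 y ∈ Finset.Icc 1 G.A ∧ G.tl (M.na 6 y) = y := fun y hy => by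
    refine (h.cur y (hI y hy)).resolve_left ?_
    by_cases hyx : y = x
    · rwa [hyx]
    · exact h.linked y (hI y hy) fun hR => hyx ((hroot y hy).1 hR)
  have hμ0 : 0 ≤ μ := hvu ▸ h.nonneg _ (halive u hut).1
  -- Restricting to indices of arcs keeps the index 0, the mark of a missing current arc, unchanged.
  obtain ⟨r', hr'⟩ : ∃ r' : ℕ → ℝ, r' = fun a => r a - if a ∈ Finset.Icc 1 G.A ∧
    M.na 6 (G.tl a) = a ∧ G.tl a ∈ t.inord then μ else 0 := ⟨_, rfl⟩
  have hr'I : ∀ a ∈ Finset.Icc 1 G.A, r' a = r a -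
      if M.na 6 (G.tl a) = a ∧ G.tl a ∈ t.inord then μ else 0 := fun a ha => by
    rw [hr']; simp only [ha, true_and]
  have hr't : ∀ y ∈ t.inord, r' (M.na 6 y) = r (M.na 6 y) - μ := fun y hy => by
    rw [hr'I _ (halive y hy).1, (halive y hy).2, if_pos ⟨rfl, hy⟩]
  have hr'n : ∀ y ∈ Finset.Icc 1 n, y ∉ t.inord → r' (M.na 6 y) = r (M.na 6 y) := fun y hy hyt => by
    rw [hr']
    simp only
    rw [if_neg, sub_zero]
    rintro ⟨h1, h2, h3⟩
    rcases h.cur y hy with h4 | h4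
    · rw [h4] at h1; simp at h1
    · rw [h4.2] at h3; exact hyt h3
  have hr'le : ∀ a, r' a ≤ r a := fun a => by
    rw [hr']; simp only; split_ifs <;> linarith
  have hr'0 : ∀ a ∈ Finset.Icc 1 G.A, 0 ≤ r' a := fun a ha => by
    rw [hr'I a ha]
    split_ifs with h1
    · have := hmin _ h1.2
      rw [h1.1] at this
      linarith
    · rw [sub_zero]; exact h.nonneg a ha
  have hr'z : ∀ a ∈ Finset.Icc 1 G.A, r a = 0 → r' a = 0 := fun a ha h0 =>
    le_antisymm (h0 ▸ hr'le a) (hr'0 a ha)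
  set M₁ := (M.setN 10 u).setRA 5 w (M.ra 5 w - μ) with hM₁
  have hF₁ : Forest n M₁ (t ::ₘ F) wt (fun y => r' (M.na 6 y)) (fun y => G.hd (M.na 6 y)) R := by
    exact Forest.shift (h.forest.setN 10 u) hr't hr'n
  have hB₁ : BF G c M₁ r' (t ::ₘ F) wt R := by
    refine ⟨h.hd, h.nx, by simp [M₁, h.s], hF₁, h.cur, fun a ha => ?_, fun a ha hlt => ?_, hr'0,
      fun a ha => (hr'le a).trans (h.le_cap a ha), fun y hy => ?_, h.linked, h.top, h.roots⟩
    · have : M₁.ra 3 a = M.ra 3 a := by simp [M₁]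
      rw [this, h.res a ha, hr']
      simp only
      rw [if_neg, sub_zero]
      rintro ⟨h1, h2, -⟩
      exact ha h1 h2.symm
    · exact (h.passed a ha hlt).imp_left (hr'z a ha)
    · have hch : t.inord.IsChain (fun y z => G.hd (M.na 6 y) = z) := h.forest.chain t htF
      have := sum_cycle G hndt halive hch hx (by rw [hxw]; rfl) μ y
      have h1 := h.conserve y hy
      have e : ∀ P : ℕ → Prop, [DecidablePred P] → (∑ a ∈ Finset.Icc 1 G.A with P a, (c a - r' a)) =
          (∑ a ∈ Finset.Icc 1 G.A with P a, (c a - r a)) + ∑ a ∈ Finset.Icc 1 G.A with P a,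
            if M.na 6 (G.tl a) = a ∧ G.tl a ∈ t.inord then μ else 0 := by
        intro P _
        rw [← Finset.sum_add_distrib]
        refine Finset.sum_congr rfl fun a ha => ?_
        rw [hr'I a (Finset.mem_filter.1 ha).1]
        ring
      rw [e, e, this, h1]
  obtain ⟨t', F₀, M₂, τ, l', r'', he, hut', hex, hB₂, hin, h12, h10, hA, hτ⟩ := hB₁.splay N
    (x := u) (by simp [M₁]) (hI u hut)
  have htt' : t' = t := hF₁.eq_of_mem (by rw [he]; simp) htF hut' hut
  subst htt'
  have hFF : F = F₀ := by simpa using he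
  subst hFF
  have h12' : M₂.na 12 u = 0 := by rw [h12]; simpa [M₁, ht] using hp
  have hB₂F : Forest n M₂ (Tr.mk true r'' u l' ::ₘ F) wt (fun y => r' (M₂.na 6 y))
      (fun y => G.hd (M₂.na 6 y)) R := hB₂.forest
  have hlast : (Tr.mk true .nil u l').inord.getLast? = some u := by
    simp [Tr.mk, List.getLast?_append]
  obtain ⟨hF₃, hpot₃⟩ := hB₂F.cutSide (R' := insert u R) N true h10 h12'
    (by intro y _; simp [hlast, or_comm, eq_comm])
  set M₃ := (cutSide true).sem N M₂ with hM₃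
  have h6₁ : M₂.na 6 = M.na 6 := hex.na rfl
  have h6 : M₃.na 6 = M₂.na 6 := Prog.sem_na N rfl M₂ rfl
  obtain ⟨τ₃, hex₃, hτ₃⟩ := Prog.exec_le N cutSide_cost M₂
  have hexec : ∃ τ', Exec N ConcaveFlow.saturate M M₃ τ' ∧ (τ' : ℝ) ≤ τ + 500 := by
    have e1 := Exec.nset (N := N) M 10 (.arr 13 (.var 22))
    have e2 := Exec.rstore (N := N) (M.setN 10 u) 5 (.var 22)
      (.sub (.arr 5 (.var 22)) (.add (.arr 6 (.var 22)) (.arr 5 (.var 22))))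
    have e1' : Exec N (.nset 10 (.arr 13 (.var 22))) M (M.setN 10 u) 3 := by
      simpa [Mem.setN, NExp.eval, NExp.size, hw, hu] using e1
    have e2' : Exec N (.rstore 5 (.var 22)
      (.sub (.arr 5 (.var 22)) (.add (.arr 6 (.var 22)) (.arr 5 (.var 22))))) (M.setN 10 u) M₁ 10 := by
      simpa [Mem.setRA, NExp.eval, RExp.eval, NExp.size, RExp.size, hw, hμ, M₁] using e2
    refine ⟨_, .seq _ _ _ _ _ _ _ e1' (.seq _ _ _ _ _ _ _ e2' (.seq _ _ _ _ _ _ _ hex hex₃)), ?_⟩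
    push_cast
    push_cast at hτ₃
    linarith
  obtain ⟨τ', hexec, hτ'⟩ := hexec
  have hB₃ : BF G c M₃ r' (Tr.mk true .nil u l' ::ₘ r'' ::ₘ F) wt (insert u R) := by
    refine ⟨(Prog.sem_na N rfl M₂ rfl).trans hB₂.hd, (Prog.sem_na N rfl M₂ rfl).trans hB₂.nx,
      (Prog.sem_nv N rfl M₂ rfl).trans hB₂.s, ?_, ?_, ?_, ?_, hB₂.nonneg, hB₂.le_cap, hB₂.conserve,
      ?_, ?_, Finset.insert_subset (hI u hut) h.roots⟩
    · rw [h6]; exact hF₃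
    · rw [h6]; exact hB₂.cur
    · rw [h6, Prog.sem_ra N rfl M₂ rfl]; exact hB₂.res
    · rw [h6]; exact hB₂.passed
    · rw [h6]
      intro y hy hyR
      exact hB₂.linked y hy fun h' => hyR (by simp [h'])
    · rw [h6]; exact hB₂.top
  refine ⟨M₃, τ', r', _, insert u R, hexec, hB₃, ?_, h6.trans h6₁, ?_⟩
  · have : potF wt (Tr.node l' u r'' ::ₘ F) = potF wt (Tr.mk true r'' u l' ::ₘ F) := rfl
    linarith
  · have hmono : ∀ y ∈ R, rootVal G (M.na 6) r' y ≤ rootVal G (M.na 6) r y := fun y hy => by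
      by_cases hb : M.na 6 y ≠ 0 ∧ (r (M.na 6 y) = 0 ∨ M.na 6 (G.hd (M.na 6 y)) = 0)
      · have : rootVal G (M.na 6) r' y = -1 := by
          refine if_pos ⟨hb.1, hb.2.imp_left fun h0 => hr'z _ ?_ h0⟩
          exact ((h.cur y (h.roots hy)).resolve_left hb.1).1
        rw [this]
        exact (rootVal_abs G _ _ _).1
      · have : rootVal G (M.na 6) r y = 1 := if_neg hb
        rw [this]
        exact (rootVal_abs G _ _ _).2
    have hub : rootVal G (M.na 6) r' u = -1 := by
      refine if_pos ⟨?_, .inl (by rw [hr't u hut, hvu, sub_self])⟩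
      have := Finset.mem_Icc.1 (halive u hut).1
      omega
    unfold progress
    by_cases huR : u ∈ R
    · rw [Finset.insert_eq_of_mem huR]
      have hux : u = x := (hroot u hut).1 huR
      have : ∑ y ∈ R, rootVal G (M.na 6) r' y < ∑ y ∈ R, rootVal G (M.na 6) r y :=
        Finset.sum_lt_sum hmono ⟨x, hxR, by rw [hgood, ← hux, hub]; norm_num⟩
      linarith
    · rw [Finset.sum_insert huR, hub]
      have := Finset.sum_le_sum hmono
      linarith

/-- Link the root in register `21` to the vertex in register `22`. -/
def linkRoot : Prog := block [.nset 10 (.var 21), splay, .nstore 12 (.var 21) (.var 22)]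

/-- `x` stops being a root of value 1, so the measure falls by 1. It has to be splayed first, as the
parent of a path is stored with the root of its splay tree. This splay leaves the tree of `w` alone,
since `x` lies in another tree. -/
theorem BF.linkRoot (N : Network n m) {w x : ℕ} {rr : Tr}
    (h : BF G c M r (.node .nil w rr ::ₘ F) wt R) (hw : M.nv 22 = w) (hx : M.nv 21 = x)
    (hp : M.na 12 w = 0) (hxw : x ∉ (Tr.node .nil w rr).inord)
    (hnx : G.hd (M.na 6 x) = w) (hxR : x ∈ R)
    (hgood : rootVal G (M.na 6) r x = 1) (hx0 : M.na 6 x ≠ 0) :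
    ∃ M' τ F' wt' R', Exec N ConcaveFlow.linkRoot M M' τ ∧ BF G c M' r F' wt' R' ∧
      (τ : ℝ) ≤ 20000 * (potF wt (.node .nil w rr ::ₘ F) - potF wt' F' + 7 * Real.logb 2 n + 4) ∧
      M'.na 6 = M.na 6 ∧ progress G (M.na 6) r R' ≤ progress G (M.na 6) r R - 1 := by
  have hxn := h.roots hxR
  have hB₀ : BF G c (M.setN 10 x) r (.node .nil w rr ::ₘ F) wt R :=
    h.update rfl rfl rfl rfl (by simp) (h.forest.setN _ _)
  obtain ⟨t, F₀, M₁, τ, l', r', he, hxt, hex, hB₁, hin, h12, h10, hA, hτ⟩ := hB₀.splay N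
    (x := x) (by simp) hxn
  have hroot := (h.forest.roots t (by rw [he]; simp) x hxt).1 hxR
  obtain ⟨F₁, rfl, rfl⟩ : ∃ F₁, F = t ::ₘ F₁ ∧ F₀ = .node .nil w rr ::ₘ F₁ := by
    rcases Multiset.cons_eq_cons.1 he with ⟨h1, -⟩ | ⟨-, F₁, h1, h2⟩
    · exact absurd (h1 ▸ hxt) hxw
    · exact ⟨F₁, h1, h2⟩
  have hwt : w ∉ t.inord := h.forest.disj (by simp) (by simp)
  have hwn : w ∈ Finset.Icc 1 n := h.forest.mem_Icc (t := .node .nil w rr) (by simp) (by simp)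
  have h6₁ : M₁.na 6 = M.na 6 := hex.na rfl
  have hA₁ : M₁.na 12 w = 0 := by
    rw [(hA w hwt (by have := Finset.mem_Icc.1 hwn; omega)).par]
    exact hp
  have hx12 : M₁.na 12 x = 0 := h12.trans hroot.2
  obtain ⟨wt', hF₂, hpot⟩ := hB₁.forest.link (M' := M₁.setNA 12 x w) (R' := R.erase x) (z := x)
    (by simp) hx12 hA₁ (by rw [hin]; exact hroot.1) (by simp only [h6₁]; exact hnx) rfl
    (by intro y _; rw [Finset.mem_erase, and_comm])
  refine ⟨M₁.setNA 12 x w, 2 + (τ + 3), .node l' x r' ::ₘ .node .nil w rr ::ₘ F₁, wt', R.erase x, ?_, ?_, ?_, h6₁, ?_⟩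
  · have e1 : Exec N (.nset 10 (.var 21)) M (M.setN 10 x) 2 := by
      simpa [Mem.setN, NExp.eval, NExp.size, hx] using Exec.nset (N := N) M 10 (.var 21)
    have e2 : Exec N (.nstore 12 (.var 21) (.var 22)) M₁ (M₁.setNA 12 x w) 3 := by
      have h21 : M₁.nv 21 = x := by rw [hex.nv rfl]; simp [hx]
      have h22 : M₁.nv 22 = w := by rw [hex.nv rfl]; simp [hw]
      simpa [Mem.setNA, NExp.eval, NExp.size, h21, h22] using
        Exec.nstore (N := N) M₁ 12 (.var 21) (.var 22)
    exact .seq _ _ _ _ _ _ _ e1 (.seq _ _ _ _ _ _ _ hex e2)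
  · have h6 : (M₁.setNA 12 x w).na 6 = M₁.na 6 := rfl
    refine ⟨hB₁.hd, hB₁.nx, hB₁.s, hF₂, hB₁.cur, hB₁.res, hB₁.passed, hB₁.nonneg, hB₁.le_cap,
      hB₁.conserve, fun y hy hyR => ?_, hB₁.top, (Finset.erase_subset _ _).trans h.roots⟩
    rw [h6, h6₁]
    by_cases hyx : y = x
    · rwa [hyx]
    · exact h.linked y hy fun h' => hyR (Finset.mem_erase.2 ⟨hyx, h'⟩)
  · push_cast
    linarith
  · unfold progress
    rw [← Finset.add_sum_erase R _ hxR, hgood]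
    linarith

end

/-- Push flow from the root in register `21` along its current arc to the vertex in register `22`,
or move to the next arc. -/
def tryArc : Prog :=
  .cond (.and (.not (.req (.add (.arr 4 (.var 21)) (.arr 5 (.var 21))) (.lit 0)))
      (.not (.neq (.arr 6 (.var 22)) (.lit 0))))
    (.seq (.nset 17 (.var 22)) (.seq access
      (.cond (.neq (.arr 14 (.var 22)) (.var 21)) saturate linkRoot)))
    advance

/-- One step of the search for augmenting cycles through the vertex in register `4`. -/
def blockStep : Prog := block
  [.nset 17 (.var 4), access, .nset 21 (.arr 14 (.var 4)), .nset 10 (.var 21), splay,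
   .cond (.neq (.arr 6 (.var 21)) (.lit 0)) (cutSide false)
     (.seq (.nset 22 (.arr 3 (.arr 6 (.var 21)))) tryArc)]

theorem advance_cost : advance.straight = true ∧ advance.cost ≤ 300 := by decide

section
variable {G : Arcs n} {c : ℕ → ℝ} {M : Mem} {r : ℕ → ℝ} {F : Multiset Tr} {wt : ℕ → ℕ}
  {R : Finset ℕ}

theorem BF.tryArc (N : Network n m) (hc : ∑ a ∈ Finset.Ico 1 G.A, c a < c G.A) {l : Tr} {x : ℕ}
    (h : BF G c M r (.node l x .nil ::ₘ F) wt R) (h10 : M.nv 10 = x) (h21 : M.nv 21 = x)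
    (hp : M.na 12 x = 0) (hs : M.na 6 G.s ≠ 0) (hx0 : M.na 6 x ≠ 0)
    (h22 : M.nv 22 = G.hd (M.na 6 x)) :
    ∃ M' τ r' F' wt' R', Exec N ConcaveFlow.tryArc M M' τ ∧ BF G c M' r' F' wt' R' ∧
      (τ : ℝ) ≤ 20000 * (potF wt (.node l x .nil ::ₘ F) - potF wt' F' + 13 * Real.logb 2 n + 8) ∧
      progress G (M'.na 6) r' R' ≤ progress G (M.na 6) r R - 1 := by
  have hxn := h.forest.mem_Icc (t := .node l x .nil) (x := x) (by simp) (by simp)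
  have hlg : 0 ≤ Real.logb 2 n := by
    refine Real.logb_nonneg (by norm_num) ?_
    have := Finset.mem_Icc.1 hxn
    exact_mod_cast this.1.trans this.2
  have hxR : x ∈ R := by
    rw [h.forest.roots (.node l x .nil) (by simp) x (by simp)]
    simp [hp]
  have hval : M.ra 4 x + M.ra 5 x = r (M.na 6 x) := by
    have := ((h.forest.rep (.node l x .nil) (by simp)).loc (by simp)).val
    simp only [Tr.rt_node] at this
    linarith
  have hcur := (h.cur x hxn).resolve_left hx0
  have hb : (BExp.and (.not (.req (.add (.arr 4 (.var 21)) (.arr 5 (.var 21))) (.lit 0)))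
      (.not (.neq (.arr 6 (.var 22)) (.lit 0)))).Holds N M ↔
      ¬ (r (M.na 6 x) = 0 ∨ M.na 6 (G.hd (M.na 6 x)) = 0) := by
    simp [BExp.Holds, NExp.eval, RExp.eval, h21, h22, hval]
  by_cases hbad : r (M.na 6 x) = 0 ∨ M.na 6 (G.hd (M.na 6 x)) = 0
  · obtain ⟨hB, hpr⟩ := h.advance N h10 hp hx0 hbad hs hc
    obtain ⟨τ, hex, hτ⟩ := Prog.exec_le N advance_cost M
    refine ⟨_, _, r, _, wt, R, .cond_false _ _ _ _ _ _ (by rw [hb, not_not]; exact hbad) hex, hB,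
      ?_, hpr⟩
    simp only [BExp.size, RExp.size, NExp.size]
    push_cast at hτ ⊢
    linarith
  · obtain ⟨w, hw⟩ : ∃ w, G.hd (M.na 6 x) = w := ⟨_, rfl⟩
    have hwn : w ∈ Finset.Icc 1 n := hw ▸ G.hd_mem _ hcur.1
    have hgood : rootVal G (M.na 6) r x = 1 := if_neg fun h' => hbad h'.2
    have hB₀ : BF G c (M.setN 17 w) r (.node l x .nil ::ₘ F) wt R :=
      h.update rfl rfl rfl rfl (by simp) (h.forest.setN _ _)
    obtain ⟨M₁, τ₁, rr, F₁, wt₁, hex₁, hB₁, hp₁, hl₁, hτ₁⟩ := hB₀.access N hwn (by simp)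
    have h6 : M₁.na 6 = M.na 6 := hex₁.na rfl
    have h21₁ : M₁.nv 21 = x := by rw [hex₁.nv rfl]; simp [h21]
    have h22₁ : M₁.nv 22 = w := by rw [hex₁.nv rfl]; simp [h22, hw]
    have e1 : Exec N (.nset 17 (.var 22)) M (M.setN 17 w) 2 := by
      simpa [Mem.setN, NExp.eval, NExp.size, h22, hw] using Exec.nset (N := N) M 17 (.var 22)
    by_cases hcyc : M₁.na 14 w = x
    · rw [hcyc] at hl₁
      obtain ⟨M₂, τ₂, r', F₂, R₂, hex₂, hB₂, hτ₂, h6₂, hpr⟩ := hB₁.saturate N h22₁ hp₁ hl₁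
        (by rw [h6, hw]) (by rw [h6]; exact hgood) (by rw [h6]; exact hx0)
      refine ⟨M₂, _, r', F₂, wt₁, R₂, .cond_true _ _ _ _ _ _ (hb.2 hbad) (.seq _ _ _ _ _ _ _ e1
        (.seq _ _ _ _ _ _ _ hex₁ (.cond_true _ _ _ _ _ _
          (by simp [BExp.Holds, NExp.eval, h22₁, h21₁, hcyc]) hex₂))), hB₂, ?_, ?_⟩
      · simp only [BExp.size, RExp.size, NExp.size]
        push_cast
        linarith
      · rw [h6₂, ← h6]; exact hpr
    · have hxw : x ∉ (Tr.node .nil w rr).inord := fun hm => by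
        have := (hB₁.forest.roots (.node .nil w rr) (by simp) x hm).1 hxR
        rw [hl₁, Option.some.injEq] at this
        exact hcyc this.1
      obtain ⟨M₂, τ₂, F₂, wt₂, R₂, hex₂, hB₂, hτ₂, h6₂, hpr⟩ := hB₁.linkRoot N h22₁ h21₁ hp₁ hxw
        (by rw [h6, hw]) hxR (by rw [h6]; exact hgood) (by rw [h6]; exact hx0)
      refine ⟨M₂, _, r, F₂, wt₂, R₂, .cond_true _ _ _ _ _ _ (hb.2 hbad) (.seq _ _ _ _ _ _ _ e1
        (.seq _ _ _ _ _ _ _ hex₁ (.cond_false _ _ _ _ _ _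
          (by simp [BExp.Holds, NExp.eval, h22₁, h21₁, hcyc]) hex₂))), hB₂, ?_, ?_⟩
      · simp only [BExp.size, RExp.size, NExp.size]
        push_cast
        linarith
      · rw [h6₂, ← h6]; exact hpr

/-- An access to the source exposes the path from the source to its root `x`. Either `x` is dead and
cut off, or its arc is useless and skipped, or the arc leads into a path ending at `x` and closes a
cycle, or it leads to another tree and is linked. Every case lowers the measure by at least 1. -/
theorem BF.blockStep (N : Network n m) (hc : ∑ a ∈ Finset.Ico 1 G.A, c a < c G.A)
    (h : BF G c M r F wt R) (hs : M.na 6 G.s ≠ 0) :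
    ∃ M' τ r' F' wt' R', Exec N ConcaveFlow.blockStep M M' τ ∧ BF G c M' r' F' wt' R' ∧
      (τ : ℝ) ≤ 20000 * (potF wt F - potF wt' F' + 25 * Real.logb 2 n + 15) ∧
      progress G (M'.na 6) r' R' ≤ progress G (M.na 6) r R - 1 := by
  have hlg : 0 ≤ Real.logb 2 n := by
    refine Real.logb_nonneg (by norm_num) ?_
    have := Finset.mem_Icc.1 G.s_mem
    exact_mod_cast this.1.trans this.2
  have hB₀ : BF G c (M.setN 17 G.s) r F wt R :=
    h.update rfl rfl rfl rfl (by simp) (h.forest.setN _ _)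
  obtain ⟨M₁, τ₁, rr, F₁, wt₁, hex₁, hB₁, hp₁, hl₁, hτ₁⟩ := hB₀.access N G.s_mem (by simp)
  have h6₁ : M₁.na 6 = M.na 6 := hex₁.na rfl
  have h4₁ : M₁.nv 4 = G.s := hB₁.s
  obtain ⟨x, hx⟩ : ∃ x, M₁.na 14 G.s = x := ⟨_, rfl⟩
  rw [hx] at hl₁
  have hxt := List.mem_of_getLast? hl₁
  have hxn := hB₁.forest.mem_Icc (t := .node .nil G.s rr) (by simp) hxt
  have hB₂ : BF G c ((M₁.setN 21 x).setN 10 x) r (.node .nil G.s rr ::ₘ F₁) wt₁ R :=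
    hB₁.update rfl rfl rfl rfl (by simp) ((hB₁.forest.setN _ _).setN _ _)
  obtain ⟨t, F₂, M₃, τ₃, l', r', he, hxt', hex₃, hB₃, hin, h12, h10, -, hτ₃⟩ := hB₂.splay N
    (x := x) (by simp) hxn
  have htt : t = .node .nil G.s rr := hB₂.forest.eq_of_mem (by rw [he]; simp) (by simp) hxt' hxt
  subst htt
  have hFF : F₁ = F₂ := by simpa using he
  subst hFF
  have h6₃ : M₃.na 6 = M.na 6 := (hex₃.na rfl).trans h6₁
  have hr' : r' = .nil := by
    by_contra hne
    obtain ⟨z, hz⟩ := Option.isSome_iff_exists.1 (List.getLast?_isSome.2 (Tr.inord_ne_nil hne))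
    have hnd := hB₃.forest.nodup (t := .node l' x r') (by simp)
    rw [← hin] at hl₁
    simp only [Tr.inord_node, List.getLast?_append, List.getLast?_cons, hz, Option.some_or,
      Option.some.injEq, Option.getD_some] at hl₁
    rw [Tr.inord_node, List.nodup_append, List.nodup_cons] at hnd
    exact hnd.2.1.1 (hl₁ ▸ List.mem_of_getLast? hz)
  subst hr'
  have h12₃ : M₃.na 12 x = 0 := by rw [h12]; simpa using hp₁
  have h21₃ : M₃.nv 21 = x := by rw [hex₃.nv rfl]; simp
  have e1 : Exec N (.nset 17 (.var 4)) M (M.setN 17 G.s) 2 := by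
    simpa [Mem.setN, NExp.eval, NExp.size, h.s] using Exec.nset (N := N) M 17 (.var 4)
  have e2 : Exec N (.nset 21 (.arr 14 (.var 4))) M₁ (M₁.setN 21 x) 3 := by
    simpa [Mem.setN, NExp.eval, NExp.size, h4₁, hx] using Exec.nset (N := N) M₁ 21 (.arr 14 (.var 4))
  have e3 : Exec N (.nset 10 (.var 21)) (M₁.setN 21 x) ((M₁.setN 21 x).setN 10 x) 2 := by
    simpa [Mem.setN, NExp.eval, NExp.size] using Exec.nset (N := N) (M₁.setN 21 x) 10 (.var 21)
  have hrest : ∃ M' τ r' F' wt' R', Exec N (.cond (.neq (.arr 6 (.var 21)) (.lit 0)) (cutSide false)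
      (.seq (.nset 22 (.arr 3 (.arr 6 (.var 21)))) ConcaveFlow.tryArc)) M₃ M' τ ∧
      BF G c M' r' F' wt' R' ∧
      (τ : ℝ) ≤ 20000 * (potF wt₁ (.node l' x .nil ::ₘ F₁) - potF wt' F' + 13 * Real.logb 2 n + 8)
        + 20 ∧ progress G (M'.na 6) r' R' ≤ progress G (M₃.na 6) r R - 1 := by
    by_cases hd : M₃.na 6 x = 0
    -- The source is alive and lies on this path, so a dead `x` differs from the source and has a
    -- predecessor.
    · have hl : l' ≠ .nil := by
        rintro rfl
        have : G.s ∈ (Tr.node .nil x .nil).inord := by rw [hin]; simp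
        simp only [Tr.inord_node, Tr.inord_nil, List.nil_append, List.mem_singleton] at this
        rw [← this, h6₃] at hd
        exact hs hd
      obtain ⟨F', R', hB', hpot, hpr⟩ := hB₃.cut_dead N h10 h12₃ hd hl
      obtain ⟨τ, hex, hτ⟩ := Prog.exec_le N cutSide_cost' M₃
      refine ⟨_, _, r, F', wt₁, R', .cond_true _ _ _ _ _ _
        (by simp [BExp.Holds, NExp.eval, h21₃, hd]) hex, hB', ?_, hpr⟩
      simp only [BExp.size, NExp.size]
      push_cast at hτ ⊢
      linarith
    · have h22 : (M₃.setN 22 (G.hd (M₃.na 6 x))).nv 22 = G.hd (M₃.na 6 x) := by simp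
      have hB₄ : BF G c (M₃.setN 22 (G.hd (M₃.na 6 x))) r (.node l' x .nil ::ₘ F₁) wt₁ R :=
        hB₃.update rfl rfl rfl rfl (by simp) (hB₃.forest.setN _ _)
      have e4 : Exec N (.nset 22 (.arr 3 (.arr 6 (.var 21)))) M₃
          (M₃.setN 22 (G.hd (M₃.na 6 x))) 4 := by
        simpa [Mem.setN, NExp.eval, NExp.size, h21₃, hB₃.hd] using
          Exec.nset (N := N) M₃ 22 (.arr 3 (.arr 6 (.var 21)))
      obtain ⟨M', τ, r', F', wt', R', hex, hB', hτ, hpr⟩ := hB₄.tryArc N hc (by simp [h10])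
        (by simp [h21₃]) (by simpa using h12₃) (by simpa [h6₃] using hs) (by simpa using hd)
        (by simp)
      refine ⟨M', _, r', F', wt', R', .cond_false _ _ _ _ _ _
        (by simp [BExp.Holds, NExp.eval, h21₃, hd]) (.seq _ _ _ _ _ _ _ e4 hex), hB', ?_, hpr⟩
      simp only [BExp.size, NExp.size]
      push_cast at hτ ⊢
      linarith
  obtain ⟨M', τ, r', F', wt', R', hex, hB', hτ, hpr⟩ := hrest
  refine ⟨M', _, r', F', wt', R', .seq _ _ _ _ _ _ _ e1 (.seq _ _ _ _ _ _ _ hex₁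
    (.seq _ _ _ _ _ _ _ e2 (.seq _ _ _ _ _ _ _ e3 (.seq _ _ _ _ _ _ _ hex₃ hex)))), hB', ?_, ?_⟩
  · push_cast
    linarith
  · rw [h6₃] at hpr; exact hpr

end

/-- A `for` loop whose iterations are paid for by a potential. -/
theorem exec_forLoop_pot {N : Network n m} (i : ℕ) (bd : NExp) (P : Prog) {γ : Type*}
    (I : ℕ → γ → Mem → Prop) (Φ : γ → ℝ) (hΦ : ∀ g, 0 ≤ Φ g)
    (b : ℕ) (c : ℝ) (hc : 0 ≤ c) (hi : P.writesN i = false)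
    (hbd : ∀ j g M, I j g M → bd.eval M = b)
    (hstep : ∀ j g M, j < b → I j g M → M.nv i = j → ∃ g' M' k, Exec N P M M' k ∧
      (k : ℝ) ≤ c + Φ g - Φ g' ∧ I (j + 1) g' (M'.setN i (j + 1))) (M : Mem) (g : γ)
    (h0 : I 0 g (M.setN i 0)) :
    ∃ g' M' k, Exec N (.forLoop i bd P) M M' k ∧ I b g' M' ∧
      (k : ℝ) ≤ (b + 1) * (c + bd.size + 7) + Φ g := by
  have hs : (0 : ℝ) ≤ bd.size := Nat.cast_nonneg _
  obtain ⟨⟨j, g'⟩, M', k, hk, ⟨hI, hj, hle⟩, hb', hle'⟩ := exec_loop (N := N) (.nlt (.var i) bd)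
    (.seq P (.nset i (.add (.var i) (.lit 1)))) (fun (p : ℕ × γ) M => I p.1 p.2 M ∧ M.nv i = p.1 ∧ p.1 ≤ b)
    (fun p => ((b : ℝ) - p.1) * (c + bd.size + 7) + Φ p.2)
    (by
      rintro ⟨j, g⟩ M ⟨-, -, h⟩
      have : (j : ℝ) ≤ b := by exact_mod_cast h
      exact add_nonneg (mul_nonneg (sub_nonneg.2 this) (by linarith)) (hΦ g))
    (by
      rintro ⟨j, g⟩ M ⟨hI, hj, hjb⟩ hb
      simp only at hI hj hjb
      simp only [BExp.Holds, NExp.eval, hj, hbd j g M hI] at hb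
      obtain ⟨g', M', k, hk, hkc, hI'⟩ := hstep j g M hb hI hj
      have hj' : M'.nv i = j := by rw [hk.nv hi, hj]
      refine ⟨⟨j + 1, g'⟩, M'.setN i (j + 1), _, .seq _ _ _ _ _ _ _ hk
        (by simpa [NExp.eval, hj', Mem.setN] using
          Exec.nset (N := N) M' i (.add (.var i) (.lit 1))), ⟨hI', by simp, hb⟩, ?_⟩
      simp only [NExp.size, BExp.size]
      push_cast
      linarith) (0, g) (M.setN i 0) ⟨h0, by simp, Nat.zero_le _⟩
  simp only at hI hj hle
  have hgb : j = b := by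
    simp only [BExp.Holds, NExp.eval, hbd _ _ _ hI, hj] at hb'
    omega
  subst hgb
  refine ⟨g', M', _, .seq _ _ _ _ _ _ _ (.nset M i (.lit 0)) hk, hI, ?_⟩
  have := hΦ g'
  simp only [NExp.size, BExp.size] at hle' ⊢
  push_cast at hle' ⊢
  linarith

theorem Tr.pot_nonneg {wt : ℕ → ℕ} (hwt : ∀ x, 1 ≤ wt x) (t : Tr) : 0 ≤ t.pot wt := by
  induction t with
  | nil => exact le_rfl
  | node l x r ihl ihr =>
    have h1 : 1 ≤ (Tr.node l x r).size wt := (hwt x).trans (Tr.le_size (by simp))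
    have h2 : 0 ≤ Real.logb 2 ((Tr.node l x r).size wt) :=
      Real.logb_nonneg (by norm_num) (by exact_mod_cast h1)
    simp only [Tr.pot]
    linarith

theorem potF_nonneg {wt : ℕ → ℕ} (hwt : ∀ x, 1 ≤ wt x) (F : Multiset Tr) : 0 ≤ potF wt F := by
  refine Multiset.sum_nonneg fun y hy => ?_
  obtain ⟨t, -, rfl⟩ := Multiset.mem_map.1 hy
  exact Tr.pot_nonneg hwt t

theorem Forest.init {M : Mem} {v : ℕ → ℝ} (nx : ℕ → ℕ)
    (h : ∀ x ∈ Finset.Icc 1 n, M.na 10 x = 0 ∧ M.na 11 x = 0 ∧ M.na 12 x = 0 ∧ M.na 13 x = x ∧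
      M.na 14 x = x ∧ M.ra 4 x = v x ∧ M.ra 5 x = 0 ∧ M.ra 6 x = v x)
    (h0 : M.na 10 0 = 0) (h0' : M.na 11 0 = 0) :
    ∃ F wt, Forest n M F wt v nx (Finset.Icc 1 n) ∧ potF wt F = 0 := by
  -- All n one-vertex trees have the parent 0, so `wts` forces the weight `1 + n` on the dummy
  -- vertex 0 and the weight 1 elsewhere.
  have hwt : ∀ x ∈ Finset.Icc 1 n, (Tr.node .nil x .nil).size (fun x => if x = 0 then 1 + n else 1) = 1 := by
    intro x hx
    have : x ≠ 0 := by rw [Finset.mem_Icc] at hx; omega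
    simp [Tr.size, this]
  refine ⟨(Finset.Icc 1 n).val.map fun x => .node .nil x .nil, fun x => if x = 0 then 1 + n else 1,
    ?_, ?_⟩
  · have hF : ∀ t ∈ (Finset.Icc 1 n).val.map (fun x => Tr.node .nil x .nil),
        ∃ x ∈ Finset.Icc 1 n, t = .node .nil x .nil := by
      intro t ht
      obtain ⟨x, hx, rfl⟩ := Multiset.mem_map.1 ht
      exact ⟨x, hx, rfl⟩
    refine ⟨?_, ?_, ?_, ?_, ?_, ?_, ?_⟩
    · rw [Multiset.bind_map]
      simp only [Tr.inord_node, Tr.inord_nil, List.nil_append, Multiset.coe_singleton]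
      exact (Multiset.bind_singleton _ _).trans (Multiset.map_id' _)
    · intro t ht
      obtain ⟨x, hx, rfl⟩ := hF t ht
      obtain ⟨h1, h2, h3, h4, h5, h6, h7, h8⟩ := h x hx
      refine ⟨?_, rfl, h1, h2, ⟨?_, ?_, ?_, ?_, ?_⟩, trivial, trivial⟩
      · rw [Finset.mem_Icc] at hx; omega
      · rw [h6, h7]; ring
      · simp [h4]
      · simp [h4]
      · rw [h8, h7, h4]; ring
      · simp [h5]
    · intro t ht _
      obtain ⟨x, hx, rfl⟩ := hF t ht
      exact .inl (h x hx).2.2.1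
    · intro t ht
      obtain ⟨x, hx, rfl⟩ := hF t ht
      simp
    · intro x
      rw [Multiset.map_map]
      have e : (Finset.Icc 1 n).val.map ((fun t : Tr => if M.na 12 t.rt = x then
          t.size (fun x => if x = 0 then 1 + n else 1) else 0) ∘ fun x => .node .nil x .nil) =
          (Finset.Icc 1 n).val.map fun _ => if 0 = x then 1 else 0 := by
        refine Multiset.map_congr rfl fun z hz => ?_
        simp only [Function.comp, Tr.rt_node, (h z hz).2.2.1, hwt z hz]
      rw [e]
      by_cases hx : x = 0
      · simp [hx]
      · simp [hx, Ne.symm hx]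
    · intro t ht x hx
      obtain ⟨y, hy, rfl⟩ := hF t ht
      simp only [Tr.inord_node, Tr.inord_nil, List.nil_append, List.mem_singleton] at hx
      subst hx
      simp only [hy, Tr.inord_node, Tr.inord_nil, List.nil_append, List.getLast?_singleton, true_and,
        Tr.rt_node, true_iff]
      exact (h x hy).2.2.1
    · intro e
      cases e
      exacts [h0, h0']
  · unfold potF
    rw [Multiset.map_map]
    refine Multiset.sum_eq_zero fun y hy => ?_
    obtain ⟨z, hz, rfl⟩ := Multiset.mem_map.1 hy
    simp only [Function.comp, Tr.pot, hwt z hz]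
    simp

/-- Search for augmenting cycles as long as the vertex in register `4` has a current arc. -/
def blockLoop : Prog := .loop (.not (.neq (.arr 6 (.var 4)) (.lit 0))) blockStep

/-- The loop is paid for by the cost of a step times the progress measure plus a multiple of the
splay potential. The measure lies between -n and 4A + n, whence the factor 4A + 2n. -/
theorem BF.blockLoop (N : Network n m) {G : Arcs n} {c : ℕ → ℝ} {M : Mem} {r : ℕ → ℝ}
    {F : Multiset Tr} {wt : ℕ → ℕ} {R : Finset ℕ} (hc : ∑ a ∈ Finset.Ico 1 G.A, c a < c G.A)
    (h : BF G c M r F wt R) :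
    ∃ M' τ r' F' wt' R', Exec N ConcaveFlow.blockLoop M M' τ ∧ BF G c M' r' F' wt' R' ∧
      M'.na 6 G.s = 0 ∧ (τ : ℝ) ≤ 20000 * (25 * Real.logb 2 n + 17) * (4 * G.A + 2 * n) +
        20000 * (potF wt F - potF wt' F') + 10 := by
  have hlg : 0 ≤ Real.logb 2 n := by
    refine Real.logb_nonneg (by norm_num) ?_
    have := Finset.mem_Icc.1 G.s_mem
    exact_mod_cast this.1.trans this.2
  obtain ⟨⟨⟨cur, r'⟩, F', wt', R'⟩, M', τ, hex, ⟨rfl, hB'⟩, hs, hτ⟩ := exec_loop (N := N)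
    (.not (.neq (.arr 6 (.var 4)) (.lit 0))) ConcaveFlow.blockStep
    (fun (g : ((ℕ → ℕ) × (ℕ → ℝ)) × Multiset Tr × (ℕ → ℕ) × Finset ℕ) M =>
      M.na 6 = g.1.1 ∧ BF G c M g.1.2 g.2.1 g.2.2.1 g.2.2.2)
    (fun g => 20000 * (25 * Real.logb 2 n + 17) * (progress G g.1.1 g.1.2 (g.2.2.2 ∩ Finset.Icc 1 n) + n)
      + 20000 * potF g.2.2.1 g.2.1)
    (by
      rintro g M ⟨-, hB⟩
      have h1 := potF_nonneg hB.forest.one_le g.2.1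
      have h2 := (progress_bounds G g.1.1 g.1.2 (Finset.inter_subset_right (s₁ := g.2.2.2))).1
      have h3 : (-(n : ℝ)) ≤ progress G g.1.1 g.1.2 (g.2.2.2 ∩ Finset.Icc 1 n) := by exact_mod_cast h2
      have h4 : (0 : ℝ) ≤ 20000 * (25 * Real.logb 2 n + 17) := by linarith
      have := mul_nonneg h4 (by linarith : 0 ≤
        (progress G g.1.1 g.1.2 (g.2.2.2 ∩ Finset.Icc 1 n) : ℝ) + n)
      linarith)
    (by
      rintro ⟨⟨cur, r⟩, F, wt, R⟩ M ⟨rfl, hB⟩ hb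
      simp only at hB
      simp only [BExp.Holds, NExp.eval, hB.s] at hb
      obtain ⟨M', τ, r', F', wt', R', hex, hB', hτ, hpr⟩ := hB.blockStep N hc hb
      refine ⟨((M'.na 6, r'), F', wt', R'), M', τ, hex, ⟨rfl, hB'⟩, ?_⟩
      simp only [Finset.inter_eq_left.2 hB.roots, Finset.inter_eq_left.2 hB'.roots]
      have h3 : (progress G (M'.na 6) r' R' : ℝ) ≤ progress G (M.na 6) r R - 1 := by
        exact_mod_cast hpr
      have h4 : (0 : ℝ) ≤ 20000 * (25 * Real.logb 2 n + 17) := by linarith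
      have := mul_le_mul_of_nonneg_left h3 h4
      simp only [BExp.size, NExp.size]
      push_cast
      linarith)
    ((M.na 6, r), F, wt, R) M ⟨rfl, h⟩
  simp only at hB'
  refine ⟨M', τ, r', F', wt', R', hex, hB', ?_, ?_⟩
  · simpa [BExp.Holds, NExp.eval, hB'.s] using hs
  · simp only [Finset.inter_eq_left.2 h.roots, Finset.inter_eq_left.2 hB'.roots, BExp.size,
      NExp.size] at hτ
    have h2 : (progress G (M.na 6) r R : ℝ) ≤ 4 * G.A + n := by
      exact_mod_cast (progress_bounds G (M.na 6) r h.roots).2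
    have h3 : -(n : ℝ) ≤ progress G (M'.na 6) r' R' := by
      exact_mod_cast (progress_bounds G (M'.na 6) r' hB'.roots).1
    have h4 : (0 : ℝ) ≤ 20000 * (25 * Real.logb 2 n + 17) := by linarith
    have h5 := mul_le_mul_of_nonneg_left (by linarith : (progress G (M.na 6) r R : ℝ) -
      progress G (M'.na 6) r' R' ≤ 4 * G.A + 2 * n) h4
    push_cast at hτ
    linarith

/-- Store the residual capacities of the current arcs. -/
def storeRes : Prog := .forLoop 24 (.var 0) (block [.nset 10 (.add (.var 24) (.lit 1)), splay,
  .rstore 3 (.arr 6 (.var 10)) (.add (.arr 4 (.var 10)) (.arr 5 (.var 10)))])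

/-- The residual capacities of current arcs exist only implicitly in the forest. After a splay of a
vertex, its value is the base plus its own offset, so one splay per vertex recovers them all. -/
theorem BF.storeRes (N : Network n m) {G : Arcs n} {c : ℕ → ℝ} {M : Mem} {r : ℕ → ℝ}
    {F : Multiset Tr} {wt : ℕ → ℕ} {R : Finset ℕ} (h : BF G c M r F wt R) (hn : M.nv 0 = n) :
    ∃ M' τ, Exec N ConcaveFlow.storeRes M M' τ ∧ (∀ a, M'.ra 3 a = r a) ∧
      (τ : ℝ) ≤ (n + 1) * (20000 * (6 * Real.logb 2 n + 4)) + 20000 * potF wt F := by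
  have hlg : 0 ≤ Real.logb 2 n := by
    refine Real.logb_nonneg (by norm_num) ?_
    have := Finset.mem_Icc.1 G.s_mem
    exact_mod_cast this.1.trans this.2
  obtain ⟨cur, hcur⟩ : ∃ cur, cur = M.na 6 := ⟨_, rfl⟩
  obtain ⟨F', M', τ, hex, ⟨hwt', hF', hcur', h0', hres', hdone⟩, hτ⟩ := exec_forLoop_pot (N := N) 24 (.var 0)
    (block [.nset 10 (.add (.var 24) (.lit 1)), ConcaveFlow.splay,
      .rstore 3 (.arr 6 (.var 10)) (.add (.arr 4 (.var 10)) (.arr 5 (.var 10)))])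
    (fun j (F : {F : Multiset Tr // 0 ≤ potF wt F}) M =>
      (∀ x, 1 ≤ wt x) ∧ Forest n M F.1 wt (fun x => r (cur x)) (fun x => G.hd (cur x)) R ∧
      M.na 6 = cur ∧ M.nv 0 = n ∧
      (∀ a, (a ∈ Finset.Icc 1 G.A → a ≠ cur (G.tl a)) → M.ra 3 a = r a) ∧
      ∀ x ∈ Finset.Icc 1 j, M.ra 3 (cur x) = r (cur x))
    (fun F => 20000 * potF wt F.1) (fun F => mul_nonneg (by norm_num) F.2) n
    (20000 * (6 * Real.logb 2 n + 3) + 50) (by linarith) rfl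
    (fun j F M hI => hI.2.2.2.1)
    (by
      rintro j ⟨F, hFn⟩ M hj ⟨hwt, hF, hcur, h0, hres, hdone⟩ hi
      simp only at hF
      have hx : j + 1 ∈ Finset.Icc 1 n := Finset.mem_Icc.2 ⟨by omega, hj⟩
      have hM₁ : Forest n (M.setN 10 (j + 1)) F wt (fun x => r (cur x)) (fun x => G.hd (cur x)) R :=
        hF.setN _ _
      obtain ⟨t, F₀, M₁, τ, l', r', rfl, hxt, hex, hF₁, hin, h12, h10, hA, hτ⟩ := hM₁.splay N
        (x := j + 1) (by simp) hx
      have hval : M₁.ra 4 (j + 1) + M₁.ra 5 (j + 1) = r (cur (j + 1)) := by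
        have := ((hF₁.rep (.node l' (j + 1) r') (by simp)).loc (by simp)).val
        simp only [Tr.rt_node] at this
        linarith
      have h6 : M₁.na 6 = cur := (hex.na rfl).trans hcur
      have h3 : M₁.ra 3 = M.ra 3 := hex.ra rfl
      have e1 : Exec N (.nset 10 (.add (.var 24) (.lit 1))) M (M.setN 10 (j + 1)) 4 := by
        simpa [Mem.setN, NExp.eval, NExp.size, hi] using
          Exec.nset (N := N) M 10 (.add (.var 24) (.lit 1))
      have e2 : Exec N (.rstore 3 (.arr 6 (.var 10)) (.add (.arr 4 (.var 10)) (.arr 5 (.var 10)))) M₁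
          (M₁.setRA 3 (cur (j + 1)) (r (cur (j + 1)))) 8 := by
        simpa [Mem.setRA, NExp.eval, RExp.eval, NExp.size, RExp.size, h10, h6, hval] using
          Exec.rstore (N := N) M₁ 3 (.arr 6 (.var 10)) (.add (.arr 4 (.var 10)) (.arr 5 (.var 10)))
      have hpn := potF_nonneg hwt (.node l' (j + 1) r' ::ₘ F₀)
      refine ⟨⟨_, hpn⟩, _, _, .seq _ _ _ _ _ _ _ e1 (.seq _ _ _ _ _ _ _ hex e2), ?_, hwt, ?_, h6,
        ?_, ?_, ?_⟩
      · have h1 : (0 : ℝ) ≤ τ := Nat.cast_nonneg _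
        push_cast
        linarith
      · refine Forest.setN (Forest.congr (M := M₁) hF₁ (fun y _ => ?_) ?_ (fun _ _ => rfl)
          fun _ _ _ => rfl) _ _
        · exact ⟨fun _ => rfl, rfl, rfl, rfl, by simp, by simp, by simp⟩
        · exact hF₁.zero
      · have : M₁.nv 0 = n := by rw [hex.nv rfl]; simp [h0]
        simp [this]
      · intro a ha
        simp only [Mem.setN_ra, Mem.setRA_ra, true_and, h3]
        split_ifs with haj
        · rw [haj]
        · exact hres a ha
      · intro x hx
        simp only [Mem.setN_ra, Mem.setRA_ra, true_and, h3]
        split_ifs with haj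
        · rw [haj]
        · refine hdone x (Finset.mem_Icc.2 ?_)
          have := Finset.mem_Icc.1 hx
          refine ⟨this.1, Nat.lt_succ_iff.1 (lt_of_le_of_ne this.2 ?_)⟩
          rintro rfl
          exact haj rfl)
    M ⟨F, potF_nonneg h.forest.one_le F⟩
    ⟨h.forest.one_le, by rw [hcur]; exact h.forest.setN _ _, hcur.symm, by simp [hn],
      by rw [hcur]; exact h.res, by simp⟩
  refine ⟨M', τ, hex, fun a => ?_, ?_⟩
  · by_cases ha : a ∈ Finset.Icc 1 G.A ∧ a = cur (G.tl a)
    · rw [ha.2]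
      exact hdone _ (G.tl_mem a ha.1)
    · exact hres' a fun h1 h2 => ha ⟨h1, h2⟩
  · refine hτ.trans ?_
    simp only [NExp.size]
    push_cast
    have : (0 : ℝ) ≤ n := Nat.cast_nonneg _
    nlinarith

/-! ### The blocking flow procedure -/

theorem exec_forLoop_straight {N : Network n m} (i : ℕ) (bd : NExp) (P : Prog) (I : ℕ → Mem → Prop)
    (b k : ℕ) (hP : P.straight = true ∧ P.cost ≤ k) (hi : P.writesN i = false)
    (hbd : ∀ j M, I j M → bd.eval M = b)
    (hstep : ∀ j M, j < b → I j M → M.nv i = j → I (j + 1) ((P.sem N M).setN i (j + 1)))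
    (M : Mem) (h0 : I 0 (M.setN i 0)) :
    ∃ M' τ, Exec N (.forLoop i bd P) M M' τ ∧ I b M' ∧ (τ : ℝ) ≤ (b + 1) * (k + bd.size + 7) := by
  refine exec_forLoop i bd P I b k (Nat.cast_nonneg _) hi hbd (fun j M hj hI hM => ?_) M h0
  obtain ⟨τ, hex, hτ⟩ := Prog.exec_le N hP M
  exact ⟨_, τ, hex, hτ, hstep j M hj hI hM⟩

/-- The arcs are stored in memory. -/
structure Stored (G : Arcs n) (M : Mem) : Prop where
  n : M.nv 0 = n
  s : M.nv 4 = G.s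
  t : M.nv 5 = G.t
  A : M.nv 6 = G.A
  tl : M.na 2 = G.tl
  hd : M.na 3 = G.hd
  nx : M.na 4 = G.nx
  fi : M.na 5 = G.fi

theorem Stored.exec {N : Network n m} {G : Arcs n} {P : Prog} {M M' : Mem} {τ : ℕ} (h : Stored G M)
    (hex : Exec N P M M' τ) (hP : (P.writesN 0 || P.writesN 4 || P.writesN 5 || P.writesN 6 ||
      P.writesNA 2 || P.writesNA 3 || P.writesNA 4 || P.writesNA 5) = false) : Stored G M' := by
  simp only [Bool.or_eq_false_iff] at hP
  obtain ⟨⟨⟨⟨⟨⟨⟨h1, h2⟩, h3⟩, h4⟩, h5⟩, h6⟩, h7⟩, h8⟩ := hP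
  exact ⟨(hex.nv h1).trans h.n, (hex.nv h2).trans h.s, (hex.nv h3).trans h.t, (hex.nv h4).trans h.A,
    (hex.na h5).trans h.tl, (hex.na h6).trans h.hd, (hex.na h7).trans h.nx, (hex.na h8).trans h.fi⟩

/-- The residual capacities are the capacities. -/
def resetArcs : Prog := .forLoop 24 (.var 6) (block
  [.nset 25 (.add (.var 24) (.lit 1)), .rstore 3 (.var 25) (.arr 2 (.var 25))])

/-- The forest consists of single vertices. -/
def resetVerts : Prog := .forLoop 24 (.var 0) (block
  [.nset 25 (.add (.var 24) (.lit 1)), .nstore 10 (.var 25) (.lit 0), .nstore 11 (.var 25) (.lit 0),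
   .nstore 12 (.var 25) (.lit 0), .nstore 13 (.var 25) (.var 25), .nstore 14 (.var 25) (.var 25),
   .nstore 6 (.var 25) (.arr 5 (.var 25)), .rstore 4 (.var 25) (.arr 3 (.arr 5 (.var 25))),
   .rstore 5 (.var 25) (.lit 0), .rstore 6 (.var 25) (.arr 3 (.arr 5 (.var 25)))])

/-- Compute the residual capacities of a blocking flow. -/
def blockFlow : Prog := block [.nstore 10 (.lit 0) (.lit 0), .nstore 11 (.lit 0) (.lit 0), resetArcs,
  resetVerts, blockLoop, storeRes]

theorem resetArcs_spec (N : Network n m) {G : Arcs n} {M : Mem} (h : Stored G M) :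
    ∃ M' τ, Exec N resetArcs M M' τ ∧ (∀ a ∈ Finset.Icc 1 G.A, M'.ra 3 a = M.ra 2 a) ∧
      (τ : ℝ) ≤ (G.A + 1) * 50 := by
  obtain ⟨M', τ, hex, ⟨-, -, hI⟩, hτ⟩ := exec_forLoop_straight (N := N) 24 (.var 6)
    (fun j M' => M'.nv 6 = G.A ∧ M'.ra 2 = M.ra 2 ∧ ∀ a ∈ Finset.Icc 1 j, M'.ra 3 a = M.ra 2 a)
    G.A 40 (P := block
      [.nset 25 (.add (.var 24) (.lit 1)), .rstore 3 (.var 25) (.arr 2 (.var 25))]) (by decide) rfl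
    (fun j M' hI => hI.1)
    (by
      rintro j M₁ hj ⟨h1, h2, h3⟩ hi
      refine ⟨by simp [block, Prog.sem, h1], by ext a; simp [block, Prog.sem, h2], ?_⟩
      intro a ha
      simp only [block, Prog.sem, NExp.eval, RExp.eval]
      simp only [Mem.setN_ra, Mem.setRA_ra, true_and, Mem.setN_nv, hi, if_true, h2]
      split_ifs with h4
      · rw [h4]
      · refine h3 a (Finset.mem_Icc.2 ?_)
        have := Finset.mem_Icc.1 ha
        omega) M ⟨by simp [h.A], rfl, by simp⟩
  refine ⟨M', τ, hex, hI, hτ.trans ?_⟩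
  simp only [NExp.size]
  push_cast
  have : (0 : ℝ) ≤ G.A := Nat.cast_nonneg _
  nlinarith

theorem resetVerts_spec (N : Network n m) {G : Arcs n} {M : Mem} (h : Stored G M) :
    ∃ M' τ, Exec N resetVerts M M' τ ∧ (∀ x ∈ Finset.Icc 1 n, M'.na 10 x = 0 ∧ M'.na 11 x = 0 ∧
      M'.na 12 x = 0 ∧ M'.na 13 x = x ∧ M'.na 14 x = x ∧ M'.ra 4 x = M.ra 3 (G.fi x) ∧
      M'.ra 5 x = 0 ∧ M'.ra 6 x = M.ra 3 (G.fi x) ∧ M'.na 6 x = G.fi x) ∧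
      (∀ a, M'.na a 0 = M.na a 0) ∧ (τ : ℝ) ≤ (n + 1) * 200 := by
  obtain ⟨M', τ, hex, ⟨-, -, -, hI, hI0⟩, hτ⟩ := exec_forLoop_straight (N := N) 24 (.var 0)
    (fun j M' => M'.nv 0 = n ∧ M'.ra 3 = M.ra 3 ∧ M'.na 5 = G.fi ∧
      (∀ x ∈ Finset.Icc 1 j, M'.na 10 x = 0 ∧ M'.na 11 x = 0 ∧
      M'.na 12 x = 0 ∧ M'.na 13 x = x ∧ M'.na 14 x = x ∧ M'.ra 4 x = M.ra 3 (G.fi x) ∧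
      M'.ra 5 x = 0 ∧ M'.ra 6 x = M.ra 3 (G.fi x) ∧ M'.na 6 x = G.fi x) ∧
      ∀ a, M'.na a 0 = M.na a 0)
    n 150 (P := block
      [.nset 25 (.add (.var 24) (.lit 1)), .nstore 10 (.var 25) (.lit 0), .nstore 11 (.var 25) (.lit 0),
   .nstore 12 (.var 25) (.lit 0), .nstore 13 (.var 25) (.var 25), .nstore 14 (.var 25) (.var 25),
   .nstore 6 (.var 25) (.arr 5 (.var 25)), .rstore 4 (.var 25) (.arr 3 (.arr 5 (.var 25))),
   .rstore 5 (.var 25) (.lit 0), .rstore 6 (.var 25) (.arr 3 (.arr 5 (.var 25)))]) (by decide) rfl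
    (fun j M' hI => hI.1)
    (by
      rintro j M₁ hj ⟨h1, h2, h3, h4, h5⟩ hi
      refine ⟨by simp [block, Prog.sem, h1], by ext a; simp [block, Prog.sem, h2],
        by ext a; simp [block, Prog.sem, h3], ?_, ?_⟩
      · intro x hx
        by_cases hxj : x = j + 1
        · subst hxj
          simp [block, Prog.sem, NExp.eval, RExp.eval, hi, h2, h3]
        · have := h4 x (Finset.mem_Icc.2 (by have := Finset.mem_Icc.1 hx; omega))
          simpa [block, Prog.sem, NExp.eval, RExp.eval, hi, h2, h3, hxj] using this
      · intro a
        simp [block, Prog.sem, NExp.eval, RExp.eval, hi, h5]) M ⟨by simp [h.n], rfl, by simp [h.fi], by simp, by simp⟩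
  refine ⟨M', τ, hex, hI, hI0, hτ.trans ?_⟩
  simp only [NExp.size]
  push_cast
  have : (0 : ℝ) ≤ n := Nat.cast_nonneg _
  nlinarith

/-- Once the source has no current arc, every arc leaving a dead vertex has been passed, so it is
saturated or its head is dead. Dead vertices are thus closed under unsaturated arcs, and the sink is
never dead because it keeps the return arc. -/
theorem blockFlow_spec (N : Network n m) {G : Arcs n} {M : Mem} (h : Stored G M)
    (hc0 : ∀ a ∈ Finset.Icc 1 G.A, 0 ≤ M.ra 2 a)
    (hc : ∑ a ∈ Finset.Ico 1 G.A, M.ra 2 a < M.ra 2 G.A) :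
    ∃ M' τ, Exec N blockFlow M M' τ ∧ (∀ a ∈ Finset.Icc 1 G.A, 0 ≤ M'.ra 3 a) ∧
      (∀ a ∈ Finset.Icc 1 G.A, M'.ra 3 a ≤ M.ra 2 a) ∧
      (∀ x ∈ Finset.Icc 1 n, ∑ a ∈ Finset.Icc 1 G.A with G.tl a = x, (M.ra 2 a - M'.ra 3 a) =
        ∑ a ∈ Finset.Icc 1 G.A with G.hd a = x, (M.ra 2 a - M'.ra 3 a)) ∧
      ¬ Relation.ReflTransGen (fun u v => ∃ a ∈ Finset.Icc 1 G.A, G.tl a = u ∧ G.hd a = v ∧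
        0 < M'.ra 3 a) G.s G.t ∧
      (τ : ℝ) ≤ 3000000 * ((Real.logb 2 n + 1) * (G.A + n)) := by
  have hlg : 0 ≤ Real.logb 2 n := by
    refine Real.logb_nonneg (by norm_num) ?_
    have := Finset.mem_Icc.1 G.s_mem
    exact_mod_cast this.1.trans this.2
  have e1 : Exec N (.nstore 10 (.lit 0) (.lit 0)) M (M.setNA 10 0 0) 3 := by
    simpa [Mem.setNA, NExp.eval, NExp.size] using Exec.nstore (N := N) M 10 (.lit 0) (.lit 0)
  have e2 : Exec N (.nstore 11 (.lit 0) (.lit 0)) (M.setNA 10 0 0) ((M.setNA 10 0 0).setNA 11 0 0) 3 := by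
    simpa [Mem.setNA, NExp.eval, NExp.size] using
      Exec.nstore (N := N) (M.setNA 10 0 0) 11 (.lit 0) (.lit 0)
  have hS₀ := (h.exec e1 rfl).exec e2 rfl
  obtain ⟨M₁, τ₁, hex₁, h₁, hτ₁⟩ := resetArcs_spec N hS₀
  have hS₁ := hS₀.exec hex₁ rfl
  obtain ⟨M₂, τ₂, hex₂, h₂, h₂0, hτ₂⟩ := resetVerts_spec N hS₁
  have hS₂ := hS₁.exec hex₂ rfl
  have h3 : M₂.ra 3 = M₁.ra 3 := hex₂.ra rfl
  have h10 : ∀ e, M₁.na (chA e) 0 = 0 := fun e => by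
    have e1 : M₁.na 10 = _ := hex₁.na rfl
    have e2 : M₁.na 11 = _ := hex₁.na rfl
    cases e
    · show M₁.na 10 0 = 0
      rw [e1]; simp
    · show M₁.na 11 0 = 0
      rw [e2]; simp
  obtain ⟨F, wt, hF, hpot⟩ := Forest.init (n := n) (M := M₂) (v := fun x => M₂.ra 3 (M₂.na 6 x))
    (fun x => G.hd (M₂.na 6 x)) (fun x hx => by
      obtain ⟨a1, a2, a3, a4, a5, a6, a7, a8, a9⟩ := h₂ x hx
      rw [h3, a9]
      exact ⟨a1, a2, a3, a4, a5, a6, a7, a8⟩)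
    (by rw [h₂0]; exact h10 false) (by rw [h₂0]; exact h10 true)
  have hr : ∀ a ∈ Finset.Icc 1 G.A, M₂.ra 3 a = M.ra 2 a := fun a ha => by
    rw [h3, h₁ a ha]; simp
  have hcur : ∀ x ∈ Finset.Icc 1 n, M₂.na 6 x = G.fi x := fun x hx => (h₂ x hx).2.2.2.2.2.2.2.2
  have hA : G.A ∈ Finset.Icc 1 G.A := Finset.mem_Icc.2 ⟨G.A_pos, le_rfl⟩
  have hB : BF G (M.ra 2) M₂ (M₂.ra 3) F wt (Finset.Icc 1 n) := by
    refine ⟨hS₂.hd, hS₂.nx, hS₂.s, hF, fun x hx => ?_, fun _ _ => rfl, fun a ha hlt => ?_,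
      fun a ha => by rw [hr a ha]; exact hc0 a ha, fun a ha => (hr a ha).le, fun x _ => ?_,
      fun x hx hx' => absurd hx hx', ?_, subset_rfl⟩
    · rw [hcur x hx]; exact G.fi_mem x hx
    · rw [hcur _ (G.tl_mem a ha)] at hlt
      exact absurd (G.le_fi a ha) (not_le.2 hlt)
    · rw [Finset.sum_eq_zero, Finset.sum_eq_zero]
      · intro a ha; rw [hr a (Finset.mem_filter.1 ha).1, sub_self]
      · intro a ha; rw [hr a (Finset.mem_filter.1 ha).1, sub_self]
    · rw [hcur _ G.t_mem]
      have h4 := G.le_fi _ hA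
      rw [G.tl_A] at h4
      have := G.A_pos
      rcases G.fi_mem _ G.t_mem with h5 | h5
      · omega
      · exact le_antisymm (Finset.mem_Icc.1 h5.1).2 h4
  obtain ⟨M₃, τ₃, r', F', wt', R', hex₃, hB₃, hs₃, hτ₃⟩ := hB.blockLoop N hc
  obtain ⟨M₄, τ₄, hex₄, hr₄, hτ₄⟩ := hB₃.storeRes N ((hS₂.exec hex₃ rfl).n)
  refine ⟨M₄, _, .seq _ _ _ _ _ _ _ e1 (.seq _ _ _ _ _ _ _ e2 (.seq _ _ _ _ _ _ _ hex₁
    (.seq _ _ _ _ _ _ _ hex₂ (.seq _ _ _ _ _ _ _ hex₃ hex₄)))), ?_, ?_, ?_, ?_, ?_⟩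
  · intro a ha; rw [hr₄]; exact hB₃.nonneg a ha
  · intro a ha; rw [hr₄]; exact hB₃.le_cap a ha
  · simp only [hr₄]; exact hB₃.conserve
  · intro hreach
    -- Every vertex reachable from the source along unsaturated arcs is dead.
    have key : ∀ y, Relation.ReflTransGen (fun u v => ∃ a ∈ Finset.Icc 1 G.A, G.tl a = u ∧
        G.hd a = v ∧ 0 < M₄.ra 3 a) G.s y → M₃.na 6 y = 0 := by
      intro y hy
      induction hy with
      | refl => exact hs₃
      | tail _ hstep ih =>
        obtain ⟨a, ha, rfl, rfl, hpos⟩ := hstep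
        refine (hB₃.passed a ha ?_).resolve_left ?_
        · rw [ih]; exact (Finset.mem_Icc.1 ha).1
        · rw [← hr₄]; exact hpos.ne'
    have := key _ hreach
    rw [hB₃.top] at this
    have := G.A_pos
    omega
  · have hn : (1 : ℝ) ≤ n := by
      have := Finset.mem_Icc.1 G.s_mem
      exact_mod_cast this.1.trans this.2
    have hA1 : (1 : ℝ) ≤ G.A := by exact_mod_cast G.A_pos
    rw [hpot] at hτ₃
    have h1 : (0 : ℝ) ≤ Real.logb 2 n * G.A := mul_nonneg hlg (by linarith)
    have h2 : (0 : ℝ) ≤ Real.logb 2 n * n := mul_nonneg hlg (by linarith)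
    have h5 : Real.logb 2 n ≤ Real.logb 2 n * n := le_mul_of_one_le_right hlg hn
    push_cast
    ring_nf at hτ₁ hτ₂ hτ₃ hτ₄ ⊢
    linarith

/-! ### Weight functions and eligible capacities -/

namespace Network

variable {N : Network n m} {wmin wmax : ℝ}

theorem IsConcave.hasDerivWithinAt (h : N.IsConcave wmin wmax) (e : Fin m) {y : ℝ}
    (hy : y ∈ Set.Icc 0 (N.cap e)) :
    HasDerivWithinAt (N.f e) (N.w e y) (Set.Icc 0 (N.cap e)) y :=
  (h.differentiable e y hy).hasDerivWithinAt

theorem IsConcave.antitone (h : N.IsConcave wmin wmax) (e : Fin m) :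
    AntitoneOn (N.w e) (Set.Icc 0 (N.cap e)) :=
  (h.concave e).antitoneOn_derivWithin (h.differentiable e)

/-- The tangent at `x` lies above the graph of a concave function; both orders of `x` and `y` are
covered by one-sided slopes, also at the ends of the interval. -/
theorem IsConcave.sub_le (h : N.IsConcave wmin wmax) (e : Fin m) {x y : ℝ}
    (hx : x ∈ Set.Icc 0 (N.cap e)) (hy : y ∈ Set.Icc 0 (N.cap e)) :
    N.f e y - N.f e x ≤ N.w e x * (y - x) := by
  rcases lt_trichotomy x y with hxy | rfl | hxy
  · have := (h.concave e).slope_le_derivWithin hx hy hxy (h.differentiable e x hx)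
    rw [slope_def_field, div_le_iff₀ (by linarith)] at this
    exact this
  · simp
  · have := (h.concave e).derivWithin_le_slope hy hx hxy (h.differentiable e x hx)
    rw [slope_def_field, le_div_iff₀ (by linarith)] at this
    have e1 : N.w e x = derivWithin (N.f e) (Set.Icc 0 (N.cap e)) x := rfl
    rw [← e1] at this
    linarith

/-- Darboux: a derivative takes all intermediate values, so it cannot jump at `x` from above `b` to
at most `b`. This replaces continuity of the derivative. -/
theorem IsConcave.w_le_of_right (h : N.IsConcave wmin wmax) (e : Fin m) {x z b : ℝ}
    (hx : 0 ≤ x) (hxz : x < z) (hz : z ≤ N.cap e)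
    (hb : ∀ y, x < y → y ≤ z → N.w e y ≤ b) : N.w e x ≤ b := by
  by_contra! hlt
  obtain ⟨c, hc1, hc2⟩ := exists_between hlt
  obtain ⟨ξ, hξ, hξc⟩ := exists_hasDerivWithinAt_eq_of_lt_of_gt (f := N.f e) (f' := N.w e) hxz.le
    (fun y hy => (h.hasDerivWithinAt e ⟨hx.trans hy.1, hy.2.trans hz⟩).mono
      (Set.Icc_subset_Icc hx hz)) hc2 ((hb z hxz le_rfl).trans_lt hc1)
  have := hb ξ hξ.1 hξ.2.le
  linarith

theorem IsConcave.le_w_of_left (h : N.IsConcave wmin wmax) (e : Fin m) {x z b : ℝ}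
    (hz : 0 ≤ z) (hzx : z < x) (hx : x ≤ N.cap e)
    (hb : ∀ y, z ≤ y → y < x → b ≤ N.w e y) : b ≤ N.w e x := by
  by_contra! hlt
  obtain ⟨c, hc1, hc2⟩ := exists_between hlt
  obtain ⟨ξ, hξ, hξc⟩ := exists_hasDerivWithinAt_eq_of_lt_of_gt (f := N.f e) (f' := N.w e) hzx.le
    (fun y hy => (h.hasDerivWithinAt e ⟨hz.trans hy.1, hy.2.trans hx⟩).mono
      (Set.Icc_subset_Icc hz hx)) (hc2.trans_le (hb z le_rfl hzx)) hc1
  have := hb ξ hξ.1.le hξ.2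
  linarith

/-- A positive supremum is attained: below it the derivative is at least `θ` because it is antitone,
and at it by `le_w_of_left`. -/
theorem IsConcave.up_spec (h : N.IsConcave wmin wmax) (e : Fin m) {y : ℝ} (θ : ℝ)
    (hy : y ∈ Set.Icc 0 (N.cap e)) : 0 ≤ N.up e y θ ∧ y + N.up e y θ ≤ N.cap e ∧
      (0 < N.up e y θ → θ ≤ N.w e (y + N.up e y θ)) ∧
      ∀ Δ, 0 ≤ Δ → y + Δ ≤ N.cap e → θ ≤ N.w e (y + Δ) → Δ ≤ N.up e y θ := by
  set A := {Δ | 0 ≤ Δ ∧ y + Δ ≤ N.cap e ∧ θ ≤ N.w e (y + Δ)} with hA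
  have hup : N.up e y θ = sSup A := rfl
  have hbdd : BddAbove A := ⟨N.cap e - y, fun Δ hΔ => by linarith [hΔ.2.1]⟩
  have h0 : 0 ≤ sSup A := Real.sSup_nonneg fun Δ hΔ => hΔ.1
  have h1 : y + sSup A ≤ N.cap e := by
    have : sSup A ≤ N.cap e - y :=
      Real.sSup_le (fun Δ hΔ => by linarith [hΔ.2.1]) (by linarith [hy.2])
    linarith
  rw [hup]
  refine ⟨h0, h1, fun hpos => ?_, fun Δ a b c => le_csSup hbdd ⟨a, b, c⟩⟩
  refine h.le_w_of_left e hy.1 (by linarith : y < y + sSup A) h1 fun ξ hξ hξ' => ?_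
  -- The supremum of the empty set is 0 by convention, which is excluded by `hpos`.
  have hne : A.Nonempty := by
    by_contra hn
    rw [Set.not_nonempty_iff_eq_empty.1 hn, Real.sSup_empty] at hpos
    exact lt_irrefl _ hpos
  obtain ⟨Δ, hΔ, hlt⟩ := exists_lt_of_lt_csSup hne (by linarith : ξ - y < sSup A)
  exact hΔ.2.2.trans (h.antitone e ⟨by linarith [hy.1], by linarith [hΔ.2.1]⟩
    ⟨by linarith [hy.1, hΔ.1], hΔ.2.1⟩ (by linarith))

theorem IsConcave.down_spec (h : N.IsConcave wmin wmax) (e : Fin m) {y : ℝ} (θ : ℝ)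
    (hy : y ∈ Set.Icc 0 (N.cap e)) : 0 ≤ N.down e y θ ∧ N.down e y θ ≤ y ∧
      (0 < N.down e y θ → N.w e (y - N.down e y θ) ≤ θ) ∧
      ∀ Δ, 0 ≤ Δ → Δ ≤ y → N.w e (y - Δ) ≤ θ → Δ ≤ N.down e y θ := by
  set A := {Δ | 0 ≤ Δ ∧ Δ ≤ y ∧ N.w e (y - Δ) ≤ θ} with hA
  have hup : N.down e y θ = sSup A := rfl
  have hbdd : BddAbove A := ⟨y, fun Δ hΔ => hΔ.2.1⟩
  have h0 : 0 ≤ sSup A := Real.sSup_nonneg fun Δ hΔ => hΔ.1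
  have h1 : sSup A ≤ y := Real.sSup_le (fun Δ hΔ => hΔ.2.1) hy.1
  rw [hup]
  refine ⟨h0, h1, fun hpos => ?_, fun Δ a b c => le_csSup hbdd ⟨a, b, c⟩⟩
  refine h.w_le_of_right e (by linarith) (by linarith : y - sSup A < y) hy.2 fun ξ hξ hξ' => ?_
  have hne : A.Nonempty := by
    by_contra hn
    rw [Set.not_nonempty_iff_eq_empty.1 hn, Real.sSup_empty] at hpos
    exact lt_irrefl _ hpos
  obtain ⟨Δ, hΔ, hlt⟩ := exists_lt_of_lt_csSup hne (by linarith : y - ξ < sSup A)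
  exact (h.antitone e ⟨by linarith [hΔ.2.1], by linarith [hΔ.1, hy.2]⟩
    ⟨by linarith, by linarith [hy.2]⟩ (by linarith)).trans hΔ.2.2

/-! ### Levels -/

theorem IsConcave.walk_le (h : N.IsConcave wmin wmax) {u v : Fin n} {k : ℕ} (hw : N.Walk u v k) :
    k ≤ n := by
  classical
  -- Along a walk the set of vertices with a walk to the current endpoint grows strictly: the new
  -- endpoint cannot have reached the old one, or there would be a closed walk.
  have key : ∀ {v : Fin n} {k : ℕ}, N.Walk u v k →
      k ≤ (Finset.univ.filter fun x => ∃ j, N.Walk x v j).card := by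
    intro v k hw
    induction hw with
    | nil => exact Nat.zero_le _
    | snoc e k _ ih =>
      refine Nat.succ_le_of_lt (ih.trans_lt (Finset.card_lt_card ⟨fun x hx => ?_, fun hsub => ?_⟩))
      · obtain ⟨j, hj⟩ := (Finset.mem_filter.1 hx).2
        exact Finset.mem_filter.2 ⟨Finset.mem_univ _, j + 1, .snoc e j hj⟩
      · obtain ⟨j, hj⟩ := (Finset.mem_filter.1
          (hsub (Finset.mem_filter.2 ⟨Finset.mem_univ (N.dst e), 0, .nil⟩))).2
        exact absurd (h.acyclic _ _ (.snoc e j hj)) (by omega)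
  exact (key hw).trans ((Finset.card_le_univ _).trans (by simp))

theorem IsConcave.bddAbove (h : N.IsConcave wmin wmax) (u : Fin n) :
    BddAbove {k | N.Walk N.s u k} := ⟨n, fun _ hk => h.walk_le hk⟩

theorem IsConcave.level_walk (h : N.IsConcave wmin wmax) (u : Fin n) :
    N.Walk N.s u (N.level u) := Nat.sSup_mem (h.reachable u) (h.bddAbove u)

theorem IsConcave.le_level (h : N.IsConcave wmin wmax) {u : Fin n} {k : ℕ} (hk : N.Walk N.s u k) :
    k ≤ N.level u := le_csSup (h.bddAbove u) hk

theorem IsConcave.level_s (h : N.IsConcave wmin wmax) : N.level N.s = 0 :=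
  h.acyclic _ _ (h.level_walk N.s)

theorem IsConcave.level_lt (h : N.IsConcave wmin wmax) (e : Fin m) :
    N.level (N.src e) + 1 ≤ N.level (N.dst e) := h.le_level (.snoc e _ (h.level_walk _))

/-- The last edge of a longest walk does it, for the walk without that edge is again a longest one.
-/
theorem IsConcave.exists_level (h : N.IsConcave wmin wmax) {v : Fin n} (hv : v ≠ N.s) :
    ∃ e, N.dst e = v ∧ N.level v = N.level (N.src e) + 1 := by
  have hw := h.level_walk v
  generalize hk : N.level v = k at hw
  cases hw with
  | nil => exact absurd rfl hv
  | snoc e k hw =>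
    refine ⟨e, rfl, ?_⟩
    have h1 := h.le_level hw
    have h2 := h.level_lt e
    omega

theorem IsConcave.dst_ne_s (h : N.IsConcave wmin wmax) (e : Fin m) : N.dst e ≠ N.s := by
  intro he
  have := h.level_lt e
  rw [he, h.level_s] at this
  omega

/-! ### Sums of potential differences -/

/-- Summation by parts: away from `s` and `t` the potential is multiplied by zero net inflow. It
serves for the eligible graph, for the network itself, and with the levels as potential. -/
theorem sum_potential {ι : Type*} [Fintype ι] (hd tl : ι → Fin n) (z : ι → ℝ) {s t : Fin n}
    (hst : s ≠ t) (hcons : ∀ v, v ≠ s → v ≠ t → ∑ a with hd a = v, z a = ∑ a with tl a = v, z a)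
    (q : Fin n → ℝ) : ∑ a, (q (hd a) - q (tl a)) * z a =
      (q t - q s) * (∑ a with tl a = s, z a - ∑ a with hd a = s, z a) := by
  have e1 : ∀ (g : ι → Fin n) (q : Fin n → ℝ), ∑ a, q (g a) * z a = ∑ v, q v * ∑ a with g a = v, z a := by
    intro g q
    rw [← Finset.sum_fiberwise (s := Finset.univ) g]
    refine Finset.sum_congr rfl fun v _ => ?_
    rw [Finset.mul_sum]
    refine Finset.sum_congr rfl fun a ha => ?_
    rw [(Finset.mem_filter.1 ha).2]
  have e2 : ∀ q : Fin n → ℝ, ∑ a, (q (hd a) - q (tl a)) * z a =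
      q s * (∑ a with hd a = s, z a - ∑ a with tl a = s, z a) +
      q t * (∑ a with hd a = t, z a - ∑ a with tl a = t, z a) := by
    intro q
    simp only [sub_mul, Finset.sum_sub_distrib]
    rw [e1, e1, ← Finset.sum_sub_distrib, Fintype.sum_eq_add s t hst]
    · ring
    · intro v hv
      rw [hcons v hv.1 hv.2, sub_self]
  -- A constant potential shows that the net inflows at `s` and `t` are opposite.
  have e3 := e2 fun _ => 1
  simp only [sub_self, zero_mul, Finset.sum_const_zero, one_mul] at e3
  rw [e2 q]
  linear_combination (-q t) * e3

theorem sum_arc (F : Arc m → ℝ) : ∑ a, F a = ∑ e, (F (e, true) + F (e, false)) := by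
  rw [Fintype.sum_prod_type]
  refine Finset.sum_congr rfl fun e _ => ?_
  rw [Fintype.sum_bool]

end Network

/-! ### One round -/

namespace Network

variable {N : Network n m} {wmin wmax : ℝ}

/-- The reduced derivative at the flow value `y`. -/
def red (N : Network n m) (p : Fin n → ℝ) (e : Fin m) (y : ℝ) : ℝ :=
  p (N.src e) - p (N.dst e) + N.w e y

/-- The invariant of the algorithm for the step size `δ`. -/
structure Inv (N : Network n m) (δ : ℝ) (S : FlowPot n m) : Prop where
  flow : N.IsFlow S.x
  ps : S.p N.s = 0
  red_le : ∀ e, S.x e < N.cap e → N.red S.p e (S.x e) ≤ 2 * δ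

theorem Inv.mem {δ : ℝ} {S : FlowPot n m} (h : N.Inv δ S) (e : Fin m) :
    S.x e ∈ Set.Icc 0 (N.cap e) := ⟨h.flow.nonneg e, h.flow.le_cap e⟩

/-- The effect of a flow in the eligible graph on an edge. -/
theorem IsConcave.push_edge (h : N.IsConcave wmin wmax) {δ : ℝ} (hδ : 0 < δ) {S : FlowPot n m}
    (hS : N.Inv δ S) {z : Arc m → ℝ} (hz : N.IsBlocking (N.eligCap δ S) z) (e : Fin m) :
    (0 < z (e, true) ∧ z (e, false) = 0 ∧ S.x e + z (e, true) ≤ N.cap e ∧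
      δ ≤ N.red S.p e (S.x e + z (e, true))) ∨
    (z (e, true) = 0 ∧ 0 < z (e, false) ∧ z (e, false) ≤ S.x e ∧
      N.red S.p e (S.x e - z (e, false)) ≤ 0) ∨ (z (e, true) = 0 ∧ z (e, false) = 0) := by
  have hx := hS.mem e
  obtain ⟨u1, u2, u3, u4⟩ := h.up_spec e (δ - (S.p (N.src e) - S.p (N.dst e))) hx
  obtain ⟨d1, d2, d3, d4⟩ := h.down_spec e (-(S.p (N.src e) - S.p (N.dst e))) hx
  have ht : z (e, true) ≤ N.up e (S.x e) (δ - (S.p (N.src e) - S.p (N.dst e))) := hz.le_cap (e, true)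
  have hf : z (e, false) ≤ N.down e (S.x e) (-(S.p (N.src e) - S.p (N.dst e))) :=
    hz.le_cap (e, false)
  have ht0 := hz.nonneg (e, true)
  have hf0 := hz.nonneg (e, false)
  have at1 : 0 < z (e, true) → S.x e + z (e, true) ≤ N.cap e ∧
      δ ≤ N.red S.p e (S.x e + z (e, true)) ∧ δ ≤ N.red S.p e (S.x e) := by
    intro hp
    have h1 := u3 (hp.trans_le ht)
    have h2 := h.antitone e ⟨by linarith [hx.1], by linarith⟩ ⟨by linarith [hx.1], u2⟩
      (by linarith : S.x e + z (e, true) ≤ _)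
    have h3 := h.antitone e hx ⟨by linarith [hx.1], by linarith⟩
      (by linarith : S.x e ≤ S.x e + z (e, true))
    unfold red
    exact ⟨by linarith, by linarith, by linarith⟩
  have at2 : 0 < z (e, false) → N.red S.p e (S.x e - z (e, false)) ≤ 0 ∧ N.red S.p e (S.x e) ≤ 0 := by
    intro hp
    have h1 := d3 (hp.trans_le hf)
    have h2 := h.antitone e ⟨by linarith [hx.1], by linarith [hx.2]⟩
      ⟨by linarith [hx.1], by linarith [hx.2]⟩
      (by linarith : S.x e - N.down e (S.x e) (-(S.p (N.src e) - S.p (N.dst e))) ≤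
        S.x e - z (e, false))
    have h3 := h.antitone e ⟨by linarith [hx.1], by linarith [hx.2]⟩ hx
      (by linarith : S.x e - z (e, false) ≤ S.x e)
    unfold red
    exact ⟨by linarith, by linarith⟩
  rcases ht0.eq_or_lt with h1 | h1 <;> rcases hf0.eq_or_lt with h2 | h2
  · exact .inr (.inr ⟨h1.symm, h2.symm⟩)
  · exact .inr (.inl ⟨h1.symm, h2, by linarith, (at2 h2).1⟩)
  · exact .inl ⟨h1, h2.symm, (at1 h1).1, (at1 h1).2.1⟩
  -- Flow in both directions of an edge would force δ ≤ red ≤ 0 at the old flow value.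
  · have := (at1 h1).2.2
    have := (at2 h2).2
    linarith

/-- A forward push lowers the reduced derivative by concavity, and after a backward push it is still
at most 0. So the upper bound survives. -/
theorem IsConcave.inv_augment (h : N.IsConcave wmin wmax) {δ : ℝ} (hδ : 0 < δ) {S : FlowPot n m}
    (hS : N.Inv δ S) {z : Arc m → ℝ} (hz : N.IsBlocking (N.eligCap δ S) z) :
    N.Inv δ (augment S z) := by
  have hmem : ∀ e, 0 ≤ (augment S z).x e ∧ (augment S z).x e ≤ N.cap e := by
    intro e
    have hx := hS.mem e
    simp only [augment]
    rcases h.push_edge hδ hS hz e with ⟨h1, h2, h3, h4⟩ | ⟨h1, h2, h3, h4⟩ | ⟨h1, h2⟩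
    · rw [h2]; exact ⟨by linarith [hx.1], by linarith⟩
    · rw [h1]; exact ⟨by linarith, by linarith [hx.2]⟩
    · rw [h1, h2]; exact ⟨by linarith [hx.1], by linarith [hx.2]⟩
  refine ⟨⟨fun e => (hmem e).1, fun e => (hmem e).2, fun v hs ht => ?_⟩, hS.ps, fun e he => ?_⟩
  · have h1 := hS.flow.conserve v hs ht
    have h2 := hz.conserve v hs ht
    rw [Finset.sum_filter, Finset.sum_filter, sum_arc, sum_arc] at h2
    simp only [head, tail, if_true, Bool.false_eq_true, if_false, Finset.sum_add_distrib] at h2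
    simp only [← Finset.sum_filter] at h2
    simp only [augment, Finset.sum_add_distrib, Finset.sum_sub_distrib]
    linarith
  · have hx := hS.mem e
    have hp := h.push_edge hδ hS hz e
    have hm := hmem e
    have hr := hS.red_le e
    simp only [augment] at he hm ⊢
    rcases hp with ⟨h1, h2, h3, h4⟩ | ⟨h1, h2, h3, h4⟩ | ⟨h1, h2⟩
    · rw [h2, sub_zero] at he hm ⊢
      have h5 := h.antitone e hx hm (by linarith)
      have := hr (by linarith)
      unfold red at this ⊢
      linarith
    · rw [h1, add_zero] at he hm ⊢
      linarith
    · rw [h1, h2, add_zero, sub_zero] at he ⊢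
      exact hr he

/-- A forward push ends with a reduced derivative of at least δ, so the edge no longer needs any
slack; a backward push can only raise the reduced derivative. -/
theorem IsConcave.red_augment_ge (h : N.IsConcave wmin wmax) {δ : ℝ} (hδ : 0 < δ) {S : FlowPot n m}
    (hS : N.Inv δ S) {z : Arc m → ℝ} (hz : N.IsBlocking (N.eligCap δ S) z) {σ : Fin m → ℝ}
    (hσ : ∀ e, 0 < S.x e → -δ - σ e ≤ N.red S.p e (S.x e)) (e : Fin m)
    (he : 0 < (augment S z).x e) :
    -δ - (if 0 < z (e, true) then 0 else σ e) ≤ N.red S.p e ((augment S z).x e) := by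
  have hx := hS.mem e
  rcases h.push_edge hδ hS hz e with ⟨h1, h2, h3, h4⟩ | ⟨h1, h2, h3, h4⟩ | ⟨h1, h2⟩
  · have e2 : (augment S z).x e = S.x e + z (e, true) := by simp [augment, h2]
    rw [if_pos h1, e2]
    linarith
  · have e2 : (augment S z).x e = S.x e - z (e, false) := by simp [augment, h1]
    rw [e2] at he ⊢
    rw [if_neg h1.not_gt]
    have h5 := h.antitone e ⟨he.le, by linarith [hx.2]⟩ hx (by linarith : S.x e - z (e, false) ≤ S.x e)
    have := hσ e (by linarith)
    unfold red at this ⊢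
    linarith
  · have e2 : (augment S z).x e = S.x e := by simp [augment, h1, h2]
    rw [e2] at he ⊢
    rw [if_neg h1.not_gt]
    exact hσ e he

/-- The sink is not reachable after a blocking flow. -/
theorem IsConcave.not_eligible_t (h : N.IsConcave wmin wmax) {δ : ℝ} (hδ : 0 < δ)
    {S : FlowPot n m} (hS : N.Inv δ S) {z : Arc m → ℝ} (hz : N.IsBlocking (N.eligCap δ S) z) :
    ¬ N.Eligible δ (augment S z) N.t := by
  have hS' := h.inv_augment hδ hS hz
  intro hel
  -- An arc that is eligible after the augmentation was unsaturated before: a push creates no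
  -- eligible arc in the opposite direction, since δ > 0, and in the same direction the new capacity
  -- plus the flow sent is an admissible amount for the old capacity.
  refine hz.blocking (Relation.ReflTransGen.mono ?_ _ _ hel)
  rintro u v ⟨⟨e, b⟩, h1, h2, h3⟩
  refine ⟨(e, b), h1, h2, ?_⟩
  have hx := hS.mem e
  have hx' := hS'.mem e
  have hp := h.push_edge hδ hS hz e
  cases b
  · simp only [eligCap, Bool.false_eq_true, if_false] at h3 ⊢
    obtain ⟨d1, d2, d3, d4⟩ := h.down_spec e (-((augment S z).p (N.src e) - (augment S z).p (N.dst e))) hx'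
    set Δ := N.down e ((augment S z).x e) (-((augment S z).p (N.src e) - (augment S z).p (N.dst e)))
    have h5 := d3 h3
    have e1 : z (e, true) = 0 ∧ (augment S z).x e = S.x e - z (e, false) := by
      rcases hp with ⟨h1, h2, h3', h4⟩ | ⟨h1, h2, h3, h4⟩ | ⟨h1, h2⟩
      · exfalso
        have e2 : (augment S z).x e = S.x e + z (e, true) := by simp [augment, h2]
        rw [e2] at h5 hx' d2
        have h6 := h.antitone e (a := S.x e + z (e, true) - Δ) ⟨by linarith, by linarith⟩ hx'
          (by linarith)
        unfold red at h4
        have e3 : (augment S z).p = S.p := rfl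
        rw [e3] at h5
        linarith
      · exact ⟨h1, by simp [augment, h1]⟩
      · exact ⟨h1, by simp [augment, h1]⟩
    have hz0 := hz.nonneg (e, false)
    rw [e1.2] at h5 d2
    have := (h.down_spec e (-(S.p (N.src e) - S.p (N.dst e))) hx).2.2.2 (z (e, false) + Δ)
      (by linarith) (by linarith) (by rw [← sub_sub]; exact h5)
    linarith
  · simp only [eligCap, if_true] at h3 ⊢
    obtain ⟨d1, d2, d3, d4⟩ := h.up_spec e (δ - ((augment S z).p (N.src e) - (augment S z).p (N.dst e))) hx'
    set Δ := N.up e ((augment S z).x e) (δ - ((augment S z).p (N.src e) - (augment S z).p (N.dst e)))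
    have h5 := d3 h3
    have e1 : z (e, false) = 0 ∧ (augment S z).x e = S.x e + z (e, true) := by
      rcases hp with ⟨h1, h2, h3', h4⟩ | ⟨h1, h2, h3, h4⟩ | ⟨h1, h2⟩
      · exact ⟨h2, by simp [augment, h2]⟩
      · exfalso
        have e2 : (augment S z).x e = S.x e - z (e, false) := by simp [augment, h1]
        rw [e2] at h5 hx' d2
        have h6 := h.antitone e (b := S.x e - z (e, false) + Δ) hx' ⟨by linarith [hx'.1], by linarith⟩
          (by linarith)
        unfold red at h4
        have e3 : (augment S z).p = S.p := rfl
        rw [e3] at h5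
        linarith
      · exact ⟨h2, by simp [augment, h2]⟩
    have hz0 := hz.nonneg (e, true)
    rw [e1.2] at h5 d2
    have := (h.up_spec e (δ - (S.p (N.src e) - S.p (N.dst e))) hx).2.2.2 (z (e, true) + Δ)
      (by linarith) (by linarith) (by rw [← add_assoc]; exact h5)
    linarith

/-- If the forward arc is missing, the derivative is below the threshold at all larger flow values,
hence not above it at the present one by `w_le_of_right`. Backward arcs are symmetric. -/
theorem IsConcave.eligible_arc (h : N.IsConcave wmin wmax) {δ : ℝ} {S : FlowPot n m}
    (hS : N.Inv δ S) (e : Fin m) :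
    (N.Eligible δ S (N.src e) → ¬ N.Eligible δ S (N.dst e) → S.x e < N.cap e →
      N.red S.p e (S.x e) ≤ δ) ∧
    (N.Eligible δ S (N.dst e) → ¬ N.Eligible δ S (N.src e) → 0 < S.x e →
      0 ≤ N.red S.p e (S.x e)) := by
  have hx := hS.mem e
  constructor
  · intro hu hv hlt
    have h0 : ¬ 0 < N.up e (S.x e) (δ - (S.p (N.src e) - S.p (N.dst e))) := fun hpos =>
      hv (hu.tail ⟨(e, true), by simp [tail], by simp [head], by simpa [eligCap] using hpos⟩)
    have h1 : N.w e (S.x e) ≤ δ - (S.p (N.src e) - S.p (N.dst e)) := by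
      refine h.w_le_of_right e hx.1 hlt le_rfl fun y hy hy' => ?_
      by_contra! hlt'
      have := (h.up_spec e (δ - (S.p (N.src e) - S.p (N.dst e))) hx).2.2.2 (y - S.x e)
        (by linarith) (by linarith) (by rw [add_sub_cancel]; exact hlt'.le)
      linarith
    unfold red
    linarith
  · intro hv hu hpos
    have h0 : ¬ 0 < N.down e (S.x e) (-(S.p (N.src e) - S.p (N.dst e))) := fun hpos =>
      hu (hv.tail ⟨(e, false), by simp [tail], by simp [head], by simpa [eligCap] using hpos⟩)
    have h1 : -(S.p (N.src e) - S.p (N.dst e)) ≤ N.w e (S.x e) := by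
      refine h.le_w_of_left e le_rfl hpos hx.2 fun y hy hy' => ?_
      by_contra! hlt'
      have := (h.down_spec e (-(S.p (N.src e) - S.p (N.dst e))) hx).2.2.2 (S.x e - y)
        (by linarith) (by linarith) (by rw [sub_sub_cancel]; exact hlt'.le)
      linarith
    unfold red
    linarith

/-- Only edges with exactly one eligible end change. If the source end is eligible, the reduced
derivative rises by δ from at most δ; if the target end is, it falls by δ from at least 0. -/
theorem IsConcave.inv_dualAdjust (h : N.IsConcave wmin wmax) {δ : ℝ} (hδ : 0 < δ)
    {S : FlowPot n m} (hS : N.Inv δ S) {σ : Fin m → ℝ} (hσ0 : ∀ e, 0 ≤ σ e)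
    (hσ : ∀ e, 0 < S.x e → -δ - σ e ≤ N.red S.p e (S.x e)) :
    N.Inv δ (N.dualAdjust δ S) ∧ ∀ e, 0 < (N.dualAdjust δ S).x e →
      -δ - σ e ≤ N.red (N.dualAdjust δ S).p e ((N.dualAdjust δ S).x e) := by
  have key : ∀ e, (S.x e < N.cap e → N.red (N.dualAdjust δ S).p e (S.x e) ≤ 2 * δ) ∧
      (0 < S.x e → -δ - σ e ≤ N.red (N.dualAdjust δ S).p e (S.x e)) := by
    intro e
    obtain ⟨h1, h2⟩ := h.eligible_arc hS e
    have h3 := hS.red_le e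
    have h4 := hσ e
    have h5 := hσ0 e
    unfold red at h1 h2 h3 h4 ⊢
    simp only [dualAdjust]
    by_cases hu : N.Eligible δ S (N.src e) <;> by_cases hv : N.Eligible δ S (N.dst e) <;>
      simp only [hu, hv, if_true, if_false] <;> constructor <;> intro hlt
    · exact h3 hlt
    · exact h4 hlt
    · linarith [h1 hu hv hlt]
    · linarith [h4 hlt]
    · linarith [h3 hlt]
    · linarith [h2 hv hu hlt]
    · linarith [h3 hlt]
    · linarith [h4 hlt]
  refine ⟨⟨hS.flow, ?_, fun e he => (key e).1 he⟩, fun e he => (key e).2 he⟩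
  have : N.Eligible δ S N.s := .refl
  simp only [dualAdjust, this, if_true]
  exact hS.ps

theorem IsConcave.dualAdjust_t (h : N.IsConcave wmin wmax) {δ : ℝ} (hδ : 0 < δ)
    {S : FlowPot n m} (hS : N.Inv δ S) {z : Arc m → ℝ} (hz : N.IsBlocking (N.eligCap δ S) z) :
    (N.dualAdjust δ (augment S z)).p N.t = S.p N.t - δ := by
  exact if_neg (h.not_eligible_t hδ hS hz)

/-- The value of an arc flow. -/
def value (N : Network n m) (z : Arc m → ℝ) : ℝ :=
  ∑ a with N.tail a = N.s, z a - ∑ a with N.head a = N.s, z a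

/-- By the tangent at the new flow value, a unit sent forward along uv gains at least p_v - p_u and
a unit sent backward loses at most that. These differences sum to p_t times the value by
`sum_potential`. -/
theorem IsConcave.weight_augment (h : N.IsConcave wmin wmax) {δ : ℝ} (hδ : 0 < δ)
    {S : FlowPot n m} (hS : N.Inv δ S) {z : Arc m → ℝ} (hz : N.IsBlocking (N.eligCap δ S) z) :
    N.weight S.x + S.p N.t * N.value z ≤ N.weight (augment S z).x := by
  have hS' := h.inv_augment hδ hS hz
  have h1 := sum_potential N.head N.tail z h.s_ne_t hz.conserve S.p
  rw [hS.ps, sub_zero, sum_arc] at h1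
  have e1 : N.value z = ∑ a with N.tail a = N.s, z a - ∑ a with N.head a = N.s, z a := rfl
  rw [e1, ← h1, weight, weight, ← Finset.sum_add_distrib]
  refine Finset.sum_le_sum fun e _ => ?_
  have h2 := h.sub_le e (hS'.mem e) (hS.mem e)
  simp only [head, tail, if_true, Bool.false_eq_true, if_false]
  rcases h.push_edge hδ hS hz e with ⟨h1, h3, h4, h5⟩ | ⟨h1, h3, h4, h5⟩ | ⟨h1, h3⟩
  · have e2 : (augment S z).x e = S.x e + z (e, true) := by simp [augment, h3]
    rw [e2] at h2 ⊢
    unfold red at h5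
    rw [h3]
    nlinarith
  · have e2 : (augment S z).x e = S.x e - z (e, false) := by simp [augment, h1]
    rw [e2] at h2 ⊢
    unfold red at h5
    rw [h1]
    nlinarith
  · have e2 : (augment S z).x e = S.x e := by simp [augment, h1, h3]
    rw [h1, h3, e2]
    linarith

end Network

/-! ### The approximation guarantee -/

namespace Network

variable {N : Network n m} {wmin wmax : ℝ}

/-- The flow on an edge, weighted with the difference of the levels, summed over all edges. -/
def levelSum (N : Network n m) (x : Fin m → ℝ) : ℝ :=
  ∑ e, ((N.level (N.dst e) : ℝ) - N.level (N.src e)) * x e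

/-- The levels form a potential with value 0 at the source and `N.depth` at the sink, so the sum
grows by the depth per unit of flow, whichever way the flow takes. -/
theorem IsConcave.levelSum_augment (h : N.IsConcave wmin wmax) {c : Arc m → ℝ} (S : FlowPot n m)
    {z : Arc m → ℝ} (hz : N.IsBlocking c z) :
    N.levelSum (augment S z).x = N.levelSum S.x + N.depth * N.value z := by
  have h1 := sum_potential N.head N.tail z h.s_ne_t hz.conserve fun v => (N.level v : ℝ)
  rw [h.level_s, Nat.cast_zero, sub_zero, sum_arc] at h1
  have e1 : N.value z = ∑ a with N.tail a = N.s, z a - ∑ a with N.head a = N.s, z a := rfl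
  have e2 : (N.depth : ℝ) = N.level N.t := rfl
  rw [e1, e2, ← h1, levelSum, levelSum, ← Finset.sum_add_distrib]
  refine Finset.sum_congr rfl fun e _ => ?_
  simp only [head, tail, if_true, Bool.false_eq_true, if_false, augment]
  ring

theorem IsConcave.levelSum_nonneg (h : N.IsConcave wmin wmax) {x : Fin m → ℝ} (hx : ∀ e, 0 ≤ x e) :
    0 ≤ N.levelSum x := by
  refine Finset.sum_nonneg fun e _ => mul_nonneg ?_ (hx e)
  have : ((N.level (N.src e) + 1 : ℕ) : ℝ) ≤ N.level (N.dst e) := by exact_mod_cast h.level_lt e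
  push_cast at this
  linarith

/-- The invariant with the amortized bound on the violation of the lower bounds. -/
structure Amortized (N : Network n m) (δ κ ε : ℝ) (S : FlowPot n m) : Prop extends N.Inv δ S where
  slack : ∃ σ : Fin m → ℝ, (∀ e, 0 ≤ σ e) ∧ (∀ e, 0 < S.x e → -δ - σ e ≤ N.red S.p e (S.x e)) ∧
    ∑ e, σ e * S.x e + κ * N.levelSum S.x ≤ 6 * ε * N.weight S.x

/-- The running time needs the upper bounds only. Taking the absolute value of the reduced
derivative as slack makes the lower bound hold trivially. -/
theorem IsConcave.inv_step (h : N.IsConcave wmin wmax) {δ : ℝ} (hδ : 0 < δ) {S : FlowPot n m}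
    (hS : N.Inv δ S) {z : Arc m → ℝ} (hz : N.IsBlocking (N.eligCap δ S) z) :
    N.Inv δ (N.dualAdjust δ (augment S z)) := by
  have hS' := h.inv_augment hδ hS hz
  refine (h.inv_dualAdjust hδ hS' (σ := fun e => |N.red (augment S z).p e ((augment S z).x e)|)
    (fun e => abs_nonneg _) fun e _ => ?_).1
  have := neg_abs_le (N.red (augment S z).p e ((augment S z).x e))
  linarith

/-- Per unit of value the left side grows by at most κ D, and 6ε times the weight by at least 6ε
p_t; `hκ` and `hθ` compare the two. The slack term itself does not grow: it vanishes on edges with a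
forward push, and the other edges do not gain flow. -/
theorem IsConcave.amortized_step (h : N.IsConcave wmin wmax) {δ κ ε θ : ℝ} (hδ : 0 < δ) (hε : 0 ≤ ε)
    {S : FlowPot n m} (hS : N.Amortized δ κ ε S) {z : Arc m → ℝ}
    (hz : N.IsBlocking (N.eligCap δ S) z) (hκ : κ * N.depth ≤ 6 * ε * θ) (hθ : θ ≤ S.p N.t) :
    N.Amortized δ κ ε (N.dualAdjust δ (augment S z)) := by
  obtain ⟨σ, hσ0, hσ, hsum⟩ := hS.slack
  have hS' := h.inv_augment hδ hS.toInv hz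
  set σ' : Fin m → ℝ := fun e => if 0 < z (e, true) then 0 else σ e with hσ'
  have hσ'0 : ∀ e, 0 ≤ σ' e := fun e => by
    simp only [hσ']
    split_ifs
    exacts [le_rfl, hσ0 e]
  have h1 := h.inv_dualAdjust hδ hS' hσ'0 (h.red_augment_ge hδ hS.toInv hz hσ)
  refine ⟨h1.1, σ', hσ'0, h1.2, ?_⟩
  have hv : 0 ≤ N.value z := sub_nonneg.2 hz.value_nonneg
  have h2 := h.weight_augment hδ hS.toInv hz
  have h3 : (N.dualAdjust δ (augment S z)).x = (augment S z).x := rfl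
  rw [h3, h.levelSum_augment S hz]
  have h4 : ∑ e, σ' e * (augment S z).x e ≤ ∑ e, σ e * S.x e := by
    refine Finset.sum_le_sum fun e _ => ?_
    simp only [hσ']
    split_ifs with hp
    · rw [zero_mul]
      exact mul_nonneg (hσ0 e) (hS.flow.nonneg e)
    · refine mul_le_mul_of_nonneg_left ?_ (hσ0 e)
      have := hz.nonneg (e, false)
      simp only [augment]
      linarith
  have h5 := mul_le_mul_of_nonneg_right hκ hv
  have h6 := mul_le_mul_of_nonneg_right hθ hv
  have h7 := mul_le_mul_of_nonneg_left h6 hε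
  have h8 := mul_le_mul_of_nonneg_left h2 hε
  nlinarith

theorem IsConcave.inv_rescale (h : N.IsConcave wmin wmax) {δ : ℝ} (hδ : 0 < δ) {S : FlowPot n m}
    (hS : N.Inv δ S) : N.Inv (δ / 2) (N.dualRescale δ S) := by
  refine ⟨hS.flow, by simp [dualRescale, hS.ps, h.level_s], fun e he => ?_⟩
  have h1 := hS.red_le e he
  have h2 : ((N.level (N.src e) + 1 : ℕ) : ℝ) ≤ N.level (N.dst e) := by exact_mod_cast h.level_lt e
  push_cast at h2
  unfold red at h1 ⊢
  simp only [dualRescale]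
  nlinarith

/-- Rescaling lowers the reduced derivative by δ times the level difference, which is at least 1,
and the bound tightens from -δ to -δ/2. Both are covered by a new slack of 3δ/2 times the level
difference. So half of the credit 3δ `levelSum` turns into slack, and the other half is exactly the
credit of the next scale. -/
theorem IsConcave.amortized_rescale (h : N.IsConcave wmin wmax) {δ ε κ : ℝ} (hδ : 0 < δ)
    {S : FlowPot n m} (hS : N.Amortized δ (3 * δ) ε S) (hκ : κ ≤ 3 * (δ / 2)) :
    N.Amortized (δ / 2) κ ε (N.dualRescale δ S) := by
  obtain ⟨σ, hσ0, hσ, hsum⟩ := hS.slack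
  have hl : ∀ e, (1 : ℝ) ≤ (N.level (N.dst e) : ℝ) - N.level (N.src e) := fun e => by
    have h2 : ((N.level (N.src e) + 1 : ℕ) : ℝ) ≤ N.level (N.dst e) := by exact_mod_cast h.level_lt e
    push_cast at h2
    linarith
  refine ⟨h.inv_rescale hδ hS.toInv, fun e => σ e + 3 / 2 * δ * ((N.level (N.dst e) : ℝ) -
    N.level (N.src e)), fun e => ?_, fun e he => ?_, ?_⟩
  · have := hσ0 e
    have := mul_nonneg hδ.le (zero_le_one.trans (hl e))
    linarith
  · have h1 := hσ e he
    have := mul_le_mul_of_nonneg_left (hl e) hδ.le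
    unfold red at h1 ⊢
    simp only [dualRescale]
    nlinarith
  · have e1 : ∑ e, (σ e + 3 / 2 * δ * ((N.level (N.dst e) : ℝ) - N.level (N.src e))) *
        (N.dualRescale δ S).x e = ∑ e, σ e * S.x e + 3 / 2 * δ * N.levelSum S.x := by
      rw [levelSum, Finset.mul_sum, ← Finset.sum_add_distrib]
      refine Finset.sum_congr rfl fun e _ => ?_
      simp only [dualRescale]
      ring
    have h2 := mul_le_mul_of_nonneg_right hκ (h.levelSum_nonneg hS.flow.nonneg)
    rw [e1]
    simp only [dualRescale]
    linarith

/-- The potential of the sink exceeds θ by a multiple of δ and drops by δ per round, so it meets θ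
exactly and is at least θ at every augmentation. -/
theorem InnerLoop.amortized (h : N.IsConcave wmin wmax) {δ θ κ ε : ℝ} (hδ : 0 < δ) (hε : 0 ≤ ε)
    (hκ : κ * N.depth ≤ 6 * ε * θ) {S S' : FlowPot n m} (hl : N.InnerLoop δ θ S S')
    (hS : N.Amortized δ κ ε S) (hp : ∃ j : ℕ, S.p N.t = θ + j * δ) :
    N.Amortized δ κ ε S' ∧ S'.p N.t = θ := by
  induction hl with
  | done S hθ => exact ⟨hS, hθ⟩
  | step S S' z hne hz _ ih =>
    obtain ⟨j, hj⟩ := hp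
    rcases j with _ | j
    · exact absurd (by simpa using hj) hne
    have hj0 : (0 : ℝ) ≤ (j + 1 : ℕ) * δ := mul_nonneg (Nat.cast_nonneg _) hδ.le
    refine ih (h.amortized_step hδ hε hS hz hκ (by linarith)) ⟨j, ?_⟩
    rw [h.dualAdjust_t hδ hS.toInv hz, hj]
    push_cast
    ring

theorem stepSize_pos {W ε : ℝ} (hW : 0 < W) (hε : 0 < ε) (i : ℕ) : 0 < stepSize W ε i := by
  unfold stepSize
  positivity

theorem stepSize_succ (W ε : ℝ) (i : ℕ) : stepSize W ε (i + 1) = stepSize W ε i / 2 := by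
  unfold stepSize
  rw [pow_succ]
  field_simp

/-- In scale i < T the threshold is D 2^k δ, and after rescaling the sink has potential D (2^k + 1)
δ = D (2^(k+1) + 2) δ/2; this is where r = 2 comes from. The credit 3δ satisfies 3δ D = 6εθ. The
last scale has θ = 0 and can earn no credit, so κ is 0 there. -/
theorem OuterLoop.amortized (h : N.IsConcave wmin wmax) {W : ℝ} (hW : 0 < W) {k : ℕ} {T i : ℕ}
    {S S' : FlowPot n m} (hl : N.OuterLoop W (1 / 2 ^ (k + 1)) T i S S') (hi : i ≤ T)
    (hS : N.Amortized (stepSize W (1 / 2 ^ (k + 1)) i)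
      (if i = T then 0 else 3 * stepSize W (1 / 2 ^ (k + 1)) i) (1 / 2 ^ (k + 1)) S)
    (hp : ∃ r : ℕ, S.p N.t = N.depth * (2 ^ (k + 1) + r) * stepSize W (1 / 2 ^ (k + 1)) i) :
    N.Amortized (stepSize W (1 / 2 ^ (k + 1)) T) 0 (1 / 2 ^ (k + 1)) S' ∧ S'.p N.t = 0 := by
  have hε : (0 : ℝ) < 1 / 2 ^ (k + 1) := by positivity
  induction hl with
  | last S S' hl =>
    obtain ⟨r, hr⟩ := hp
    rw [if_pos rfl] at hS
    refine InnerLoop.amortized h (stepSize_pos hW hε _) hε.le (by simp) hl hS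
      ⟨N.depth * (2 ^ (k + 1) + r), ?_⟩
    rw [hr]
    push_cast
    ring
  | next i S S₁ S' hi' hl _ ih =>
    obtain ⟨r, hr⟩ := hp
    rw [if_neg hi'.ne] at hS
    have hθ : (N.depth : ℝ) * W / 2 ^ (i + 1) = N.depth * 2 ^ k * stepSize W (1 / 2 ^ (k + 1)) i := by
      unfold stepSize
      rw [pow_succ, pow_succ]
      field_simp
    obtain ⟨hS₁, hp₁⟩ := InnerLoop.amortized h (stepSize_pos hW hε _) hε.le
      (by
        rw [hθ]
        unfold stepSize
        rw [pow_succ]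
        apply le_of_eq
        field_simp
        ring) hl hS
      ⟨N.depth * (2 ^ k + r), by
        rw [hr, hθ]
        push_cast
        rw [pow_succ]
        ring⟩
    refine ih hi' ?_ ⟨2, ?_⟩
    · rw [stepSize_succ]
      refine h.amortized_rescale (stepSize_pos hW hε _) hS₁ ?_
      split_ifs
      · have := stepSize_pos hW hε i
        positivity
      · exact le_rfl
    · have : (N.dualRescale (stepSize W (1 / 2 ^ (k + 1)) i) S₁).p N.t =
          S₁.p N.t + stepSize W (1 / 2 ^ (k + 1)) i * N.depth := rfl
      rw [this, hp₁, hθ, stepSize_succ, pow_succ]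
      push_cast
      ring

theorem IsConcave.weight_ge (h : N.IsConcave wmin wmax) {y : Fin m → ℝ} (hy : N.IsFlow y) :
    wmin * ∑ e, y e ≤ N.weight y := by
  rw [Finset.mul_sum, weight]
  refine Finset.sum_le_sum fun e _ => ?_
  have hm : y e ∈ Set.Icc 0 (N.cap e) := ⟨hy.nonneg e, hy.le_cap e⟩
  have h0 : (0 : ℝ) ∈ Set.Icc 0 (N.cap e) := ⟨le_rfl, (h.cap_pos e).le⟩
  have h1 := h.sub_le e hm h0
  have h2 := h.zero_nonneg e
  have h3 := mul_le_mul_of_nonneg_right (h.le_deriv e _ hm) hm.1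
  linarith

/-- Each edge is compared with y by the tangent at x: the upper bound 2δ is used where y is larger,
the lower bound -δ - σ where x is larger. The potential terms vanish since p_s = p_t. The bounds on
total flow from `weight_ge` turn δ = ε w_min into ε times weights, leaving 2ε f(y) and (1 + 6)ε
f(x). -/
theorem IsConcave.approx_of_amortized (h : N.IsConcave wmin wmax) {ε : ℝ} (hε : 0 ≤ ε)
    {S : FlowPot n m} (hS : N.Amortized (ε * wmin) 0 ε S) (ht : S.p N.t = 0) :
    N.IsApprox (1 - 9 * ε) S.x := by
  refine ⟨hS.flow, fun y hy => ?_⟩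
  obtain ⟨σ, hσ0, hσ, hsum⟩ := hS.slack
  rw [zero_mul, add_zero] at hsum
  have hwx := h.weight_ge hS.flow
  have hwy := h.weight_ge hy
  have hx0 : 0 ≤ ∑ e, S.x e := Finset.sum_nonneg fun e _ => hS.flow.nonneg e
  have hy0 : 0 ≤ ∑ e, y e := Finset.sum_nonneg fun e _ => hy.nonneg e
  have hw0 := h.wmin_pos
  have e1 := sum_potential N.dst N.src S.x h.s_ne_t hS.flow.conserve S.p
  have e2 := sum_potential N.dst N.src y h.s_ne_t hy.conserve S.p
  rw [ht, hS.ps, sub_self, zero_mul] at e1 e2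
  have key : N.weight y - N.weight S.x ≤ ∑ e, (2 * (ε * wmin) * y e + (ε * wmin + σ e) * S.x e -
      (S.p (N.dst e) - S.p (N.src e)) * S.x e + (S.p (N.dst e) - S.p (N.src e)) * y e) := by
    rw [weight, weight, ← Finset.sum_sub_distrib]
    refine Finset.sum_le_sum fun e _ => ?_
    have hm : y e ∈ Set.Icc 0 (N.cap e) := ⟨hy.nonneg e, hy.le_cap e⟩
    have h1 := h.sub_le e (hS.mem e) hm
    have h2 := mul_nonneg hε hw0.le
    have h3 := hσ0 e
    have hmx := hS.mem e
    rcases lt_trichotomy (S.x e) (y e) with hlt | heq | hlt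
    · have h4 := hS.red_le e (hlt.trans_le hm.2)
      unfold red at h4
      have h5 := mul_le_mul_of_nonneg_right h4 (sub_nonneg.2 hlt.le)
      have h6 := mul_nonneg h2 hmx.1
      have h7 := mul_nonneg h3 hmx.1
      nlinarith
    · rw [← heq] at h1 ⊢
      have h6 := mul_nonneg h2 hmx.1
      have h7 := mul_nonneg h3 hmx.1
      nlinarith
    · have h4 := hσ e (hm.1.trans_lt hlt)
      unfold red at h4
      have h5 := mul_le_mul_of_nonneg_right h4 (sub_nonneg.2 hlt.le)
      have h6 := mul_nonneg h2 hm.1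
      have h7 := mul_nonneg h3 hm.1
      nlinarith
  simp only [Finset.sum_add_distrib, Finset.sum_sub_distrib] at key
  rw [e1, e2] at key
  simp only [add_mul, Finset.sum_add_distrib] at key
  rw [← Finset.mul_sum, ← Finset.mul_sum] at key
  have h1 := mul_le_mul_of_nonneg_left hwx hε
  have h2 := mul_le_mul_of_nonneg_left hwy hε
  have hfx : 0 ≤ N.weight S.x := (mul_nonneg hw0.le hx0).trans hwx
  have hfy : 0 ≤ N.weight y := (mul_nonneg hw0.le hy0).trans hwy
  have h3 : (1 - 2 * ε) * N.weight y ≤ (1 + 7 * ε) * N.weight S.x := by nlinarith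
  -- A nonpositive factor makes the claim trivial because weights are nonnegative; otherwise (1 +
  -- 7ε)(1 - 9ε) ≤ 1 - 2ε.
  by_cases h9 : 1 - 9 * ε ≤ 0
  · exact (mul_nonpos_of_nonpos_of_nonneg h9 hfy).trans hfx
  · have h4 : (1 + 7 * ε) * ((1 - 9 * ε) * N.weight y) ≤ (1 - 2 * ε) * N.weight y := by
      have : (1 + 7 * ε) * (1 - 9 * ε) ≤ 1 - 2 * ε := by nlinarith
      nlinarith
    exact le_of_mul_le_mul_left (h4.trans h3) (by linarith)

/-- Without flow there is no lower bound to keep, and levels rise by at least 1 along an edge, so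
the reduced derivative is at most w_max - W ≤ 0. Any W ≥ w_max will do, as needed when w_max is
rounded up. -/
theorem IsConcave.amortized_init (h : N.IsConcave wmin wmax) {δ κ ε W : ℝ} (hδ : 0 ≤ δ) (hε : 0 ≤ ε)
    (hW : wmax ≤ W) : N.Amortized δ κ ε ⟨fun _ => 0, fun u => W * N.level u⟩ := by
  have h0 : ∀ e, (0 : ℝ) ∈ Set.Icc 0 (N.cap e) := fun e => ⟨le_rfl, (h.cap_pos e).le⟩
  refine ⟨⟨⟨fun _ => le_rfl, fun e => (h.cap_pos e).le, fun v _ _ => by simp⟩, by simp [h.level_s],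
    fun e _ => ?_⟩, fun _ => 0, fun _ => le_rfl, fun e he => absurd he (lt_irrefl _), ?_⟩
  · have h1 := h.deriv_le e 0 (h0 e)
    have h2 := h.le_deriv e 0 (h0 e)
    have h3 := h.wmin_pos
    have h4 : ((N.level (N.src e) + 1 : ℕ) : ℝ) ≤ N.level (N.dst e) := by exact_mod_cast h.level_lt e
    push_cast at h4
    unfold red
    simp only
    nlinarith
  · have : 0 ≤ N.weight fun _ => 0 := Finset.sum_nonneg fun e _ => h.zero_nonneg e
    simp only [Finset.sum_const_zero, levelSum, mul_zero, zero_add]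
    positivity

/-- Whatever blocking flows are chosen, the algorithm returns a `(1 - 9 ε)`-approximation. -/
theorem IsConcave.approx_of_returns (h : N.IsConcave wmin wmax) {k : ℕ} (hk : 1 ≤ k) {W : ℝ}
    (hW : wmax ≤ W) (hW0 : 0 < W) {x : Fin m → ℝ} (hx : N.Returns wmin W (1 / 2 ^ k) x) :
    N.IsApprox (1 - 9 * (1 / 2 ^ k)) x := by
  obtain ⟨k, rfl⟩ : ∃ j, k = j + 1 := ⟨k - 1, by omega⟩
  obtain ⟨T, p, hT, hl⟩ := hx
  have hε : (0 : ℝ) < 1 / 2 ^ (k + 1) := by positivity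
  obtain ⟨h1, h2⟩ := OuterLoop.amortized h hW0 hl (Nat.zero_le _)
    (h.amortized_init (stepSize_pos hW0 hε _).le hε.le hW)
    ⟨0, by
      have : (N.depth : ℝ) = N.level N.t := rfl
      rw [this]
      unfold stepSize
      field_simp
      simp⟩
  refine h.approx_of_amortized hε.le (S := ⟨x, p⟩) ?_ h2
  have : stepSize W (1 / 2 ^ (k + 1)) T = 1 / 2 ^ (k + 1) * wmin := by
    unfold stepSize
    rw [hT]
    field_simp
  rwa [this] at h1

end Network

/-! ### Graph search -/

/-- The queue is the list `L`. -/
structure Queue (n : ℕ) (L : List ℕ) (M : Mem) : Prop where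
  len : M.nv 31 = L.length
  get : ∀ i, i < L.length → L[i]? = some (M.na 15 i)
  nodup : L.Nodup
  mem : ∀ x ∈ L, x ∈ Finset.Icc 1 n

theorem Queue.length_le {L : List ℕ} {M : Mem} (h : Queue n L M) : L.length ≤ n := by
  rw [← List.toFinset_card_of_nodup h.nodup]
  refine (Finset.card_le_card (t := Finset.Icc 1 n) fun x hx => h.mem x (List.mem_toFinset.1 hx)).trans ?_
  simp

theorem Queue.push {L : List ℕ} {M M' : Mem} (h : Queue n L M) {v : ℕ} (hv : v ∉ L)
    (hvn : v ∈ Finset.Icc 1 n) (h1 : M'.nv 31 = L.length + 1)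
    (h2 : ∀ i, M'.na 15 i = if i = L.length then v else M.na 15 i) : Queue n (L ++ [v]) M' := by
  refine ⟨by simp [h1], fun i hi => ?_, ?_, ?_⟩
  · rw [h2]
    split_ifs with hil
    · simp [hil]
    · have : i < L.length := by simp at hi; omega
      rw [List.getElem?_append_left this, h.get i this]
  · exact List.nodup_append.2 ⟨h.nodup, List.nodup_singleton _, by
      rintro a ha b hb rfl
      exact hv (by simp at hb; rwa [hb] at ha)⟩
  · intro x hx
    rcases List.mem_append.1 hx with hx | hx
    · exact h.mem x hx
    · rw [List.mem_singleton.1 hx]; exact hvn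

/-- Run `B` on every arc (in register `29`) that leaves a vertex in the queue; `B` may append
vertices to the queue. -/
def search (B : Prog) : Prog := block [.nset 29 (.lit 0), .nset 30 (.lit 0),
  .loop (.not (.and (.neq (.var 29) (.lit 0)) (.neq (.var 30) (.var 31))))
    (.cond (.neq (.var 29) (.lit 0))
      (block [.nset 29 (.arr 5 (.arr 15 (.var 30))), .nset 30 (.add (.var 30) (.lit 1))])
      (.seq B (.nset 29 (.arr 4 (.var 29)))))]

/-- The common loop of reachability and of the computation of levels. The processed arcs are those
leaving a vertex taken from the queue; for the vertex taken last, only the arcs above the current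
one, since lists are decreasing. At the end they are all arcs that leave a vertex of the queue. -/
theorem exec_search (N : Network n m) {G : Arcs n} (B : Prog) (k : ℕ)
    (hB : B.straight = true ∧ B.cost ≤ k)
    (hw : (B.writesN 0 || B.writesN 4 || B.writesN 5 || B.writesN 6 ||
      B.writesNA 2 || B.writesNA 3 || B.writesNA 4 || B.writesNA 5) = false)
    (hw' : (B.writesN 29 || B.writesN 30) = false)
    (J : Finset ℕ → List ℕ → Mem → Prop)
    (hJ : ∀ Pr L M i v, i = 29 ∨ i = 30 → J Pr L M → J Pr L (M.setN i v))
    (hstep : ∀ Pr L M, Stored G M → Queue n L M → J Pr L M → M.nv 29 ∈ Finset.Icc 1 G.A →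
      M.nv 29 ∉ Pr → G.tl (M.nv 29) ∈ L → ∃ L', L <+: L' ∧ Queue n L' (B.sem N M) ∧
        J (insert (M.nv 29) Pr) L' (B.sem N M))
    {M : Mem} {L₀ : List ℕ} (hS : Stored G M) (hQ : Queue n L₀ M) (h0 : J ∅ L₀ M) :
    ∃ M' τ L, Exec N (search B) M M' τ ∧ L₀ <+: L ∧ Queue n L M' ∧
      J {b ∈ Finset.Icc 1 G.A | G.tl b ∈ L} L M' ∧ (τ : ℝ) ≤ (G.A + n + 1) * (k + 30) := by
  simp only [Bool.or_eq_false_iff] at hw'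
  set body : Prog := .cond (.neq (.var 29) (.lit 0))
      (block [.nset 29 (.arr 5 (.arr 15 (.var 30))), .nset 30 (.add (.var 30) (.lit 1))])
      (.seq B (.nset 29 (.arr 4 (.var 29)))) with hbody
  have hbs : body.straight = true ∧ body.cost ≤ k + 18 := by
    constructor
    · simp [body, Prog.straight, block, hB.1]
    · have := hB.2
      simp only [body, Prog.cost, block, BExp.size, NExp.size]
      omega
  obtain ⟨⟨Pr, L, q⟩, M', τ, hex, ⟨hS', hQ', hJ', hq, hqL, hPr, ha, hL₀⟩, hend, hτ⟩ := exec_loop (N := N)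
    (.not (.and (.neq (.var 29) (.lit 0)) (.neq (.var 30) (.var 31)))) body
    (fun (g : Finset ℕ × List ℕ × ℕ) M => Stored G M ∧ Queue n g.2.1 M ∧ J g.1 g.2.1 M ∧
      M.nv 30 = g.2.2 ∧ g.2.2 ≤ g.2.1.length ∧
      (∀ b, b ∈ g.1 ↔ b ∈ Finset.Icc 1 G.A ∧ ∃ i < g.2.2, g.2.1[i]? = some (G.tl b) ∧
        (i + 1 = g.2.2 → M.nv 29 < b)) ∧
      (M.nv 29 = 0 ∨ M.nv 29 ∈ Finset.Icc 1 G.A ∧ 1 ≤ g.2.2 ∧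
        g.2.1[g.2.2 - 1]? = some (G.tl (M.nv 29))) ∧ L₀ <+: g.2.1)
    -- Every iteration either processes a new arc or takes a vertex from the queue.
    (fun g => ((G.A : ℝ) - g.1.card + (n - g.2.2)) * (k + 30))
    (by
      rintro ⟨Pr, L, q⟩ M ⟨hS, hQ, hJ', hq, hqL, hPr, ha, -⟩
      simp only at *
      have h1 : Pr.card ≤ G.A := by
        refine (Finset.card_le_card (t := Finset.Icc 1 G.A) fun b hb => ((hPr b).1 hb).1).trans ?_
        simp
      have h2 := hqL.trans hQ.length_le
      have h1' : (Pr.card : ℝ) ≤ G.A := by exact_mod_cast h1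
      have h2' : (q : ℝ) ≤ n := by exact_mod_cast h2
      exact mul_nonneg (by linarith) (by positivity))
    (by
      rintro ⟨Pr, L, q⟩ M ⟨hS, hQ, hJ', hq, hqL, hPr, ha, hpre⟩ hb
      simp only at hS hQ hJ' hq hqL hPr ha hpre
      obtain ⟨τ, hex, hτ⟩ := Prog.exec_le N hbs M
      have hcost : (τ : ℝ) + (BExp.not (.and (.neq (.var 29) (.lit 0))
          (.neq (.var 30) (.var 31)))).size + 1 ≤ k + 30 := by
        simp only [BExp.size, NExp.size]
        push_cast at hτ ⊢
        linarith
      by_cases h0 : M.nv 29 = 0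
      · have hqlt : q < L.length := by
          simp only [BExp.Holds, NExp.eval, h0, hq, hQ.len, true_and] at hb
          omega
        have hsem : body.sem N M = (M.setN 29 (G.fi (M.na 15 q))).setN 30 (q + 1) := by
          simp [body, Prog.sem, BExp.Holds, NExp.eval, h0, block, hq, hS.fi]
        have hu := hQ.get q hqlt
        have hmem : M.na 15 q ∈ Finset.Icc 1 n := hQ.mem _ (List.mem_of_getElem? hu)
        rw [hsem] at hex
        refine ⟨(Pr, L, q + 1), _, τ, hex, ⟨?_, ?_, hJ _ _ _ _ _ (.inr rfl) (hJ _ _ _ _ _ (.inl rfl) hJ'),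
          by simp, hqlt, ?_, ?_, hpre⟩, ?_⟩
        · exact ⟨by simp [hS.n], by simp [hS.s], by simp [hS.t], by simp [hS.A], hS.tl, hS.hd,
            hS.nx, hS.fi⟩
        · exact ⟨by simp [hQ.len], by simpa using hQ.get, hQ.nodup, hQ.mem⟩
        · intro b
          rw [hPr]
          refine and_congr_right fun hbA => ⟨?_, ?_⟩
          · rintro ⟨i, hi, h1, h2⟩
            exact ⟨i, by simp only; omega, h1, fun h3 => by simp only at h3; omega⟩
          · rintro ⟨i, hi, h1, h2⟩
            rcases Nat.lt_succ_iff_lt_or_eq.1 hi with hi | hi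
            · exact ⟨i, hi, h1, fun _ => by rw [h0]; exact (Finset.mem_Icc.1 hbA).1⟩
            · exfalso
              subst hi
              have h3 := h2 rfl
              have h4 := G.le_fi b hbA
              simp only at h1
              rw [hu] at h1
              simp only [Mem.setN_nv, Option.some.injEq] at h1 h3
              rw [← h1] at h4
              simp at h3
              omega
        · simp only [Mem.setN_nv]
          rcases G.fi_mem _ hmem with h1 | h1
          · left; simp [h1]
          · right
            simp [h1.1, h1.2, hu]
        · push_cast
          linarith
      · obtain ⟨haA, hq1, hqa⟩ := ha.resolve_left h0
        have hainv : M.nv 29 ∉ Pr := by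
          intro hin
          obtain ⟨-, i, hi, h1, h2⟩ := (hPr _).1 hin
          -- The queue has no repetitions, so the tail of the current arc determines its position.
          have hii : i = q - 1 :=
            (List.getElem?_inj (by omega) hQ.nodup).1 (h1.trans hqa.symm)
          exact absurd (h2 (by omega)) (lt_irrefl _)
        obtain ⟨L', hLL', hQ', hJ''⟩ := hstep Pr L M hS hQ hJ' haA hainv (List.mem_of_getElem? hqa)
        obtain ⟨σ, hexB, -⟩ := Prog.exec_le N hB M
        have hS' := hS.exec hexB hw
        have e29 : (B.sem N M).nv 29 = M.nv 29 := hexB.nv hw'.1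
        have e30 : (B.sem N M).nv 30 = M.nv 30 := hexB.nv hw'.2
        have hsem : body.sem N M = (B.sem N M).setN 29 (G.nx (M.nv 29)) := by
          simp [body, Prog.sem, BExp.Holds, NExp.eval, h0, hS'.nx, e29]
        have hget : ∀ i < q, L'[i]? = L[i]? := by
          intro i hi
          obtain ⟨l, rfl⟩ := hLL'
          exact List.getElem?_append_left (by omega)
        have hlen : L.length ≤ L'.length := hLL'.length_le
        rw [hsem] at hex
        refine ⟨(insert (M.nv 29) Pr, L', q), _, τ, hex, ⟨?_, ?_, hJ _ _ _ _ _ (.inl rfl) hJ'',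
          by simp [e30, hq], hqL.trans hlen, ?_, ?_, hpre.trans hLL'⟩, ?_⟩
        · exact ⟨by simp [hS'.n], by simp [hS'.s], by simp [hS'.t], by simp [hS'.A], hS'.tl, hS'.hd,
            hS'.nx, hS'.fi⟩
        · exact ⟨by simp [hQ'.len], by simpa using hQ'.get, hQ'.nodup, hQ'.mem⟩
        · intro b
          rw [Finset.mem_insert, hPr]
          simp only [Mem.setN_nv, if_true]
          have hlt := G.nx_lt _ haA
          constructor
          · rintro (rfl | ⟨hbA, i, hi, h1, h2⟩)
            · exact ⟨haA, q - 1, by omega, by rw [hget _ (by omega), hqa], fun _ => hlt⟩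
            · exact ⟨hbA, i, hi, by rw [hget _ hi, h1], fun h3 => hlt.trans (h2 h3)⟩
          · rintro ⟨hbA, i, hi, h1, h2⟩
            rw [hget _ hi] at h1
            by_cases hba : b = M.nv 29
            · exact .inl hba
            · refine .inr ⟨hbA, i, hi, h1, fun h3 => ?_⟩
              have h4 : i = q - 1 := by omega
              rw [h4, hqa] at h1
              by_contra hlt'
              have := G.le_nx _ haA b hbA (Option.some.inj h1).symm (by omega)
              have := h2 h3
              omega
        · simp only [Mem.setN_nv, if_true]
          rcases G.nx_mem _ haA with h1 | h1
          · exact .inl h1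
          · exact .inr ⟨h1.1, hq1, by rw [hget _ (by omega), hqa, h1.2]⟩
        · rw [Finset.card_insert_of_notMem hainv]
          push_cast
          linarith)
    (∅, L₀, 0) ((M.setN 29 0).setN 30 0) ⟨⟨by simp [hS.n], by simp [hS.s], by simp [hS.t],
      by simp [hS.A], hS.tl, hS.hd, hS.nx, hS.fi⟩, ⟨by simp [hQ.len], by simpa using hQ.get, hQ.nodup,
      hQ.mem⟩, hJ _ _ _ _ _ (.inr rfl) (hJ _ _ _ _ _ (.inl rfl) h0), by simp, Nat.zero_le _,
      by simp, by simp, List.prefix_rfl⟩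
  refine ⟨M', _, L, .seq _ _ _ _ _ _ _ (.nset M 29 (.lit 0)) (.seq _ _ _ _ _ _ _
    (.nset (M.setN 29 0) 30 (.lit 0)) hex), hL₀, hQ', ?_, ?_⟩
  · simp only [BExp.Holds, NExp.eval, not_not] at hend
    simp only at hPr hJ' hq hqL hQ'
    convert hJ' using 1
    ext b
    rw [hPr, Finset.mem_filter]
    refine and_congr_right fun hbA => ?_
    rw [hend.1, ← hq, hend.2, hQ'.len, List.mem_iff_getElem?]
    constructor
    · rintro ⟨i, hi⟩
      exact ⟨i, (List.getElem?_eq_some_iff.1 hi).1, hi, fun _ => (Finset.mem_Icc.1 hbA).1⟩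
    · rintro ⟨i, -, hi, -⟩
      exact ⟨i, hi⟩
  · simp only [NExp.size, BExp.size] at hτ ⊢
    have hpos : 0 ≤ ((G.A : ℝ) - Pr.card + (n - q)) * (k + 30) := by
      have h1 : Pr.card ≤ G.A := by
        refine (Finset.card_le_card (t := Finset.Icc 1 G.A) fun b hb => ((hPr b).1 hb).1).trans ?_
        simp
      have h1' : (Pr.card : ℝ) ≤ G.A := by exact_mod_cast h1
      have h2' : (q : ℝ) ≤ n := by exact_mod_cast hqL.trans hQ'.length_le
      exact mul_nonneg (by linarith) (by positivity)
    have hk0 : (0 : ℝ) ≤ k := Nat.cast_nonneg _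
    push_cast at hτ ⊢
    simp only [Finset.card_empty, Nat.cast_zero] at hτ
    linarith

/-! ### Networks in memory -/

/-- The number of an arc. -/
def num (a : Arc m) : ℕ := if a.2 then a.1 + 1 else m + a.1 + 1

theorem num_mem (a : Arc m) : num a ∈ Finset.Ico 1 (2 * m + 1) := by
  have := a.1.2
  unfold num
  split_ifs <;> simp only [Finset.mem_Ico] <;> omega

theorem exists_num {b : ℕ} (hb : b ∈ Finset.Ico 1 (2 * m + 1)) : ∃ a : Arc m, num a = b := by
  have := Finset.mem_Ico.1 hb
  by_cases h : b ≤ m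
  · exact ⟨(⟨b - 1, by omega⟩, true), by simp [num]; omega⟩
  · exact ⟨(⟨b - m - 1, by omega⟩, false), by simp [num]; omega⟩

theorem sum_num (F : ℕ → ℝ) : ∑ b ∈ Finset.Ico 1 (2 * m + 1), F b = ∑ a : Arc m, F (num a) := by
  rw [Network.sum_arc, Finset.sum_add_distrib,
    ← Finset.sum_Ico_consecutive F (by omega : 1 ≤ m + 1) (by omega : m + 1 ≤ 2 * m + 1),
    Finset.sum_Ico_eq_sum_range, Finset.sum_Ico_eq_sum_range, Finset.sum_range,
    (by omega : 2 * m + 1 - (m + 1) = m), Finset.sum_range]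
  congr 1
  · refine Finset.sum_congr (by simp) fun e _ => ?_
    simp [num, add_comm]
  · refine Finset.sum_congr rfl fun e _ => ?_
    simp only [num, Bool.false_eq_true, if_false]
    congr 1
    omega

/-- The network is stored in memory. -/
structure Layout (N : Network n m) (G : Arcs n) (M : Mem) : Prop where
  stored : Stored G M
  edges : M.nv 1 = m
  A : G.A = 2 * m + 1
  s : G.s = N.s + 1
  t : G.t = N.t + 1
  tl : ∀ a : Arc m, G.tl (num a) = N.tail a + 1
  hd : ∀ a : Arc m, G.hd (num a) = N.head a + 1
  level : ∀ v : Fin n, M.ra 8 (v + 1) = N.level v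

theorem Layout.exec {N : Network n m} {G : Arcs n} {P : Prog} {M M' : Mem} {τ : ℕ}
    (h : Layout N G M) (hex : Exec N P M M' τ)
    (hP : (P.writesN 0 || P.writesN 4 || P.writesN 5 || P.writesN 6 ||
      P.writesNA 2 || P.writesNA 3 || P.writesNA 4 || P.writesNA 5) = false)
    (hP' : (P.writesN 1 || P.writesRA 8) = false) : Layout N G M' := by
  simp only [Bool.or_eq_false_iff] at hP'
  exact ⟨h.stored.exec hex hP, (hex.nv hP'.1).trans h.edges, h.A, h.s, h.t, h.tl, h.hd, fun v => by
    rw [hex.ra hP'.2, h.level]⟩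

/-- The current flow and potentials are stored in memory. -/
structure Current (S : FlowPot n m) (M : Mem) : Prop where
  x : ∀ e : Fin m, M.ra 1 e = S.x e
  p : ∀ v : Fin n, M.ra 7 (v + 1) = S.p v

theorem Current.exec {N : Network n m} {S : FlowPot n m} {P : Prog} {M M' : Mem} {τ : ℕ}
    (h : Current S M) (hex : Exec N P M M' τ) (hP : (P.writesRA 1 || P.writesRA 7) = false) :
    Current S M' := by
  simp only [Bool.or_eq_false_iff] at hP
  exact ⟨fun e => by rw [hex.ra hP.1, h.x], fun v => by rw [hex.ra hP.2, h.p]⟩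

/-- Compute the eligible capacities; the capacity of the additional arc exceeds their sum. -/
def eligCaps : Prog := block [.rset 8 (.lit 1), .forLoop 26 (.var 1) (block [
  .nset 27 (.add (.var 26) (.lit 1)), .nset 28 (.add (.var 1) (.var 27)),
  .rset 11 (.sub (.arr 7 (.arr 2 (.var 27))) (.arr 7 (.arr 3 (.var 27)))),
  .rstore 2 (.var 27) (.up (.var 26) (.arr 1 (.var 26)) (.sub (.var 5) (.var 11))),
  .rstore 2 (.var 28) (.down (.var 26) (.arr 1 (.var 26)) (.sub (.lit 0) (.var 11))),
  .rset 8 (.add (.var 8) (.add (.arr 2 (.var 27)) (.arr 2 (.var 28))))]),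
  .rstore 2 (.var 6) (.var 8)]

theorem eligCaps_spec {N : Network n m} {G : Arcs n} {M : Mem} {S : FlowPot n m}
    (h : Layout N G M) (hS : Current S M) :
    ∃ M' τ, Exec N eligCaps M M' τ ∧ (∀ a, M'.ra 2 (num a) = N.eligCap (M.rv 5) S a) ∧
      ∑ a ∈ Finset.Ico 1 G.A, M'.ra 2 a < M'.ra 2 G.A ∧ (τ : ℝ) ≤ 60 * (m + 1) := by
  set g : ℕ → ℝ := fun i => if hi : i < m then N.eligCap (M.rv 5) S (⟨i, hi⟩, true) +
    N.eligCap (M.rv 5) S (⟨i, hi⟩, false) else 0 with hg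
  obtain ⟨M₁, τ, hex, ⟨h1, h2, h3, h4, h5, h6, h7⟩, hτ⟩ := exec_forLoop_straight (N := N) 26 (.var 1)
    (fun j M' => M'.nv 1 = m ∧ M'.na = M.na ∧ M'.ra 1 = M.ra 1 ∧ M'.ra 7 = M.ra 7 ∧
      M'.rv 5 = M.rv 5 ∧ (∀ a : Arc m, (a.1 : ℕ) < j → M'.ra 2 (num a) = N.eligCap (M.rv 5) S a) ∧
      M'.rv 8 = 1 + ∑ i ∈ Finset.range j, g i) m 45 (P := block [
  .nset 27 (.add (.var 26) (.lit 1)), .nset 28 (.add (.var 1) (.var 27)),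
  .rset 11 (.sub (.arr 7 (.arr 2 (.var 27))) (.arr 7 (.arr 3 (.var 27)))),
  .rstore 2 (.var 27) (.up (.var 26) (.arr 1 (.var 26)) (.sub (.var 5) (.var 11))),
  .rstore 2 (.var 28) (.down (.var 26) (.arr 1 (.var 26)) (.sub (.lit 0) (.var 11))),
  .rset 8 (.add (.var 8) (.add (.arr 2 (.var 27)) (.arr 2 (.var 28))))]) (by decide) rfl
    (fun j M' hI => hI.1)
    (by
      rintro j M₁ hj ⟨h1, h2, h3, h4, h5, h6, h7⟩ hi
      have e1 : G.tl (j + 1) = N.src ⟨j, hj⟩ + 1 := h.tl (⟨j, hj⟩, true)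
      have e2 : G.hd (j + 1) = N.dst ⟨j, hj⟩ + 1 := h.hd (⟨j, hj⟩, true)
      have e3 : M.ra 1 j = S.x ⟨j, hj⟩ := hS.x ⟨j, hj⟩
      have e4 := hS.p (N.src ⟨j, hj⟩)
      have e5 := hS.p (N.dst ⟨j, hj⟩)
      refine ⟨by simp [block, Prog.sem, h1], by simp [block, Prog.sem, h2],
        by ext; simp [block, Prog.sem, h3], by ext; simp [block, Prog.sem, h4],
        by simp [block, Prog.sem, h5], ?_, ?_⟩
      · rintro ⟨⟨i, him⟩, b⟩ hij
        by_cases hij' : i = j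
        · subst hij'
          cases b
          · simp [block, Prog.sem, NExp.eval, RExp.eval, hi, h1, h2, h3, h4, h5, h.stored.tl,
              h.stored.hd, e1, e2, e3, e4, e5, hj, num, Network.eligCap, add_assoc]
          · simp [block, Prog.sem, NExp.eval, RExp.eval, hi, h1, h2, h3, h4, h5, h.stored.tl,
              h.stored.hd, e1, e2, e3, e4, e5, hj, num, Network.eligCap]
            intro h0
            omega
        · have h8 := h6 (⟨i, him⟩, b) (by simp only at hij ⊢; omega)
          have e6 : num (⟨i, him⟩, b) ≠ j + 1 := by simp only [num]; split_ifs <;> omega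
          have e7 : num (⟨i, him⟩, b) ≠ m + (j + 1) := by simp only [num]; split_ifs <;> omega
          simpa [block, Prog.sem, NExp.eval, RExp.eval, hi, h1, e6, e7] using h8
      · rw [Finset.sum_range_succ]
        have e8 : g j = _ := dif_pos hj
        rw [e8]
        simp [block, Prog.sem, NExp.eval, RExp.eval, hi, h1, h2, h3, h4, h5, h7, h.stored.tl,
              h.stored.hd, e1, e2, e3, e4, e5, hj, Network.eligCap, add_assoc]
        intro h0
        exact absurd h0 (by omega))
    (M.setR 8 1) ⟨by simp [h.edges], by simp, by simp, by simp, by simp, by simp, by simp⟩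
  have hcap : ∀ a : Arc m, M₁.ra 2 (num a) = N.eligCap (M.rv 5) S a := fun a => h6 a a.1.2
  have e6 : M₁.nv 6 = G.A := (hex.nv rfl).trans h.stored.A
  have ex1 : Exec N (.rset 8 (.lit 1)) M (M.setR 8 1) 2 := by
    simpa [Mem.setR, RExp.eval, RExp.size] using Exec.rset (N := N) M 8 (.lit 1)
  have ex2 : Exec N (.rstore 2 (.var 6) (.var 8)) M₁ (M₁.setRA 2 G.A (M₁.rv 8)) 3 := by
    simpa [Mem.setRA, RExp.eval, RExp.size, NExp.eval, NExp.size, e6] using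
      Exec.rstore (N := N) M₁ 2 (.var 6) (.var 8)
  have hne : ∀ a : Arc m, num a ≠ G.A := fun a => by
    have := Finset.mem_Ico.1 (num_mem a)
    rw [h.A]
    omega
  refine ⟨_, _, .seq _ _ _ _ _ _ _ ex1 (.seq _ _ _ _ _ _ _ hex ex2), ?_, ?_, ?_⟩
  · intro a
    simp [hne, hcap]
  · rw [h.A, sum_num, ← h.A]
    simp only [Mem.setRA_ra, hne, true_and, if_false, hcap, if_true, h7]
    rw [Network.sum_arc, Finset.sum_range]
    have : ∀ e : Fin m, g e = N.eligCap (M.rv 5) S (e, true) + N.eligCap (M.rv 5) S (e, false) :=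
      fun e => dif_pos e.2
    simp only [this]
    linarith
  · simp only [NExp.size] at hτ
    push_cast at hτ ⊢
    have : (0 : ℝ) ≤ m := Nat.cast_nonneg _
    linarith

/-- Augment the flow. -/
def applyFlow : Prog := .forLoop 26 (.var 1) (block [
  .nset 27 (.add (.var 26) (.lit 1)), .nset 28 (.add (.var 1) (.var 27)),
  .rstore 1 (.var 26) (.sub (.add (.arr 1 (.var 26)) (.sub (.arr 2 (.var 27)) (.arr 3 (.var 27))))
    (.sub (.arr 2 (.var 28)) (.arr 3 (.var 28))))])

theorem applyFlow_spec {N : Network n m} {G : Arcs n} {M : Mem} {S : FlowPot n m}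
    (h : Layout N G M) (hS : Current S M) :
    ∃ M' τ, Exec N applyFlow M M' τ ∧
      Current (augment S fun a => M.ra 2 (num a) - M.ra 3 (num a)) M' ∧
      (τ : ℝ) ≤ 40 * (m + 1) := by
  obtain ⟨M₁, τ, hex, ⟨h1, h2, h3, h4⟩, hτ⟩ := exec_forLoop_straight (N := N) 26 (.var 1)
    (fun j M' => M'.nv 1 = m ∧ M'.ra 2 = M.ra 2 ∧ M'.ra 3 = M.ra 3 ∧ ∀ e : Fin m, M'.ra 1 e =
      if (e : ℕ) < j then (augment S fun a => M.ra 2 (num a) - M.ra 3 (num a)).x e else S.x e) m 32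
    (P := block [
  .nset 27 (.add (.var 26) (.lit 1)), .nset 28 (.add (.var 1) (.var 27)),
  .rstore 1 (.var 26) (.sub (.add (.arr 1 (.var 26)) (.sub (.arr 2 (.var 27)) (.arr 3 (.var 27))))
    (.sub (.arr 2 (.var 28)) (.arr 3 (.var 28))))]) (by decide) rfl
    (fun j M' hI => hI.1)
    (by
      rintro j M₁ hj ⟨h1, h2, h3, h4⟩ hi
      refine ⟨by simp [block, Prog.sem, h1], by ext; simp [block, Prog.sem, h2],
        by ext; simp [block, Prog.sem, h3], fun e => ?_⟩
      have h5 := h4 e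
      by_cases hej : (e : ℕ) = j
      · subst hej
        rw [if_neg (lt_irrefl _)] at h5
        simp [block, Prog.sem, NExp.eval, RExp.eval, hi, h1, h2, h3, h5, augment, num, add_assoc]
      · have : (e : ℕ) < j + 1 ↔ (e : ℕ) < j := by omega
        simpa [block, Prog.sem, NExp.eval, RExp.eval, hi, hej, this] using h5)
    M ⟨by simp [h.edges], rfl, rfl, by simpa using hS.x⟩
  refine ⟨M₁, τ, hex, ⟨fun e => by rw [h4, if_pos e.2], fun v => ?_⟩, ?_⟩
  · rw [hex.ra rfl]
    exact hS.p v
  · simp only [NExp.size] at hτ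
    push_cast at hτ
    linarith

/-- Lower the potentials of the unmarked vertices. -/
def lower : Prog := .forLoop 26 (.var 0) (block [.nset 27 (.add (.var 26) (.lit 1)),
  .cond (.neq (.arr 17 (.var 27)) (.lit 0))
    (.rstore 7 (.var 27) (.sub (.arr 7 (.var 27)) (.var 5))) .skip])

/-- The for loop over the vertices that updates the potentials. -/
theorem exec_potentials {N : Network n m} (P : Prog) (k : ℕ)
    (hP : P.straight = true ∧ P.cost ≤ k) (hw : (P.writesN 0 || P.writesN 26) = false)
    (q : Fin n → ℝ) {M : Mem} {S : FlowPot n m} (I : Mem → Prop) (hI : I (M.setN 26 0))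
    (hstep : ∀ v : Fin n, ∀ M, I M → M.nv 26 = v → I ((P.sem N M).setN 26 (v + 1)) ∧
      (P.sem N M).ra 1 = M.ra 1 ∧
      (M.ra 7 (v + 1) = S.p v → ∀ i, (P.sem N M).ra 7 i = if i = v + 1 then q v else M.ra 7 i))
    (hn : M.nv 0 = n) (hS : Current S M) :
    ∃ M' τ, Exec N (.forLoop 26 (.var 0) P) M M' τ ∧ Current ⟨S.x, q⟩ M' ∧
      (τ : ℝ) ≤ (n + 1) * (k + 8) := by
  simp only [Bool.or_eq_false_iff] at hw
  obtain ⟨M₁, τ, hex, ⟨h1, h2, h3, h4⟩, hτ⟩ := exec_forLoop_straight (N := N) 26 (.var 0) P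
    (fun j M' => M'.nv 0 = n ∧ I M' ∧ (∀ e : Fin m, M'.ra 1 e = S.x e) ∧ ∀ v : Fin n,
      M'.ra 7 (v + 1) = if (v : ℕ) < j then q v else S.p v) n k
    hP hw.2 (fun j M' hI => hI.1)
    (by
      rintro j M₁ hj ⟨h1, h2, h3, h4⟩ hi
      obtain ⟨h5, h6, h7⟩ := hstep ⟨j, hj⟩ M₁ h2 hi
      have h8 := h7 (by simpa using h4 ⟨j, hj⟩)
      refine ⟨by simp [Prog.sem_nv N hP.1 _ hw.1, h1], h5, by simpa [h6] using h3, fun v => ?_⟩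
      rw [Mem.setN_ra, h8]
      by_cases hv : (v : ℕ) = j
      · have : v = ⟨j, hj⟩ := Fin.ext hv
        subst this
        simp
      · have : (v : ℕ) < j + 1 ↔ (v : ℕ) < j := by omega
        simp [hv, this, h4])
    M ⟨by simp [hn], hI, by simpa using hS.x, by simpa using hS.p⟩
  refine ⟨M₁, τ, hex, ⟨h3, fun v => by rw [h4, if_pos v.2]⟩, ?_⟩
  simp only [NExp.size] at hτ
  push_cast at hτ
  linarith

open Classical in
theorem lower_spec {N : Network n m} {G : Arcs n} {M : Mem} {S : FlowPot n m}
    (h : Layout N G M) (hS : Current S M)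
    (hm : ∀ v : Fin n, M.na 17 (v + 1) = 0 ↔ ¬ N.Eligible (M.rv 5) S v) :
    ∃ M' τ, Exec N lower M M' τ ∧ Current (N.dualAdjust (M.rv 5) S) M' ∧
      (τ : ℝ) ≤ (n + 1) * 38 := by
  obtain ⟨M', τ, hex, hC, hτ⟩ := exec_potentials (N := N) (block [.nset 27 (.add (.var 26) (.lit 1)),
    .cond (.neq (.arr 17 (.var 27)) (.lit 0))
    (.rstore 7 (.var 27) (.sub (.arr 7 (.var 27)) (.var 5))) .skip]) 30 (by decide) (by decide)
    (fun v => if N.Eligible (M.rv 5) S v then S.p v else S.p v - M.rv 5)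
    (fun M' => M'.na 17 = M.na 17 ∧ M'.rv 5 = M.rv 5) (M := M) (S := S) ⟨rfl, rfl⟩
    (by
      rintro v M₁ ⟨h1, h2⟩ hi
      have h3 := hm v
      by_cases hv : N.Eligible (M.rv 5) S v
      · rw [iff_false_right (not_not.2 hv)] at h3
        refine ⟨?_, ?_, fun h4 i => ?_⟩
        · simp [block, Prog.sem, BExp.Holds, NExp.eval, hi, h1, h2, h3]
        · simp [block, Prog.sem, BExp.Holds, NExp.eval, hi, h1, h3]
        · simp only [block, Prog.sem, BExp.Holds, NExp.eval, Mem.setN_na, Mem.setN_nv, if_true, hi, h1,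
            h3, if_false, Mem.setN_ra, hv]
          split_ifs with h5
          · rw [h5, h4]
          · rfl
      · rw [iff_true_right hv] at h3
        refine ⟨?_, ?_, fun h4 i => ?_⟩
        · simp [block, Prog.sem, BExp.Holds, NExp.eval, hi, h1, h2, h3]
        · ext
          simp [block, Prog.sem, BExp.Holds, NExp.eval, hi, h1, h3]
        · simp [block, Prog.sem, BExp.Holds, NExp.eval, RExp.eval, hi, h1, h2, h3, hv, h4])
    h.stored.n hS
  refine ⟨M', τ, hex, hC, hτ.trans (by norm_num)⟩

/-- Clear the marks. -/
def resetMarks : Prog := .forLoop 26 (.var 0) (block [.nset 27 (.add (.var 26) (.lit 1)),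
  .nstore 17 (.var 27) (.lit 0)])

/-- Mark and enqueue the head of the arc in register `29` if the arc is eligible. -/
def reachStep : Prog := .cond (.and (.rlt (.lit 0) (.arr 2 (.var 29)))
    (.and (.nlt (.var 29) (.var 6)) (.neq (.arr 17 (.arr 3 (.var 29))) (.lit 0))))
  (block [.nstore 17 (.arr 3 (.var 29)) (.lit 1), .nstore 15 (.var 31) (.arr 3 (.var 29)),
    .nset 31 (.add (.var 31) (.lit 1))]) .skip

/-- Mark the eligible vertices. -/
def reach : Prog := block [resetMarks, .nstore 17 (.var 4) (.lit 1), .nstore 15 (.lit 0) (.var 4),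
  .nset 31 (.lit 1), search reachStep]

theorem resetMarks_spec (N : Network n m) {M : Mem} (hn : M.nv 0 = n) :
    ∃ M' τ, Exec N resetMarks M M' τ ∧ (∀ v : Fin n, M'.na 17 (v + 1) = 0) ∧
      (τ : ℝ) ≤ (n + 1) * 16 := by
  obtain ⟨M₁, τ, hex, ⟨h1, h2⟩, hτ⟩ := exec_forLoop_straight (N := N) 26 (.var 0)
    (block [.nset 27 (.add (.var 26) (.lit 1)), .nstore 17 (.var 27) (.lit 0)])
    (fun j M' => M'.nv 0 = n ∧ ∀ v : Fin n, (v : ℕ) < j → M'.na 17 (v + 1) = 0) n 8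
    (by decide) (by decide) (fun j M' hI => hI.1)
    (by
      rintro j M₁ hj ⟨h1, h2⟩ hi
      refine ⟨by simp [block, Prog.sem, h1], fun v hv => ?_⟩
      simp only [block, Prog.sem, NExp.eval, Mem.setN_na, Mem.setNA_na, Mem.setN_nv, if_true, hi]
      split_ifs with h3
      · rfl
      · exact h2 v (by
          simp only [true_and] at h3
          omega))
    M ⟨by simp [hn], by simp⟩
  refine ⟨M₁, τ, hex, fun v => h2 v v.2, hτ.trans ?_⟩
  simp only [NExp.size]
  push_cast
  linarith

/-- The marks mirror membership in the queue. Enqueued vertices are eligible, and the queue is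
closed under arcs of positive capacity; the return arc is excluded by the comparison with register
6. -/
theorem reach_spec {N : Network n m} {G : Arcs n} {M : Mem} {S : FlowPot n m} {δ : ℝ}
    (h : Layout N G M) (hc : ∀ a, M.ra 2 (num a) = N.eligCap δ S a) :
    ∃ M' τ, Exec N reach M M' τ ∧ (∀ v : Fin n, M'.na 17 (v + 1) = 0 ↔ ¬ N.Eligible δ S v) ∧
      (τ : ℝ) ≤ (G.A + n + 1) * 90 := by
  obtain ⟨M₁, τ₁, hex₁, hm₁, hτ₁⟩ := resetMarks_spec N h.stored.n
  have h₁ := h.exec hex₁ rfl rfl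
  set M₂ := ((M₁.setNA 17 G.s 1).setNA 15 0 G.s).setN 31 1 with hM₂
  have e1 := Exec.nstore (N := N) M₁ 17 (.var 4) (.lit 1)
  have e2 := Exec.nstore (N := N) (M₁.setNA 17 G.s 1) 15 (.lit 0) (.var 4)
  have e3 := Exec.nset (N := N) ((M₁.setNA 17 G.s 1).setNA 15 0 G.s) 31 (.lit 1)
  simp only [NExp.eval, h₁.stored.s] at e1
  simp only [NExp.eval, Mem.setNA_nv, h₁.stored.s] at e2
  have h₂ : Layout N G M₂ := ((h₁.exec e1 rfl rfl).exec e2 rfl rfl).exec e3 rfl rfl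
  have hra : M₂.ra 2 = M.ra 2 := hex₁.ra rfl
  obtain ⟨M₃, τ₃, L, hex₃, hL₀, hQ, ⟨-, hmk, hsound, hcomp⟩, hτ₃⟩ := exec_search N (G := G) reachStep 30
    (by decide) rfl rfl
    (fun Pr L M' => M'.ra 2 = M.ra 2 ∧ (∀ v : Fin n, M'.na 17 (v + 1) = 0 ↔ (v : ℕ) + 1 ∉ L) ∧
      (∀ v : Fin n, (v : ℕ) + 1 ∈ L → N.Eligible δ S v) ∧
      ∀ a : Arc m, num a ∈ Pr → 0 < N.eligCap δ S a → (N.head a : ℕ) + 1 ∈ L)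
    (by rintro Pr L M' i v - ⟨h1, h2, h3, h4⟩; exact ⟨h1, h2, h3, h4⟩)
    (by
      rintro Pr L M' hS hQ ⟨h1, h2, h3, h4⟩ hA hPr htl
      by_cases hb : M'.nv 29 = G.A
      · have hsem : reachStep.sem N M' = M' := by
          simp [reachStep, Prog.sem, BExp.Holds, NExp.eval, hb, hS.A]
        rw [hsem]
        refine ⟨L, List.prefix_rfl, hQ, h1, h2, h3, fun a ha hpos => h4 a ?_ hpos⟩
        refine (Finset.mem_insert.1 ha).resolve_left fun h5 => ?_
        have := Finset.mem_Ico.1 (num_mem a)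
        rw [h5, hb, h.A] at this
        omega
      · have hlt : M'.nv 29 < G.A := lt_of_le_of_ne (Finset.mem_Icc.1 hA).2 hb
        obtain ⟨a, ha⟩ := exists_num (m := m) (b := M'.nv 29)
          (Finset.mem_Ico.2 ⟨(Finset.mem_Icc.1 hA).1, by rw [← h.A]; exact hlt⟩)
        have hhd : G.hd (M'.nv 29) = N.head a + 1 := by rw [← ha, h.hd]
        have hcap : M'.ra 2 (M'.nv 29) = N.eligCap δ S a := by rw [h1, ← ha, hc]
        have hinj : ∀ a' : Arc m, num a' = M'.nv 29 → a' = a := by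
          rintro ⟨e, b⟩ h5
          rw [← ha] at h5
          obtain ⟨e', b'⟩ := a
          have := e.2
          have := e'.2
          unfold num at h5
          cases b <;> cases b' <;> simp at h5 <;> first
            | (rw [Fin.ext h5]) | omega
        rw [← ha, h.tl] at htl
        by_cases hgo : 0 < N.eligCap δ S a ∧ (N.head a : ℕ) + 1 ∉ L
        · have hmk := (h2 (N.head a)).2 hgo.2
          have hsem : reachStep.sem N M' = ((M'.setNA 17 (N.head a + 1) 1).setNA 15 L.length
              (N.head a + 1)).setN 31 (L.length + 1) := by
            simp [reachStep, Prog.sem, BExp.Holds, NExp.eval, RExp.eval, hS.A, hS.hd, hhd, hcap, hgo.1,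
              hmk, hlt, block, hQ.len]
          rw [hsem]
          refine ⟨L ++ [(N.head a : ℕ) + 1], List.prefix_append _ _, hQ.push hgo.2 ?_ ?_ ?_, h1, ?_, ?_, ?_⟩
          · simp
          · simp
          · intro i; simp
          · intro v
            have := h2 v
            by_cases hv : (v : ℕ) = N.head a <;> simp [hv, this]
          · intro v hv
            rcases List.mem_append.1 hv with hv | hv
            · exact h3 v hv
            · have : v = N.head a := Fin.ext (by simpa using hv)
              rw [this]
              exact (h3 _ htl).tail ⟨a, rfl, rfl, hgo.1⟩
          · intro a' ha' hpos
            rcases Finset.mem_insert.1 ha' with h5 | h5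
            · rw [hinj a' h5]; simp
            · exact List.mem_append_left _ (h4 a' h5 hpos)
        · have hsem : reachStep.sem N M' = M' := by
            rw [not_and, not_not] at hgo
            by_cases hpos : 0 < N.eligCap δ S a
            · have : ¬ M'.na 17 (N.head a + 1) = 0 := by rw [h2]; exact not_not.2 (hgo hpos)
              simp [reachStep, Prog.sem, BExp.Holds, NExp.eval, RExp.eval, hS.hd, hhd, this]
            · simp [reachStep, Prog.sem, BExp.Holds, NExp.eval, RExp.eval, hcap, hpos]
          rw [hsem]
          refine ⟨L, List.prefix_rfl, hQ, h1, h2, h3, fun a' ha' hpos => ?_⟩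
          rcases Finset.mem_insert.1 ha' with h5 | h5
          · rw [hinj a' h5] at hpos ⊢
            by_contra hn
            exact hgo ⟨hpos, hn⟩
          · exact h4 a' h5 hpos)
    h₂.stored (M := M₂) (L₀ := [G.s]) ⟨by simp [M₂], by
        intro i hi
        have : i = 0 := by simpa using hi
        subst this
        simp [M₂], by simp, by simpa using Finset.mem_Icc.1 G.s_mem⟩
    ⟨hra, by
      intro v
      have := hm₁ v
      by_cases hv : (v : ℕ) = N.s <;> simp [M₂, hv, h.s, this], by
      intro v hv
      have : v = N.s := Fin.ext (by simpa [h.s] using hv)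
      rw [this]
      exact .refl, by simp⟩
  refine ⟨M₃, _, .seq _ _ _ _ _ _ _ hex₁ (.seq _ _ _ _ _ _ _ e1 (.seq _ _ _ _ _ _ _ e2
    (.seq _ _ _ _ _ _ _ e3 hex₃))), fun v => ?_, ?_⟩
  · rw [hmk, not_iff_not]
    refine ⟨hsound v, fun hv => ?_⟩
    induction hv with
    | refl =>
      rw [← h.s]
      exact hL₀.subset (by simp)
    | tail _ hstep ih =>
      obtain ⟨a, rfl, rfl, hpos⟩ := hstep
      refine hcomp a (Finset.mem_filter.2 ⟨?_, by rwa [h.tl]⟩) hpos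
      have := Finset.mem_Ico.1 (num_mem a)
      rw [h.A]
      exact Finset.mem_Icc.2 ⟨this.1, this.2.le⟩
  · simp only [NExp.size]
    push_cast at hτ₃ ⊢
    have : (0 : ℝ) ≤ G.A := Nat.cast_nonneg _
    linarith

/-! ### Rounds and scales -/

theorem Network.eligCap_nonneg (N : Network n m) (δ : ℝ) (S : FlowPot n m) (a : Arc m) :
    0 ≤ N.eligCap δ S a := by
  unfold Network.eligCap
  split_ifs
  · exact Real.sSup_nonneg fun Δ hΔ => hΔ.1
  · exact Real.sSup_nonneg fun Δ hΔ => hΔ.1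

theorem Layout.sum_filter {N : Network n m} {G : Arcs n} {M : Mem} (h : Layout N G M) (F : ℕ → ℝ)
    {g : ℕ → ℕ} {g' : Arc m → Fin n} (hg : ∀ a, g (num a) = g' a + 1) (v : Fin n) :
    ∑ a ∈ Finset.Icc 1 G.A with g a = v + 1, F a =
      ∑ a with g' a = v, F (num a) + if g G.A = v + 1 then F G.A else 0 := by
  rw [Finset.sum_filter, Finset.sum_filter, h.A, Finset.sum_Icc_succ_top (by omega)]
  congr 1
  have : Finset.Icc 1 (2 * m) = Finset.Ico 1 (2 * m + 1) := by ext; simp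
  rw [this, sum_num]
  refine Finset.sum_congr rfl fun a _ => ?_
  simp [hg, Fin.ext_iff]

/-- Dropping the return arc from the circulation leaves conservation intact away from the source and
the sink, and makes the value of the flow equal to the nonnegative flow on the return arc. -/
theorem Layout.isBlocking {N : Network n m} {G : Arcs n} {M : Mem} (h : Layout N G M)
    {c : Arc m → ℝ} {C r : ℕ → ℝ} (hC : ∀ a, C (num a) = c a)
    (h0 : ∀ a ∈ Finset.Icc 1 G.A, 0 ≤ r a) (h1 : ∀ a ∈ Finset.Icc 1 G.A, r a ≤ C a)
    (h2 : ∀ x ∈ Finset.Icc 1 n, ∑ a ∈ Finset.Icc 1 G.A with G.tl a = x, (C a - r a) =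
      ∑ a ∈ Finset.Icc 1 G.A with G.hd a = x, (C a - r a))
    (h3 : ¬ Relation.ReflTransGen (fun u v => ∃ a ∈ Finset.Icc 1 G.A, G.tl a = u ∧ G.hd a = v ∧
      0 < r a) G.s G.t) : N.IsBlocking c fun a => C (num a) - r (num a) := by
  have hnum : ∀ a : Arc m, num a ∈ Finset.Icc 1 G.A := fun a => by
    have := Finset.mem_Ico.1 (num_mem a)
    rw [h.A]
    exact Finset.mem_Icc.2 ⟨this.1, this.2.le⟩
  have hv : ∀ v : Fin n, (v : ℕ) + 1 ∈ Finset.Icc 1 n := fun v => by simp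
  have key : ∀ v, _ := fun v : Fin n => h2 _ (hv v)
  simp only [h.sum_filter _ h.tl, h.sum_filter _ h.hd, G.tl_A, G.hd_A, h.s, h.t, add_left_inj,
    Fin.val_inj] at key
  refine ⟨fun a => sub_nonneg.2 (h1 _ (hnum a)), fun a => ?_, fun v hs ht => ?_, ?_, fun hre => h3 ?_⟩
  · rw [hC]
    linarith [h0 _ (hnum a)]
  · have := key v
    rw [if_neg hs.symm, if_neg ht.symm, add_zero, add_zero] at this
    exact this.symm
  · have h4 := key N.s
    have hA := h1 G.A (Finset.mem_Icc.2 ⟨G.A_pos, le_rfl⟩)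
    have hst : N.t ≠ N.s := fun he => G.s_ne (by rw [h.s, h.t, he])
    rw [if_pos rfl, if_neg hst, add_zero] at h4
    linarith
  · rw [h.s, h.t]
    refine Relation.ReflTransGen.lift (fun v : Fin n => (v : ℕ) + 1) ?_ _ _ hre
    rintro u v ⟨a, rfl, rfl, ha⟩
    refine ⟨num a, hnum a, h.tl a, h.hd a, ?_⟩
    rw [hC] at ha
    linarith

/-- Send a blocking flow in the eligible graph and adjust the potentials. -/
def round : Prog := block [eligCaps, blockFlow, applyFlow, eligCaps, reach, lower]

/-- The eligible capacities are computed twice, first for the blocking flow and then for the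
augmented flow, on which the search for the vertices to be lowered depends. -/
theorem round_spec {N : Network n m} {G : Arcs n} {M : Mem} {S : FlowPot n m} (h : Layout N G M)
    (hS : Current S M) : ∃ M' τ z, Exec N round M M' τ ∧ N.IsBlocking (N.eligCap (M.rv 5) S) z ∧
      Current (N.dualAdjust (M.rv 5) (augment S z)) M' ∧
      (τ : ℝ) ≤ 3000400 * ((Real.logb 2 n + 1) * (G.A + n)) := by
  obtain ⟨M₁, τ₁, hex₁, hc, hlt, hτ₁⟩ := eligCaps_spec h hS
  have hL₁ := h.exec hex₁ rfl rfl
  have hS₁ := hS.exec hex₁ rfl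
  have hnn : ∀ a ∈ Finset.Ico 1 G.A, 0 ≤ M₁.ra 2 a := fun a ha => by
    rw [h.A] at ha
    obtain ⟨a, rfl⟩ := exists_num ha
    rw [hc]
    exact N.eligCap_nonneg _ _ _
  obtain ⟨M₂, τ₂, hex₂, h0, h1, h2, h3, hτ₂⟩ := blockFlow_spec N hL₁.stored (fun a ha => by
    rcases (Finset.mem_Icc.1 ha).2.eq_or_lt with h4 | h4
    · rw [h4]
      exact (Finset.sum_nonneg hnn).trans hlt.le
    · exact hnn a (Finset.mem_Ico.2 ⟨(Finset.mem_Icc.1 ha).1, h4⟩)) hlt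
  have hL₂ := hL₁.exec hex₂ rfl rfl
  have hS₂ := hS₁.exec hex₂ rfl
  have hz := hL₁.isBlocking hc h0 h1 h2 h3
  obtain ⟨M₃, τ₃, hex₃, hS₃, hτ₃⟩ := applyFlow_spec hL₂ hS₂
  have hL₃ := hL₂.exec hex₃ rfl rfl
  have e2 : M₂.ra 2 = M₁.ra 2 := hex₂.ra rfl
  rw [e2] at hS₃
  obtain ⟨M₄, τ₄, hex₄, hc₄, -, hτ₄⟩ := eligCaps_spec hL₃ hS₃
  have hL₄ := hL₃.exec hex₄ rfl rfl
  have hS₄ := hS₃.exec hex₄ rfl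
  obtain ⟨M₅, τ₅, hex₅, hm, hτ₅⟩ := reach_spec hL₄ hc₄
  have hL₅ := hL₄.exec hex₅ rfl rfl
  have hS₅ := hS₄.exec hex₅ rfl
  have e3 : M₃.rv 5 = M.rv 5 := by
    rw [hex₃.rv rfl, hex₂.rv rfl, hex₁.rv rfl]
  have e5 : M₅.rv 5 = M.rv 5 := by rw [hex₅.rv rfl, hex₄.rv rfl, e3]
  obtain ⟨M₆, τ₆, hex₆, hS₆, hτ₆⟩ := lower_spec hL₅ hS₅ (by rw [e5, ← e3]; exact hm)
  rw [e5] at hS₆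
  refine ⟨M₆, _, _, .seq _ _ _ _ _ _ _ hex₁ (.seq _ _ _ _ _ _ _ hex₂ (.seq _ _ _ _ _ _ _ hex₃
    (.seq _ _ _ _ _ _ _ hex₄ (.seq _ _ _ _ _ _ _ hex₅ hex₆)))), hz, hS₆, ?_⟩
  have hn : (1 : ℝ) ≤ n := by
    have := Finset.mem_Icc.1 G.s_mem
    exact_mod_cast this.1.trans this.2
  have hA : (G.A : ℝ) = 2 * m + 1 := by rw [h.A]; push_cast; ring
  have hlg : 0 ≤ Real.logb 2 n := Real.logb_nonneg (by norm_num) hn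
  have hAn : (0 : ℝ) ≤ G.A + n := by positivity
  have h6 : (G.A : ℝ) + n ≤ (Real.logb 2 n + 1) * (G.A + n) :=
    le_mul_of_one_le_left hAn (by linarith)
  push_cast
  have : (0 : ℝ) ≤ m := Nat.cast_nonneg _
  linarith

/-- One scale. -/
def innerLoop : Prog := .loop (.not (.req (.arr 7 (.var 5)) (.var 6))) round

/-- `j` is the exact number of rounds that remain, as each round lowers the potential of the sink by
δ. -/
theorem innerLoop_spec {N : Network n m} {wmin wmax : ℝ} (hN : N.IsConcave wmin wmax) {G : Arcs n}
    {δ θ : ℝ} (hδ : 0 < δ) : ∀ (j : ℕ) {M : Mem} {S : FlowPot n m}, Layout N G M → Current S M →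
    M.rv 5 = δ → M.rv 6 = θ → N.Inv δ S → S.p N.t = θ + j * δ → ∃ M' τ S', Exec N innerLoop M M' τ ∧
      Current S' M' ∧ N.InnerLoop δ θ S S' ∧ N.Inv δ S' ∧ S'.p N.t = θ ∧
      (τ : ℝ) ≤ j * (3000400 * ((Real.logb 2 n + 1) * (G.A + n)) + 6) + 6
  | 0, M, S, h, hS, h5, h6, hI, hp => by
    have hp' : S.p N.t = θ := by simpa using hp
    refine ⟨M, _, S, .loop_false _ _ _ ?_, hS, .done S hp', hI, hp', by
      simp only [BExp.size, RExp.size, NExp.size]; norm_num⟩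
    simp [BExp.Holds, RExp.eval, NExp.eval, h.stored.t, h.t, hS.p, h6, hp']
  | j + 1, M, S, h, hS, h5, h6, hI, hp => by
    obtain ⟨M₁, τ₁, z, hex₁, hz, hS₁, hτ₁⟩ := round_spec h hS
    rw [h5] at hz hS₁
    have hne : S.p N.t ≠ θ := by
      rw [hp]
      have : (0 : ℝ) < (j + 1 : ℕ) * δ := by positivity
      linarith
    obtain ⟨M', τ, S', hex, hS', hl, hI', hp', hτ⟩ := innerLoop_spec hN hδ j (h.exec hex₁ rfl rfl) hS₁
      ((hex₁.rv rfl).trans h5) ((hex₁.rv rfl).trans h6) (hN.inv_step hδ hI hz) (by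
        rw [hN.dualAdjust_t hδ hI hz, hp]
        push_cast
        ring)
    refine ⟨M', _, S', .loop_true _ _ _ _ _ _ _ ?_ hex₁ hex, hS', .step S S' z hne hz hl, hI', hp', ?_⟩
    · simpa [BExp.Holds, RExp.eval, NExp.eval, h.stored.t, h.t, hS.p, h6] using hne
    · simp only [BExp.size, RExp.size, NExp.size]
      push_cast
      linarith

/-- Rescale the potentials. -/
def rescale : Prog := .forLoop 26 (.var 0) (block [.nset 27 (.add (.var 26) (.lit 1)),
  .rstore 7 (.var 27) (.add (.arr 7 (.var 27)) (.mul (.var 5) (.arr 8 (.var 27))))])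

theorem rescale_spec {N : Network n m} {G : Arcs n} {M : Mem} {S : FlowPot n m}
    (h : Layout N G M) (hS : Current S M) : ∃ M' τ, Exec N rescale M M' τ ∧
      Current (N.dualRescale (M.rv 5) S) M' ∧ (τ : ℝ) ≤ (n + 1) * 28 := by
  obtain ⟨M', τ, hex, hC, hτ⟩ := exec_potentials (N := N) (block [.nset 27 (.add (.var 26) (.lit 1)),
    .rstore 7 (.var 27) (.add (.arr 7 (.var 27)) (.mul (.var 5) (.arr 8 (.var 27))))]) 20 (by decide)
    (by decide) (fun v => S.p v + M.rv 5 * N.level v)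
    (fun M' => M'.ra 8 = M.ra 8 ∧ M'.rv 5 = M.rv 5) (M := M) (S := S) ⟨rfl, rfl⟩
    (by
      rintro v M₁ ⟨h1, h2⟩ hi
      refine ⟨⟨by ext; simp [block, Prog.sem, h1], by simp [block, Prog.sem, h2]⟩,
        by ext; simp [block, Prog.sem], fun h4 i => ?_⟩
      simp [block, Prog.sem, NExp.eval, RExp.eval, hi, h1, h2, h4, h.level])
    h.stored.n hS
  exact ⟨M', τ, hex, hC, hτ.trans (by norm_num)⟩

/-- A scale that is not the last one. -/
def scale : Prog := block [.rset 6 (.div (.mul (.var 7) (.var 9)) (.lit 2)), innerLoop, rescale,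
  .rset 9 (.div (.var 9) (.lit 2)), .rset 5 (.div (.var 5) (.lit 2))]

theorem scale_spec {N : Network n m} {wmin wmax : ℝ} (hN : N.IsConcave wmin wmax) {G : Arcs n}
    {δ θ : ℝ} (hδ : 0 < δ) (j : ℕ) {M : Mem} {S : FlowPot n m} (h : Layout N G M) (hS : Current S M)
    (h5 : M.rv 5 = δ) (h6 : M.rv 7 * M.rv 9 / 2 = θ) (hI : N.Inv δ S)
    (hp : S.p N.t = θ + j * δ) : ∃ M' τ S', Exec N scale M M' τ ∧ Layout N G M' ∧
      Current (N.dualRescale δ S') M' ∧ N.InnerLoop δ θ S S' ∧ N.Inv (δ / 2) (N.dualRescale δ S') ∧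
      S'.p N.t = θ ∧ M'.rv 5 = δ / 2 ∧ M'.rv 9 = M.rv 9 / 2 ∧ M'.rv 7 = M.rv 7 ∧ M'.rv 0 = M.rv 0 ∧
      (τ : ℝ) ≤ j * (3000400 * ((Real.logb 2 n + 1) * (G.A + n)) + 6) + 28 * n + 60 := by
  have ex1 : Exec N (.rset 6 (.div (.mul (.var 7) (.var 9)) (.lit 2))) M (M.setR 6 θ) 6 := by
    simpa [Mem.setR, RExp.eval, RExp.size, h6] using
      Exec.rset (N := N) M 6 (.div (.mul (.var 7) (.var 9)) (.lit 2))
  obtain ⟨M₁, τ₁, S', hex₁, hS₁, hl, hI₁, hp₁, hτ₁⟩ := innerLoop_spec hN hδ j (θ := θ)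
    (h.exec ex1 rfl rfl) (hS.exec ex1 rfl) (by simp [h5]) (by simp) hI hp
  have hL₁ := (h.exec ex1 rfl rfl).exec hex₁ rfl rfl
  obtain ⟨M₂, τ₂, hex₂, hS₂, hτ₂⟩ := rescale_spec hL₁ hS₁
  have e5 : M₁.rv 5 = δ := by rw [hex₁.rv rfl]; simp [h5]
  rw [e5] at hS₂
  have ex3 : Exec N (.rset 9 (.div (.var 9) (.lit 2))) M₂ (M₂.setR 9 (M₂.rv 9 / 2)) 4 := by
    simpa [Mem.setR, RExp.eval, RExp.size] using Exec.rset (N := N) M₂ 9 (.div (.var 9) (.lit 2))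
  have ex4 : Exec N (.rset 5 (.div (.var 5) (.lit 2))) (M₂.setR 9 (M₂.rv 9 / 2))
      ((M₂.setR 9 (M₂.rv 9 / 2)).setR 5 (M₂.rv 5 / 2)) 4 := by
    simpa [Mem.setR, RExp.eval, RExp.size] using
      Exec.rset (N := N) (M₂.setR 9 (M₂.rv 9 / 2)) 5 (.div (.var 5) (.lit 2))
  have f : ∀ i, innerLoop.writesR i = false → rescale.writesR i = false → i ≠ 6 →
      M₂.rv i = M.rv i := by
    intro i h1 h2 h3
    rw [hex₂.rv h2, hex₁.rv h1]
    simp [h3]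
  refine ⟨_, _, S', .seq _ _ _ _ _ _ _ ex1 (.seq _ _ _ _ _ _ _ hex₁ (.seq _ _ _ _ _ _ _ hex₂
    (.seq _ _ _ _ _ _ _ ex3 ex4))), ((hL₁.exec hex₂ rfl rfl).exec ex3 rfl rfl).exec ex4 rfl rfl,
    (hS₂.exec ex3 rfl).exec ex4 rfl, hl, hN.inv_rescale hδ hI₁, hp₁, ?_, ?_, ?_, ?_, ?_⟩
  · simp [f 5 rfl rfl (by decide), h5]
  · simp [f 9 rfl rfl (by decide)]
  · simp [f 7 rfl rfl (by decide)]
  · simp [f 0 rfl rfl (by decide)]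
  · push_cast
    linarith

/-- All scales but the last one. -/
def outerLoop : Prog := .loop (.rlt (.var 0) (.var 9)) scale

/-- The last scale. -/
def lastScale : Prog := .seq (.rset 6 (.lit 0)) innerLoop

/-- Register 9 holds W/2^i, which exceeds w_min exactly when i < T; so no logarithm has to be
computed. The start of each scale is at most D (2^(k+1) + 2) steps above 0, which bounds the rounds
of every scale. -/
theorem outerLoop_spec {N : Network n m} {wmin wmax W : ℝ} (hN : N.IsConcave wmin wmax) {G : Arcs n}
    {k T : ℕ} (hW : W = 2 ^ T * wmin) : ∀ (d i : ℕ) {M : Mem} {S : FlowPot n m}, i + d = T →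
    Layout N G M → Current S M → M.rv 5 = stepSize W (1 / 2 ^ (k + 1)) i → M.rv 9 = W / 2 ^ i →
    M.rv 7 = N.depth → M.rv 0 = wmin → N.Inv (stepSize W (1 / 2 ^ (k + 1)) i) S →
    (∃ r : ℕ, r ≤ 2 ∧ S.p N.t = N.depth * (2 ^ (k + 1) + r) * stepSize W (1 / 2 ^ (k + 1)) i) →
    ∃ M₁ τ₁ M' τ₂ S', Exec N outerLoop M M₁ τ₁ ∧ Exec N lastScale M₁ M' τ₂ ∧ Current S' M' ∧
      N.OuterLoop W (1 / 2 ^ (k + 1)) T i S S' ∧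
      (τ₁ : ℝ) + τ₂ ≤ (d + 1) * ((N.depth * (2 ^ (k + 1) + 2)) *
        (3000400 * ((Real.logb 2 n + 1) * (G.A + n)) + 6) + 28 * n + 100) := by
  have hw := hN.wmin_pos
  have hW0 : 0 < W := by rw [hW]; positivity
  have hε : (0 : ℝ) < 1 / 2 ^ (k + 1) := by positivity
  intro d
  induction d with
  | zero =>
    intro i M S hi h hS h5 h9 h7 h0 hI hp
    rw [add_zero] at hi
    subst hi
    obtain ⟨r, hr, hp⟩ := hp
    have ex1 : Exec N (.rset 6 (.lit 0)) M (M.setR 6 0) 2 := by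
      simpa [Mem.setR, RExp.eval, RExp.size] using Exec.rset (N := N) M 6 (.lit 0)
    obtain ⟨M₁, τ₁, S', hex₁, hS₁, hl, hI₁, hp₁, hτ₁⟩ := innerLoop_spec hN
      (Network.stepSize_pos hW0 hε i) (N.depth * (2 ^ (k + 1) + r)) (θ := 0)
      (h.exec ex1 rfl rfl) (hS.exec ex1 rfl) (by simp [h5]) (by simp) hI (by
        rw [hp]; push_cast; ring)
    refine ⟨M, _, M₁, _, S', .loop_false _ _ _ ?_, .seq _ _ _ _ _ _ _ ex1 hex₁, hS₁, .last _ _ hl, ?_⟩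
    · have : W / 2 ^ i = wmin := by rw [hW]; field_simp
      simp [BExp.Holds, RExp.eval, h9, h0, this]
    · simp only [BExp.size, RExp.size]
      have hr' : (r : ℝ) ≤ 2 := by exact_mod_cast hr
      have hn : (1 : ℝ) ≤ n := by
        have := Finset.mem_Icc.1 G.s_mem
        exact_mod_cast this.1.trans this.2
      have hlg : 0 ≤ Real.logb 2 n := Real.logb_nonneg (by norm_num) hn
      have h8 : (N.depth * (2 ^ (k + 1) + r) : ℝ) * (3000400 * ((Real.logb 2 n + 1) * (G.A + n)) + 6) ≤
          (N.depth * (2 ^ (k + 1) + 2)) * (3000400 * ((Real.logb 2 n + 1) * (G.A + n)) + 6) := by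
        gcongr
      push_cast at hτ₁ ⊢
      linarith
  | succ d ih =>
    intro i M S hi h hS h5 h9 h7 h0 hI hp
    obtain ⟨r, hr, hp⟩ := hp
    have hθ : (N.depth : ℝ) * W / 2 ^ (i + 1) = N.depth * 2 ^ k * stepSize W (1 / 2 ^ (k + 1)) i := by
      unfold stepSize
      rw [pow_succ, pow_succ]
      field_simp
    obtain ⟨M₁, τ₁, S₁, hex₁, hL₁, hS₁, hl, hI₁, hp₁, h5', h9', h7', h0', hτ₁⟩ := scale_spec hN
      (Network.stepSize_pos hW0 hε i) (N.depth * (2 ^ k + r)) (θ := N.depth * W / 2 ^ (i + 1)) h hS h5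
      (by rw [h7, h9, pow_succ]; field_simp) hI (by
        rw [hp, hθ, pow_succ]
        push_cast
        ring)
    rw [← Network.stepSize_succ] at h5' hI₁
    obtain ⟨M₂, τ₂, M', τ₃, S', hex₂, hex₃, hS', hout, hτ⟩ := ih (i + 1) (by omega) hL₁ hS₁ h5'
      (by rw [h9', h9, pow_succ]; field_simp) (h7'.trans h7) (h0'.trans h0) hI₁ ⟨2, le_rfl, by
        have : (N.dualRescale (stepSize W (1 / 2 ^ (k + 1)) i) S₁).p N.t =
          S₁.p N.t + stepSize W (1 / 2 ^ (k + 1)) i * N.depth := rfl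
        rw [this, hp₁, hθ, Network.stepSize_succ, pow_succ]
        push_cast
        ring⟩
    refine ⟨M₂, _, M', τ₃, S', .loop_true _ _ _ _ _ _ _ ?_ hex₁ hex₂, hex₃, hS',
      .next i _ _ _ (by omega) hl hout, ?_⟩
    · simp only [BExp.Holds, RExp.eval, h9, h0]
      rw [hW, lt_div_iff₀ (by positivity), ← hi, pow_add, pow_succ]
      have h1 : (1 : ℝ) ≤ 2 ^ d := one_le_pow₀ (by norm_num)
      have h2 : (0 : ℝ) < 2 ^ i * wmin := by positivity
      nlinarith
    · simp only [BExp.size, RExp.size]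
      have hr' : (r : ℝ) ≤ 2 := by exact_mod_cast hr
      have hn : (1 : ℝ) ≤ n := by
        have := Finset.mem_Icc.1 G.s_mem
        exact_mod_cast this.1.trans this.2
      have hlg : 0 ≤ Real.logb 2 n := Real.logb_nonneg (by norm_num) hn
      have hk : (2 : ℝ) ^ k ≤ 2 ^ (k + 1) := pow_le_pow_right₀ (by norm_num) (by omega)
      have h8 : (N.depth * (2 ^ k + r) : ℝ) * (3000400 * ((Real.logb 2 n + 1) * (G.A + n)) + 6) ≤
          (N.depth * (2 ^ (k + 1) + 2)) * (3000400 * ((Real.logb 2 n + 1) * (G.A + n)) + 6) := by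
        gcongr
      push_cast at hτ₁ hτ ⊢
      linarith
/-! ### Building the arcs -/

/-- Write the arcs and count the edges into every vertex. -/
def makeArcs : Prog := .forLoop 26 (.var 1) (block [
  .nset 27 (.add (.var 26) (.lit 1)), .nset 28 (.add (.var 1) (.var 27)),
  .nset 32 (.add (.arr 0 (.var 26)) (.lit 1)), .nset 33 (.add (.arr 1 (.var 26)) (.lit 1)),
  .nstore 2 (.var 27) (.var 32), .nstore 3 (.var 27) (.var 33),
  .nstore 2 (.var 28) (.var 33), .nstore 3 (.var 28) (.var 32),
  .nstore 16 (.var 33) (.add (.arr 16 (.var 33)) (.lit 1))])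

theorem makeArcs_spec (N : Network n m) {M : Mem} (h1 : M.nv 1 = m)
    (hsrc : ∀ e : Fin m, M.na 0 e = N.src e) (hdst : ∀ e : Fin m, M.na 1 e = N.dst e)
    (h16 : ∀ i, M.na 16 i = 0) :
    ∃ M' τ, Exec N makeArcs M M' τ ∧ (∀ a : Arc m, M'.na 2 (num a) = N.tail a + 1) ∧
      (∀ a : Arc m, M'.na 3 (num a) = N.head a + 1) ∧
      (∀ v : Fin n, M'.na 16 (v + 1) = (Finset.univ.filter fun e => N.dst e = v).card) ∧
      (τ : ℝ) ≤ (m + 1) * 58 := by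
  obtain ⟨M₁, τ, hex, ⟨-, -, -, h2, h3, h4⟩, hτ⟩ := exec_forLoop_straight (N := N) 26 (.var 1) (block [
  .nset 27 (.add (.var 26) (.lit 1)), .nset 28 (.add (.var 1) (.var 27)),
  .nset 32 (.add (.arr 0 (.var 26)) (.lit 1)), .nset 33 (.add (.arr 1 (.var 26)) (.lit 1)),
  .nstore 2 (.var 27) (.var 32), .nstore 3 (.var 27) (.var 33),
  .nstore 2 (.var 28) (.var 33), .nstore 3 (.var 28) (.var 32),
  .nstore 16 (.var 33) (.add (.arr 16 (.var 33)) (.lit 1))])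
    (fun j M' => M'.nv 1 = m ∧ M'.na 0 = M.na 0 ∧ M'.na 1 = M.na 1 ∧
      (∀ a : Arc m, (a.1 : ℕ) < j → M'.na 2 (num a) = N.tail a + 1) ∧
      (∀ a : Arc m, (a.1 : ℕ) < j → M'.na 3 (num a) = N.head a + 1) ∧
      ∀ v : Fin n, M'.na 16 (v + 1) =
        (Finset.univ.filter fun e : Fin m => N.dst e = v ∧ (e : ℕ) < j).card) m 50
    (by decide) (by decide) (fun j M' hI => hI.1)
    (by
      rintro j M₁ hj ⟨h1, h0, h0', h2, h3, h4⟩ hi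
      have e1 : M.na 0 j = N.src ⟨j, hj⟩ := hsrc ⟨j, hj⟩
      have e2 : M.na 1 j = N.dst ⟨j, hj⟩ := hdst ⟨j, hj⟩
      refine ⟨by simp [block, Prog.sem, h1], by ext; simp [block, Prog.sem, h0],
        by ext; simp [block, Prog.sem, h0'], ?_, ?_, ?_⟩
      · rintro ⟨⟨i, him⟩, b⟩ hij
        by_cases hij' : i = j
        · subst hij'
          cases b <;> simp [block, Prog.sem, NExp.eval, hi, h0, h0', h1, e1, e2, num, Network.tail,
            add_assoc]
          intro h5
          omega
        · have h5 := h2 (⟨i, him⟩, b) (by simp only at hij ⊢; omega)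
          have e6 : num (⟨i, him⟩, b) ≠ j + 1 := by simp only [num]; split_ifs <;> omega
          have e7 : num (⟨i, him⟩, b) ≠ m + (j + 1) := by simp only [num]; split_ifs <;> omega
          simpa [block, Prog.sem, NExp.eval, hi, h1, e6, e7] using h5
      · rintro ⟨⟨i, him⟩, b⟩ hij
        by_cases hij' : i = j
        · subst hij'
          cases b <;> simp [block, Prog.sem, NExp.eval, hi, h0, h0', h1, e1, e2, num, Network.head,
            add_assoc]
          intro h5
          omega
        · have h5 := h3 (⟨i, him⟩, b) (by simp only at hij ⊢; omega)
          have e6 : num (⟨i, him⟩, b) ≠ j + 1 := by simp only [num]; split_ifs <;> omega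
          have e7 : num (⟨i, him⟩, b) ≠ m + (j + 1) := by simp only [num]; split_ifs <;> omega
          simpa [block, Prog.sem, NExp.eval, hi, h1, e6, e7] using h5
      · intro v
        have h5 := h4 v
        by_cases hv : N.dst ⟨j, hj⟩ = v
        · have : (Finset.univ.filter fun e : Fin m => N.dst e = v ∧ (e : ℕ) < j + 1) =
              insert ⟨j, hj⟩ (Finset.univ.filter fun e : Fin m => N.dst e = v ∧ (e : ℕ) < j) := by
            ext e
            simp only [Finset.mem_filter, Finset.mem_univ, true_and, Finset.mem_insert, Fin.ext_iff]
            constructor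
            · rintro ⟨h6, h7⟩
              by_cases h8 : (e : ℕ) = j
              · exact .inl h8
              · exact .inr ⟨h6, by omega⟩
            · rintro (h6 | ⟨h6, h7⟩)
              · have : e = ⟨j, hj⟩ := Fin.ext h6
                rw [this, hv]
                exact ⟨rfl, Nat.lt_succ_self j⟩
              · exact ⟨h6, by omega⟩
          rw [this, Finset.card_insert_of_notMem (by simp), ← h5]
          simp [block, Prog.sem, NExp.eval, hi, h0, h0', h1, e1, e2, hv]
        · have : (Finset.univ.filter fun e : Fin m => N.dst e = v ∧ (e : ℕ) < j + 1) =
              Finset.univ.filter fun e : Fin m => N.dst e = v ∧ (e : ℕ) < j := by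
            refine Finset.filter_congr fun e _ => and_congr_right fun h6 => ?_
            have : (e : ℕ) ≠ j := by
              rintro rfl
              exact hv h6
            omega
          have hv' : (v : ℕ) ≠ N.dst ⟨j, hj⟩ := fun h6 => hv (Fin.ext h6.symm)
          rw [this, ← h5]
          simp [block, Prog.sem, NExp.eval, hi, h0, h0', h1, e1, e2, hv'])
    M ⟨by simp [h1], rfl, rfl, by simp, by simp, by simp [h16]⟩
  refine ⟨M₁, τ, hex, fun a => h2 a a.1.2, fun a => h3 a a.1.2, fun v => by rw [h4]; simp, hτ.trans ?_⟩
  simp only [NExp.size]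
  push_cast
  linarith

/-- Link the arcs with the same tail. -/
def makeLinks : Prog := .forLoop 26 (.var 6) (block [.nset 27 (.add (.var 26) (.lit 1)),
  .nset 32 (.arr 2 (.var 27)), .nstore 4 (.var 27) (.arr 5 (.var 32)),
  .nstore 5 (.var 32) (.var 27)])

/-- Arcs are prepended to the lists in increasing order, so every list is decreasing and its first
element is the largest arc with this tail. -/
theorem makeLinks_spec (N : Network n m) {M : Mem} {A : ℕ} (hA : M.nv 6 = A)
    (h5 : ∀ x, M.na 5 x = 0) :
    ∃ M' τ, Exec N makeLinks M M' τ ∧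
      (∀ x, (M'.na 5 x = 0 ∨ M'.na 5 x ∈ Finset.Icc 1 A ∧ M.na 2 (M'.na 5 x) = x) ∧
        ∀ a ∈ Finset.Icc 1 A, M.na 2 a = x → a ≤ M'.na 5 x) ∧
      (∀ a ∈ Finset.Icc 1 A, (M'.na 4 a = 0 ∨ M'.na 4 a ∈ Finset.Icc 1 A ∧
        M.na 2 (M'.na 4 a) = M.na 2 a) ∧ M'.na 4 a < a ∧
        ∀ b ∈ Finset.Icc 1 A, M.na 2 b = M.na 2 a → b < a → b ≤ M'.na 4 a) ∧
      (τ : ℝ) ≤ (A + 1) * 28 := by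
  obtain ⟨M₁, τ, hex, ⟨-, -, h2, h3⟩, hτ⟩ := exec_forLoop_straight (N := N) 26 (.var 6) (block [
  .nset 27 (.add (.var 26) (.lit 1)),
  .nset 32 (.arr 2 (.var 27)), .nstore 4 (.var 27) (.arr 5 (.var 32)),
  .nstore 5 (.var 32) (.var 27)])
    (fun j M' => M'.nv 6 = A ∧ M'.na 2 = M.na 2 ∧
      (∀ x, (M'.na 5 x = 0 ∨ M'.na 5 x ∈ Finset.Icc 1 j ∧ M.na 2 (M'.na 5 x) = x) ∧
        ∀ a ∈ Finset.Icc 1 j, M.na 2 a = x → a ≤ M'.na 5 x) ∧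
      (∀ a ∈ Finset.Icc 1 j, (M'.na 4 a = 0 ∨ M'.na 4 a ∈ Finset.Icc 1 A ∧
        M.na 2 (M'.na 4 a) = M.na 2 a) ∧ M'.na 4 a < a ∧
        ∀ b ∈ Finset.Icc 1 A, M.na 2 b = M.na 2 a → b < a → b ≤ M'.na 4 a)) A 20
    (by decide) (by decide) (fun j M' hI => hI.1)
    (by
      rintro j M₁ hj ⟨h1, h2, h3, h4⟩ hi
      have e4 : ∀ a, (((block [.nset 27 (.add (.var 26) (.lit 1)),
          .nset 32 (.arr 2 (.var 27)), .nstore 4 (.var 27) (.arr 5 (.var 32)),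
          .nstore 5 (.var 32) (.var 27)] : Prog).sem N M₁).setN 26 (j + 1)).na 4 a =
          if a = j + 1 then M₁.na 5 (M.na 2 (j + 1)) else M₁.na 4 a := by
        intro a; simp [block, Prog.sem, NExp.eval, hi, h2]
      have e5 : ∀ x, (((block [.nset 27 (.add (.var 26) (.lit 1)),
          .nset 32 (.arr 2 (.var 27)), .nstore 4 (.var 27) (.arr 5 (.var 32)),
          .nstore 5 (.var 32) (.var 27)] : Prog).sem N M₁).setN 26 (j + 1)).na 5 x =
          if x = M.na 2 (j + 1) then j + 1 else M₁.na 5 x := by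
        intro a; simp [block, Prog.sem, NExp.eval, hi, h2]
      refine ⟨by simp [block, Prog.sem, h1], by ext; simp [block, Prog.sem, h2], fun x => ?_,
        fun a ha => ?_⟩
      · rw [e5]
        obtain ⟨h5, h6⟩ := h3 x
        split_ifs with hx
        · refine ⟨.inr ⟨by simp, hx.symm⟩, fun a ha _ => (Finset.mem_Icc.1 ha).2⟩
        · refine ⟨h5.imp_right fun h7 => ⟨Finset.Icc_subset_Icc_right (Nat.le_succ j) h7.1, h7.2⟩,
            fun a ha hax => h6 a ?_ hax⟩
          have := Finset.mem_Icc.1 ha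
          have : a ≠ j + 1 := by
            rintro rfl
            exact hx hax.symm
          exact Finset.mem_Icc.2 (by omega)
      · rw [e4]
        have ha' := Finset.mem_Icc.1 ha
        split_ifs with hax
        · subst hax
          obtain ⟨h5, h6⟩ := h3 (M.na 2 (j + 1))
          refine ⟨h5.imp_right fun h7 => ⟨Finset.Icc_subset_Icc_right hj.le h7.1, h7.2⟩, ?_,
            fun b hb hbt hlt => h6 b ?_ hbt⟩
          · rcases h5 with h5 | h5
            · omega
            · have := Finset.mem_Icc.1 h5.1
              omega
          · have := Finset.mem_Icc.1 hb
            exact Finset.mem_Icc.2 (by omega)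
        · exact h4 a (Finset.mem_Icc.2 (by omega)))
    M ⟨by simp [hA], rfl, by simp [h5], by simp⟩
  refine ⟨M₁, τ, hex, h2, h3, hτ.trans ?_⟩
  simp only [NExp.size]
  push_cast
  linarith

/-! ### Levels in memory -/

/-- Process an edge into a vertex; when it was the last one, the level of the vertex is known. -/
def levelStep : Prog := .cond (.nlt (.var 29) (.add (.var 1) (.lit 1)))
  (block [.nset 32 (.arr 3 (.var 29)), .nstore 16 (.var 32) (.sub (.arr 16 (.var 32)) (.lit 1)),
    .cond (.rlt (.arr 8 (.var 32)) (.add (.arr 8 (.arr 2 (.var 29))) (.lit 1)))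
      (.rstore 8 (.var 32) (.add (.arr 8 (.arr 2 (.var 29))) (.lit 1))) .skip,
    .cond (.neq (.arr 16 (.var 32)) (.lit 0))
      (block [.nstore 15 (.var 31) (.var 32), .nset 31 (.add (.var 31) (.lit 1))]) .skip]) .skip

/-- The state of the computation of the levels after the edges in `P`. -/
structure Levels (N : Network n m) (P : Finset (Fin m)) (L : List ℕ) (M : Mem) : Prop where
  edges : M.nv 1 = m
  deg : ∀ v : Fin n, M.na 16 (v + 1) = (Finset.univ.filter fun e => N.dst e = v ∧ e ∉ P).card
  mem : ∀ v : Fin n, (v : ℕ) + 1 ∈ L ↔ M.na 16 (v + 1) = 0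
  le : ∀ e ∈ P, (N.level (N.src e) : ℝ) + 1 ≤ M.ra 8 (N.dst e + 1)
  eq : ∀ v : Fin n, M.ra 8 (v + 1) = 0 ∨
    ∃ e ∈ P, N.dst e = v ∧ M.ra 8 (v + 1) = (N.level (N.src e) : ℝ) + 1

/-- A vertex enters the queue when all edges into it have been processed. Its entry is then the
maximum of the levels of their sources plus 1, which is its level; the source of the network keeps
the entry 0. -/
theorem Levels.level {N : Network n m} {wmin wmax : ℝ} (hN : N.IsConcave wmin wmax)
    {P : Finset (Fin m)} {L : List ℕ} {M : Mem} (h : Levels N P L M) {v : Fin n}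
    (hv : (v : ℕ) + 1 ∈ L) : M.ra 8 (v + 1) = N.level v := by
  rw [h.mem, h.deg, Finset.card_eq_zero, Finset.filter_eq_empty_iff] at hv
  by_cases hs : v = N.s
  · subst hs
    rcases h.eq N.s with h1 | ⟨e, -, h1, -⟩
    · rw [h1, hN.level_s, Nat.cast_zero]
    · exact absurd h1 (hN.dst_ne_s e)
  · obtain ⟨e, rfl, he⟩ := hN.exists_level hs
    have h1 := h.le e (by
      by_contra h2
      exact hv (Finset.mem_univ e) ⟨rfl, h2⟩)
    refine le_antisymm ?_ (by rw [he]; push_cast; exact h1)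
    rcases h.eq (N.dst e) with h2 | ⟨e', -, h2, h3⟩
    · rw [h2]; positivity
    · rw [h3]
      have := hN.level_lt e'
      rw [h2] at this
      exact_mod_cast this

theorem Levels.step {N : Network n m} {wmin wmax : ℝ} (hN : N.IsConcave wmin wmax) {G : Arcs n}
    {P : Finset (Fin m)} {L : List ℕ} {M : Mem} (h : Levels N P L M) (hS : Stored G M)
    (hQ : Queue n L M) {e : Fin m} (he : e ∉ P) (ha : M.nv 29 = e + 1)
    (htl : G.tl (e + 1) = N.src e + 1) (hhd : G.hd (e + 1) = N.dst e + 1)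
    (hL : (N.src e : ℕ) + 1 ∈ L) : ∃ L', L <+: L' ∧ Queue n L' (levelStep.sem N M) ∧
      Levels N (insert e P) L' (levelStep.sem N M) := by
  have hlv := h.level hN hL
  have he' := e.2
  -- The unprocessed edge `e` keeps the counter of its target positive. So the target is not yet in
  -- the queue, and the truncated subtraction is a true one.
  have hmemf : e ∈ Finset.univ.filter fun e' => N.dst e' = N.dst e ∧ e' ∉ P := by simp [he]
  have hdeg0 := h.deg (N.dst e)
  have hpos := Finset.card_pos.2 ⟨e, hmemf⟩
  have hnL : (N.dst e : ℕ) + 1 ∉ L := by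
    rw [h.mem, hdeg0]
    omega
  have hdeg : ∀ v : Fin n, (if v = N.dst e then M.na 16 (v + 1) - 1 else M.na 16 (v + 1)) =
      (Finset.univ.filter fun e' => N.dst e' = v ∧ e' ∉ insert e P).card := by
    intro v
    split_ifs with hv
    · subst hv
      rw [hdeg0, ← Finset.card_erase_of_mem hmemf]
      congr 1
      ext e'
      simp only [Finset.mem_erase, Finset.mem_filter, Finset.mem_univ, true_and, Finset.mem_insert,
        not_or]
      tauto
    · rw [h.deg]
      congr 1
      refine Finset.filter_congr fun e' _ => and_congr_right fun h1 => ?_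
      have : e' ≠ e := by
        rintro rfl
        exact hv h1.symm
      simp [this]
  set r : ℝ := max (M.ra 8 (N.dst e + 1)) (N.level (N.src e) + 1) with hr
  set d := M.na 16 (N.dst e + 1) - 1 with hd
  have hsem1 : (levelStep.sem N M).nv 1 = m ∧
      (∀ i, (levelStep.sem N M).na 16 i = if i = N.dst e + 1 then d else M.na 16 i) ∧
      (∀ i, (levelStep.sem N M).ra 8 i = if i = N.dst e + 1 then r else M.ra 8 i) ∧
      (levelStep.sem N M).nv 31 = (if d = 0 then L.length + 1 else L.length) ∧
      (∀ i, (levelStep.sem N M).na 15 i = if d = 0 ∧ i = L.length then (N.dst e : ℕ) + 1 else M.na 15 i) := by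
    by_cases hlt : M.ra 8 (N.dst e + 1) < (N.level (N.src e) + 1)
    · have hr' : r = N.level (N.src e) + 1 := max_eq_right hlt.le
      rw [hr']
      by_cases hd0 : d = 0 <;>
      simp [levelStep, block, Prog.sem, BExp.Holds, NExp.eval, RExp.eval, ha, hS.tl, hS.hd, htl, hhd,
          hlv, hlt, ← hd, hd0, h.edges, hQ.len]
    · have hr' : r = M.ra 8 (N.dst e + 1) := max_eq_left (not_lt.1 hlt)
      rw [hr']
      by_cases hd0 : d = 0 <;>
      simp [levelStep, block, Prog.sem, BExp.Holds, NExp.eval, RExp.eval, ha, hS.tl, hS.hd, htl, hhd,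
          hlv, hlt, ← hd, hd0, h.edges, hQ.len]
  obtain ⟨s1, s16, s8, s31, s15⟩ := hsem1
  have hle : ∀ e' ∈ insert e P, (N.level (N.src e') : ℝ) + 1 ≤
      (levelStep.sem N M).ra 8 (N.dst e' + 1) := by
    intro e' hmem
    rw [s8]
    rcases Finset.mem_insert.1 hmem with rfl | hmem
    · rw [if_pos rfl]; exact le_max_right _ _
    · split_ifs with h2
      · rw [hr, ← h2]
        exact (h.le e' hmem).trans (le_max_left _ _)
      · exact h.le e' hmem
  have heq : ∀ v : Fin n, (levelStep.sem N M).ra 8 (v + 1) = 0 ∨ ∃ e' ∈ insert e P, N.dst e' = v ∧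
      (levelStep.sem N M).ra 8 (v + 1) = (N.level (N.src e') : ℝ) + 1 := by
    intro v
    rw [s8]
    have hold := h.eq v
    have hins : (∃ e' ∈ P, N.dst e' = v ∧ M.ra 8 (v + 1) = (N.level (N.src e') : ℝ) + 1) →
      ∃ e' ∈ insert e P, N.dst e' = v ∧ M.ra 8 (v + 1) = (N.level (N.src e') : ℝ) + 1 :=
      fun ⟨e', h1, h2⟩ => ⟨e', Finset.mem_insert_of_mem h1, h2⟩
    split_ifs with h2
    · have hv : v = N.dst e := Fin.ext (by omega)
      rcases max_choice (M.ra 8 (N.dst e + 1)) ((N.level (N.src e) : ℝ) + 1) with h3 | h3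
      · rw [hr, h3, ← hv]
        exact hold.imp_right hins
      · rw [hr, h3]
        exact .inr ⟨e, Finset.mem_insert_self _ _, hv.symm, rfl⟩
    · exact hold.imp_right hins
  have hdeg' : ∀ v : Fin n, (levelStep.sem N M).na 16 (v + 1) =
      (Finset.univ.filter fun e' => N.dst e' = v ∧ e' ∉ insert e P).card := by
    intro v
    rw [← hdeg, s16]
    by_cases hv : v = N.dst e
    · simp [hv, hd]
    · have : (v : ℕ) ≠ N.dst e := fun h3 => hv (Fin.ext h3)
      simp [hv, this]
  by_cases hd0 : d = 0
  · refine ⟨L ++ [(N.dst e : ℕ) + 1], List.prefix_append _ _, hQ.push hnL (by simp) (by rw [s31, if_pos hd0])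
      (by intro i; rw [s15]; simp [hd0]), s1, hdeg', fun v => ?_, hle, heq⟩
    rw [List.mem_append, List.mem_singleton, s16]
    split_ifs with h3
    · simp [h3, hd0]
    · simp only [h3, or_false]
      exact h.mem v
  · refine ⟨L, List.prefix_rfl, ⟨by rw [s31, if_neg hd0, ], fun i hi => ?_, hQ.nodup, hQ.mem⟩, s1, hdeg',
      fun v => ?_, hle, heq⟩
    · rw [s15]
      simpa [hd0] using hQ.get i hi
    · rw [s16]
      split_ifs with h3
      · rw [h3]
        exact iff_of_false hnL hd0
      · exact h.mem v

/-- Compute the levels. -/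
def levels : Prog := block [.nstore 15 (.lit 0) (.var 4), .nset 31 (.lit 1), search levelStep]

theorem levels_spec {N : Network n m} {wmin wmax : ℝ} (hN : N.IsConcave wmin wmax) {G : Arcs n}
    {M : Mem} (hS : Stored G M) (h1 : M.nv 1 = m) (hA : G.A = 2 * m + 1) (hs : G.s = N.s + 1)
    (htl : ∀ a : Arc m, G.tl (num a) = N.tail a + 1) (hhd : ∀ a : Arc m, G.hd (num a) = N.head a + 1)
    (h16 : ∀ v : Fin n, M.na 16 (v + 1) = (Finset.univ.filter fun e => N.dst e = v).card)
    (h8 : ∀ i, M.ra 8 i = 0) : ∃ M' τ, Exec N levels M M' τ ∧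
      (∀ v : Fin n, M'.ra 8 (v + 1) = N.level v) ∧ (τ : ℝ) ≤ (G.A + n + 1) * 100 := by
  classical
  have e1 := Exec.nstore (N := N) M 15 (.lit 0) (.var 4)
  have e2 := Exec.nset (N := N) (M.setNA 15 0 G.s) 31 (.lit 1)
  simp only [NExp.eval, hS.s] at e1
  have hS₂ : Stored G ((M.setNA 15 0 G.s).setN 31 1) := (hS.exec e1 rfl).exec e2 rfl
  obtain ⟨M₃, τ₃, L, hex₃, hL₀, hQ, hJ, hτ₃⟩ := exec_search N (G := G) levelStep 60
    (by decide) rfl rfl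
    (fun Pr L M' => Levels N (Finset.univ.filter fun e => num (e, true) ∈ Pr) L M')
    (by
      rintro Pr L M' i v hi ⟨h1, h2, h3, h4, h5⟩
      refine ⟨?_, h2, h3, h4, h5⟩
      rcases hi with rfl | rfl <;> simpa using h1)
    (by
      intro Pr L M' hS' hQ hJ hA' hPr ht
      by_cases hle : M'.nv 29 ≤ m
      · have h29 := (Finset.mem_Icc.1 hA').1
        set e : Fin m := ⟨M'.nv 29 - 1, by omega⟩ with he
        have hnum : num (e, true) = M'.nv 29 := by
          simp only [num, if_true, he]
          omega
        have hins : (Finset.univ.filter fun e' : Fin m => num (e', true) ∈ insert (M'.nv 29) Pr) =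
            insert e (Finset.univ.filter fun e' => num (e', true) ∈ Pr) := by
          ext e'
          simp only [Finset.mem_filter, Finset.mem_univ, true_and, Finset.mem_insert, ← hnum]
          refine or_congr_left ⟨fun h2 => ?_, fun h2 => by rw [h2]⟩
          simp only [num, if_true] at h2
          exact Fin.ext (by omega)
        rw [hins]
        have htl' := htl (e, true)
        have hhd' := hhd (e, true)
        refine Levels.step hN hJ hS' hQ (by simpa [hnum] using hPr) (by rw [← hnum]; rfl) htl' hhd' ?_
        rw [← hnum, htl'] at ht
        exact ht
      · have hsem : levelStep.sem N M' = M' := by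
          have : ¬ M'.nv 29 < m + 1 := by omega
          simp only [levelStep, Prog.sem, BExp.Holds, NExp.eval, hJ.edges, this, if_false]
        rw [hsem]
        refine ⟨L, List.prefix_rfl, hQ, ?_⟩
        have : (Finset.univ.filter fun e' : Fin m => num (e', true) ∈ insert (M'.nv 29) Pr) =
            Finset.univ.filter fun e' => num (e', true) ∈ Pr := by
          refine Finset.filter_congr fun e' _ => ?_
          have h2 : num (e', true) ≠ M'.nv 29 := by
            have := e'.2
            simp only [num, if_true]
            omega
          simp [h2]
        rwa [this])
    hS₂ (L₀ := [G.s]) ⟨by simp, by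
        intro i hi
        have : i = 0 := by simpa using hi
        subst this
        simp, by simp, by simpa using Finset.mem_Icc.1 G.s_mem⟩
    ⟨by simpa using h1, by simpa using h16, fun v => by
      have : ((M.setNA 15 0 G.s).setN 31 1).na 16 (v + 1) = M.na 16 (v + 1) := by simp
      rw [this, h16, Finset.card_eq_zero, Finset.filter_eq_empty_iff, List.mem_singleton, hs]
      constructor
      · intro h2 e _ h3
        exact hN.dst_ne_s e (by rw [h3]; exact Fin.ext (by omega))
      · intro h2
        by_contra h3
        obtain ⟨e, he, -⟩ := hN.exists_level (v := v) fun h4 => h3 (by rw [h4])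
        exact h2 (Finset.mem_univ e) he, by simp, fun v => by simp [h8]⟩
  refine ⟨M₃, _, .seq _ _ _ _ _ _ _ e1 (.seq _ _ _ _ _ _ _ e2 hex₃), fun v => hJ.level hN ?_, ?_⟩
  -- Every vertex is enqueued, by induction on the level: the sources of all edges into it have
  -- smaller level, so these edges have been processed and its counter is 0.
  · have key : ∀ k, ∀ v : Fin n, N.level v < k → (v : ℕ) + 1 ∈ L := by
      intro k
      induction k with
      | zero => intro v hv; omega
      | succ k ih =>
        intro v hv
        rw [hJ.mem, hJ.deg, Finset.card_eq_zero, Finset.filter_eq_empty_iff]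
        rintro e - ⟨rfl, h3⟩
        refine h3 (Finset.mem_filter.2 ⟨Finset.mem_univ _, Finset.mem_filter.2 ⟨?_, ?_⟩⟩)
        · have := Finset.mem_Ico.1 (num_mem (e, true))
          rw [hA]
          exact Finset.mem_Icc.2 ⟨this.1, this.2.le⟩
        · rw [htl]
          have := hN.level_lt e
          exact ih (N.src e) (by omega)
    exact key _ v (Nat.lt_succ_self _)
  · simp only [NExp.size]
    push_cast at hτ₃ ⊢
    have h9 : (0 : ℝ) ≤ G.A := Nat.cast_nonneg _
    have h10 : (0 : ℝ) ≤ n := Nat.cast_nonneg _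
    linarith
/-! ### The program -/

/-- Set up the arcs and the levels. -/
def setup : Prog := block [.nset 4 (.add (.var 2) (.lit 1)), .nset 5 (.add (.var 3) (.lit 1)),
  .nset 6 (.add (.add (.var 1) (.var 1)) (.lit 1)), makeArcs, .nstore 2 (.var 6) (.var 5),
  .nstore 3 (.var 6) (.var 4), makeLinks, levels]

theorem setup_spec {N : Network n m} {wmin wmax : ℝ} (hN : N.IsConcave wmin wmax) (ε : ℝ) :
    ∃ M' τ, ∃ G : Arcs n, Exec N setup (inputMem N wmin wmax ε) M' τ ∧ Layout N G M' ∧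
      (τ : ℝ) ≤ 1000 * (m + n + 1) := by
  set M := inputMem N wmin wmax ε with hM
  have e4 := Exec.nset (N := N) M 4 (.add (.var 2) (.lit 1))
  have e5 := Exec.nset (N := N) (M.setN 4 (N.s + 1)) 5 (.add (.var 3) (.lit 1))
  have e6 := Exec.nset (N := N) ((M.setN 4 (N.s + 1)).setN 5 (N.t + 1)) 6
    (.add (.add (.var 1) (.var 1)) (.lit 1))
  have v0 : M.nv 0 = n := by simp [M, inputMem]
  have v1 : M.nv 1 = m := by simp [M, inputMem]
  have v2 : M.nv 2 = N.s := by simp [M, inputMem]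
  have v3 : M.nv 3 = N.t := by simp [M, inputMem]
  have ha : ∀ a i, 2 ≤ a → M.na a i = 0 := fun a i h => by
    have h0 : a ≠ 0 := by omega
    have h1 : a ≠ 1 := by omega
    simp [M, inputMem, h0, h1]
  have hr : ∀ a i, 1 ≤ a → M.ra a i = 0 := fun a i h => by
    have h0 : a ≠ 0 := by omega
    simp [M, inputMem, h0]
  simp only [NExp.eval, v2] at e4
  simp [NExp.eval, v3] at e5
  simp [NExp.eval, v1] at e6
  set M₀ := (((M.setN 4 (N.s + 1)).setN 5 (N.t + 1)).setN 6 (m + m + 1)) with hM₀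
  obtain ⟨M₁, τ₁, hex₁, h2, h3, h16, hτ₁⟩ := makeArcs_spec N (M := M₀) (by simp [M₀, v1])
    (fun e => by simp [M₀, M, inputMem]) (fun e => by simp [M₀, M, inputMem])
    (fun i => by simp [M₀, ha])
  have w0 : M₁.nv 0 = n := by rw [hex₁.nv rfl]; simp [M₀, v0]
  have w1 : M₁.nv 1 = m := by rw [hex₁.nv rfl]; simp [M₀, v1]
  have w4 : M₁.nv 4 = N.s + 1 := by rw [hex₁.nv rfl]; simp [M₀]
  have w5 : M₁.nv 5 = N.t + 1 := by rw [hex₁.nv rfl]; simp [M₀]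
  have w6 : M₁.nv 6 = m + m + 1 := by rw [hex₁.nv rfl]; simp [M₀]
  have f2 := Exec.nstore (N := N) M₁ 2 (.var 6) (.var 5)
  have f3 := Exec.nstore (N := N) (M₁.setNA 2 (m + m + 1) (N.t + 1)) 3 (.var 6) (.var 4)
  simp only [NExp.eval, w5, w6] at f2
  simp only [NExp.eval, Mem.setNA_nv, w4, w6] at f3
  set M₂ := (M₁.setNA 2 (m + m + 1) (N.t + 1)).setNA 3 (m + m + 1) (N.s + 1) with hM₂
  obtain ⟨M₃, τ₃, hex₃, hfi, hnx, hτ₃⟩ := makeLinks_spec N (M := M₂) (A := m + m + 1) w6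
    (fun x => by
      have : M₁.na 5 = M₀.na 5 := hex₁.na rfl
      simp [M₂, this, M₀, ha])
  have hne : ∀ a : Arc m, num a ≠ m + m + 1 := fun a => by
    have := Finset.mem_Ico.1 (num_mem a)
    omega
  have t2 : ∀ a : Arc m, M₂.na 2 (num a) = N.tail a + 1 := fun a => by simp [M₂, hne, h2]
  have t3 : ∀ a : Arc m, M₂.na 3 (num a) = N.head a + 1 := fun a => by simp [M₂, hne, h3]
  have t2A : M₂.na 2 (m + m + 1) = N.t + 1 := by simp [M₂]
  have t3A : M₂.na 3 (m + m + 1) = N.s + 1 := by simp [M₂]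
  have hcase : ∀ (g : ℕ → ℕ) (g' : Arc m → Fin n) (v : Fin n), (∀ a, g (num a) = g' a + 1) →
      g (m + m + 1) = v + 1 → ∀ a ∈ Finset.Icc 1 (m + m + 1), g a ∈ Finset.Icc 1 n := by
    intro g g' v h1 h2 a ha
    by_cases haA : a = m + m + 1
    · rw [haA, h2]; simp
    · obtain ⟨a', rfl⟩ := exists_num (m := m) (b := a) (by
        have := Finset.mem_Icc.1 ha
        exact Finset.mem_Ico.2 (by omega))
      rw [h1]; simp
  let G : Arcs n :=
    { A := m + m + 1, tl := M₂.na 2, hd := M₂.na 3, fi := M₃.na 5, nx := M₃.na 4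
      s := N.s + 1, t := N.t + 1, s_mem := by simp, t_mem := by simp
      s_ne := fun h => hN.s_ne_t (Fin.ext (by omega))
      A_pos := by omega
      tl_A := t2A, hd_A := t3A
      tl_mem := hcase _ _ _ t2 t2A
      hd_mem := hcase _ _ _ t3 t3A
      fi_mem := fun x _ => (hfi x).1
      le_fi := fun a ha => (hfi _).2 a ha rfl
      nx_mem := fun a ha => (hnx a ha).1
      nx_lt := fun a ha => (hnx a ha).2.1
      le_nx := fun a ha => (hnx a ha).2.2 }
  have hst : Stored G M₃ := ⟨(hex₃.nv rfl).trans w0, (hex₃.nv rfl).trans w4, (hex₃.nv rfl).trans w5,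
    (hex₃.nv rfl).trans w6, hex₃.na rfl, hex₃.na rfl, rfl, rfl⟩
  have hA : G.A = 2 * m + 1 := by
    show m + m + 1 = _
    omega
  obtain ⟨M₄, τ₄, hex₄, hlv, hτ₄⟩ := levels_spec hN hst ((hex₃.nv rfl).trans w1) hA rfl t2 t3
    (fun v => by
      have : M₃.na 16 = M₂.na 16 := hex₃.na rfl
      simp [this, M₂, h16])
    (fun i => by
      have e1 : M₃.ra 8 = M₂.ra 8 := hex₃.ra rfl
      have e2 : M₁.ra 8 = M₀.ra 8 := hex₁.ra rfl
      simp [e1, M₂, e2, M₀, hr])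
  refine ⟨M₄, _, G, .seq _ _ _ _ _ _ _ e4 (.seq _ _ _ _ _ _ _ e5 (.seq _ _ _ _ _ _ _ e6
    (.seq _ _ _ _ _ _ _ hex₁ (.seq _ _ _ _ _ _ _ f2 (.seq _ _ _ _ _ _ _ f3 (.seq _ _ _ _ _ _ _ hex₃
      hex₄)))))), ⟨hst.exec hex₄ rfl, ?_, hA, rfl, rfl, t2, t3, hlv⟩, ?_⟩
  · rw [hex₄.nv rfl, hex₃.nv rfl]; exact w1
  · simp only [NExp.size]
    rw [hA] at hτ₄
    push_cast at *
    have h9 : (0 : ℝ) ≤ m := Nat.cast_nonneg _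
    have h10 : (0 : ℝ) ≤ n := Nat.cast_nonneg _
    linarith

/-- Iterated assignments to a real register. -/
theorem exec_iterate (N : Network n m) (r : ℕ) (E : RExp) (b : BExp) (f : ℕ → ℝ) (M : Mem)
    (hE : ∀ i, E.eval N (M.setR r (f i)) = f (i + 1)) : ∀ (d i T : ℕ), i + d = T →
    (∀ i < T, b.Holds N (M.setR r (f i))) → ¬ b.Holds N (M.setR r (f T)) →
    ∃ τ, Exec N (.loop b (.rset r E)) (M.setR r (f i)) (M.setR r (f T)) τ ∧
      τ ≤ (d + 1) * (E.size + b.size + 2)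
  | 0, i, T, hi, _, hT => by
    obtain rfl : i = T := by omega
    exact ⟨_, .loop_false _ _ _ hT, by omega⟩
  | d + 1, i, T, hi, hb, hT => by
    obtain ⟨τ, hex, hτ⟩ := exec_iterate N r E b f M hE d (i + 1) T (by omega) hb hT
    have e1 := Exec.rset (N := N) (M.setR r (f i)) r E
    have e2 : ({ M.setR r (f i) with
        rv := Function.update (M.setR r (f i)).rv r (E.eval N (M.setR r (f i))) } : Mem) =
        M.setR r (f (i + 1)) := by
      rw [hE]
      simp [Mem.setR]
    rw [e2] at e1
    refine ⟨_, .loop_true _ _ _ _ _ _ _ (hb i (by omega)) e1 hex, ?_⟩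
    rw [add_mul (d + 1)]
    omega

/-- Initialize the potentials. -/
def initPotentials : Prog := .forLoop 26 (.var 0) (block [.nset 27 (.add (.var 26) (.lit 1)),
  .rstore 7 (.var 27) (.mul (.var 9) (.arr 8 (.var 27)))])

theorem initPotentials_spec {N : Network n m} {G : Arcs n} {M : Mem} (h : Layout N G M)
    (h1 : ∀ e : Fin m, M.ra 1 e = 0) : ∃ M' τ, Exec N initPotentials M M' τ ∧
      Current (⟨fun _ => 0, fun u => M.rv 9 * N.level u⟩ : FlowPot n m) M' ∧
      (τ : ℝ) ≤ (n + 1) * 28 := by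
  obtain ⟨M', τ, hex, hC, hτ⟩ := exec_potentials (N := N) (block [.nset 27 (.add (.var 26) (.lit 1)),
    .rstore 7 (.var 27) (.mul (.var 9) (.arr 8 (.var 27)))]) 20 (by decide)
    (by decide) (fun v => M.rv 9 * N.level v)
    (fun M' => M'.ra 8 = M.ra 8 ∧ M'.rv 9 = M.rv 9) (M := M)
    (S := ⟨fun _ => 0, fun v => M.ra 7 (v + 1)⟩) ⟨rfl, rfl⟩
    (by
      rintro v M₁ ⟨h1, h2⟩ hi
      refine ⟨⟨by ext; simp [block, Prog.sem, h1], by simp [block, Prog.sem, h2]⟩,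
        by ext; simp [block, Prog.sem], fun h4 i => ?_⟩
      simp [block, Prog.sem, NExp.eval, RExp.eval, hi, h1, h2, h.level])
    h.stored.n ⟨h1, fun v => rfl⟩
  exact ⟨M', τ, hex, hC, hτ.trans (by norm_num)⟩

/-- The algorithm with rounded parameters. -/
def program : Prog := block [setup, .rset 9 (.var 0),
  .loop (.rlt (.var 9) (.var 1)) (.rset 9 (.add (.var 9) (.var 9))),
  .rset 12 (.div (.lit 1) (.lit 2)),
  .loop (.rlt (.var 2) (.mul (.lit 9) (.var 12))) (.rset 12 (.div (.var 12) (.lit 2))),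
  .rset 5 (.mul (.var 12) (.var 9)), .rset 7 (.arr 8 (.var 5)), initPotentials, outerLoop, lastScale]

/-- The hypotheses say that `T` and `k` are least, i.e. that the two loops that double w_min and
halve the precision stop there. -/
theorem program_spec {N : Network n m} {wmin wmax ε : ℝ} (hN : N.IsConcave wmin wmax) {T k : ℕ}
    (hT : wmax ≤ 2 ^ T * wmin) (hT' : ∀ i < T, 2 ^ i * wmin < wmax)
    (hk : 9 * (1 / 2 ^ (k + 1)) ≤ ε) (hk' : ∀ i < k, ε < 9 * (1 / 2 ^ (i + 1))) :
    ∃ M τ, Exec N program (inputMem N wmin wmax ε) M τ ∧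
      N.Returns wmin (2 ^ T * wmin) (1 / 2 ^ (k + 1)) (output m M) ∧
      (τ : ℝ) ≤ 1000 * (m + n + 1) + 10 * (T + 1) + 10 * (k + 1) + 28 * (n + 1) + 100 +
        (T + 1) * ((N.depth * (2 ^ (k + 1) + 2)) *
        (3000400 * ((Real.logb 2 n + 1) * (2 * m + 1 + n)) + 6) + 28 * n + 100) := by
  obtain ⟨M₁, τ₁, G, hex₁, h₁, hτ₁⟩ := setup_spec hN ε
  have r0 : M₁.rv 0 = wmin := by rw [hex₁.rv rfl]; simp [inputMem]
  have r1 : M₁.rv 1 = wmax := by rw [hex₁.rv rfl]; simp [inputMem]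
  have r2 : M₁.rv 2 = ε := by rw [hex₁.rv rfl]; simp [inputMem]
  have a1 : ∀ e : Fin m, M₁.ra 1 e = 0 := fun e => by rw [hex₁.ra rfl]; simp [inputMem]
  set W := 2 ^ T * wmin with hW
  have e1 := Exec.rset (N := N) M₁ 9 (.var 0)
  obtain ⟨τ₂, hex₂, hτ₂⟩ := exec_iterate N 9 (.add (.var 9) (.var 9)) (.rlt (.var 9) (.var 1))
    (fun i => 2 ^ i * wmin) M₁ (fun i => by simp [RExp.eval, pow_succ]; ring) T 0 T (zero_add _)
    (fun i hi => by simpa [BExp.Holds, RExp.eval, r1] using hT' i hi)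
    (by simpa [BExp.Holds, RExp.eval, r1] using hT)
  rw [pow_zero, one_mul] at hex₂
  simp only [RExp.eval, r0] at e1
  set M₂ := M₁.setR 9 W with hM₂
  have e3 := Exec.rset (N := N) M₂ 12 (.div (.lit 1) (.lit 2))
  obtain ⟨τ₃, hex₃, hτ₃⟩ := exec_iterate N 12 (.div (.var 12) (.lit 2))
    (.rlt (.var 2) (.mul (.lit 9) (.var 12)))
    (fun i => 1 / 2 ^ (i + 1)) M₂ (fun i => by simp [RExp.eval, pow_succ]; ring) k 0 k (zero_add _)
    (fun i hi => by simpa [BExp.Holds, RExp.eval, M₂, r2] using hk' i hi)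
    (by simpa [BExp.Holds, RExp.eval, M₂, r2] using hk)
  rw [zero_add, pow_one] at hex₃
  simp only [RExp.eval, Nat.cast_one, Nat.cast_ofNat] at e3
  set ε' : ℝ := 1 / 2 ^ (k + 1) with hε'
  have e5 := Exec.rset (N := N) (M₂.setR 12 ε') 5 (.mul (.var 12) (.var 9))
  have e7 := Exec.rset (N := N) ((M₂.setR 12 ε').setR 5 (ε' * W)) 7 (.arr 8 (.var 5))
  have hlt : M₁.ra 8 (M₁.nv 5) = N.depth := by rw [h₁.stored.t, h₁.t, h₁.level]; rfl
  simp [RExp.eval, M₂] at e5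
  simp [RExp.eval, NExp.eval, M₂, hlt] at e7
  set M₃ := ((M₂.setR 12 ε').setR 5 (ε' * W)).setR 7 N.depth with hM₃
  have h₃ : Layout N G M₃ := ⟨⟨h₁.stored.n, h₁.stored.s, h₁.stored.t, h₁.stored.A, h₁.stored.tl,
    h₁.stored.hd, h₁.stored.nx, h₁.stored.fi⟩, h₁.edges, h₁.A, h₁.s, h₁.t, h₁.tl, h₁.hd, h₁.level⟩
  obtain ⟨M₄, τ₄, hex₄, hC₄, hτ₄⟩ := initPotentials_spec h₃ (by simpa [M₃, M₂] using a1)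
  have e9 : M₃.rv 9 = W := by simp [M₃, M₂]
  have hw := hN.wmin_pos
  have hW0 : 0 < W := by rw [hW]; positivity
  have hε0 : 0 < ε' := by rw [hε']; positivity
  rw [e9] at hC₄
  obtain ⟨M₅, τ₅, M₆, τ₆, S', hex₅, hex₆, hC₆, hout, hτ⟩ := outerLoop_spec hN (G := G) (k := k) hW T 0
    (zero_add _) (h₃.exec hex₄ rfl rfl) hC₄
    (by rw [hex₄.rv rfl]; simp [M₃, M₂, stepSize, hε']) (by rw [hex₄.rv rfl]; simp [M₃, M₂])
    (by rw [hex₄.rv rfl]; simp [M₃, M₂]) (by rw [hex₄.rv rfl]; simp [M₃, M₂, r0])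
    -- Only the part `Inv` is wanted here, so the credit and the precision in the amortized
    -- statement may be set to 0.
    (hN.amortized_init (κ := 0) (ε := 0) (Network.stepSize_pos hW0 hε0 _).le le_rfl hT).toInv
    ⟨0, by norm_num, by
      have : (N.depth : ℝ) = N.level N.t := rfl
      rw [this]
      unfold stepSize
      field_simp
      simp⟩
  have hx : output m M₆ = S'.x := funext fun e => hC₆.x e
  refine ⟨M₆, _, .seq _ _ _ _ _ _ _ hex₁ (.seq _ _ _ _ _ _ _ e1 (.seq _ _ _ _ _ _ _ hex₂
    (.seq _ _ _ _ _ _ _ e3 (.seq _ _ _ _ _ _ _ hex₃ (.seq _ _ _ _ _ _ _ e5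
      (.seq _ _ _ _ _ _ _ e7 (.seq _ _ _ _ _ _ _ hex₄ (.seq _ _ _ _ _ _ _ hex₅ hex₆)))))))),
    ⟨T, S'.p, rfl, by rw [hx]; exact hout⟩, ?_⟩
  have hA : (G.A : ℝ) = 2 * m + 1 := by rw [h₁.A]; push_cast; ring
  rw [hA] at hτ
  have hτ₂' : (τ₂ : ℝ) ≤ (T + 1) * 8 := by
    exact_mod_cast hτ₂.trans (by simp only [RExp.size, BExp.size]; omega)
  have hτ₃' : (τ₃ : ℝ) ≤ (k + 1) * 10 := by
    exact_mod_cast hτ₃.trans (by simp only [RExp.size, BExp.size]; omega)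
  simp only [RExp.size, NExp.size]
  push_cast
  have h11 : (0 : ℝ) ≤ T := Nat.cast_nonneg _
  linarith

/-! ### Rounding of the parameters and the final time bound -/

theorem Network.IsConcave.le_edges {N : Network n m} {wmin wmax : ℝ} (hN : N.IsConcave wmin wmax) :
    n ≤ m + 1 := by
  -- Every vertex other than the source is reachable and so has an edge into it.
  have h1 : (Finset.univ.erase N.s) ⊆ Finset.univ.image N.dst := fun v hv => by
    obtain ⟨e, he, -⟩ := hN.exists_level (Finset.ne_of_mem_erase hv)
    exact Finset.mem_image.2 ⟨e, Finset.mem_univ _, he⟩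
  have h2 := (Finset.card_le_card h1).trans Finset.card_image_le
  rw [Finset.card_erase_of_mem (Finset.mem_univ _), Finset.card_univ, Finset.card_univ,
    Fintype.card_fin, Fintype.card_fin] at h2
  omega

/-- Minimality of `T` gives both the running condition of the doubling loop and the loss of at most
a factor 2. -/
theorem exists_scales {wmin wmax : ℝ} (h0 : 0 < wmin) (h : wmin ≤ wmax) :
    ∃ T : ℕ, wmax ≤ 2 ^ T * wmin ∧ (∀ i < T, 2 ^ i * wmin < wmax) ∧ 2 ^ T * wmin ≤ 2 * wmax := by
  classical
  have hex : ∃ T : ℕ, wmax ≤ 2 ^ T * wmin := by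
    obtain ⟨T, hT⟩ := pow_unbounded_of_one_lt (wmax / wmin) (one_lt_two (α := ℝ))
    exact ⟨T, by rw [div_lt_iff₀ h0] at hT; exact hT.le⟩
  refine ⟨Nat.find hex, Nat.find_spec hex, fun i hi => not_le.1 (Nat.find_min hex hi), ?_⟩
  rcases hT : Nat.find hex with _ | T
  · rw [pow_zero]
    linarith
  · have := not_le.1 (Nat.find_min hex (m := T) (by omega))
    rw [pow_succ]
    linarith

theorem exists_precision {ε : ℝ} (h0 : 0 < ε) (h1 : ε < 1) : ∃ k : ℕ, 9 * (1 / 2 ^ (k + 1)) ≤ ε ∧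
    (∀ i < k, ε < 9 * (1 / 2 ^ (i + 1))) ∧ ε ≤ 18 * (1 / 2 ^ (k + 1)) := by
  classical
  have hex : ∃ k : ℕ, 9 * (1 / 2 ^ (k + 1)) ≤ ε := by
    obtain ⟨k, hk⟩ := pow_unbounded_of_one_lt (9 / ε) (one_lt_two (α := ℝ))
    refine ⟨k, ?_⟩
    rw [div_lt_iff₀ h0] at hk
    rw [pow_succ, mul_one_div, div_le_iff₀ (by positivity)]
    have : (0 : ℝ) < 2 ^ k := by positivity
    nlinarith
  refine ⟨Nat.find hex, Nat.find_spec hex, fun i hi => not_le.1 (Nat.find_min hex hi), ?_⟩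
  rcases hk : Nat.find hex with _ | k
  · norm_num
    linarith
  · have := not_le.1 (Nat.find_min hex (m := k) (by omega))
    rw [pow_succ, ← div_div]
    linarith

/-- As n ≤ m + 1 and log n ≥ log 2, each round is O(m log n) and all additive terms are absorbed by
a single round. Then T + 1 ≤ 2(1 + log(w_max/w_min)) and 2^(k+1) ≤ 18/ε. -/
theorem program_time {n m D T k : ℕ} {wmin wmax ε : ℝ} (hn : 2 ≤ n) (hnm : n ≤ m + 1) (hD : 1 ≤ D)
    (h0 : 0 < wmin) (hw : wmin ≤ wmax) (hε : 0 < ε) (hT : 2 ^ T * wmin ≤ 2 * wmax)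
    (hk : ε ≤ 18 * (1 / 2 ^ (k + 1))) :
    1000 * (m + n + 1) + 10 * (T + 1) + 10 * (k + 1) + 28 * (n + 1) + 100 +
        (T + 1) * ((D * (2 ^ (k + 1) + 2)) *
        (3000400 * ((Real.logb 2 n + 1) * (2 * m + 1 + n)) + 6) + 28 * n + 100) ≤
      100000000000 * (D * m * ε⁻¹ * (1 + Real.log (wmax / wmin)) * Real.log n) := by
  have l2 : (1 / 2 : ℝ) ≤ Real.log 2 := by linarith [Real.log_two_gt_d9]
  have hn' : (2 : ℝ) ≤ n := by exact_mod_cast hn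
  have hnm' : (n : ℝ) ≤ m + 1 := by exact_mod_cast hnm
  have hD' : (1 : ℝ) ≤ D := by exact_mod_cast hD
  have hm' : (1 : ℝ) ≤ m := by linarith
  set lg := Real.logb 2 n with hlg
  set ln := Real.log n with hln
  set L := Real.log (wmax / wmin) with hL
  set E : ℝ := 2 ^ (k + 1) with hE
  have hL0 : 0 ≤ L := Real.log_nonneg (by rwa [one_le_div h0])
  have hln2 : Real.log 2 ≤ ln := Real.log_le_log (by norm_num) hn'
  have hlgln : lg * Real.log 2 = ln := by
    rw [hlg, Real.logb, div_mul_cancel₀ _ (by linarith)]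
  have hlg1 : 1 ≤ lg := by
    by_contra! hlt
    have := mul_lt_mul_of_pos_right hlt (by linarith : 0 < Real.log 2)
    linarith
  have hlg2 : lg ≤ 2 * ln := by nlinarith
  -- From 2^T ≤ 2 w_max/w_min, with log 2 ≥ 1/2 for the change of base.
  have hTL : (T : ℝ) + 1 ≤ 2 * (1 + L) := by
    have h1 : (2 : ℝ) ^ T ≤ 2 * (wmax / wmin) := by
      rw [← mul_div_assoc, le_div_iff₀ h0]
      exact hT
    have h2 := Real.log_le_log (by positivity) h1
    rw [Real.log_pow, Real.log_mul (by norm_num) (by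
      have : 0 < wmax / wmin := div_pos (by linarith) h0
      exact this.ne')] at h2
    have h3 : ((T : ℝ) - 1) * Real.log 2 ≤ L := by linarith
    by_contra! hlt
    have h4 : 2 * L < (T : ℝ) - 1 := by linarith
    nlinarith
  have hE2 : (2 : ℝ) ≤ E := by
    rw [hE, pow_succ]
    have : (1 : ℝ) ≤ 2 ^ k := one_le_pow₀ (by norm_num)
    linarith
  have hEε : E ≤ 18 * ε⁻¹ := by
    rw [mul_one_div, le_div_iff₀ (by linarith)] at hk
    rw [← div_eq_mul_inv, le_div_iff₀ hε]
    linarith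
  have hkE : (k : ℝ) + 1 ≤ E := by
    rw [hE]
    exact_mod_cast (Nat.lt_two_pow_self (n := k + 1)).le
  have hT0 : (0 : ℝ) ≤ T := Nat.cast_nonneg _
  set X : ℝ := m * ln with hX
  have hXm : (m : ℝ) ≤ 2 * X := by rw [hX]; nlinarith
  have hlgX : (lg + 1) * (2 * m + 1 + n) ≤ 20 * X := by
    have h1 : (lg + 1) * (2 * m + 1 + n) ≤ (4 * ln) * (5 * m) := by
      apply mul_le_mul <;> linarith
    rw [hX]
    linarith
  have hDE : (1 : ℝ) ≤ D * E := one_le_mul_of_one_le_of_one_le hD' (by linarith)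
  have hX0 : 0 ≤ X := by linarith
  have hDEX : X ≤ D * E * X := le_mul_of_one_le_left hX0 hDE
  have hin : (D * (E + 2)) * (3000400 * ((lg + 1) * (2 * m + 1 + n)) + 6) + 28 * n + 100 ≤
      130000000 * (D * E * X) := by
    have h1 : (D * (E + 2) : ℝ) ≤ 2 * (D * E) := by nlinarith
    have h2 : 3000400 * ((lg + 1) * (2 * m + 1 + n)) + 6 ≤ 60008020 * X := by linarith
    have h3 : (D * (E + 2)) * (3000400 * ((lg + 1) * (2 * m + 1 + n)) + 6) ≤
        (2 * (D * E)) * (60008020 * X) := by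
      apply mul_le_mul h1 h2
      · have : 0 ≤ (lg + 1) * (2 * m + 1 + n) := mul_nonneg (by linarith) (by linarith)
        linarith
      · linarith
    linarith
  have hTT : (1 : ℝ) ≤ T + 1 := by linarith
  have hTX : D * E * X ≤ (T + 1) * (D * E * X) := le_mul_of_one_le_left (by linarith) hTT
  have hEX : E ≤ 2 * (D * E * X) := by
    have h1 : (1 : ℝ) ≤ D * (2 * X) := one_le_mul_of_one_le_of_one_le hD' (by linarith)
    have := mul_le_mul_of_nonneg_right h1 (by linarith : 0 ≤ E)
    linarith
  have hT10 : (T : ℝ) + 1 ≤ (T + 1) * (2 * (D * E * X)) := by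
    refine le_mul_of_one_le_right (by linarith) ?_
    linarith
  have hbig := mul_le_mul_of_nonneg_left hin (by linarith : (0 : ℝ) ≤ T + 1)
  have htotal : 1000 * (m + n + 1) + 10 * (T + 1) + 10 * (k + 1) + 28 * (n + 1) + 100 +
        (T + 1) * ((D * (E + 2)) * (3000400 * ((lg + 1) * (2 * m + 1 + n)) + 6) + 28 * n + 100) ≤
      200000000 * ((T + 1) * (D * E * X)) := by
    linarith
  refine htotal.trans ?_
  have h5 : (T + 1) * (D * E * X) ≤ (2 * (1 + L)) * (D * (18 * ε⁻¹) * X) := by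
    gcongr
  have h6 : 0 ≤ D * m * ε⁻¹ * (1 + L) * ln := by
    have : 0 ≤ ln := by linarith
    positivity
  calc 200000000 * ((T + 1) * (D * E * X)) ≤ 200000000 * ((2 * (1 + L)) * (D * (18 * ε⁻¹) * X)) := by
        linarith
    _ = 7200000000 * (D * m * ε⁻¹ * (1 + L) * ln) := by rw [hX]; ring
    _ ≤ _ := by linarith

end ConcaveFlow

end

theorem theorem1 :
    -- whatever blocking flows are chosen, ConcaveFlow returns a `(1 - 9 ε)`-approximation
    (∀ (n m : ℕ) (N : ConcaveFlow.Network n m) (wmin wmax : ℝ) (k : ℕ) (x : Fin m → ℝ),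
      N.IsConcave wmin wmax → 1 ≤ k → N.Returns wmin wmax (1 / 2 ^ k) x →
        N.IsApprox (1 - 9 * (1 / 2 ^ k)) x) ∧
    -- a fixed real-RAM program runs ConcaveFlow, with `wmax` and `ε` rounded, in the claimed time
    ∃ (P : ConcaveFlow.Prog) (C : ℝ),
      ∀ (n m : ℕ) (N : ConcaveFlow.Network n m) (wmin wmax ε : ℝ),
        N.IsConcave wmin wmax → 0 < ε → ε < 1 →
        ∃ (M : ConcaveFlow.Mem) (τ : ℕ),
          ConcaveFlow.Exec N P (ConcaveFlow.inputMem N wmin wmax ε) M τ ∧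
          (τ : ℝ) ≤ C * (N.depth * m * ε⁻¹ * (1 + Real.log (wmax / wmin)) * Real.log n) ∧
          N.IsApprox (1 - ε) (ConcaveFlow.output m M) ∧
          ∃ k T : ℕ, 9 * (1 / 2 ^ k) ≤ ε ∧ ε ≤ 18 * (1 / 2 ^ k) ∧
            wmax ≤ 2 ^ T * wmin ∧ 2 ^ T * wmin ≤ 2 * wmax ∧
            N.Returns wmin (2 ^ T * wmin) (1 / 2 ^ k) (ConcaveFlow.output m M) := by
  refine ⟨fun n m N wmin wmax k x hN hk hx => ?_, ConcaveFlow.program, 100000000000,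
    fun n m N wmin wmax ε hN hε hε1 => ?_⟩
  · have hpos : 0 < wmax := by
      obtain ⟨T, p, hT, -⟩ := hx
      rw [hT]
      exact mul_pos (by positivity) hN.wmin_pos
    exact hN.approx_of_returns hk le_rfl hpos hx
  · obtain ⟨e, -, he⟩ := hN.exists_level hN.s_ne_t.symm
    have h0 := hN.wmin_pos
    have hmem : (0 : ℝ) ∈ Set.Icc 0 (N.cap e) := ⟨le_rfl, (hN.cap_pos e).le⟩
    have hw : wmin ≤ wmax := (hN.le_deriv e 0 hmem).trans (hN.deriv_le e 0 hmem)
    obtain ⟨T, hT, hTlt, hT2⟩ := ConcaveFlow.exists_scales h0 hw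
    obtain ⟨k, hk, hklt, hk2⟩ := ConcaveFlow.exists_precision hε hε1
    obtain ⟨M, τ, hex, hret, hτ⟩ := ConcaveFlow.program_spec hN hT hTlt hk hklt
    have hn : 2 ≤ n := by
      have h1 := N.s.2
      have h2 := N.t.2
      have h3 : (N.s : ℕ) ≠ N.t := fun h => hN.s_ne_t (Fin.ext h)
      omega
    -- The sink is not the source, so by `he` its level is 1 plus the level of another vertex.
    have hD : 1 ≤ N.depth := by
      have : N.depth = N.level N.t := rfl
      omega
    refine ⟨M, τ, hex, hτ.trans (ConcaveFlow.program_time hn hN.le_edges hD h0 hw hε hT2 hk2), ?_,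
      k + 1, T, hk, hk2, hT, hT2, hret⟩
    obtain ⟨hf, happ⟩ := hN.approx_of_returns (by omega) hT (by positivity) hret
    -- Weights are nonnegative, so the factor 1 - 9·2^(-(k+1)) may be weakened to 1 - ε.
    refine ⟨hf, fun y hy => (mul_le_mul_of_nonneg_right (by linarith) ?_).trans (happ y hy)⟩
    exact (mul_nonneg h0.le (Finset.sum_nonneg fun e _ => hy.nonneg e)).trans (hN.weight_ge hy)
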